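/- **Diagrams.** Let $C=(C_{ij})_{i,j\in I}$ be the Cartan matrix of a simply laced Dynkin diagram and $\sigma$ an automorphism of the diagram of order $M$, the pair being of type $(A_n,2)$ ($n\ge 2$, $n\ne 3$), $(D_{n+1},2)$ ($n\ge 2$; the diagram is the chain $1,\dots,n$ with the node $n+1$ attached to $n-1$, and $\sigma$ exchanges $n$ and $n+1$), $(D_4,3)$ or $(E_6,2)$. Let $I_0\subset I$ be the set of the smallest nodes of the $\sigma$-orbits and $\zeta=e^{2\pi \mathrm i/M}$. For $i\in I_0$ put $N_i=M$ if $\sigma(i)=i$ and $N_i=1$ otherwise; $d_i=M$ if $C_{i\sigma(i)}=2$, $d_i=1/2$ if $C_{i\sigma(i)}=-1$ and $d_i=1$ if $C_{i\sigma(i)}=0$. Let $q\in\mathbb C^*$ be not a root of unity, fix a square root $q^{1/2}$, and let $q_i=q^{d_i}$. Let $I_{\mathbb Z}=\{(i,r)\in I_0\times\mathbb Z: M\mid r\text{ if }\sigma(i)=i\}$ and let $\Lambda$ be the group of coweights $\mu$, given by integers $\alpha_i(\mu)$ $(i\in I_0)$ with $M\mid\alpha_i(\mu)$ if $\sigma(i)=i$.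 **Algebra.** For $\mu\in\Lambda$, $\mathcal U^\mu$ is the associative unital $\mathbb C$-algebra generated by $x^\pm_{i,r},\phi^\pm_{i,r}$ ($i\in I_0$, $r\in\mathbb Z$) and $h_{i,m}$ ($i\in I_0$, $m\in\mathbb Z\setminus\{0\}$) with the following relations, in which $\mu_+=0$, $\mu_-=\mu$. The elements $\phi^\pm_{i,\mp\alpha_i(\mu_\pm)}$ are invertible; $x^\pm_{i,r}=0$ and $h_{i,r}=0$ for $(i,r)\notin I_{\mathbb Z}$; all $\phi^\pm_{i,r}$ and $h_{j,m}$ commute with each other; and $$\phi^\pm_i(z):=\sum_{r}\phi^\pm_{i,r}z^{r}=z^{\mp\alpha_i(\mu_\pm)}\phi^\pm_{i,\mp\alpha_i(\mu_\pm)}\exp\Bigl(\pm(q_i-q_i^{-1})\sum_{m\ge1}h_{i,\pm m}z^{\pm m}\Bigr),$$ where here and below the coefficients of $\phi^\pm_i(z)$ are indexed so that $\phi^\pm_{i,r}$ is the coefficient of $z^r$; $$\phi^{\epsilon}_{i,-\epsilon\alpha_i(\mu_{\epsilon})}\,x^{\pm}_{j,r}=q^{\pm\epsilon\sum_{s=1}^MC_{i,\sigma^s(j)}}\,x^\pm_{j,r}\,\phi^{\epsilon}_{i,-\epsilon\alpha_i(\mu_{\epsilon})}\qquad(\epsilon=\pm),$$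 $$[h_{i,m},x^\pm_{j,r}]=\pm\frac1m\Bigl(\sum_{s=1}^M\frac{q^{mC_{i,\sigma^s(j)}}-q^{-mC_{i,\sigma^s(j)}}}{q_i-q_i^{-1}}\zeta^{ms}\Bigr)x^\pm_{j,m+r},\qquad [x^+_{i,r},x^-_{j,r'}]=\frac{\sum_{s=1}^M\delta_{\sigma^s(i),j}\zeta^{sr'}}{N_i}\cdot\frac{\phi^+_{i,r+r'}-\phi^-_{i,r+r'}}{q_i-q_i^{-1}}.$$ With $x^\pm_i(u)=\sum_{r}x^\pm_{i,r}u^{-r}$, and with products over those $s\in\{1,\dots,M\}$ for which $C_{i,\sigma^s(j)}\neq0$ (an empty product is $1$), $$\prod_s\bigl(u_1-\zeta^sq^{\pm C_{i,\sigma^s(j)}}u_2\bigr)x^\pm_i(u_1)x^\pm_j(u_2)=\prod_s\bigl(q^{\pm C_{i,\sigma^s(j)}}u_1-\zeta^su_2\bigr)x^\pm_j(u_2)x^\pm_i(u_1)\qquad(i,j\in I_0).$$ If $C_{ij}=-1$ and $\sigma(i)\ne j$, then $$\mathrm{Sym}_{u_1,u_2}\Bigl\{P^\pm_{ij}(u_1,u_2)\bigl(x^\pm_j(v)x^\pm_i(u_1)x^\pm_i(u_2)-(q^{2Md_{ij}}+q^{-2Md_{ij}})x^\pm_i(u_1)x^\pm_j(v)x^\pm_i(u_2)+x^\pm_i(u_1)x^\pm_i(u_2)x^\pm_j(v)\bigr)\Bigr\}=0,$$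 where $(P^\pm_{ij},d_{ij})$ is $(1,\frac12)$ if $C_{i\sigma(i)}=2$; $(1,\frac1{2M})$ if $C_{i\sigma(i)}=0$ and $\sigma(j)\ne j$; $\bigl(\frac{q^{\pm2M}u_1^M-u_2^M}{q^{\pm2}u_1-u_2},\frac12\bigr)$ if $C_{i\sigma(i)}=0$ and $\sigma(j)=j$; $(q^{\pm1}u_1+u_2,\frac14)$ if $C_{i\sigma(i)}=-1$. If $C_{i\sigma(i)}=-1$, then the symmetrizations in $u_1,u_2,u_3$ of $$\bigl(q^{3/2}u_1^{\mp1}-(q^{1/2}+q^{-1/2})u_2^{\mp1}+q^{-3/2}u_3^{\mp1}\bigr)x^\pm_i(u_1)x^\pm_i(u_2)x^\pm_i(u_3),$$ $$\bigl(q^{-3/2}u_1^{\pm1}-(q^{1/2}+q^{-1/2})u_2^{\pm1}+q^{3/2}u_3^{\pm1}\bigr)x^\pm_i(u_1)x^\pm_i(u_2)x^\pm_i(u_3)$$ vanish. **Modules.** On $\mathfrak t^*=(\mathbb C^*)^{I_0}$ write $\omega'\le\omega$ if $\omega\omega'^{-1}$ is a product of elements $\overline{\alpha}_i$ $(i\in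 I_0)$, where $\overline\alpha_i(j)=q^{\sum_{s=1}^M C_{i,\sigma^s(j)}}$. A $\mathcal U^\mu$-module $V$ is in $\mathcal O_\mu$ if $V=\bigoplus_\omega V_\omega^+=\bigoplus_\omega V_\omega^-$, where $V^+_\omega=\{v:\phi^+_{i,0}v=\omega(i)v\ \forall i\}$ and $V^-_\omega=\{v:\phi^-_{i,\alpha_i(\mu)}v=\omega(i)^{-1}v\ \forall i\}$, all $V^\pm_\omega$ are finite-dimensional, and there are $\omega_1,\dots,\omega_p\in\mathfrak t^*$ such that every $\omega$ with $V^+_\omega\ne0$ or $V^-_\omega\neq0$ satisfies $\omega\le\omega_k$ for some $k$. Let $\mathfrak r_\mu$ be the set of $\mathbf\Psi=(\Psi_i(z))_{i\in I_0}\in\mathbb C(z)^{I_0}$ with $\Psi_i$ regular and nonzero at $z=0$ and of degree $\alpha_i(\mu)$. A module $V$ is of highest $\ell$-weight $\mathbf\Psi\in\mathfrak r_\mu$ if it is generated by a vector $v\ne0$ with $x^+_{i,r}v=0$ for all $i,r$ such that $\phi_i^+(z)v$ and $\phi_i^-(z)v$ are $v$ times the expansion of $\Psi_i(z)$ at $z=0$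 and at $z=\infty$. For $V$ in $\mathcal O_\mu$ let $V_{\mathbf\Psi}$ be the simultaneous generalized eigenspace of the $\phi^+_{i,m}$ $(m\ge0)$ with eigenvalues the coefficients of the expansions of $\Psi_i$ at $0$, and $\chi_q(V)=\sum_{\mathbf\Psi\in\mathfrak r_\mu}\dim(V_{\mathbf\Psi})[\mathbf\Psi]$; such formal sums are multiplied by $[\mathbf\Psi_1][\mathbf\Psi_2]=[\mathbf\Psi_1\mathbf\Psi_2]$. **Theorem.** Let $\mu_1,\mu_2\in\Lambda$. There is exactly one algebra homomorphism $\Delta_u:\mathcal U^{\mu_1+\mu_2}\to(\mathcal U^{\mu_1}\otimes\mathcal U^{\mu_2})((u))$ with $$\Delta_u(x_i^+(z))=x_i^+(z)\otimes1+\phi_i^-(z^{-1})\otimes x_i^+(zu^{-1}),\qquad \Delta_u(x_i^-(z))=1\otimes x_i^-(zu^{-1})+x_i^-(z)\otimes\phi_i^+(z^{-1}u),\qquad \Delta_u(\phi^\pm_i(z))=\phi_i^\pm(z)\otimes\phi_i^\pm(zu).$$ For $k=1,2$ let $V_k\in\mathcal O_{\mu_k}$ be a module of highest $\ell$-weight $\mathbf\Psi_k\in\mathfrak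 r_{\mu_k}$, with highest $\ell$-weight vector $v_k$. Let $\mathcal U^{\mu_1+\mu_2}$ act on $(V_1\otimes V_2)((u))$ through $\Delta_u$, let $V(u)\subset(V_1\otimes V_2)((u))$ be the $\mathbb C(u)$-span of $V_1\otimes V_2$ (rational functions being expanded at $u=0$), let $\mathcal A\subset\mathbb C(u)$ be the ring of rational functions regular at $u=1$, and put $$\widetilde V=(\mathcal A\otimes\mathcal U^{\mu_1+\mu_2})(v_1\otimes v_2),\qquad V_1*V_2=\widetilde V/(u-1)\widetilde V .$$ Then $\widetilde V$ is an $\mathcal A$-form of $V(u)$, that is, it is stable under $\mathcal U^{\mu_1+\mu_2}$, it is contained in $V(u)$ and spans it over $\mathbb C(u)$, and its intersection with each weight space $\{f\in V(u):\phi^+_{i,0}f=\omega(i)f\ \forall i\in I_0\}$, $\omega\in\mathfrak t^*$, is a finitely generated $\mathcal A$-module. The $\mathcal U^{\mu_1+\mu_2}$-module $V_1*V_2$ lies in $\mathcal O_{\mu_1+\mu_2}$, and it is of highest $\ell$-weight $\mathbf\Psi_1\mathbf\Psi_2$, with the class of $v_1\otimes v_2$ as highest $\ell$-weight vector. All $\ell$-weight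 spaces of $V_1$, $V_2$ and $V_1*V_2$ are finite-dimensional, the coefficients of the product $\chi_q(V_1)\chi_q(V_2)$ are finite sums, and $$\chi_q(V_1*V_2)=\chi_q(V_1)\,\chi_q(V_2).$$ -/

import Mathlib

open scoped TensorProduct

noncomputable section

namespace TwistedFusion

/-! ### The simply laced diagrams with a nontrivial automorphism -/

/-- The pairs (diagram, automorphism): `A m` is `(A_m, 2)` with `m ≥ 2`, `m ≠ 3`; `D n` is
`(D_{n+1}, 2)` with `n ≥ 2`; `D4` is `(D_4, 3)`; `E6` is `(E_6, 2)`. -/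
inductive TwistedType : Type
  | A (m : ℕ) (hm : 2 ≤ m) (hm3 : m ≠ 3)
  | D (n : ℕ) (hn : 2 ≤ n)
  | D4
  | E6

namespace TwistedType

/-- Number of nodes of the diagram. The node with label `k` is `k - 1 : Fin rank`. -/
def rank : TwistedType → ℕ
  | A m _ _ => m
  | D n _ => n + 1
  | D4 => 4
  | E6 => 6

/-- The edges of the diagram, each listed in one direction (nodes numbered from `0`).
`A_m` is a chain. `D_{n+1}` is a chain `0, …, n - 1` with the node `n` attached to `n - 2`.
`E_6` is the chain `0, 1, 2, 4, 5` with the node `3` attached to `2`. -/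
def edge : TwistedType → ℕ → ℕ → Prop
  | A _ _ _, a, b => a + 1 = b
  | D n _, a, b => (a + 1 = b ∧ b < n) ∨ (a + 2 = n ∧ b = n)
  | D4, a, b => (a + 1 = b ∧ b < 3) ∨ (a = 1 ∧ b = 3)
  | E6, a, b => (a = 0 ∧ b = 1) ∨ (a = 1 ∧ b = 2) ∨ (a = 2 ∧ b = 4) ∨ (a = 4 ∧ b = 5) ∨
      (a = 2 ∧ b = 3)

open scoped Classical in
/-- The Cartan matrix of the diagram. -/
def C (T : TwistedType) (i j : Fin T.rank) : ℤ :=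
  if i = j then 2 else if T.edge i j ∨ T.edge j i then -1 else 0

/-- The diagram automorphism. -/
def σ : (T : TwistedType) → Equiv.Perm (Fin T.rank)
  | A _ _ _ => Fin.revPerm
  | D n hn => Equiv.swap ⟨n - 1, by simp only [rank]; omega⟩ ⟨n, by simp only [rank]; omega⟩
  | D4 => (Equiv.swap (0 : Fin 4) 2 * Equiv.swap (2 : Fin 4) 3 : Equiv.Perm (Fin 4))
  | E6 => (Equiv.swap (0 : Fin 6) 5 * Equiv.swap (1 : Fin 6) 4 : Equiv.Perm (Fin 6))

/-- The order of the automorphism. -/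
def M : TwistedType → ℕ
  | D4 => 3
  | _ => 2

/-- The set of orbit representatives: in each orbit the smallest node. -/
def I0 (T : TwistedType) : Type :=
  {i : Fin T.rank // ∀ k : ℕ, i ≤ (T.σ ^ k) i}

instance (T : TwistedType) : Finite T.I0 := inferInstanceAs (Finite (Subtype _))

instance (T : TwistedType) : Fintype T.I0 := Fintype.ofFinite _

instance (T : TwistedType) : DecidableEq T.I0 := Classical.decEq _

/-- `σ (i) = i`. -/
def IsFixed (T : TwistedType) (i : T.I0) : Prop := T.σ i.1 = i.1

/-- The integers `C_{i, σ^s (j)}`. -/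
def Cσ (T : TwistedType) (i j : T.I0) (s : ℕ) : ℤ := T.C i.1 ((T.σ ^ s) j.1)

/-- The sum of `C_{i, σ^s (j)}` over `s = 1, …, M`. It equals `d_i C^σ_{ij}`, where `C^σ` is the
Cartan matrix of the finite part of the twisted affine diagram. -/
def sumC (T : TwistedType) (i j : T.I0) : ℤ := ∑ s ∈ Finset.Icc 1 T.M, T.Cσ i j s

open scoped Classical in
/-- Twice the symmetrizing number `d_i`: one has `d_i = M` if `σ (i) = i`, `d_i = 1/2` if
`C_{i, σ (i)} = -1` and `d_i = 1` if `C_{i, σ (i)} = 0`. -/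
def twoD (T : TwistedType) (i : T.I0) : ℕ :=
  if T.IsFixed i then 2 * T.M else if T.Cσ i i 1 = -1 then 1 else 2

open scoped Classical in
/-- The number `N_i`. -/
def N (T : TwistedType) (i : T.I0) : ℕ := if T.IsFixed i then T.M else 1

/-- The set `I_ℤ` of pairs `(i, r)` with `r` divisible by `d_i`; this is a condition only when
`σ (i) = i`, where `d_i = M`. -/
def InIZ (T : TwistedType) (i : T.I0) (r : ℤ) : Prop := T.IsFixed i → (T.M : ℤ) ∣ r

/-- The primitive root of unity `exp (2 π i / M)`. -/
def ζ (T : TwistedType) : ℂ := Complex.exp (2 * Real.pi * Complex.I / T.M)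

/-- The lattice `Λ` of admissible coweights; a coweight `μ` is given by the integers `α_i (μ)`. -/
def Coweight (T : TwistedType) : AddSubgroup (T.I0 → ℤ) where
  carrier := {μ | ∀ i, T.IsFixed i → (T.M : ℤ) ∣ μ i}
  zero_mem' := fun _ _ => dvd_zero _
  add_mem' := fun ha hb i hi => dvd_add (ha i hi) (hb i hi)
  neg_mem' := fun ha i hi => (dvd_neg).2 (ha i hi)

end TwistedType

/-! ### Shifted twisted quantum affine algebras

The parameter `t` is a square root of the quantum parameter: `q = t ^ 2`. Signs `±` are elements
`ε` of `ℤˣ`. -/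

/-- `q ^ n`. -/
def qpow (t : ℂˣ) (n : ℤ) : ℂ := ((t : ℂ) ^ 2) ^ n

/-- `q_i = q ^ (d_i)`. -/
def qi (T : TwistedType) (t : ℂˣ) (i : T.I0) : ℂ := (t : ℂ) ^ (T.twoD i)

/-- `q_i - q_i⁻¹`. -/
def qdiff (T : TwistedType) (t : ℂˣ) (i : T.I0) : ℂ := qi T t i - (qi T t i)⁻¹

/-- The generators: `x_{i,r}^ε`, `φ_{i,r}^ε`, `h_{i,m}` and formal inverses `κ_i^ε` of the leading
modes of `φ_i^ε`. -/
inductive Gen (T : TwistedType) : Type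
  | x (ε : ℤˣ) (i : T.I0) (r : ℤ)
  | φ (ε : ℤˣ) (i : T.I0) (r : ℤ)
  | h (i : T.I0) (m : ℤ)
  | κ (ε : ℤˣ) (i : T.I0)

/-- The free algebra on the generators. -/
abbrev Free (T : TwistedType) : Type := FreeAlgebra ℂ (Gen T)

namespace Free

variable {T : TwistedType}

def x (ε : ℤˣ) (i : T.I0) (r : ℤ) : Free T := FreeAlgebra.ι ℂ (Gen.x ε i r)
def φ (ε : ℤˣ) (i : T.I0) (r : ℤ) : Free T := FreeAlgebra.ι ℂ (Gen.φ ε i r)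
def h (i : T.I0) (m : ℤ) : Free T := FreeAlgebra.ι ℂ (Gen.h i m)
def κ (ε : ℤˣ) (i : T.I0) : Free T := FreeAlgebra.ι ℂ (Gen.κ ε i)

end Free

/-- The coefficient of `y ^ n` in `exp (∑_{m ≥ 1} a m y ^ m)`. -/
def expCoeff {A : Type} [Ring A] [Algebra ℂ A] (a : ℕ → A) (n : ℕ) : A :=
  PowerSeries.coeff n (∑ k ∈ Finset.range (n + 1),
    ((k.factorial : ℂ)⁻¹) • (PowerSeries.mk fun m => if m = 0 then 0 else a m) ^ k)

/-- `∑ c_{k,l} • f k l` for a polynomial `P = ∑ c_{k,l} u₁ ^ k u₂ ^ l`. If `X (u) = ∑ X_r u ^ (-r)`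
and `Y (u) = ∑ Y_r u ^ (-r)`, the coefficient of `u₁ ^ (-a) u₂ ^ (-b)` in `P X (u₁) Y (u₂)` is
`coeffSum P fun k l => X_{a+k} * Y_{b+l}`. -/
def coeffSum {A : Type} [Ring A] [Algebra ℂ A] (P : MvPolynomial (Fin 2) ℂ) (f : ℤ → ℤ → A) : A :=
  ∑ m ∈ P.support, P.coeff m • f (m 0) (m 1)

open scoped Classical in
/-- The indices `s = 1, …, M` with `C_{i, σ^s (j)} ≠ 0`. -/
def activeSet (T : TwistedType) (i j : T.I0) : Finset ℕ :=
  (Finset.Icc 1 T.M).filter fun s => T.Cσ i j s ≠ 0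

/-- The product of `u₁ - ζ^s q^{ε C_{i, σ^s (j)}} u₂` over the active `s`. -/
def polyF (T : TwistedType) (t : ℂˣ) (ε : ℤˣ) (i j : T.I0) : MvPolynomial (Fin 2) ℂ :=
  ∏ s ∈ activeSet T i j, (MvPolynomial.X 0 -
    MvPolynomial.C (T.ζ ^ s * qpow t (ε * T.Cσ i j s)) * MvPolynomial.X 1)

/-- The product of `q^{ε C_{i, σ^s (j)}} u₁ - ζ^s u₂` over the active `s`. -/
def polyG (T : TwistedType) (t : ℂˣ) (ε : ℤˣ) (i j : T.I0) : MvPolynomial (Fin 2) ℂ :=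
  ∏ s ∈ activeSet T i j, (MvPolynomial.C (qpow t (ε * T.Cσ i j s)) * MvPolynomial.X 0 -
    MvPolynomial.C (T.ζ ^ s) * MvPolynomial.X 1)

open scoped Classical in
/-- The polynomial `P_{ij}^ε (u₁, u₂)` of the Serre relations: `1` if `C_{i, σ (i)} = 2`;
`q^ε u₁ + u₂` if `C_{i, σ (i)} = -1`; if `C_{i, σ (i)} = 0`, it is `1` when `σ (j) ≠ j` and
`(q^{2 M ε} u₁^M - u₂^M) / (q^{2 ε} u₁ - u₂)` when `σ (j) = j`. -/
def serreP (T : TwistedType) (t : ℂˣ) (ε : ℤˣ) (i j : T.I0) : MvPolynomial (Fin 2) ℂ :=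
  if T.IsFixed i then 1
  else if T.Cσ i i 1 = -1 then
    MvPolynomial.C (qpow t ε) * MvPolynomial.X 0 + MvPolynomial.X 1
  else if T.IsFixed j then
    ∑ k ∈ Finset.range T.M, (MvPolynomial.C (qpow t (2 * ε)) * MvPolynomial.X 0) ^ k *
      MvPolynomial.X 1 ^ (T.M - 1 - k)
  else 1

open scoped Classical in
/-- The exponent `e = 2 M d_{ij}` in the coefficient `q^e + q^{-e}` of the Serre relations. -/
def serreExp (T : TwistedType) (i j : T.I0) : ℤ :=
  if T.IsFixed i then T.M
  else if T.Cσ i i 1 = -1 then 1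
  else if T.IsFixed j then T.M
  else 1

/-- The coefficient of `u₁ ^ (-a) u₂ ^ (-b) v ^ (-c)` in `P_{ij}^ε (u₁, u₂)` times
`x_j (v) x_i (u₁) x_i (u₂) - (q^e + q^{-e}) x_i (u₁) x_j (v) x_i (u₂) + x_i (u₁) x_i (u₂) x_j (v)`,
where `x = x^ε`. -/
def serreTerm (T : TwistedType) (t : ℂˣ) (ε : ℤˣ) (i j : T.I0) (a b c : ℤ) : Free T :=
  coeffSum (serreP T t ε i j) fun k l =>
    Free.x ε j c * Free.x ε i (a + k) * Free.x ε i (b + l)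
    - (qpow t (serreExp T i j) + qpow t (-serreExp T i j)) •
        (Free.x ε i (a + k) * Free.x ε j c * Free.x ε i (b + l))
    + Free.x ε i (a + k) * Free.x ε i (b + l) * Free.x ε j c

/-- The coefficient of `u₁ ^ (-a 0) u₂ ^ (-a 1) u₃ ^ (-a 2)` in the symmetrization of
`(c u₁ ^ k - (q^{1/2} + q^{-1/2}) u₂ ^ k + c⁻¹ u₃ ^ k) x_i (u₁) x_i (u₂) x_i (u₃)`, where `x = x^ε`
and `k` is an integer. -/
def cubicTerm (T : TwistedType) (t : ℂˣ) (c : ℂ) (k : ℤ) (ε : ℤˣ) (i : T.I0) (a : Fin 3 → ℤ) :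
    Free T :=
  ∑ π : Equiv.Perm (Fin 3),
    (c • (Free.x ε i (a (π 0) + k) * Free.x ε i (a (π 1)) * Free.x ε i (a (π 2)))
    - ((t : ℂ) + (t : ℂ)⁻¹) •
        (Free.x ε i (a (π 0)) * Free.x ε i (a (π 1) + k) * Free.x ε i (a (π 2)))
    + c⁻¹ • (Free.x ε i (a (π 0)) * Free.x ε i (a (π 1)) * Free.x ε i (a (π 2) + k)))

/-- The index of the leading mode of `φ_i^ε`: it is `-α_i (μ₊)` for `ε = +` and `α_i (μ₋)` for
`ε = -`. -/
def leadIdx {T : TwistedType} (μp μm : T.Coweight) (ε : ℤˣ) (i : T.I0) : ℤ :=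
  if ε = 1 then -(μp.1 i) else μm.1 i

open scoped Classical in
/-- The defining relations of the shifted twisted quantum affine algebra of shifts `μ₊, μ₋`. -/
inductive Rel (T : TwistedType) (t : ℂˣ) (μp μm : T.Coweight) : Free T → Free T → Prop
  | x_zero (ε i r) (hr : ¬ T.InIZ i r) : Rel T t μp μm (Free.x ε i r) 0
  | h_zero (i m) (hm : m = 0 ∨ ¬ T.InIZ i m) : Rel T t μp μm (Free.h i m) 0
  | lead_inv (ε i) :
      Rel T t μp μm (Free.φ ε i (leadIdx μp μm ε i) * Free.κ ε i) 1
  | inv_lead (ε i) :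
      Rel T t μp μm (Free.κ ε i * Free.φ ε i (leadIdx μp μm ε i)) 1
  | φ_zero (ε : ℤˣ) (i) (n : ℕ) (hn : 0 < n) :
      Rel T t μp μm (Free.φ ε i (leadIdx μp μm ε i - ε * n)) 0
  | φ_exp (ε : ℤˣ) (i) (n : ℕ) :
      Rel T t μp μm (Free.φ ε i (leadIdx μp μm ε i + ε * n))
        (Free.φ ε i (leadIdx μp μm ε i) *
          expCoeff (fun m : ℕ => (((ε : ℤ) : ℂ) * qdiff T t i) • Free.h i (ε * m)) n)
  | φφ (ε ε' i j r r') :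
      Rel T t μp μm (Free.φ ε i r * Free.φ ε' j r') (Free.φ ε' j r' * Free.φ ε i r)
  | φh (ε i j r m) :
      Rel T t μp μm (Free.φ ε i r * Free.h j m) (Free.h j m * Free.φ ε i r)
  | hh (i j m m') :
      Rel T t μp μm (Free.h i m * Free.h j m') (Free.h j m' * Free.h i m)
  | lead_x (ε ε' : ℤˣ) (i j r) :
      Rel T t μp μm (Free.φ ε i (leadIdx μp μm ε i) * Free.x ε' j r)
        (qpow t (ε * ε' * T.sumC i j) • (Free.x ε' j r * Free.φ ε i (leadIdx μp μm ε i)))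
  | hx (ε : ℤˣ) (i j r) (m : ℤ) (hm : m ≠ 0) :
      Rel T t μp μm (Free.h i m * Free.x ε j r - Free.x ε j r * Free.h i m)
        ((((ε : ℤ) : ℂ) * (1 / (m : ℂ)) *
          ∑ s ∈ Finset.Icc 1 T.M,
            (qpow t (m * T.Cσ i j s) - qpow t (-(m * T.Cσ i j s))) / qdiff T t i * T.ζ ^ (m * s)) •
          Free.x ε j (m + r))
  | xx_pm (i j r r') :
      Rel T t μp μm (Free.x 1 i r * Free.x (-1) j r' - Free.x (-1) j r' * Free.x 1 i r)
        (((∑ s ∈ Finset.Icc 1 T.M,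
            if (T.σ ^ s) i.1 = j.1 then T.ζ ^ ((s : ℤ) * r') else 0) / (T.N i : ℂ) /
            qdiff T t i) • (Free.φ 1 i (r + r') - Free.φ (-1) i (r + r')))
  | xx (ε i j) (a b : ℤ) :
      Rel T t μp μm
        (coeffSum (polyF T t ε i j) fun k l => Free.x ε i (a + k) * Free.x ε j (b + l))
        (coeffSum (polyG T t ε i j) fun k l => Free.x ε j (b + l) * Free.x ε i (a + k))
  | serre (ε i j) (hij : T.C i.1 j.1 = -1) (hσ : T.σ i.1 ≠ j.1) (a b c : ℤ) :
      Rel T t μp μm (serreTerm T t ε i j a b c + serreTerm T t ε i j b a c) 0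
  | cubic₁ (ε : ℤˣ) (i) (hi : T.Cσ i i 1 = -1) (a : Fin 3 → ℤ) :
      Rel T t μp μm (cubicTerm T t ((t : ℂ) ^ 3) (-(ε : ℤ)) ε i a) 0
  | cubic₂ (ε : ℤˣ) (i) (hi : T.Cσ i i 1 = -1) (a : Fin 3 → ℤ) :
      Rel T t μp μm (cubicTerm T t (((t : ℂ) ^ 3)⁻¹) ε ε i a) 0

/-- The shifted twisted quantum affine algebra of shifts `μ₊, μ₋`. -/
def Alg₂ (T : TwistedType) (t : ℂˣ) (μp μm : T.Coweight) : Type := RingQuot (Rel T t μp μm)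

instance (T : TwistedType) (t : ℂˣ) (μp μm : T.Coweight) : Ring (Alg₂ T t μp μm) :=
  inferInstanceAs (Ring (RingQuot (Rel T t μp μm)))

instance (T : TwistedType) (t : ℂˣ) (μp μm : T.Coweight) : Algebra ℂ (Alg₂ T t μp μm) :=
  inferInstanceAs (Algebra ℂ (RingQuot (Rel T t μp μm)))

/-- The shifted twisted quantum affine algebra of shift `μ`, that is, of shifts `0, μ`. -/
abbrev Alg (T : TwistedType) (t : ℂˣ) (μ : T.Coweight) : Type := Alg₂ T t 0 μ

namespace Alg

variable {T : TwistedType} {t : ℂˣ} {μ : T.Coweight}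

/-- The mode `x_{i,r}^ε`. -/
def x (ε : ℤˣ) (i : T.I0) (r : ℤ) : Alg T t μ :=
  RingQuot.mkAlgHom ℂ (Rel T t 0 μ) (Free.x ε i r)

/-- The mode `φ_{i,r}^ε`. -/
def φ (ε : ℤˣ) (i : T.I0) (r : ℤ) : Alg T t μ :=
  RingQuot.mkAlgHom ℂ (Rel T t 0 μ) (Free.φ ε i r)

/-- The leading mode of `φ_i^ε`: `φ_{i,0}^+` for `ε = +` and `φ_{i,α_i (μ)}^-` for `ε = -`. -/
def lead (ε : ℤˣ) (i : T.I0) : Alg T t μ := φ ε i (leadIdx 0 μ ε i)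

end Alg

/-! ### Category `𝒪_μ`, highest `ℓ`-weight modules and `q`-characters

A module over `Alg T t μ` is a complex vector space `V` with an algebra homomorphism
`ρ : Alg T t μ →ₐ[ℂ] Module.End ℂ V`. -/

section Modules

/-- The group `𝔱^*` of weights. -/
abbrev Weight (T : TwistedType) : Type := T.I0 → ℂˣ

/-- The image of the simple root `α_i` in `𝔱^*`, whose value at `j` is `q_i ^ (C^σ_{ij})`. -/
def rootWeight (T : TwistedType) (t : ℂˣ) (i : T.I0) : Weight T := fun j => (t ^ 2) ^ T.sumC i j

/-- The order on `𝔱^*`: `ω ≤ ω'` if `ω' ω⁻¹` is a product of simple roots. -/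
def Weight.le {T : TwistedType} (t : ℂˣ) (ω ω' : Weight T) : Prop :=
  ∃ n : T.I0 → ℕ, ω' * ω⁻¹ = ∏ i, rootWeight T t i ^ n i

variable {T : TwistedType} {t : ℂˣ} {μ : T.Coweight} {V : Type*} [AddCommGroup V] [Module ℂ V]

/-- The weight space `V_ω^ε`. -/
def weightSpace (ρ : Alg T t μ →ₐ[ℂ] Module.End ℂ V) (ε : ℤˣ) (ω : Weight T) : Submodule ℂ V :=
  ⨅ i, Module.End.eigenspace (ρ (Alg.lead ε i)) (((ω i) ^ (ε : ℤ) : ℂˣ) : ℂ)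

/-- The module `V` belongs to the category `𝒪_μ`. -/
structure InO (ρ : Alg T t μ →ₐ[ℂ] Module.End ℂ V) : Prop where
  indep : ∀ ε, iSupIndep (weightSpace ρ ε)
  iSup_eq_top : ∀ ε, ⨆ ω, weightSpace ρ ε ω = ⊤
  finite : ∀ ε ω, Module.Finite ℂ (weightSpace ρ ε ω)
  cone : ∃ s : Finset (Weight T), ∀ ε ω, weightSpace ρ ε ω ≠ ⊥ → ∃ ω' ∈ s, Weight.le t ω ω'

/-- The set `𝔯_μ` of tuples `(Ψ_i (z))` of rational functions that are regular and nonzero at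
`z = 0`, with `deg Ψ_i = α_i (μ)`. -/
def LWeight (T : TwistedType) (μ : T.Coweight) : Type :=
  {Ψ : T.I0 → RatFunc ℂ // ∀ i, (Ψ i).denom.eval 0 ≠ 0 ∧ (Ψ i).num.eval 0 ≠ 0 ∧
    (Ψ i).intDegree = μ.1 i}

/-- The componentwise product `𝔯_{μ₁} × 𝔯_{μ₂} → 𝔯_{μ₁ + μ₂}`. -/
def LWeight.mul {μ₁ μ₂ : T.Coweight} (Ψ₁ : LWeight T μ₁) (Ψ₂ : LWeight T μ₂) :
    LWeight T (μ₁ + μ₂) :=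
  ⟨fun i => Ψ₁.1 i * Ψ₂.1 i, fun i => by
    obtain ⟨a1, b1, c1⟩ := Ψ₁.2 i
    obtain ⟨a2, b2, c2⟩ := Ψ₂.2 i
    refine ⟨fun h0 => ?_, fun h0 => ?_, ?_⟩
    · obtain ⟨w, hw⟩ := RatFunc.denom_mul_dvd (Ψ₁.1 i) (Ψ₂.1 i)
      have := congrArg (Polynomial.eval 0) hw
      rw [Polynomial.eval_mul, Polynomial.eval_mul, h0, zero_mul] at this
      exact (mul_ne_zero a1 a2) this
    · obtain ⟨w, hw⟩ := RatFunc.num_mul_dvd (Ψ₁.1 i) (Ψ₂.1 i)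
      have := congrArg (Polynomial.eval 0) hw
      rw [Polynomial.eval_mul, Polynomial.eval_mul, h0, zero_mul] at this
      exact (mul_ne_zero b1 b2) this
    · have n1 : Ψ₁.1 i ≠ 0 := fun h => by simp [h] at b1
      have n2 : Ψ₂.1 i ≠ 0 := fun h => by simp [h] at b2
      rw [RatFunc.intDegree_mul n1 n2, c1, c2]
      rfl⟩

open scoped RatFunc in
/-- The expansion of rational functions at `0` as Laurent series. -/
def expandZero (F : Type) [Field F] : RatFunc F →+* LaurentSeries F :=
  algebraMap (RatFunc F) (LaurentSeries F)

open scoped RatFunc in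
theorem expandZero_C {F : Type} [Field F] (c : F) :
    expandZero F (RatFunc.C c) = HahnSeries.single (0 : ℤ) c := by
  rw [expandZero, ← RatFunc.algebraMap_C, ← IsScalarTower.algebraMap_apply]
  simp [HahnSeries.algebraMap_apply', PowerSeries.algebraMap_apply']

/-- The coefficient of `z ^ m` in the expansion of a rational function at `z = 0`. -/
def coeffAtZero (f : RatFunc ℂ) (m : ℤ) : ℂ :=
  (expandZero ℂ f).coeff m

/-- The coefficient of `z ^ m` in the expansion of a rational function at `z = ∞`, computed in
Laurent series in `w = z⁻¹`. -/
def coeffAtInfty (f : RatFunc ℂ) (m : ℤ) : ℂ :=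
  (RatFunc.eval (algebraMap ℂ (LaurentSeries ℂ)) (HahnSeries.single (-1 : ℤ) (1 : ℂ)) f).coeff (-m)

/-- `V` is generated by `v`, a highest `ℓ`-weight vector of `ℓ`-weight `Ψ`. -/
structure IsHighest (ρ : Alg T t μ →ₐ[ℂ] Module.End ℂ V) (Ψ : LWeight T μ) (v : V) : Prop where
  ne_zero : v ≠ 0
  generates : ∀ w : V, ∃ a : Alg T t μ, ρ a v = w
  x_plus : ∀ i r, ρ (Alg.x 1 i r) v = 0
  φ_plus : ∀ i m, ρ (Alg.φ 1 i m) v = coeffAtZero (Ψ.1 i) m • v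
  φ_minus : ∀ i m, ρ (Alg.φ (-1) i m) v = coeffAtInfty (Ψ.1 i) m • v

/-- The `ℓ`-weight space `V_Ψ`: the simultaneous generalized eigenspace of all `φ_{i,m}^+`,
`m ≥ 0`. -/
def lWeightSpace (ρ : Alg T t μ →ₐ[ℂ] Module.End ℂ V) (Ψ : LWeight T μ) : Submodule ℂ V :=
  ⨅ i, ⨅ m : ℕ, (ρ (Alg.φ 1 i m)).maxGenEigenspace (coeffAtZero (Ψ.1 i) m)

/-- The `q`-character of `V`, as a function on `𝔯_μ`. -/
def qChar (ρ : Alg T t μ →ₐ[ℂ] Module.End ℂ V) (Ψ : LWeight T μ) : ℤ :=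
  Module.finrank ℂ (lWeightSpace ρ Ψ)

/-- The pairs of `ℓ`-weights with a given product. -/
abbrev Factorization {μ₁ μ₂ : T.Coweight} (Ψ : LWeight T (μ₁ + μ₂)) : Type :=
  {p : LWeight T μ₁ × LWeight T μ₂ // p.1.mul p.2 = Ψ}

/-- The product of formal series on `𝔯_{μ₁}` and `𝔯_{μ₂}`, induced by `[Ψ₁] [Ψ₂] = [Ψ₁ Ψ₂]`. -/
def convolve {μ₁ μ₂ : T.Coweight} (c₁ : LWeight T μ₁ → ℤ) (c₂ : LWeight T μ₂ → ℤ)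
    (Ψ : LWeight T (μ₁ + μ₂)) : ℤ :=
  ∑ᶠ p : Factorization Ψ, c₁ p.1.1 * c₂ p.1.2

/-- The coefficients of the product of `c₁` and `c₂` are finite sums. -/
def Convolvable {μ₁ μ₂ : T.Coweight} (c₁ : LWeight T μ₁ → ℤ) (c₂ : LWeight T μ₂ → ℤ) : Prop :=
  ∀ Ψ : LWeight T (μ₁ + μ₂), {p : Factorization Ψ | c₁ p.1.1 * c₂ p.1.2 ≠ 0}.Finite

end Modules

/-! ### The deformed Drinfeld coproduct -/

/-- The algebra `(U^{μ₁} ⊗ U^{μ₂})((u))` of formal Laurent series. -/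
abbrev LaurentTensor (T : TwistedType) (t : ℂˣ) (μ₁ μ₂ : T.Coweight) : Type :=
  HahnSeries ℤ (Alg T t μ₁ ⊗[ℂ] Alg T t μ₂)

/-- `Δ` is the deformed Drinfeld coproduct. Coefficientwise in the spectral parameter `z`,
`Δ (x_i^+ (z)) = x_i^+ (z) ⊗ 1 + φ_i^- (z⁻¹) ⊗ x_i^+ (z u⁻¹)`,
`Δ (x_i^- (z)) = 1 ⊗ x_i^- (z u⁻¹) + x_i^- (z) ⊗ φ_i^+ (z⁻¹ u)` and
`Δ (φ_i^± (z)) = φ_i^± (z) ⊗ φ_i^± (z u)`,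
where `x_i^± (z) = ∑ x_{i,r}^± z ^ (-r)` and `φ_i^± (z) = ∑ φ_{i,r}^± z ^ r`; the fields give the
coefficient of `u ^ n` in the image of each mode. -/
structure IsDeformedCoproduct {T : TwistedType} {t : ℂˣ} {μ₁ μ₂ : T.Coweight}
    (Δ : Alg T t (μ₁ + μ₂) →ₐ[ℂ] LaurentTensor T t μ₁ μ₂) : Prop where
  x_plus : ∀ i p n, (Δ (Alg.x 1 i p)).coeff n =
    (if n = 0 then Alg.x 1 i p ⊗ₜ[ℂ] 1 else 0) + Alg.φ (-1) i (p - n) ⊗ₜ[ℂ] Alg.x 1 i n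
  x_minus : ∀ i p n, (Δ (Alg.x (-1) i p)).coeff n =
    (if n = p then 1 ⊗ₜ[ℂ] Alg.x (-1) i p else 0) + Alg.x (-1) i (p - n) ⊗ₜ[ℂ] Alg.φ 1 i n
  φ : ∀ ε i m n, (Δ (Alg.φ ε i m)).coeff n = Alg.φ ε i (m - n) ⊗ₜ[ℂ] Alg.φ ε i n

/-! ### Laurent series with coefficients in a vector space -/

section Laurent

variable (W : Type*) [AddCommGroup W] [Module ℂ W]

/-- The space `W((u))`, a module over the field of Laurent series. -/
abbrev LaurentVec : Type _ := HahnModule ℤ ℂ W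

/-- `W((u))` is a vector space over the rational functions, expanded at `u = 0`. -/
instance : Module (RatFunc ℂ) (LaurentVec W) :=
  Module.compHom _ (expandZero ℂ)

variable {W}

theorem ratFunc_smul_def (f : RatFunc ℂ) (x : LaurentVec W) :
    f • x = (expandZero ℂ f) • x := rfl

instance : IsScalarTower ℂ (RatFunc ℂ) (LaurentVec W) where
  smul_assoc c f x := by
    rw [ratFunc_smul_def, ratFunc_smul_def, RatFunc.smul_eq_C_mul, map_mul, mul_smul]
    have h : expandZero ℂ (RatFunc.C c) = HahnSeries.single (0 : ℤ) c := expandZero_C c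
    rw [h, HahnModule.single_zero_smul_eq_smul]
    rfl

instance : SMulCommClass (LaurentSeries ℂ) ℂ (LaurentVec W) :=
  SMulCommClass.symm _ _ _

/-- The constant series `w`. -/
def constVec (w : W) : LaurentVec W := HahnModule.of ℂ (HahnSeries.single (0 : ℤ) w)

variable (W) in
/-- The space `W(u)` of rational Laurent series: the span of `W` over `ℂ(u)` in `W((u))`. -/
def ratVec : Submodule (RatFunc ℂ) (LaurentVec W) :=
  Submodule.span (RatFunc ℂ) (Set.range constVec)

/-- A scalar Laurent series as a series with coefficients in `End W`. -/
def scalarSeries (c : LaurentSeries ℂ) : HahnSeries ℤ (Module.End ℂ W) :=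
  HahnSeries.map c (algebraMap ℂ (Module.End ℂ W))

theorem scalarSeries_smul (c : LaurentSeries ℂ) (f : LaurentVec W) :
    HahnModule.of (Module.End ℂ W) ((HahnModule.of ℂ).symm (c • f)) =
      scalarSeries (W := W) c • HahnModule.of (Module.End ℂ W) ((HahnModule.of ℂ).symm f) := by
  ext a
  rw [HahnModule.coeff_smul_left c.isPWO_support, Equiv.symm_apply_apply, HahnModule.coeff_smul]
  · rfl
  · intro n hn
    rw [HahnSeries.mem_support] at hn ⊢
    intro h
    exact hn (by simp [scalarSeries, h])

theorem scalarSeries_comm (c : LaurentSeries ℂ) (A : HahnSeries ℤ (Module.End ℂ W)) :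
    A * scalarSeries c = scalarSeries c * A := by
  ext1
  funext n
  rw [HahnSeries.coeff_mul, HahnSeries.coeff_mul]
  refine Finset.sum_nbij' Prod.swap Prod.swap ?_ ?_ ?_ ?_ ?_
  · rintro ⟨a, b⟩ h
    simp only [Prod.swap_prod_mk, Finset.mem_antidiagonal] at h ⊢
    exact ⟨h.2.1, h.1, by rw [add_comm]; exact h.2.2⟩
  · rintro ⟨a, b⟩ h
    simp only [Prod.swap_prod_mk, Finset.mem_antidiagonal] at h ⊢
    exact ⟨h.2.1, h.1, by rw [add_comm]; exact h.2.2⟩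
  · intro a _; simp
  · intro a _; simp
  · rintro ⟨a, b⟩ _
    exact (Algebra.commutes _ _).symm

/-- A Laurent series with coefficients in `End W` acts on `W((u))` by the product of series. -/
def laurentAct : HahnSeries ℤ (Module.End ℂ W) →ₐ[ℂ]
    Module.End (LaurentSeries ℂ) (LaurentVec W) where
  toFun A :=
    { toFun := fun f => HahnModule.of ℂ ((HahnModule.of (Module.End ℂ W)).symm
        (A • HahnModule.of (Module.End ℂ W) ((HahnModule.of ℂ).symm f)))
      map_add' := fun f g => by
        rw [HahnModule.of_symm_add, HahnModule.of_add, smul_add, HahnModule.of_symm_add,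
          HahnModule.of_add]
      map_smul' := fun c f => by
        have h (g : HahnModule ℤ (Module.End ℂ W) W) :
            A • scalarSeries (W := W) c • g = scalarSeries (W := W) c • A • g :=
          (mul_smul A (scalarSeries (W := W) c) g).symm.trans
            ((congrArg (· • g) (scalarSeries_comm c A)).trans
              (mul_smul (scalarSeries (W := W) c) A g))
        rw [scalarSeries_smul, h]
        refine (congrArg
          (fun g => HahnModule.of ℂ ((HahnModule.of (Module.End ℂ W)).symm g))
          (scalarSeries_smul c (HahnModule.of ℂ ((HahnModule.of (Module.End ℂ W)).symm
            (A • HahnModule.of (Module.End ℂ W) ((HahnModule.of ℂ).symm f)))))).symm.trans rfl }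
  map_one' := by
    ext f
    simp
  map_mul' A B := by
    ext1 f
    exact congrArg (fun g => HahnModule.of ℂ ((HahnModule.of (Module.End ℂ W)).symm g))
      (mul_smul A B (HahnModule.of (Module.End ℂ W) ((HahnModule.of ℂ).symm f)))
  map_zero' := by
    ext f
    simp
  map_add' A B := by
    ext f
    simp [add_smul]
  commutes' c := by
    ext1 f
    change HahnModule.of ℂ _ = c • f
    rw [HahnSeries.algebraMap_apply, HahnSeries.C_apply, HahnModule.single_zero_smul_eq_smul]
    rfl

/-- The map on Laurent series induced by an algebra homomorphism of the coefficients. -/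
def laurentMap {A B : Type*} [Ring A] [Algebra ℂ A] [Ring B] [Algebra ℂ B] (g : A →ₐ[ℂ] B) :
    HahnSeries ℤ A →ₐ[ℂ] HahnSeries ℤ B where
  toFun f := HahnSeries.map f g
  map_one' := by
    ext n
    by_cases h : n = 0
    · simp [h]
    · simp [HahnSeries.coeff_one, h]
  map_mul' f f' := HahnSeries.map_mul ((g : A →+* B) : A →ₙ+* B)
  map_zero' := by ext n; simp
  map_add' f f' := by ext n; simp
  commutes' c := by
    ext n
    by_cases h : n = 0
    · simp [HahnSeries.algebraMap_apply, h]
    · simp [HahnSeries.algebraMap_apply, HahnSeries.coeff_single_of_ne h]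

end Laurent

/-! ### The `𝒜`-form and its specialization -/

/-- The ring `𝒜` of rational functions in `u` that are regular at `u = 1`. -/
def regOne : Subalgebra ℂ (RatFunc ℂ) where
  carrier := {f | f.denom.eval 1 ≠ 0}
  mul_mem' := fun {f g} hf hg h0 => by
    obtain ⟨w, hw⟩ := RatFunc.denom_mul_dvd f g
    have := congrArg (Polynomial.eval 1) hw
    rw [Polynomial.eval_mul, Polynomial.eval_mul, h0, zero_mul] at this
    exact (mul_ne_zero hf hg) this
  add_mem' := fun {f g} hf hg h0 => by
    obtain ⟨w, hw⟩ := RatFunc.denom_add_dvd f g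
    have := congrArg (Polynomial.eval 1) hw
    rw [Polynomial.eval_mul, Polynomial.eval_mul, h0, zero_mul] at this
    exact (mul_ne_zero hf hg) this
  algebraMap_mem' := fun c => by
    change (algebraMap ℂ (RatFunc ℂ) c).denom.eval 1 ≠ 0
    rw [RatFunc.algebraMap_eq_C, RatFunc.denom_C]
    simp

/-- The element `u - 1` of `𝒜`. -/
def uSubOne : regOne :=
  ⟨RatFunc.X - RatFunc.C 1, by
    change (RatFunc.X - RatFunc.C 1 : RatFunc ℂ).denom.eval 1 ≠ 0
    have h : (RatFunc.X - RatFunc.C 1 : RatFunc ℂ) =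
        algebraMap (Polynomial ℂ) (RatFunc ℂ) (Polynomial.X - Polynomial.C 1) := by
      rw [map_sub, RatFunc.algebraMap_X, RatFunc.algebraMap_C]
    rw [h, RatFunc.denom_algebraMap]
    simp⟩

section Fusion

variable {U : Type*} [Ring U] [Algebra ℂ U] {W : Type*} [AddCommGroup W] [Module ℂ W]

/-- The submodule `(𝒜 ⊗ U) w` of `W((u))` generated by a vector `w` of `W`. -/
def lattice (R : U →ₐ[ℂ] Module.End (LaurentSeries ℂ) (LaurentVec W)) (w : W) :
    Submodule regOne (LaurentVec W) :=
  Submodule.span regOne (Set.range fun a => R a (constVec w))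

variable (R : U →ₐ[ℂ] Module.End (LaurentSeries ℂ) (LaurentVec W)) (w : W)

theorem act_smul (a : U) (c : regOne) (f : LaurentVec W) : R a (c • f) = c • R a f :=
  map_smul (R a) (expandZero ℂ c.1) f

theorem lattice_stable (a : U) {f : LaurentVec W} (hf : f ∈ lattice R w) :
    R a f ∈ lattice R w := by
  induction hf using Submodule.span_induction with
  | mem x hx =>
    obtain ⟨b, rfl⟩ := hx
    exact Submodule.subset_span ⟨a * b, by simp⟩
  | zero => rw [map_zero]; exact Submodule.zero_mem _
  | add x y _ _ hx hy => rw [map_add]; exact Submodule.add_mem _ hx hy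
  | smul c x _ hx => rw [act_smul]; exact Submodule.smul_mem _ c hx

/-- The action of an element of `U` on `(𝒜 ⊗ U) w`. -/
def latticeAct (a : U) : lattice R w →ₗ[regOne] lattice R w where
  toFun f := ⟨R a f.1, lattice_stable R w a f.2⟩
  map_add' f g := Subtype.ext (map_add (R a) f.1 g.1)
  map_smul' c f := Subtype.ext (act_smul R a c f.1)

/-- The specialization of `(𝒜 ⊗ U) w` at `u = 1`, the quotient by the image of `u - 1`. -/
def Fusion : Type _ :=
  lattice R w ⧸ LinearMap.range (LinearMap.lsmul regOne (lattice R w) uSubOne)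

instance : AddCommGroup (Fusion R w) :=
  inferInstanceAs (AddCommGroup
    (lattice R w ⧸ LinearMap.range (LinearMap.lsmul regOne (lattice R w) uSubOne)))

instance : Module regOne (Fusion R w) :=
  inferInstanceAs (Module regOne
    (lattice R w ⧸ LinearMap.range (LinearMap.lsmul regOne (lattice R w) uSubOne)))

instance : Module ℂ (Fusion R w) := Module.compHom _ (algebraMap ℂ regOne)

/-- The class in the specialization of an element of `(𝒜 ⊗ U) w`. -/
def fusionMk : lattice R w →ₗ[regOne] Fusion R w :=
  Submodule.mkQ (LinearMap.range (LinearMap.lsmul regOne (lattice R w) uSubOne))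

theorem fusionMk_surjective : Function.Surjective (fusionMk R w) :=
  Submodule.mkQ_surjective _

/-- The class in the specialization of the generator `w`. -/
def fusionVec : Fusion R w :=
  fusionMk R w ⟨constVec w, Submodule.subset_span ⟨1, by simp⟩⟩

theorem range_le_comap (a : U) :
    LinearMap.range (LinearMap.lsmul regOne (lattice R w) uSubOne) ≤
      (LinearMap.range (LinearMap.lsmul regOne (lattice R w) uSubOne)).comap
        (latticeAct R w a) := by
  rintro _ ⟨f, rfl⟩
  exact ⟨latticeAct R w a f, ((latticeAct R w a).map_smul uSubOne f).symm⟩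

/-- The induced action of an element of `U` on the specialization. -/
def fusionAct (a : U) : Fusion R w →ₗ[regOne] Fusion R w :=
  Submodule.mapQ _ _ (latticeAct R w a) (range_le_comap R w a)

theorem fusionAct_mk (a : U) (f : lattice R w) :
    fusionAct R w a (fusionMk R w f) = fusionMk R w (latticeAct R w a f) := rfl

/-- The specialization as a representation of `U`. -/
def fusionRep : U →ₐ[ℂ] Module.End ℂ (Fusion R w) where
  toFun a :=
    { toFun := fusionAct R w a
      map_add' := map_add (fusionAct R w a)
      map_smul' := fun c x => map_smul (fusionAct R w a) (algebraMap ℂ regOne c) x }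
  map_one' := by
    ext x
    obtain ⟨f, rfl⟩ := fusionMk_surjective R w x
    exact congrArg (fusionMk R w) (Subtype.ext (by simp [latticeAct]))
  map_mul' a b := by
    ext x
    obtain ⟨f, rfl⟩ := fusionMk_surjective R w x
    exact congrArg (fusionMk R w) (Subtype.ext (by simp [latticeAct]))
  map_zero' := by
    ext x
    obtain ⟨f, rfl⟩ := fusionMk_surjective R w x
    exact (congrArg (fusionMk R w) (Subtype.ext (by simp [latticeAct]))).trans (map_zero _)
  map_add' a b := by
    ext x
    obtain ⟨f, rfl⟩ := fusionMk_surjective R w x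
    exact (congrArg (fusionMk R w) (Subtype.ext (by simp [latticeAct]))).trans (map_add _ _ _)
  commutes' c := by
    ext x
    obtain ⟨f, rfl⟩ := fusionMk_surjective R w x
    have h : latticeAct R w (algebraMap ℂ U c) f =
        LinearMap.lsmul regOne (lattice R w) (algebraMap ℂ regOne c) f := by
      apply Subtype.ext
      change R (algebraMap ℂ U c) f.1 = algebraMap ℂ regOne c • f.1
      rw [AlgHom.commutes, Module.algebraMap_end_apply, algebraMap_smul]
    exact (congrArg (fusionMk R w) h).trans (map_smul (fusionMk R w) _ f)

end Fusion

section Main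

variable {T : TwistedType} {t : ℂˣ} {μ₁ μ₂ : T.Coweight}
  {V₁ : Type*} [AddCommGroup V₁] [Module ℂ V₁] {V₂ : Type*} [AddCommGroup V₂] [Module ℂ V₂]

/-- The action of `U^{μ₁ + μ₂}` on `(V₁ ⊗ V₂)((u))` through `Δ`. -/
def deformedAct (Δ : Alg T t (μ₁ + μ₂) →ₐ[ℂ] LaurentTensor T t μ₁ μ₂)
    (ρ₁ : Alg T t μ₁ →ₐ[ℂ] Module.End ℂ V₁) (ρ₂ : Alg T t μ₂ →ₐ[ℂ] Module.End ℂ V₂) :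
    Alg T t (μ₁ + μ₂) →ₐ[ℂ] Module.End (LaurentSeries ℂ) (LaurentVec (V₁ ⊗[ℂ] V₂)) :=
  laurentAct.comp ((laurentMap
    (Module.endTensorEndAlgHom.comp (Algebra.TensorProduct.map ρ₁ ρ₂))).comp Δ)

/-- The weight space of weight `ω` in `W(u)`. -/
def ratWeightSpace {μ : T.Coweight} {W : Type*} [AddCommGroup W] [Module ℂ W]
    (R : Alg T t μ →ₐ[ℂ] Module.End (LaurentSeries ℂ) (LaurentVec W)) (ω : Weight T) :
    Submodule regOne (LaurentVec W) where
  carrier := {f | f ∈ ratVec W ∧ ∀ i, R (Alg.lead 1 i) f = (ω i : ℂ) • f}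
  zero_mem' := ⟨Submodule.zero_mem _, fun i => (map_zero _).trans (smul_zero _).symm⟩
  add_mem' := fun hf hg => ⟨Submodule.add_mem _ hf.1 hg.1, fun i => by
    rw [map_add, hf.2 i, hg.2 i, smul_add]⟩
  smul_mem' := fun c f hf => ⟨Submodule.smul_mem _ c.1 hf.1, fun i => by
    rw [act_smul, hf.2 i, smul_comm]⟩

/-- `L` is an `𝒜`-form of `W(u)`: an `𝒜`-submodule stable under the algebra that generates `W(u)`
over `ℂ(u)` and meets each weight space of `W(u)` in a finitely generated `𝒜`-module. -/
structure IsAForm {μ : T.Coweight} {W : Type*} [AddCommGroup W] [Module ℂ W]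
    (R : Alg T t μ →ₐ[ℂ] Module.End (LaurentSeries ℂ) (LaurentVec W))
    (L : Submodule regOne (LaurentVec W)) : Prop where
  stable : ∀ a, ∀ f ∈ L, R a f ∈ L
  span_eq : Submodule.span (RatFunc ℂ) (L : Set (LaurentVec W)) = ratVec W
  fg : ∀ ω, (L ⊓ ratWeightSpace R ω).FG

end Main

end TwistedFusion

end

open TwistedFusion

open TwistedFusion
open Finset.HasAntidiagonal (antidiagonal mem_antidiagonal)
set_option linter.unusedSectionVars false

noncomputable section

namespace TwistedFusion
open MvPolynomial (C_apply rename_id algebraMap_eq rename_rename rename_C induction_on' isHomogeneous_C isHomogeneous_X IsHomogeneous)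
open Finset (sum_congr range sum_subset mul_sum sum_eq_zero sum_sigma' sum_nbij' sum_mul smul_sum sum_add_distrib sum_smul sum_sub_distrib univ mem_insert mem_singleton sum_insert sum_singleton induction_on prod_insert mem_univ mem_range prod_mul_distrib prod_congr mem_Icc mem_filter prod_pair sum_range_succ sum_ite_eq mem_vaddAntidiagonal sum_pair)
open Submodule (span subset_span span_mono span_le smul_mem span_induction finiteDimensional_of_le mem_iSup_of_mem map₂ map₂_le coe_smul mem_top mem_span_singleton map₂_iSup_left map₂_iSup_right mem_iInf iSup_induction' ne_bot_iff coe_sum)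
open PowerSeries (derivative coeff_mul coeff_derivative coeff_mk coeff coeff_one smul_eq_C_mul)
open HahnSeries (coeff_smul coeff_add single coeff_single_of_ne single_mul_single coeff_sub coeff_single_same ofPowerSeries)
open TensorProduct (tmul_zero zero_tmul tmul_add add_tmul smul_tmul' tmul_smul smul_tmul_smul sub_tmul tmul_sub map₂_mk_top_top_eq_top ext' mk_apply)
open Module.End (genEigenspace mem_eigenspace_iff)
open Module (End finBasis finrank algebraMap_end_apply)
open Algebra.TensorProduct (tmul_mul_tmul one_def)
open LinearMap (funLeft)
open FreeAlgebra (lift_ι_apply)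
open RatFunc (algebraMap_ne_zero)
open Polynomial (constantCoeff_coe)
open Matrix (cons_val diag_apply)
open Units (val_one val_neg val_mul mk0)
open Nat (succ_ne_zero cast_zero)
open Int (toNat_of_nonneg units_eq_one_or)
open TwistedFusion.Alg (lead)
open Module.Finite (iff_fg)

variable {T : TwistedType} {t : ℂˣ} {μ μ1 μ2 : T.Coweight} {V : Type*} [AddCommGroup V] [Module ℂ V]
  {W : Type*} [AddCommGroup W] [Module ℂ W] {V1 : Type*} [AddCommGroup V1] [Module ℂ V1]
  {V2 : Type*} [AddCommGroup V2] [Module ℂ V2] {ρ : Alg T t μ →ₐ[ℂ] End ℂ V}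
  {Δ : Alg T t (μ1 + μ2) →ₐ[ℂ] LaurentTensor T t μ1 μ2} {ρ1 : Alg T t μ1 →ₐ[ℂ] End ℂ V1}
  {ρ2 : Alg T t μ2 →ₐ[ℂ] End ℂ V2} {v1 : V1} {v2 : V2} {ω1 ω2 : ℤˣ → Weight T}
  {ω : Weight T} (ε : ℤˣ) (i j : T.I0)
local notation "Poly2" => MvPolynomial (Fin 2) ℂ
local notation "Poly3" => MvPolynomial (Fin 3) ℂ
local notation "swapVars" => MvPolynomial.rename ![(1 : Fin 2), 0]
local notation "LT12" => LaurentTensor T t μ1 μ2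
local notation "V12" => V1 ⊗[ℂ] V2
local notation "v12" => v1 ⊗ₜ[ℂ] v2
local notation "ρΔ" => deformedAct Δ ρ1 ρ2

/-- No positive power of `q = t ^ 2` is `1`. -/
def Generic (t : ℂˣ) : Prop := ∀ n : ℕ, 0 < n → (t ^ 2) ^ n ≠ 1

/-! ### Exponential series -/

/-- The sequence `E` consists of the coefficients of `exp (∑_{m ≥ 1} a m y ^ m)`, expressed by the
recursion that comes from the logarithmic derivative. -/
structure IsExp {A : Type*} [Ring A] [Algebra ℂ A] (a E : ℕ → A) : Prop where
  zero : E 0 = 1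
  succ : ∀ n : ℕ, ((n : ℂ) + 1) • E (n + 1) =
    ∑ p ∈ antidiagonal n, ((p.1 : ℂ) + 1) • (a (p.1 + 1) * E p.2)

lemma IsExp.unique {A : Type*} [Ring A] [Algebra ℂ A] {a E E' : ℕ → A}
    (h : IsExp a E) (h' : IsExp a E') : E = E' := by
  funext n
  induction n using Nat.strong_induction_on with
  | _ n ih =>
    cases n with
    | zero => rw [h.zero, h'.zero]
    | succ n =>
      have hn : ((n : ℂ) + 1) ≠ 0 := by exact_mod_cast succ_ne_zero n
      apply smul_right_injective A hn
      simp only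
      rw [h.succ, h'.succ]
      refine sum_congr rfl fun p hp => ?_
      rw [ih p.2 (by have := mem_antidiagonal.1 hp; omega)]

lemma IsExp.congr {A : Type*} [Ring A] [Algebra ℂ A] {a b E : ℕ → A}
    (h : IsExp a E) (hab : ∀ m, a (m + 1) = b (m + 1)) : IsExp b E :=
  ⟨h.zero, fun n => by rw [h.succ]; simp only [hab]⟩

lemma IsExp.map {A B : Type*} [Ring A] [Algebra ℂ A] [Ring B] [Algebra ℂ B] {a E : ℕ → A}
    (h : IsExp a E) (g : A →ₐ[ℂ] B) : IsExp (fun m => g (a m)) (fun m => g (E m)) :=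
  ⟨by rw [h.zero, map_one], fun n => by
    rw [← map_smul, h.succ, map_sum]
    simp only [map_smul, map_mul]⟩

lemma isExp_iff_deriv {A : Type*} [CommRing A] [Algebra ℂ A] {a E : ℕ → A} :
    IsExp a E ↔ E 0 = 1 ∧ derivative A (PowerSeries.mk E) =
      derivative A (PowerSeries.mk a) * PowerSeries.mk E := by
  have key : (∀ n : ℕ, ((n : ℂ) + 1) • E (n + 1) =
      ∑ p ∈ antidiagonal n, ((p.1 : ℂ) + 1) • (a (p.1 + 1) * E p.2)) ↔
      derivative A (PowerSeries.mk E) =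
      derivative A (PowerSeries.mk a) * PowerSeries.mk E := by
    rw [PowerSeries.ext_iff]
    refine forall_congr' fun n => ?_
    rw [coeff_mul]
    simp only [coeff_derivative, coeff_mk]
    have hc (k : ℕ) (x : A) : ((k : ℂ) + 1) • x = x * ((k : A) + 1) := by
      rw [Algebra.smul_def]; simp [mul_comm]
    simp only [hc]
    rw [show (∑ p ∈ antidiagonal n, a (p.1 + 1) * E p.2 * ((p.1 : A) + 1)) =
      ∑ p ∈ antidiagonal n, a (p.1 + 1) * ((p.1 : A) + 1) * E p.2 from
      sum_congr rfl fun p _ => by ring]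
  exact ⟨fun h => ⟨h.zero, key.1 h.succ⟩, fun h => ⟨h.1, key.2 h.2⟩⟩

lemma IsExp.mul_of_comm {A : Type*} [CommRing A] [Algebra ℂ A] {a b E E' : ℕ → A}
    (h : IsExp a E) (h' : IsExp b E') :
    IsExp (fun m => a m + b m) (fun n => ∑ p ∈ antidiagonal n, E p.1 * E' p.2) := by
  have hmk : PowerSeries.mk (fun n => ∑ p ∈ antidiagonal n, E p.1 * E' p.2) =
      PowerSeries.mk E * PowerSeries.mk E' := by
    ext n; simp [coeff_mul]
  have hab : PowerSeries.mk (fun m => a m + b m) = PowerSeries.mk a + PowerSeries.mk b := by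
    ext n; simp
  rw [isExp_iff_deriv] at h h' ⊢
  refine ⟨by simp [h.1, h'.1], ?_⟩
  rw [hmk, hab, Derivation.leibniz, h.2, h'.2, map_add]
  simp only [smul_eq_mul]
  ring

lemma expCoeff_map {A B : Type} [Ring A] [Algebra ℂ A] [Ring B] [Algebra ℂ B]
    (g : A →ₐ[ℂ] B) (a : ℕ → A) (n : ℕ) :
    g (expCoeff a n) = expCoeff (fun m => g (a m)) n := by
  have hmk : (PowerSeries.mk fun m => if m = 0 then 0 else g (a m)) =
      PowerSeries.map (g : A →+* B) (PowerSeries.mk fun m => if m = 0 then 0 else a m) := by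
    ext m; by_cases hm : m = 0 <;> simp [hm]
  unfold expCoeff
  rw [hmk, map_sum, map_sum, map_sum]
  refine sum_congr rfl fun k _ => ?_
  rw [PowerSeries.coeff_smul, PowerSeries.coeff_smul, map_smul, ← map_pow, PowerSeries.coeff_map]
  rfl

lemma isExp_expCoeff_of_comm {A : Type} [CommRing A] [Algebra ℂ A] (a : ℕ → A) :
    IsExp a (expCoeff a) := by
  set α : PowerSeries A := PowerSeries.mk fun m => if m = 0 then 0 else a m with hα
  have hX : PowerSeries.X ∣ α := by rw [PowerSeries.X_dvd_iff]; simp [hα]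
  have hlow (n k : ℕ) (hnk : n < k) : coeff n (α ^ k) = 0 :=
    PowerSeries.X_pow_dvd_iff.1 (pow_dvd_pow_of_dvd hX k) n hnk
  have hstab (n K : ℕ) (hK : n ≤ K) : expCoeff a n =
      coeff n (∑ k ∈ range (K + 1), ((k.factorial : ℂ)⁻¹) • α ^ k) := by
    rw [expCoeff, map_sum, map_sum]
    apply sum_subset
    · intro x; simp; omega
    · intro k _ hk
      rw [PowerSeries.coeff_smul, hlow n k (by simpa using hk), smul_zero]
  have hd (K : ℕ) : derivative A (∑ k ∈ range (K + 2), ((k.factorial : ℂ)⁻¹) • α ^ k) =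
      derivative A α * ∑ k ∈ range (K + 1), ((k.factorial : ℂ)⁻¹) • α ^ k := by
    have hs (c : ℂ) (f : PowerSeries A) : c • f = (algebraMap ℂ A c) • f := by rw [algebraMap_smul]
    rw [Finset.sum_range_succ', map_add, map_sum, mul_sum]
    simp only [hs, pow_zero]
    rw [(derivative A).map_smul, (derivative A).map_one_eq_zero, smul_zero, add_zero]
    refine sum_congr rfl fun k _ => ?_
    rw [(derivative A).map_smul, Derivation.leibniz_pow, Nat.add_sub_cancel, ← hs, ← hs, mul_smul_comm, smul_eq_mul, ← Nat.cast_smul_eq_nsmul ℂ, smul_smul,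
      mul_comm (α ^ k)]
    congr 1
    rw [Nat.factorial_succ]
    have : ((k : ℂ) + 1) ≠ 0 := by exact_mod_cast succ_ne_zero k
    have h2 : (k.factorial : ℂ) ≠ 0 := by exact_mod_cast Nat.factorial_ne_zero k
    push_cast
    field_simp
  refine ⟨by simp [expCoeff], fun n => ?_⟩
  have := congrArg (coeff n) (hd n)
  rw [coeff_derivative, ← hstab (n + 1) (n + 1) le_rfl, coeff_mul] at this
  have hc (k : ℕ) (x : A) : ((k : ℂ) + 1) • x = x * ((k : A) + 1) := by
    rw [Algebra.smul_def]; simp [mul_comm]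
  rw [hc, this]
  refine sum_congr rfl fun p hp => ?_
  rw [← hstab p.2 n (by have := mem_antidiagonal.1 hp; omega), hc, coeff_derivative]
  simp [hα]
  ring

lemma exists_comm_cover {A : Type} [Ring A] [Algebra ℂ A] {ι : Type*} (f : ι → A)
    (hf : ∀ i j, Commute (f i) (f j)) :
    ∃ (C : Type) (_ : CommRing C) (_ : Algebra ℂ C) (j : C →ₐ[ℂ] A) (g : ι → C),
      ∀ i, j (g i) = f i :=
  have hS : IsMulCommutative (Algebra.adjoin ℂ (Set.range f)) := Algebra.isMulCommutative_adjoin ℂ (by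
      rintro _ ⟨i, rfl⟩ _ ⟨j, rfl⟩; exact hf i j)
  ⟨Algebra.adjoin ℂ (Set.range f),
    { (Algebra.adjoin ℂ (Set.range f)).toRing with mul_comm := hS.is_comm.comm }, inferInstance,
    (Algebra.adjoin ℂ (Set.range f)).val,
    fun i => ⟨f i, Algebra.subset_adjoin ⟨i, rfl⟩⟩, fun _ => rfl⟩

lemma isExp_expCoeff {A : Type} [Ring A] [Algebra ℂ A] (a : ℕ → A)
    (ha : ∀ i j, Commute (a i) (a j)) : IsExp a (expCoeff a) := by
  obtain ⟨C, _, _, j, g, hg⟩ := exists_comm_cover a ha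
  obtain rfl : (fun i => j (g i)) = a := funext hg
  have := (isExp_expCoeff_of_comm g).map j
  simpa only [expCoeff_map] using this

lemma expCoeff_add {A : Type} [Ring A] [Algebra ℂ A] (a b : ℕ → A)
    (ha : ∀ i j, Commute (a i) (a j)) (hb : ∀ i j, Commute (b i) (b j))
    (hab : ∀ i j, Commute (a i) (b j)) (n : ℕ) :
    expCoeff (fun m => a m + b m) n = ∑ p ∈ antidiagonal n, expCoeff a p.1 * expCoeff b p.2 := by
  obtain ⟨C, _, _, j, g, hg⟩ := exists_comm_cover (Sum.elim a b) (by
    rintro (i | i) (k | k)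
    exacts [ha i k, hab i k, (hab k i).symm, hb i k])
  obtain rfl : (fun i => j (g (Sum.inl i))) = a := funext fun i => hg (Sum.inl i)
  obtain rfl : (fun i => j (g (Sum.inr i))) = b := funext fun i => hg (Sum.inr i)
  simp only [← expCoeff_map, ← map_add, ← map_mul, ← map_sum]
  rw [congrFun ((isExp_expCoeff_of_comm _).unique
    ((isExp_expCoeff_of_comm fun i => g (Sum.inl i)).mul_of_comm
    (isExp_expCoeff_of_comm fun i => g (Sum.inr i)))) n]

lemma IsExp.eq_zero_of_not_dvd {A : Type*} [Ring A] [Algebra ℂ A] {a E : ℕ → A}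
    (h : IsExp a E) {d : ℕ} (ha : ∀ m, ¬ d ∣ m → a m = 0) (n : ℕ) (hnd : ¬ d ∣ n) : E n = 0 := by
  induction n using Nat.strong_induction_on with
  | _ n ih =>
    cases n with
    | zero => simp at hnd
    | succ n =>
      have hn : ((n : ℂ) + 1) ≠ 0 := by exact_mod_cast succ_ne_zero n
      apply smul_right_injective A hn
      simp only [smul_zero]
      rw [h.succ]
      refine sum_eq_zero fun p hp => ?_
      have hp' := mem_antidiagonal.1 hp
      by_cases h1 : d ∣ p.1 + 1
      · rw [ih p.2 (by omega), mul_zero, smul_zero]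
        intro h2
        exact hnd (by have := dvd_add h1 h2; rwa [show p.1 + 1 + p.2 = n + 1 by omega] at this)
      · rw [ha _ h1, zero_mul, smul_zero]

lemma IsExp.scale {A : Type*} [Ring A] [Algebra ℂ A] {a E : ℕ → A}
    (h : IsExp a E) (c : A) (hc : ∀ x, Commute c x) :
    IsExp (fun m => c ^ m * a m) (fun m => c ^ m * E m) := by
  refine ⟨by simp [h.zero], fun n => ?_⟩
  rw [← mul_smul_comm, h.succ, mul_sum]
  refine sum_congr rfl fun p hp => ?_
  have hp' := mem_antidiagonal.1 hp
  rw [mul_smul_comm]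
  congr 1
  rw [show n + 1 = (p.1 + 1) + p.2 by omega, pow_add, mul_assoc, mul_assoc, ← mul_assoc (a _),
    ← ((hc _).pow_left p.2).eq, mul_assoc]

lemma sum_antidiagonal_swap {B : Type*} [AddCommMonoid B] (n : ℕ) (f : ℕ → ℕ → ℕ → B) :
    ∑ p ∈ antidiagonal n, ∑ s ∈ antidiagonal p.2, f p.1 s.1 s.2 =
      ∑ p ∈ antidiagonal n, ∑ s ∈ antidiagonal p.2, f s.1 p.1 s.2 := by
  rw [sum_sigma', sum_sigma']
  refine sum_nbij' (fun x => ⟨(x.2.1, x.1.1 + x.2.2), (x.1.1, x.2.2)⟩)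
    (fun x => ⟨(x.2.1, x.1.1 + x.2.2), (x.1.1, x.2.2)⟩) ?_ ?_ ?_ ?_ ?_
  all_goals
    rintro ⟨⟨a, b⟩, ⟨c, d⟩⟩ h
    simp only [Finset.mem_sigma, mem_antidiagonal] at h ⊢
  · exact ⟨by omega, trivial⟩
  · exact ⟨by omega, trivial⟩
  · obtain ⟨h1, rfl⟩ := h; rfl
  · obtain ⟨h1, rfl⟩ := h; rfl

lemma sum_antidiagonal_assoc {B : Type*} [AddCommMonoid B] (n : ℕ) (f : ℕ → ℕ → ℕ → B) :
    ∑ p ∈ antidiagonal n, ∑ s ∈ antidiagonal p.2, f p.1 s.1 s.2 =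
      ∑ p ∈ antidiagonal n, ∑ s ∈ antidiagonal p.1, f s.1 s.2 p.2 := by
  rw [sum_sigma', sum_sigma']
  refine sum_nbij' (fun x => ⟨(x.1.1 + x.2.1, x.2.2), (x.1.1, x.2.1)⟩)
    (fun x => ⟨(x.2.1, x.2.2 + x.1.2), (x.2.2, x.1.2)⟩) ?_ ?_ ?_ ?_ ?_
  all_goals
    rintro ⟨⟨a, b⟩, ⟨c, d⟩⟩ h
    simp only [Finset.mem_sigma, mem_antidiagonal] at h ⊢
  · exact ⟨by omega, trivial⟩
  · exact ⟨by omega, trivial⟩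
  · obtain ⟨h1, rfl⟩ := h; rfl
  · obtain ⟨h1, rfl⟩ := h; rfl

lemma IsExp.mul_shift {A : Type*} [Ring A] [Algebra ℂ A] {a E : ℕ → A} {c e : ℕ → ℂ}
    (h : IsExp a E) (he : IsExp c e) (x : ℕ → A)
    (hx : ∀ m r, 0 < m → a m * x r = x r * a m + c m • x (r + m)) (n r : ℕ) :
    E n * x r = ∑ p ∈ antidiagonal n, e p.1 • (x (r + p.1) * E p.2) := by
  induction n using Nat.strong_induction_on generalizing r with
  | _ n ih =>
    cases n with
    | zero => simp [h.zero, he.zero]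
    | succ n =>
      have hn : ((n : ℂ) + 1) ≠ 0 := by exact_mod_cast succ_ne_zero n
      apply smul_right_injective A hn
      simp only
      rw [← smul_mul_assoc, h.succ, sum_mul]
      have step1 : ∀ p ∈ antidiagonal n, (((p.1 : ℂ) + 1) • (a (p.1 + 1) * E p.2)) * x r =
          ∑ s ∈ antidiagonal p.2, (((p.1 : ℂ) + 1) * e s.1) •
            (x (r + s.1) * a (p.1 + 1) * E s.2 + c (p.1 + 1) • (x (r + s.1 + (p.1 + 1)) * E s.2)) := by
        intro p hp
        have hp' := mem_antidiagonal.1 hp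
        rw [smul_mul_assoc, mul_assoc, ih p.2 (by omega), mul_sum, smul_sum]
        refine sum_congr rfl fun s _ => ?_
        rw [mul_smul_comm, smul_smul, ← mul_assoc, hx _ _ (Nat.succ_pos _), add_mul (x _ * _),
          smul_mul_assoc (c _)]
      rw [sum_congr rfl step1]
      have split : ∀ p ∈ antidiagonal (n + 1), ((n : ℂ) + 1) • (e p.1 • (x (r + p.1) * E p.2))
          = (e p.1 * p.2) • (x (r + p.1) * E p.2) + (p.1 * e p.1) • (x (r + p.1) * E p.2) := by
        intro p hp
        have hp' := mem_antidiagonal.1 hp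
        have : ((n : ℂ) + 1) = p.1 + p.2 := by exact_mod_cast hp'.symm
        rw [this, smul_smul, ← add_smul]; congr 1; ring
      rw [smul_sum, sum_congr rfl split, sum_add_distrib]
      simp only [smul_add, sum_add_distrib]
      congr 1
      · rw [Finset.Nat.antidiagonal_succ']
        rw [Finset.sum_cons]
        simp only [cast_zero, mul_zero, zero_smul, zero_add, Finset.sum_map,
          Function.Embedding.prodMap, Function.Embedding.coeFn_mk, Prod.map, Function.Embedding.refl_apply]
        have : ∀ p ∈ antidiagonal n, (e p.1 * ((p.2.succ : ℕ) : ℂ)) • (x (r + p.1) * E p.2.succ) =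
            ∑ s ∈ antidiagonal p.2, (((s.1 : ℂ) + 1) * e p.1) • (x (r + p.1) * a (s.1 + 1) * E s.2) := by
          intro p _
          rw [mul_smul, Nat.succ_eq_add_one, Nat.cast_succ, ← mul_smul_comm, h.succ, mul_sum, smul_sum]
          refine sum_congr rfl fun s _ => ?_
          rw [mul_smul_comm, smul_smul, mul_comm (e _), mul_assoc]
        rw [sum_congr rfl this, sum_antidiagonal_swap n
          (fun s t z => (((s : ℂ) + 1) * e t) • (x (r + t) * a (s + 1) * E z))]
      · rw [Finset.Nat.antidiagonal_succ]
        rw [Finset.sum_cons]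
        simp only [cast_zero, zero_mul, zero_smul, zero_add, Finset.sum_map,
          Function.Embedding.prodMap, Function.Embedding.coeFn_mk, Prod.map, Function.Embedding.refl_apply]
        have : ∀ p ∈ antidiagonal n, (((p.1.succ : ℕ) : ℂ) * e p.1.succ) • (x (r + p.1.succ) * E p.2) =
            ∑ s ∈ antidiagonal p.1, (((s.1 : ℂ) + 1) * e s.2) • (c (s.1 + 1) • (x (r + s.2 + (s.1 + 1)) * E p.2)) := by
          intro p _
          have := he.succ p.1
          simp only [smul_eq_mul] at this
          rw [Nat.succ_eq_add_one, Nat.cast_succ, this, sum_smul]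
          refine sum_congr rfl fun s hs => ?_
          have hs' := mem_antidiagonal.1 hs
          rw [smul_smul, show r + s.2 + (s.1 + 1) = r + (p.1 + 1) by omega]
          congr 1; ring
        rw [sum_congr rfl this, sum_antidiagonal_assoc n
          (fun s t z => (((s : ℂ) + 1) * e t) • (c (s + 1) • (x (r + t + (s + 1)) * E z)))]


section

open MvPolynomial (X)

/-! ### Formal distributions as a module over polynomials -/

/-- Formal distributions in variables `u_k`, `k : ι`, with coefficients in `A`; the value at `p` is
the coefficient of `∏ u_k ^ (-p k)`. -/
def Dist (ι : Type) (A : Type*) : Type _ := (ι → ℤ) → A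

namespace Dist

variable {ι : Type} [DecidableEq ι] {A : Type*} [Ring A] [Algebra ℂ A]

instance : AddCommGroup (Dist ι A) := inferInstanceAs (AddCommGroup ((ι → ℤ) → A))
instance : Module ℂ (Dist ι A) := inferInstanceAs (Module ℂ ((ι → ℤ) → A))

/-- Translation of the index. -/
def shift : Multiplicative (ι →₀ ℕ) →* End ℂ (Dist ι A) where
  toFun m :=
    { toFun := fun T p => T (p + fun k => (m.toAdd k : ℤ))
      map_add' := fun _ _ => rfl
      map_smul' := fun _ _ => rfl }
  map_one' := by
    ext T; funext p
    change T _ = T p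
    congr 1; funext k; simp
  map_mul' a b := by
    ext T; funext p
    change T _ = T _
    congr 1; funext k; simp; ring

/-- The action of polynomials on formal distributions by multiplication. -/
def polyAct : MvPolynomial ι ℂ →ₐ[ℂ] End ℂ (Dist ι A) :=
  AddMonoidAlgebra.lift ℂ (End ℂ (Dist ι A)) (ι →₀ ℕ) shift

instance : Module (MvPolynomial ι ℂ) (Dist ι A) :=
  Module.compHom _ (polyAct (ι := ι) (A := A)).toRingHom

lemma smul_def (P : MvPolynomial ι ℂ) (T : Dist ι A) : P • T = polyAct P T := rfl

lemma monomial_smul (m : ι →₀ ℕ) (c : ℂ) (T : Dist ι A) (p : ι → ℤ) :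
    (MvPolynomial.monomial m c • T) p = c • T (p + fun k => (m k : ℤ)) := by
  rw [smul_def]
  have : polyAct (A := A) (MvPolynomial.monomial m c) = c • shift (Multiplicative.ofAdd m) :=
    AddMonoidAlgebra.lift_single _ _ _
  rw [this]; rfl

lemma add_apply (T S : Dist ι A) (p : ι → ℤ) : (T + S) p = T p + S p := rfl
lemma sub_apply (T S : Dist ι A) (p : ι → ℤ) : (T - S) p = T p - S p := rfl
lemma zero_apply (p : ι → ℤ) : (0 : Dist ι A) p = 0 := rfl
lemma csmul_apply (c : ℂ) (T : Dist ι A) (p : ι → ℤ) : (c • T) p = c • T p := rfl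

lemma sum_apply {κ : Type*} (s : Finset κ) (T : κ → Dist ι A) (p : ι → ℤ) :
    (∑ k ∈ s, T k) p = ∑ k ∈ s, T k p := Finset.sum_apply p s T

lemma C_smul (c : ℂ) (T : Dist ι A) : (MvPolynomial.C c : MvPolynomial ι ℂ) • T = c • T := by
  funext p
  rw [C_apply, monomial_smul]
  exact congrArg (fun p => c • T p) (by funext k; simp)

lemma X_smul (k : ι) (T : Dist ι A) (p : ι → ℤ) :
    ((X k : MvPolynomial ι ℂ) • T) p = T (p + Pi.single k 1) := by
  rw [X, monomial_smul, one_smul]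
  congr 2; funext j
  by_cases h : j = k <;> simp [h]

lemma rename_smul (e : Fin 2 → ι) (P : Poly2) (T : Dist ι A) (p : ι → ℤ) :
    (MvPolynomial.rename e P • T) p = ∑ m ∈ P.support, P.coeff m •
      T (p + (Pi.single (e 0) (m 0 : ℤ) + Pi.single (e 1) (m 1 : ℤ))) := by
  conv_lhs => rw [P.as_sum]
  rw [map_sum, sum_smul, sum_apply]
  refine sum_congr rfl fun m _ => ?_
  rw [MvPolynomial.rename_monomial, monomial_smul]
  congr 3
  funext k
  have hm : m = Finsupp.single 0 (m 0) + Finsupp.single 1 (m 1) := by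
    ext j; fin_cases j <;> simp
  conv_lhs => rw [hm]
  rw [Finsupp.mapDomain_add, Finsupp.mapDomain_single, Finsupp.mapDomain_single]
  simp only [Finsupp.add_apply, Finsupp.single_apply, Nat.cast_add, Pi.add_apply, Pi.single_apply, eq_comm (a := k)]
  split_ifs <;> simp

end Dist

variable {A : Type} [Ring A] [Algebra ℂ A] {F G F' G' : Poly2} {f g f' g' : ℤ → A}

/-- The two-variable exchange relation `F (u1, u2) f (u1) g (u2) = G (u1, u2) g (u2) f (u1)`. -/
def Exchange (F G : Poly2) (f g : ℤ → A) : Prop :=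
  ∀ a b : ℤ, coeffSum F (fun k l => f (a + k) * g (b + l)) =
    coeffSum G (fun k l => g (b + l) * f (a + k))

/-- The product `f (u_i) g (u_j) h (u_k)`. -/
def word (f : ℤ → A) (i : Fin 3) (g : ℤ → A) (j : Fin 3) (h : ℤ → A) (k : Fin 3) :
    Dist (Fin 3) A := fun p => f (p i) * g (p j) * h (p k)

/-- A polynomial in two of three variables. -/
abbrev poly2 (P : Poly2) (i j : Fin 3) : Poly3 := MvPolynomial.rename ![i, j] P

lemma Exchange.word_left (H : Exchange F G f g) (h : ℤ → A) {i j k : Fin 3}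
    (hij : i ≠ j := by omega) (hik : i ≠ k := by omega) (hjk : j ≠ k := by omega) :
    poly2 F i j • word f i g j h k = poly2 G i j • word g j f i h k := by
  funext p
  rw [Dist.rename_smul, Dist.rename_smul]
  have := congrArg (· * h (p k)) (H (p i) (p j))
  simp only [coeffSum, sum_mul, smul_mul_assoc] at this
  simpa [word, hij, hij.symm, hik.symm, hjk.symm, Pi.single_apply] using this

lemma Exchange.word_right (H : Exchange F G f g) (h : ℤ → A) {i j k : Fin 3}
    (hij : i ≠ j := by omega) (hik : i ≠ k := by omega) (hjk : j ≠ k := by omega) :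
    poly2 F i j • word h k f i g j = poly2 G i j • word h k g j f i := by
  funext p
  rw [Dist.rename_smul, Dist.rename_smul]
  have := congrArg (h (p k) * ·) (H (p i) (p j))
  simp only [coeffSum, mul_sum, mul_smul_comm, ← mul_assoc] at this
  simpa [word, hij, hij.symm, hik.symm, hjk.symm, Pi.single_apply] using this

/-- A doubly indexed family as a formal distribution in two variables. -/
def dist₂ (f : ℤ → ℤ → A) : Dist (Fin 2) A := fun p => f (p 0) (p 1)

lemma coeffSum_eq_smul (P : Poly2) (f : ℤ → ℤ → A) (a b : ℤ) :
    coeffSum P (fun k l => f (a + k) (b + l)) = (P • dist₂ f) ![a, b] := by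
  have := Dist.rename_smul id P (dist₂ f) ![a, b]
  rw [rename_id, AlgHom.id_apply] at this
  rw [this]
  simp [coeffSum, dist₂]

lemma coeffSum_swap (P : Poly2) (f : ℤ → ℤ → A) (a b : ℤ) :
    coeffSum (swapVars P) (fun k l => f (a + k) (b + l)) =
      coeffSum P (fun k l => f (a + l) (b + k)) := by
  rw [coeffSum_eq_smul, Dist.rename_smul]
  simp [coeffSum, dist₂]

lemma coeffSum_C_mul (c : ℂ) (P : Poly2) (f : ℤ → ℤ → A) (a b : ℤ) :
    coeffSum (MvPolynomial.C c * P) (fun k l => f (a + k) (b + l)) =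
      c • coeffSum P (fun k l => f (a + k) (b + l)) := by
  rw [coeffSum_eq_smul, mul_smul, Dist.C_smul, Dist.csmul_apply, ← coeffSum_eq_smul]

lemma Exchange.reverse (H : Exchange F G f g) {κ : ℂ} (hF : F' = MvPolynomial.C κ * swapVars G)
    (hG : G' = MvPolynomial.C κ * swapVars F) : Exchange F' G' g f := by
  intro a b
  rw [hF, hG, coeffSum_C_mul _ _ (fun a b => g a * f b), coeffSum_swap _ (fun a b => g a * f b),
    coeffSum_C_mul _ _ (fun a b => f b * g a), coeffSum_swap _ (fun a b => f b * g a), H b a]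

lemma coeffSum_add (P : Poly2) (f g : ℤ → ℤ → A) :
    coeffSum P (fun k l => f k l + g k l) = coeffSum P f + coeffSum P g := by
  simp [coeffSum, sum_add_distrib]

lemma coeffSum_map {B : Type} [Ring B] [Algebra ℂ B] (g : A →ₐ[ℂ] B) (P : Poly2) (f : ℤ → ℤ → A) :
    g (coeffSum P f) = coeffSum P (fun k l => g (f k l)) := by
  simp [coeffSum, map_sum]

lemma Exchange.add (h1 : Exchange F G f g) (h2 : Exchange F G f g') (h3 : Exchange F G f' g)
    (h4 : Exchange F G f' g') :
    Exchange F G (fun r => f r + f' r) (fun r => g r + g' r) := by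
  intro a b
  simp only [add_mul, mul_add, coeffSum_add]
  rw [h1 a b, h2 a b, h3 a b, h4 a b]
  abel

/-! ### The order in the Laurent variable -/

variable {B : Type} [Ring B] [Algebra ℂ B]

/-- The order in `u` of the coefficient of index `p` is at least `∑ e_k p_k` up to a constant. -/
def OrderBound {ι : Type} [Fintype ι] (e : ι → ℕ) (T : Dist ι (HahnSeries ℤ B)) : Prop :=
  ∃ b : ℤ, ∀ p n, n < ∑ k, (e k : ℤ) * p k - b → (T p).coeff n = 0

namespace OrderBound

variable {ι : Type} [Fintype ι] [DecidableEq ι] {e : ι → ℕ} {S T : Dist ι (HahnSeries ℤ B)}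

lemma add (hS : OrderBound e S) (hT : OrderBound e T) : OrderBound e (S + T) := by
  obtain ⟨b, hb⟩ := hS
  obtain ⟨c, hc⟩ := hT
  refine ⟨max b c, fun p n hn => ?_⟩
  rw [Dist.add_apply, coeff_add, hb p n (by have := le_max_left b c; omega),
    hc p n (by have := le_max_right b c; omega), add_zero]

lemma csmul (c : ℂ) (hT : OrderBound e T) : OrderBound e (c • T) := by
  obtain ⟨b, hb⟩ := hT
  refine ⟨b, fun p n hn => ?_⟩
  rw [Dist.csmul_apply, coeff_smul, hb p n hn, smul_zero]

lemma smul (P : MvPolynomial ι ℂ) (hT : OrderBound e T) : OrderBound e (P • T) := by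
  induction P using MvPolynomial.induction_on with
  | C a => rw [Dist.C_smul]; exact hT.csmul a
  | add P Q hP hQ => rw [add_smul]; exact hP.add hQ
  | mul_X P k hP =>
    rw [mul_comm, mul_smul]
    obtain ⟨b, hb⟩ := hP
    refine ⟨b, fun p n hn => ?_⟩
    rw [Dist.X_smul]
    apply hb
    simp only [Pi.add_apply, mul_add, sum_add_distrib]
    have : (0 : ℤ) ≤ ∑ j, (e j : ℤ) * (Pi.single k 1 : ι → ℤ) j :=
      Finset.sum_nonneg fun j _ => mul_nonneg (by positivity) (by
        rw [Pi.single_apply]; split_ifs <;> norm_num)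
    omega

lemma sub (hS : OrderBound e S) (hT : OrderBound e T) : OrderBound e (S - T) := by
  have := hS.add (hT.csmul (-1))
  rwa [neg_one_smul, ← sub_eq_add_neg] at this

lemma eq_zero_of_linear (hT : OrderBound e T) {x y : ι} (hy : e y = 1) (hx : e x = 0) {c : ℂ}
    (hc : c ≠ 0)
    (h : (X y - MvPolynomial.C c * X x : MvPolynomial ι ℂ) • T = 0) :
    T = 0 := by
  obtain ⟨b, hb⟩ := hT
  have hstep (p : ι → ℤ) : T p = c⁻¹ • T (p + (Pi.single y 1 - Pi.single x 1)) := by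
    have := congrFun h (p - Pi.single x 1)
    rw [sub_smul, mul_smul, Dist.sub_apply, Dist.C_smul, Dist.csmul_apply, Dist.X_smul,
      Dist.X_smul, sub_add_cancel, Dist.zero_apply, sub_eq_zero] at this
    rw [show p + (Pi.single y 1 - Pi.single x 1) = p - Pi.single x 1 + Pi.single y 1 by abel, this,
      smul_smul, inv_mul_cancel₀ hc, one_smul]
  have hiter (k : ℕ) (p : ι → ℤ) :
      T p = c⁻¹ ^ k • T (p + (k : ℤ) • (Pi.single y 1 - Pi.single x 1)) := by
    induction k generalizing p with
    | zero => simp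
    | succ k ih =>
      rw [ih p, hstep, smul_smul, pow_succ]
      congr 2
      push_cast
      rw [add_smul, one_smul, add_assoc]
  funext p
  ext n
  set N := (n + 1 + b - ∑ k, (e k : ℤ) * p k).toNat with hN
  rw [hiter N p, coeff_smul, hb, smul_zero]
  · rfl
  · have h1 : ∑ k, (e k : ℤ) * (Pi.single y 1 : ι → ℤ) k = 1 := by simp [Pi.single_apply, hy]
    have h2 : ∑ k, (e k : ℤ) * (Pi.single x 1 : ι → ℤ) k = 0 := by simp [Pi.single_apply, hx]
    have h3 : ∑ k, (e k : ℤ) * (p + (N : ℤ) • (Pi.single y 1 - Pi.single x 1) : ι → ℤ) k =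
        ∑ k, (e k : ℤ) * p k + N * (∑ k, (e k : ℤ) * (Pi.single y 1 : ι → ℤ) k -
          ∑ k, (e k : ℤ) * (Pi.single x 1 : ι → ℤ) k) := by
      rw [← sum_sub_distrib, mul_sum, ← sum_add_distrib]
      refine sum_congr rfl fun k _ => ?_
      simp only [Pi.add_apply, Pi.smul_apply, Pi.sub_apply, smul_eq_mul]
      ring
    rw [h3, h1, h2]
    have := Int.self_le_toNat (n + 1 + b - ∑ k, (e k : ℤ) * p k)
    rw [← hN] at this
    omega

end OrderBound

lemma coeff_mul_eq_zero {f g : HahnSeries ℤ B} {a b n : ℤ} (hf : ∀ m < a, f.coeff m = 0)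
    (hg : ∀ m < b, g.coeff m = 0) (hn : n < a + b) : (f * g).coeff n = 0 := by
  rw [HahnSeries.coeff_mul]
  refine sum_eq_zero fun p hp => ?_
  rw [Finset.mem_antidiagonal] at hp
  by_cases h : p.1 < a
  · rw [hf _ h, zero_mul]
  · rw [hg _ (by omega), mul_zero]

lemma sum_fin3 {M : Type*} [AddCommMonoid M] {i j k : Fin 3} (hij : i ≠ j) (hik : i ≠ k)
    (hjk : j ≠ k) (f : Fin 3 → M) : ∑ l, f l = f i + f j + f k := by
  have hu : (univ : Finset (Fin 3)) = {i, j, k} := by grind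
  simp [hu, hij, hik, hjk, add_assoc]

/-- The order in `u` of `f p` is at least `e p` up to a constant. -/
def OrderBound1 (e : ℕ) (f : ℤ → HahnSeries ℤ B) : Prop :=
  ∃ b : ℤ, ∀ p n, n < (e : ℤ) * p - b → (f p).coeff n = 0

lemma OrderBound.word {f g h : ℤ → HahnSeries ℤ B} {e : Fin 3 → ℕ} {i j k : Fin 3}
    (hf : OrderBound1 (e i) f) (hg : OrderBound1 (e j) g) (hh : OrderBound1 (e k) h)
    (hij : i ≠ j := by omega) (hik : i ≠ k := by omega) (hjk : j ≠ k := by omega) :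
    OrderBound e (word f i g j h k) := by
  obtain ⟨a, ha⟩ := hf
  obtain ⟨b, hb⟩ := hg
  obtain ⟨c, hc⟩ := hh
  refine ⟨a + b + c, fun p n hn => ?_⟩
  refine coeff_mul_eq_zero (a := ((e i : ℤ) * p i - a) + ((e j : ℤ) * p j - b))
    (b := (e k : ℤ) * p k - c)
    (fun m hm => coeff_mul_eq_zero (fun _ => ha _ _) (fun _ => hb _ _) hm) (fun _ => hc _ _) ?_
  rw [sum_fin3 hij hik hjk] at hn
  omega

/-- Multiplication by `D` is injective on distributions with the given order bound. -/
def Cancels (B : Type) [Ring B] [Algebra ℂ B] (e : Fin 3 → ℕ) (D : Poly3) : Prop :=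
  ∀ T : Dist (Fin 3) (HahnSeries ℤ B), OrderBound e T → D • T = 0 → T = 0

lemma Cancels.mul {e : Fin 3 → ℕ} {D D' : Poly3} (h : Cancels B e D)
    (h' : Cancels B e D') : Cancels B e (D * D') := fun T hT h0 =>
  h' T hT (h _ (hT.smul D') (by rw [smul_smul, h0]))

lemma Cancels.prod {e : Fin 3 → ℕ} {κ : Type*} (s : Finset κ) (D : κ → Poly3)
    (h : ∀ k ∈ s, Cancels B e (D k)) : Cancels B e (∏ k ∈ s, D k) := by
  classical
  induction s using induction_on with
  | empty => intro T _ h0; rwa [Finset.prod_empty, one_smul] at h0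
  | insert k s hk ih =>
    rw [prod_insert hk]
    exact (h k (by simp)).mul (ih fun j hj => h j (by simp [hj]))

lemma TwistedType.M_pos (T : TwistedType) : 0 < T.M := by cases T <;> simp [TwistedType.M]

lemma TwistedType.ζ_ne_zero (T : TwistedType) : T.ζ ≠ 0 := Complex.exp_ne_zero _

lemma qpow_ne_zero (t : ℂˣ) (n : ℤ) : qpow t n ≠ 0 := zpow_ne_zero _ (pow_ne_zero _ t.ne_zero)

/-- `F (u_y, u_x)` cancels for orders bounded below in `u_y` only. -/
def Cancelling (B : Type) [Ring B] [Algebra ℂ B] (F : Poly2) : Prop :=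
  ∀ ⦃e : Fin 3 → ℕ⦄ ⦃x y : Fin 3⦄, e y = 1 → e x = 0 → Cancels B e (poly2 F y x)

lemma cancelling_polyF : Cancelling B (polyF T t ε i j) := by
  intro e x y hy hx
  rw [poly2, polyF, map_prod]
  refine Cancels.prod _ _ fun s _ S hS h0 => ?_
  refine hS.eq_zero_of_linear hy hx (c := T.ζ ^ s * qpow t (ε * T.Cσ i j s))
    (mul_ne_zero (pow_ne_zero _ T.ζ_ne_zero) (qpow_ne_zero _ _)) ?_
  simpa [algebraMap_eq] using h0


end

section

open MvPolynomial (C)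
open MvPolynomial (X)

/-! ### Mixed Serre relations -/

section Module

variable {R D : Type*} [CommRing R] [AddCommGroup D] [Module R D]

lemma cubic_mixed {p q s p' q' s' F F' S f1 f2 g1 g2 : R} {a b c a' b' c' : D}
    (hS : p * f1 * f2 + q * f1 * g2 + s * g1 * g2 = F * S)
    (hS' : p' * f1 * f2 + q' * f2 * g1 + s' * g1 * g2 = F' * S)
    (h1 : f1 • a = g1 • b) (h2 : f2 • b = g2 • c) (h3 : f2 • a' = g2 • b')
    (h4 : f1 • b' = g1 • c') (h5 : F • c = -(F' • c')) :
    (f1 * f2) • (p • c + q • b + s • a + (p' • c' + q' • b' + s' • a')) = 0 := by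
  linear_combination (norm := module) (s * f2) • h1 + (q * f1 + s * g1) • h2 + (s' * f1) • h3 +
    (q' * f2 + s' * g2) • h4 + hS • c + hS' • c' + S • h5

lemma serre_mixed {r P P' f g f' g' x y z : R} {a b c d a' b' : D}
    (k1 : r * P * f * f' + r * P' * g * f' - (r ^ 2 + 1) * P' * g * g' = -(z * y))
    (k2 : -(r ^ 2 + 1) * P * f * f' + r * P * f * g' + r * P' * g * g' = z * x)
    (h1 : f' • a = g' • b) (h2 : f • c = g • d) (h3 : f' • a' = g' • c) (h4 : f • b' = g • a)
    (h5 : x • b = y • d) :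
    (f * f') • (P • (r • d - (r ^ 2 + 1) • b + r • a) +
      P' • (r • c - (r ^ 2 + 1) • a' + r • b')) = 0 := by
  linear_combination (norm := module) (r * P * f + r * P' * g) • h1 +
    (r * P' * f' - (r ^ 2 + 1) * P' * g') • h2 + (-(r ^ 2 + 1) * P' * f) • h3 +
    (r * P' * f') • h4 + k1 • d + k2 • b + z • h5

end Module

/-! ### Relations for a sum of two families -/

lemma poly2_rename_swap (P : Poly2) (i j : Fin 3) : poly2 (swapVars P) i j = poly2 P j i := by
  rw [poly2, rename_rename]
  exact congrArg (fun e => MvPolynomial.rename e P) (funext fun k => by fin_cases k <;> rfl)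

section Words

variable {A : Type} [Ring A] [Algebra ℂ A]

lemma word_add1 (f f' g h : ℤ → A) (i j k : Fin 3) :
    word (fun r => f r + f' r) i g j h k = word f i g j h k + word f' i g j h k := by
  funext p; simp only [word, Dist.add_apply, add_mul]

lemma word_add2 (f g g' h : ℤ → A) (i j k : Fin 3) :
    word f i (fun r => g r + g' r) j h k = word f i g j h k + word f i g' j h k := by
  funext p; simp only [word, Dist.add_apply, add_mul, mul_add]

lemma word_add3 (f g h h' : ℤ → A) (i j k : Fin 3) :
    word f i g j (fun r => h r + h' r) k = word f i g j h k + word f i g j h' k := by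
  funext p; simp only [word, Dist.add_apply, mul_add]

/-- The symmetrized left-hand side of the Serre relations, with a possibly different series for each
letter: `a` and `b` are the letters of the repeated node, in the variables `i` and `j`. -/
def serreDist (P : Poly2) (s : ℂ) (a : ℤ → A) (i : Fin 3) (b : ℤ → A) (j : Fin 3)
    (c : ℤ → A) (k : Fin 3) : Dist (Fin 3) A :=
  poly2 P i j • (word c k a i b j - s • word a i c k b j + word a i b j c k) +
  poly2 P j i • (word c k b j a i - s • word b j c k a i + word b j a i c k)

lemma serreDist_swap (P : Poly2) (s : ℂ) (a : ℤ → A) (i : Fin 3) (b : ℤ → A)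
    (j : Fin 3) (c : ℤ → A) (k : Fin 3) : serreDist P s a i b j c k = serreDist P s b j a i c k :=
  add_comm _ _

lemma serreDist_add1 (P : Poly2) (s : ℂ) (a a' : ℤ → A) (i : Fin 3) (b : ℤ → A)
    (j : Fin 3) (c : ℤ → A) (k : Fin 3) : serreDist P s (fun r => a r + a' r) i b j c k =
      serreDist P s a i b j c k + serreDist P s a' i b j c k := by
  simp only [serreDist, word_add1, word_add2, word_add3, smul_add, smul_sub]
  abel

lemma serreDist_add3 (P : Poly2) (s : ℂ) (a : ℤ → A) (i : Fin 3) (b : ℤ → A)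
    (j : Fin 3) (c c' : ℤ → A) (k : Fin 3) : serreDist P s a i b j (fun r => c r + c' r) k =
      serreDist P s a i b j c k + serreDist P s a i b j c' k := by
  simp only [serreDist, word_add1, word_add2, word_add3, smul_add, smul_sub]
  abel

lemma C_smul_serreDist {r s : ℂ} (hs : r * s = r ^ 2 + 1) (P : Poly2)
    (a : ℤ → A) (i : Fin 3) (b : ℤ → A) (j : Fin 3) (c : ℤ → A) (k : Fin 3)
    {R : Poly3} (hR : R = C r) : R • serreDist P s a i b j c k =
    poly2 P i j • (R • word c k a i b j - (R ^ 2 + 1) • word a i c k b j + R • word a i b j c k) +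
    poly2 P j i • (R • word c k b j a i - (R ^ 2 + 1) • word b j c k a i +
      R • word b j a i c k) := by
  have hs' : R * C s = R ^ 2 + 1 := by rw [hR, ← map_mul, hs]; simp
  rw [← hs', serreDist]
  simp only [← Dist.C_smul s]
  module

/-- The sum over all orders of three letters, the letter `L k` being taken in the variable `k`. -/
def cubicDist (p : Fin 3 → Fin 3 → Fin 3 → Poly3) (L : Fin 3 → ℤ → A)
    (i j k : Fin 3) : Dist (Fin 3) A :=
  p i j k • word (L i) i (L j) j (L k) k + p i k j • word (L i) i (L k) k (L j) j +
    p k i j • word (L k) k (L i) i (L j) j +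
  (p j i k • word (L j) j (L i) i (L k) k + p j k i • word (L j) j (L k) k (L i) i +
    p k j i • word (L k) k (L j) j (L i) i)

lemma cubicDist_eq_sum (p : Fin 3 → Fin 3 → Fin 3 → Poly3)
    (L : Fin 3 → ℤ → A) : cubicDist p L 0 1 2 = ∑ π : Equiv.Perm (Fin 3),
      p (π 0) (π 1) (π 2) • word (L (π 0)) (π 0) (L (π 1)) (π 1) (L (π 2)) (π 2) := by
  have h : (univ : Finset (Equiv.Perm (Fin 3))) =
      {1, Equiv.swap 1 2, Equiv.swap 0 1, Equiv.swap 0 2, Equiv.swap 0 1 * Equiv.swap 1 2,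
        Equiv.swap 1 2 * Equiv.swap 0 1} := by decide
  rw [h]
  simp +decide [cubicDist, sum_insert, Equiv.swap_apply_def]
  abel

lemma cubicDist_add (p : Fin 3 → Fin 3 → Fin 3 → Poly3) (x y : ℤ → A) :
    cubicDist p (fun _ r => x r + y r) 0 1 2 =
      cubicDist p (fun _ => x) 0 1 2 + cubicDist p (fun _ => y) 0 1 2 +
      (cubicDist p ![x, x, y] 0 1 2 + cubicDist p ![x, y, x] 2 0 1 + cubicDist p ![y, x, x] 1 2 0) +
      (cubicDist p ![x, y, y] 1 2 0 + cubicDist p ![y, x, y] 2 0 1 +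
        cubicDist p ![y, y, x] 0 1 2) := by
  simp only [cubicDist, word_add1, word_add2, word_add3, smul_add, cons_val]
  abel

end Words

section Cancel

variable {B : Type} [Ring B] [Algebra ℂ B]

lemma Cancels.C_mul {e : Fin 3 → ℕ} {D : Poly3} (h : Cancels B e D) {r : ℂ}
    (hr : r ≠ 0) : Cancels B e (C r * D) := by
  refine Cancels.mul (fun T _ h0 => ?_) h
  rw [Dist.C_smul] at h0
  exact (smul_eq_zero_iff_right hr).1 h0

lemma Cancels.eq_zero {e : Fin 3 → ℕ} {D : Poly3} (h : Cancels B e D) {r : ℂ}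
    (hr : r ≠ 0) {T : Dist (Fin 3) (HahnSeries ℤ B)} (hT : OrderBound e T)
    (h0 : D • (C r : Poly3) • T = 0) : T = 0 := by
  have := h _ (hT.smul _) h0
  rw [Dist.C_smul] at this
  exact (smul_eq_zero_iff_right hr).1 this

variable {e : Fin 3 → ℕ} {i j k : Fin 3} {a b c : ℤ → HahnSeries ℤ B}

lemma OrderBound.serreDist (P : Poly2) (s : ℂ) (ha : OrderBound1 (e i) a)
    (hb : OrderBound1 (e j) b) (hc : OrderBound1 (e k) c) (hij : i ≠ j) (hik : i ≠ k)
    (hjk : j ≠ k) : OrderBound e (serreDist P s a i b j c k) :=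
  .add (.smul _ (.add (.sub (.word hc ha hb) (.csmul _ (.word ha hc hb))) (.word ha hb hc)))
    (.smul _ (.add (.sub (.word hc hb ha) (.csmul _ (.word hb hc ha))) (.word hb ha hc)))

lemma OrderBound.cubicDist (p : Fin 3 → Fin 3 → Fin 3 → Poly3)
    {L : Fin 3 → ℤ → HahnSeries ℤ B} (hL : ∀ i, OrderBound1 (e i) (L i)) (hij : i ≠ j) (hik : i ≠ k)
    (hjk : j ≠ k) : OrderBound e (cubicDist p L i j k) := by
  refine .add (.add (.add (.smul _ ?_) (.smul _ ?_)) (.smul _ ?_))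
    (.add (.add (.smul _ ?_) (.smul _ ?_)) (.smul _ ?_)) <;> exact .word (hL _) (hL _) (hL _)

lemma exists_eq_of_ne (k : Fin 3) (a b : ℕ) : ∃ e : Fin 3 → ℕ, e k = a ∧ ∀ l ≠ k, e l = b :=
  ⟨fun l => if l = k then a else b, if_pos rfl, fun _ h => if_neg h⟩

/-- The shape of the structure polynomials for a pair of nodes subject to a Serre relation with
coefficient `s = r + r⁻¹`. -/
structure SerreShape (P Fii Gii Fij Gij Fji Gji : Poly2) (r s : ℂ) : Prop where
  r_ne : r ≠ 0
  rs : r * s = r ^ 2 + 1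
  skew : Gii = -swapVars Fii
  exists_shape : ∃ (m : ℕ) (S b : Poly2), C r * Fij = C r * X 0 ^ m - X 1 ^ m ∧
    C r * Gij = X 0 ^ m - C r * X 1 ^ m ∧
    C r * Fji = C r * X 0 ^ m - X 1 ^ m ∧
    C r * Gji = X 0 ^ m - C r * X 1 ^ m ∧
    swapVars S = S ∧
    P * (X 0 ^ m - C r ^ 2 * X 1 ^ m) = Fii * S ∧
    P * swapVars Fii = b * (X 1 ^ m - C r ^ 2 * X 0 ^ m) ∧
    swapVars P * swapVars Gii = b * (C r ^ 2 * X 1 ^ m - X 0 ^ m)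

variable {P Fii Gii Fij Gij Fji Gji : Poly2} {r s : ℂ}

lemma SerreShape.exists_poly2 (H : SerreShape P Fii Gii Fij Gij Fji Gji r s) :
    ∃ (R : Poly3) (U : Fin 3 → Poly3) (S b : Fin 3 → Fin 3 → Poly3), R = C r ∧
    (∀ i j, R * poly2 Fij i j = R * U i - U j) ∧ (∀ i j, R * poly2 Gij i j = U i - R * U j) ∧
    (∀ i j, R * poly2 Fji i j = R * U i - U j) ∧ (∀ i j, R * poly2 Gji i j = U i - R * U j) ∧
    (∀ i j, S i j = S j i) ∧ (∀ i j, poly2 P i j * (U i - R ^ 2 * U j) = poly2 Fii i j * S i j) ∧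
    (∀ i j, poly2 P i j * poly2 Fii j i = b i j * (U j - R ^ 2 * U i)) ∧
    ∀ i j, poly2 P j i * poly2 Gii j i = b i j * (R ^ 2 * U j - U i) := by
  obtain ⟨m, S, b, h1, h2, h3, h4, h5, h6, h7, h8⟩ := H.exists_shape
  refine ⟨_, fun i => X i ^ m, poly2 S, poly2 b, rfl, fun i j => ?_, fun i j => ?_, fun i j => ?_,
    fun i j => ?_, fun i j => ?_, fun i j => ?_, fun i j => ?_, fun i j => ?_⟩
  · simpa using congrArg (poly2 · i j) h1
  · simpa using congrArg (poly2 · i j) h2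
  · simpa using congrArg (poly2 · i j) h3
  · simpa using congrArg (poly2 · i j) h4
  · rw [← poly2_rename_swap, h5]
  · simpa using congrArg (poly2 · i j) h6
  · rw [← poly2_rename_swap Fii]; simpa using congrArg (poly2 · i j) h7
  · rw [← poly2_rename_swap P, ← poly2_rename_swap Gii]; simpa using congrArg (poly2 · i j) h8

lemma C_mul_smul_eq {F G : Poly2} {T T' : Dist (Fin 3) (HahnSeries ℤ B)}
    {i j : Fin 3} (R : Poly3) (h : poly2 F i j • T = poly2 G i j • T') :
    (R * poly2 F i j) • T = (R * poly2 G i j) • T' := by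
  rw [mul_smul, h, mul_smul]

lemma smul_word_skew {F : Poly2} {T T' : Dist (Fin 3) (HahnSeries ℤ B)}
    {i j : Fin 3} (h : poly2 F i j • T = poly2 (-swapVars F) i j • T') :
    poly2 F i j • T = -(poly2 F j i • T') := by
  rw [h, ← neg_smul, ← poly2_rename_swap F i j, poly2, poly2, map_neg]

lemma serreDist_xxy (H : SerreShape P Fii Gii Fij Gij Fji Gji r s) (hc : Cancelling B Fji)
    (ha : OrderBound1 0 a) (hb : OrderBound1 1 b) (haa : Exchange Fii Gii a a)
    (hba : Exchange Fji Gji b a) (hij : i ≠ j) (hik : i ≠ k) (hjk : j ≠ k) :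
    serreDist P s a i a j b k = 0 := by
  obtain ⟨R, U, S, -, hR, -, -, hF, hG, hSs, hS, -, -⟩ := H.exists_poly2
  obtain ⟨e, e1, e0⟩ := exists_eq_of_ne k 1 0
  have ei := e0 i hik
  have ej := e0 j hjk
  refine (((hc e1 ei).C_mul H.r_ne).mul ((hc e1 ej).C_mul H.r_ne)).eq_zero H.r_ne
    (.serreDist _ _ (by rwa [ei]) (by rwa [ej]) (by rwa [e1]) hij hik hjk) ?_
  rw [← hR, C_smul_serreDist H.rs _ _ _ _ _ _ _ hR]
  linear_combination (norm := module) cubic_mixed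
    (p := R * poly2 P i j) (q := -(R ^ 2 + 1) * poly2 P i j) (s := R * poly2 P i j)
    (p' := R * poly2 P j i) (q' := -(R ^ 2 + 1) * poly2 P j i) (s' := R * poly2 P j i)
    (S := -U k * (R ^ 2 - 1) * S i j)
    (by rw [hF, hF, hG, hG]; linear_combination (-U k * (R ^ 2 - 1)) * hS i j)
    (by rw [hF, hF, hG, hG, hSs]; linear_combination (-U k * (R ^ 2 - 1)) * hS j i)
    (C_mul_smul_eq R (hba.word_left a)) (C_mul_smul_eq R (hba.word_right a))
    (C_mul_smul_eq R (hba.word_left a)) (C_mul_smul_eq R (hba.word_right a))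
    (smul_word_skew (H.skew ▸ haa.word_left b hij hik hjk))

lemma serreDist_yyx (H : SerreShape P Fii Gii Fij Gij Fji Gji r s) (hc : Cancelling B Fij)
    (ha : OrderBound1 1 a) (hb : OrderBound1 0 b) (haa : Exchange Fii Gii a a)
    (hab : Exchange Fij Gij a b) (hij : i ≠ j) (hik : i ≠ k) (hjk : j ≠ k) :
    serreDist P s a i a j b k = 0 := by
  obtain ⟨R, U, S, -, hR, hF, hG, -, -, hSs, hS, -, -⟩ := H.exists_poly2
  obtain ⟨e, e0, e1⟩ := exists_eq_of_ne k 0 1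
  have ei := e1 i hik
  have ej := e1 j hjk
  refine (((hc ej e0).C_mul H.r_ne).mul ((hc ei e0).C_mul H.r_ne)).eq_zero H.r_ne
    (.serreDist _ _ (by rwa [ei]) (by rwa [ej]) (by rwa [e0]) hij hik hjk) ?_
  rw [← hR, C_smul_serreDist H.rs _ _ _ _ _ _ _ hR]
  linear_combination (norm := module) cubic_mixed
    (p := R * poly2 P i j) (q := -(R ^ 2 + 1) * poly2 P i j) (s := R * poly2 P i j)
    (p' := R * poly2 P j i) (q' := -(R ^ 2 + 1) * poly2 P j i) (s' := R * poly2 P j i)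
    (S := -U k * (R ^ 2 - 1) * S i j)
    (by rw [hF, hF, hG, hG]; linear_combination (-U k * (R ^ 2 - 1)) * hS i j)
    (by rw [hF, hF, hG, hG, hSs]; linear_combination (-U k * (R ^ 2 - 1)) * hS j i)
    (C_mul_smul_eq R (hab.word_right a)) (C_mul_smul_eq R (hab.word_left a))
    (C_mul_smul_eq R (hab.word_right a)) (C_mul_smul_eq R (hab.word_left a))
    (smul_word_skew (H.skew ▸ haa.word_right b hij hik hjk))

lemma serreDist_xyx (H : SerreShape P Fii Gii Fij Gij Fji Gji r s) (hcii : Cancelling B Fii)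
    (hcij : Cancelling B Fij) (ha : OrderBound1 0 a) (hb : OrderBound1 1 b) (hcc : OrderBound1 0 c)
    (hba : Exchange Fii Gii b a) (hbc : Exchange Fij Gij b c) (hac : Exchange Fij Gij a c)
    (hij : i ≠ j) (hik : i ≠ k) (hjk : j ≠ k) : serreDist P s a i b j c k = 0 := by
  obtain ⟨R, U, -, b', hR, hF, hG, -, -, -, -, hB, hB'⟩ := H.exists_poly2
  obtain ⟨e, e1, e0⟩ := exists_eq_of_ne j 1 0
  have ei := e0 i hij
  have ek := e0 k hjk.symm
  refine ((hcii e1 ei).mul ((hcij e1 ek).C_mul H.r_ne)).eq_zero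
    H.r_ne (.serreDist _ _ (by rwa [ei]) (by rwa [e1]) (by rwa [ek]) hij hik hjk) ?_
  rw [← hR, C_smul_serreDist H.rs _ _ _ _ _ _ _ hR]
  refine serre_mixed (x := R * U i - U k) (y := U i - R * U k) (z := b' i j * U j * (R ^ 4 - 1))
    ?_ ?_ (C_mul_smul_eq R (hbc.word_right a)) (hba.word_right c)
    (C_mul_smul_eq R (hbc.word_left a)) (hba.word_left c)
    (hF i k ▸ hG i k ▸ C_mul_smul_eq R (hac.word_left b)) <;> rw [hF, hG]
  · linear_combination (R * (R * U j - U k)) * hB i j +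
      (R * (R * U j - U k) - (R ^ 2 + 1) * (U j - R * U k)) * hB' i j
  · linear_combination (-(R ^ 2 + 1) * (R * U j - U k) + R * (U j - R * U k)) * hB i j +
      R * (U j - R * U k) * hB' i j

lemma serreDist_xyy (H : SerreShape P Fii Gii Fij Gij Fji Gji r s) (hcii : Cancelling B Fii)
    (hcji : Cancelling B Fji) (ha : OrderBound1 0 a) (hb : OrderBound1 1 b) (hcc : OrderBound1 1 c)
    (hba : Exchange Fii Gii b a) (hca : Exchange Fji Gji c a) (hbc : Exchange Fij Gij b c)
    (hij : i ≠ j) (hik : i ≠ k) (hjk : j ≠ k) : serreDist P s a i b j c k = 0 := by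
  obtain ⟨R, U, -, b', hR, hF, hG, hF', hG', -, -, hB, hB'⟩ := H.exists_poly2
  obtain ⟨e, e0, e1⟩ := exists_eq_of_ne i 0 1
  have ej := e1 j hij.symm
  have ek := e1 k hik.symm
  refine ((hcii ej e0).mul ((hcji ek e0).C_mul H.r_ne)).eq_zero
    H.r_ne (.serreDist _ _ (by rwa [e0]) (by rwa [ej]) (by rwa [ek]) hij hik hjk) ?_
  rw [← hR, C_smul_serreDist H.rs _ _ _ _ _ _ _ hR]
  have h5 := C_mul_smul_eq R (hbc.word_right a (i := j) (j := k) (k := i))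
  rw [hF, hG] at h5
  have := serre_mixed (r := R) (P := poly2 P i j) (P' := poly2 P j i)
    (f := poly2 Fii j i) (g := poly2 Gii j i) (f' := R * poly2 Fji k i) (g' := R * poly2 Gji k i)
    (x := U j - R * U k) (y := R * U j - U k) (z := -(b' i j * U i * (R ^ 4 - 1)))
    (by rw [hF', hG']; linear_combination R * (R * U k - U i) * hB i j +
      (R * (R * U k - U i) - (R ^ 2 + 1) * (U k - R * U i)) * hB' i j)
    (by
      rw [hF', hG']
      linear_combination (-(R ^ 2 + 1) * (R * U k - U i) + R * (U k - R * U i)) * hB i j +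
        R * (U k - R * U i) * hB' i j)
    (C_mul_smul_eq R (hca.word_left b)) (hba.word_left c) (C_mul_smul_eq R (hca.word_right b))
    (hba.word_right c) h5.symm
  convert this using 4 <;> abel

lemma serreDist_add (H : SerreShape P Fii Gii Fij Gij Fji Gji r s) (hcii : Cancelling B Fii)
    (hcij : Cancelling B Fij) (hcji : Cancelling B Fji) {xi xj yi yj : ℤ → HahnSeries ℤ B}
    (bxi : OrderBound1 0 xi) (bxj : OrderBound1 0 xj) (byi : OrderBound1 1 yi)
    (byj : OrderBound1 1 yj) (hxii : Exchange Fii Gii xi xi) (hxij : Exchange Fij Gij xi xj)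
    (hyii : Exchange Fii Gii yi yi) (hyij : Exchange Fij Gij yi yj)
    (hyxii : Exchange Fii Gii yi xi) (hyxij : Exchange Fij Gij yi xj)
    (hyxji : Exchange Fji Gji yj xi)
    (hx : serreDist P s xi 0 xi 1 xj 2 = 0) (hy : serreDist P s yi 0 yi 1 yj 2 = 0) :
    serreDist P s (fun r => xi r + yi r) 0 (fun r => xi r + yi r) 1 (fun r => xj r + yj r) 2 = 0 := by
  have n1 : (0 : Fin 3) ≠ 1 := by decide
  have n2 : (0 : Fin 3) ≠ 2 := by decide
  have n3 : (1 : Fin 3) ≠ 2 := by decide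
  simp only [serreDist_add3, serreDist_add1]
  rw [serreDist_swap P s xi, serreDist_swap P s yi, serreDist_swap P s xi 0 _ 1 yj,
    serreDist_swap P s yi 0 _ 1 yj]
  simp only [serreDist_add1]
  rw [serreDist_swap P s xi 1 xi, hx, serreDist_swap P s yi 1 yi 0 yj, hy,
    serreDist_xyx H hcii hcij bxi byi bxj hyxii hyxij hxij n1.symm n3 n2,
    serreDist_swap P s yi 1 xi,
    serreDist_xyx H hcii hcij bxi byi bxj hyxii hyxij hxij n1 n2 n3,
    serreDist_yyx H hcij byi bxj hyii hyxij n1.symm n3 n2,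
    serreDist_xxy H hcji bxi byj hxii hyxji n1.symm n3 n2,
    serreDist_xyy H hcii hcji bxi byi byj hyxii hyxji hyij n1.symm n3 n2,
    serreDist_swap P s yi 1 xi,
    serreDist_xyy H hcii hcji bxi byi byj hyxii hyxji hyij n1 n2 n3]
  simp

variable {p S : Fin 3 → Fin 3 → Fin 3 → Poly3} {F G : Poly2}

lemma cubicDist_xxy
    (hS : ∀ i j k, p i j k * poly2 F k i * poly2 F k j + p i k j * poly2 F k i * poly2 G k j
      + p k i j * poly2 G k i * poly2 G k j = poly2 F i j * S i j k)
    (hSs : ∀ i j k, S i j k = S j i k) (hskew : G = -swapVars F)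
    (hc : Cancelling B F) (ha : OrderBound1 0 a) (hb : OrderBound1 1 b) (haa : Exchange F G a a)
    (hba : Exchange F G b a) {L : Fin 3 → ℤ → HahnSeries ℤ B} (hLi : L i = a) (hLj : L j = a)
    (hLk : L k = b) (hij : i ≠ j := by decide) (hik : i ≠ k := by decide)
    (hjk : j ≠ k := by decide) : cubicDist p L i j k = 0 := by
  obtain ⟨e, e1, e0⟩ := exists_eq_of_ne k 1 0
  have hL (l) : OrderBound1 (e l) (L l) := by
    by_cases h : l = k
    · rwa [h, e1, hLk]
    · obtain rfl | rfl : l = i ∨ l = j := by omega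
      exacts [by rwa [e0 _ h, hLi], by rwa [e0 _ h, hLj]]
  refine ((hc e1 (e0 i hik)).mul (hc e1 (e0 j hjk))) _ (.cubicDist p hL hij hik hjk) ?_
  rw [cubicDist, hLi, hLj, hLk]
  exact cubic_mixed (hS i j k) (by rw [hSs i j k, ← hS j i k]; ring)
    (hba.word_left a) (hba.word_right a) (hba.word_left a) (hba.word_right a)
    (smul_word_skew (hskew ▸ haa.word_left b hij hik hjk))

lemma cubicDist_xyy
    (hS : ∀ i j k, p i j k * poly2 G i k * poly2 G j k + p i k j * poly2 G i k * poly2 F j k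
      + p k i j * poly2 F i k * poly2 F j k = poly2 F i j * S i j k)
    (hSs : ∀ i j k, S i j k = S j i k) (hskew : G = -swapVars F)
    (hc : Cancelling B F) (ha : OrderBound1 0 a) (hb : OrderBound1 1 b) (hbb : Exchange F G b b)
    (hba : Exchange F G b a) {L : Fin 3 → ℤ → HahnSeries ℤ B} (hLi : L i = b) (hLj : L j = b)
    (hLk : L k = a) (hij : i ≠ j := by decide) (hik : i ≠ k := by decide)
    (hjk : j ≠ k := by decide) : cubicDist p L i j k = 0 := by
  obtain ⟨e, e0, e1⟩ := exists_eq_of_ne k 0 1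
  have hL (l) : OrderBound1 (e l) (L l) := by
    by_cases h : l = k
    · rwa [h, e0, hLk]
    · obtain rfl | rfl : l = i ∨ l = j := by omega
      exacts [by rwa [e1 _ h, hLi], by rwa [e1 _ h, hLj]]
  refine ((hc (e1 j hjk) e0).mul (hc (e1 i hik) e0)) _ (.cubicDist p hL hij hik hjk) ?_
  rw [cubicDist, hLi, hLj, hLk]
  linear_combination (norm := module) cubic_mixed (s := p i j k) (q := p i k j) (p := p k i j)
    (s' := p j i k) (q' := p j k i) (p' := p k j i) (S := S i j k) (by linear_combination hS i j k)
    (by linear_combination hS j i k - poly2 F j i * hSs i j k)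
    (hba.word_right b) (hba.word_left b) (hba.word_right b) (hba.word_left b)
    (smul_word_skew (hskew ▸ hbb.word_right a hij hik hjk))

end Cancel


end

/-! ### Hadamard products of formal distributions -/

section Hadamard

variable {ι : Type} [Fintype ι] [DecidableEq ι] {U V : Type} [Ring U] [Algebra ℂ U] [Ring V]
  [Algebra ℂ V]

/-- Support conditions that make `∑_n Φ (p - n) ⊗ Ψ n u ^ |n|` a Laurent series. -/
def Summable2 (Φ : Dist ι U) (Ψ : Dist ι V) : Prop :=
  ∀ k, (∃ b : ℤ, ∀ n : ι → ℤ, n k < b → Ψ n = 0) ∨ (∃ b : ℤ, ∀ m : ι → ℤ, b < m k → Φ m = 0)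

lemma Summable2.exists_bound {Φ : Dist ι U} {Ψ : Dist ι V} (h : Summable2 Φ Ψ) (p : ι → ℤ) :
    ∃ b : ι → ℤ, ∀ n : ι → ℤ, ¬ b ≤ n → Φ (p - n) ⊗ₜ[ℂ] Ψ n = 0 := by
  have : ∀ k, ∃ b : ℤ, ∀ n : ι → ℤ, n k < b → Φ (p - n) ⊗ₜ[ℂ] Ψ n = 0 := by
    intro k
    rcases h k with ⟨b, hb⟩ | ⟨b, hb⟩
    · exact ⟨b, fun n hn => by rw [hb n hn, tmul_zero]⟩
    · exact ⟨p k - b, fun n hn => by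
        rw [hb (p - n) (by simp only [Pi.sub_apply]; omega), zero_tmul]⟩
  choose b hb using this
  refine ⟨b, fun n hn => ?_⟩
  obtain ⟨k, hk⟩ := not_forall.1 hn
  exact hb k n (not_le.1 hk)

/-- The family of the terms of a Hadamard product. -/
def hadamardFamily (Φ : Dist ι U) (Ψ : Dist ι V) (h : Summable2 Φ Ψ) (p : ι → ℤ) :
    HahnSeries.SummableFamily ℤ (U ⊗[ℂ] V) (ι → ℤ) where
  toFun n := single (∑ k, n k) (Φ (p - n) ⊗ₜ[ℂ] Ψ n)
  isPWO_iUnion_support' := by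
    obtain ⟨b, hb⟩ := h.exists_bound p
    refine Set.IsPWO.mono (t := Set.Ici (∑ k, b k)) ?_ ?_
    · exact (BddBelow.isWF ⟨_, fun _ h => h⟩).isPWO
    · refine Set.iUnion_subset fun n g hg => ?_
      rw [HahnSeries.mem_support] at hg
      have h1 : g = ∑ k, n k := by
        by_contra hne; exact hg (coeff_single_of_ne hne)
      by_cases hbn : b ≤ n
      · rw [h1]; exact Finset.sum_le_sum fun k _ => hbn k
      · exact absurd (by rw [hb n hbn]; simp) hg
  finite_co_support' g := by
    obtain ⟨b, hb⟩ := h.exists_bound p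
    refine Set.Finite.subset (Set.finite_Icc b (fun k => g - ∑ j, b j + b k)) fun n hn => ?_
    have h1 : g = ∑ k, n k := by
      by_contra hne; exact hn (coeff_single_of_ne hne)
    have hbn : b ≤ n := by
      by_contra hbn; exact hn (by rw [hb n hbn]; simp)
    refine ⟨hbn, fun k => ?_⟩
    have : n k - b k ≤ ∑ j, (n j - b j) :=
      Finset.single_le_sum (f := fun j => n j - b j) (fun j _ => sub_nonneg.2 (hbn j)) (mem_univ k)
    rw [sum_sub_distrib, ← h1] at this
    simp only
    omega

open scoped Classical in
/-- The Hadamard product: its coefficient of index `p` is `∑_n Φ (p - n) ⊗ Ψ n u ^ |n|`. -/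
def hadamard (Φ : Dist ι U) (Ψ : Dist ι V) : Dist ι (HahnSeries ℤ (U ⊗[ℂ] V)) := fun p =>
  if h : Summable2 Φ Ψ then (hadamardFamily Φ Ψ h p).hsum else 0

lemma hadamard_apply {Φ : Dist ι U} {Ψ : Dist ι V} (h : Summable2 Φ Ψ) (p : ι → ℤ) :
    hadamard Φ Ψ p = (hadamardFamily Φ Ψ h p).hsum := dif_pos h

/-- Multiplication by a power of `u`. -/
def uMul {B : Type} [Ring B] [Algebra ℂ B] (d : ℤ) (T : Dist ι (HahnSeries ℤ B)) :
    Dist ι (HahnSeries ℤ B) := fun p => single d 1 * T p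

lemma Summable2.add_right {Φ : Dist ι U} {Ψ Ψ' : Dist ι V} (h : Summable2 Φ Ψ)
    (h' : Summable2 Φ Ψ') : Summable2 Φ (Ψ + Ψ') := by
  intro k
  rcases h k with ⟨b, hb⟩ | hb
  · rcases h' k with ⟨c, hc⟩ | hc
    · exact Or.inl ⟨min b c, fun n hn => by
        rw [Dist.add_apply, hb n (lt_of_lt_of_le hn (min_le_left _ _)),
          hc n (lt_of_lt_of_le hn (min_le_right _ _)), add_zero]⟩
    · exact Or.inr hc
  · exact Or.inr hb

lemma Summable2.add_left {Φ Φ' : Dist ι U} {Ψ : Dist ι V} (h : Summable2 Φ Ψ)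
    (h' : Summable2 Φ' Ψ) : Summable2 (Φ + Φ') Ψ := by
  intro k
  rcases h k with hb | ⟨b, hb⟩
  · exact Or.inl hb
  · rcases h' k with hc | ⟨c, hc⟩
    · exact Or.inl hc
    · exact Or.inr ⟨max b c, fun n hn => by
        rw [Dist.add_apply, hb n (lt_of_le_of_lt (le_max_left _ _) hn),
          hc n (lt_of_le_of_lt (le_max_right _ _) hn), add_zero]⟩

lemma Summable2.monomial_right {Φ : Dist ι U} {Ψ : Dist ι V} (h : Summable2 Φ Ψ)
    (m : ι →₀ ℕ) (c : ℂ) : Summable2 Φ (MvPolynomial.monomial m c • Ψ) := by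
  intro k
  rcases h k with ⟨b, hb⟩ | hb
  · exact Or.inl ⟨b - m k, fun n hn => by
      rw [Dist.monomial_smul, hb _ (by simp only [Pi.add_apply]; omega), smul_zero]⟩
  · exact Or.inr hb

lemma Summable2.monomial_left {Φ : Dist ι U} {Ψ : Dist ι V} (h : Summable2 Φ Ψ)
    (m : ι →₀ ℕ) (c : ℂ) : Summable2 (MvPolynomial.monomial m c • Φ) Ψ := by
  intro k
  rcases h k with hb | ⟨b, hb⟩
  · exact Or.inl hb
  · exact Or.inr ⟨b, fun n hn => by
      rw [Dist.monomial_smul, hb _ (by simp only [Pi.add_apply]; omega), smul_zero]⟩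

lemma hadamard_add_right {Φ : Dist ι U} {Ψ Ψ' : Dist ι V} (h : Summable2 Φ Ψ)
    (h' : Summable2 Φ Ψ') : hadamard Φ (Ψ + Ψ') = hadamard Φ Ψ + hadamard Φ Ψ' := by
  funext p
  rw [Dist.add_apply, hadamard_apply h, hadamard_apply h', hadamard_apply (h.add_right h'),
    ← HahnSeries.SummableFamily.hsum_add]
  congr 1
  ext1 n
  simp [hadamardFamily, Dist.add_apply, tmul_add]

lemma hadamard_add_left {Φ Φ' : Dist ι U} {Ψ : Dist ι V} (h : Summable2 Φ Ψ)
    (h' : Summable2 Φ' Ψ) : hadamard (Φ + Φ') Ψ = hadamard Φ Ψ + hadamard Φ' Ψ := by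
  funext p
  rw [Dist.add_apply, hadamard_apply h, hadamard_apply h', hadamard_apply (h.add_left h'),
    ← HahnSeries.SummableFamily.hsum_add]
  congr 1
  ext1 n
  simp [hadamardFamily, Dist.add_apply, add_tmul]

lemma coeff_hadamard {Φ : Dist ι U} {Ψ : Dist ι V} (h : Summable2 Φ Ψ) (p : ι → ℤ) (N : ℤ) :
    (hadamard Φ Ψ p).coeff N = ∑ᶠ n : ι → ℤ, (if N = ∑ k, n k then Φ (p - n) ⊗ₜ[ℂ] Ψ n else 0) := by
  rw [hadamard_apply h, HahnSeries.SummableFamily.coeff_hsum]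
  refine finsum_congr fun n => ?_
  simp [hadamardFamily, HahnSeries.coeff_single]

lemma hadamard_zero_right (Φ : Dist ι U) : hadamard Φ (0 : Dist ι V) = 0 := by
  have h : Summable2 Φ (0 : Dist ι V) := fun k => Or.inl ⟨0, fun _ _ => rfl⟩
  funext p
  ext N
  rw [coeff_hadamard h]
  simp [Dist.zero_apply]

lemma hadamard_zero_left (Ψ : Dist ι V) : hadamard (0 : Dist ι U) Ψ = 0 := by
  have h : Summable2 (0 : Dist ι U) Ψ := fun k => Or.inr ⟨0, fun _ _ => rfl⟩
  funext p
  ext N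
  rw [coeff_hadamard h]
  simp [Dist.zero_apply]

lemma monomial_smul_hadamard_left {Φ : Dist ι U} {Ψ : Dist ι V} (h : Summable2 Φ Ψ)
    (m : ι →₀ ℕ) (c : ℂ) : MvPolynomial.monomial m c • hadamard Φ Ψ =
      hadamard (MvPolynomial.monomial m c • Φ) Ψ := by
  funext p
  ext N
  rw [Dist.monomial_smul, coeff_smul, coeff_hadamard h, coeff_hadamard
    (h.monomial_left m c), smul_finsum]
  refine finsum_congr fun n => ?_
  rw [Dist.monomial_smul, smul_ite, smul_zero, smul_tmul', sub_add_eq_add_sub]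

lemma monomial_smul_hadamard_right {Φ : Dist ι U} {Ψ : Dist ι V} (h : Summable2 Φ Ψ)
    (m : ι →₀ ℕ) (c : ℂ) : MvPolynomial.monomial m c • hadamard Φ Ψ =
      uMul m.degree (hadamard Φ (MvPolynomial.monomial m c • Ψ)) := by
  funext p
  ext N
  rw [Dist.monomial_smul, coeff_smul, coeff_hadamard h, uMul,
    show N = (N - m.degree) + m.degree by ring, HahnSeries.coeff_single_mul_add, one_mul,
    coeff_hadamard (h.monomial_right m c), smul_finsum]
  set e : (ι → ℤ) ≃ (ι → ℤ) := Equiv.addRight (fun k => (m k : ℤ)) with he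
  rw [← finsum_comp_equiv e]
  refine finsum_congr fun n => ?_
  have hsum : ∑ k, (e n) k = ∑ k, n k + m.degree := by
    rw [Finsupp.degree_eq_sum]
    simp [he, sum_add_distrib]
  rw [Dist.monomial_smul, hsum]
  simp only [add_left_inj, smul_ite, smul_zero, tmul_smul]
  congr 3
  simp only [he, Equiv.coe_addRight]
  exact congrArg Φ (add_sub_add_right_eq_sub _ _ _)

lemma Summable2.smul_left {Φ : Dist ι U} {Ψ : Dist ι V} (h : Summable2 Φ Ψ)
    (P : MvPolynomial ι ℂ) : Summable2 (P • Φ) Ψ ∧ P • hadamard Φ Ψ = hadamard (P • Φ) Ψ := by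
  induction P using induction_on' with
  | monomial m c => exact ⟨h.monomial_left m c, monomial_smul_hadamard_left h m c⟩
  | add P Q hP hQ =>
    rw [add_smul, add_smul]
    exact ⟨hP.1.add_left hQ.1, by rw [hP.2, hQ.2, hadamard_add_left hP.1 hQ.1]⟩

lemma uMul_add {B : Type} [Ring B] [Algebra ℂ B] (d : ℤ) (T S : Dist ι (HahnSeries ℤ B)) :
    uMul d (T + S) = uMul d T + uMul d S := by
  funext p; exact mul_add _ _ _

lemma Summable2.smul_right {Φ : Dist ι U} {Ψ : Dist ι V} (h : Summable2 Φ Ψ)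
    {P : MvPolynomial ι ℂ} {d : ℕ} (hP : P.IsHomogeneous d) :
    P • hadamard Φ Ψ = uMul d (hadamard Φ (P • Ψ)) := by
  have key : ∀ s : Finset (ι →₀ ℕ), s ⊆ P.support →
      Summable2 Φ ((∑ m ∈ s, MvPolynomial.monomial m (P.coeff m)) • Ψ) ∧
      (∑ m ∈ s, MvPolynomial.monomial m (P.coeff m)) • hadamard Φ Ψ =
      uMul d (hadamard Φ ((∑ m ∈ s, MvPolynomial.monomial m (P.coeff m)) • Ψ)) := by
    intro s
    induction s using induction_on with
    | empty =>
      intro _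
      rw [Finset.sum_empty, zero_smul (MvPolynomial ι ℂ) Ψ,
        zero_smul (MvPolynomial ι ℂ) (hadamard Φ Ψ), hadamard_zero_right]
      refine ⟨fun k => Or.inl ⟨0, fun _ _ => rfl⟩, ?_⟩
      funext p; exact (mul_zero _).symm
    | insert m s hm ih =>
      intro hs
      obtain ⟨i1, i2⟩ := ih fun x hx => hs (Finset.mem_insert_of_mem hx)
      have hd : m.degree = d := by
        have := hP (MvPolynomial.mem_support_iff.1 (hs (Finset.mem_insert_self m s)))
        rwa [Finsupp.degree_eq_weight_one]
      rw [sum_insert hm, add_smul, add_smul]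
      have i3 := h.monomial_right m (P.coeff m)
      refine ⟨i3.add_right i1, ?_⟩
      rw [i2, hadamard_add_right i3 i1, uMul_add, monomial_smul_hadamard_right h, hd]
  have := (key P.support subset_rfl).2
  rwa [← P.as_sum] at this

lemma smul_uMul {B : Type} [Ring B] [Algebra ℂ B] (d : ℤ) (P : MvPolynomial ι ℂ)
    (T : Dist ι (HahnSeries ℤ B)) : P • uMul d T = uMul d (P • T) := by
  induction P using induction_on' with
  | monomial m c =>
    funext p
    rw [Dist.monomial_smul, uMul, uMul, Dist.monomial_smul, mul_smul_comm]
  | add P Q hP hQ => rw [add_smul, add_smul, hP, hQ, uMul_add]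

end Hadamard

section Letters

variable {U V : Type} [Ring U] [Algebra ℂ U] [Ring V] [Algebra ℂ V]

/-- Support conditions that make `∑_n f (p - n) ⊗ g n u ^ n` a Laurent series. -/
def Summable1 (f : ℤ → U) (g : ℤ → V) : Prop :=
  (∃ b : ℤ, ∀ n < b, g n = 0) ∨ (∃ b : ℤ, ∀ m, b < m → f m = 0)

lemma Summable1.exists_bound {f : ℤ → U} {g : ℤ → V} (h : Summable1 f g) (p : ℤ) :
    ∃ b : ℤ, ∀ n < b, f (p - n) ⊗ₜ[ℂ] g n = 0 := by
  rcases h with ⟨b, hb⟩ | ⟨b, hb⟩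
  · exact ⟨b, fun n hn => by rw [hb n hn, tmul_zero]⟩
  · exact ⟨p - b, fun n hn => by rw [hb (p - n) (by omega), zero_tmul]⟩

open scoped Classical in
/-- The Hadamard product of two series in one variable: the coefficient of index `p` is
`∑_n f (p - n) ⊗ g n u ^ n`. -/
def letter (f : ℤ → U) (g : ℤ → V) (p : ℤ) : HahnSeries ℤ (U ⊗[ℂ] V) := if h : Summable1 f g then
    HahnSeries.ofSuppBddBelow (fun n => f (p - n) ⊗ₜ[ℂ] g n) (by
      obtain ⟨b, hb⟩ := h.exists_bound p
      exact ⟨b, fun n hn => by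
        by_contra hlt
        exact hn (hb n (not_le.1 hlt))⟩)
  else 0

lemma coeff_letter {f : ℤ → U} {g : ℤ → V} (h : Summable1 f g) (p n : ℤ) :
    (letter f g p).coeff n = f (p - n) ⊗ₜ[ℂ] g n := by
  rw [letter, dif_pos h]; rfl

/-- The terms of a Hadamard product in one variable. -/
def letterFamily (f : ℤ → U) (g : ℤ → V) (h : Summable1 f g) (p : ℤ) :
    HahnSeries.SummableFamily ℤ (U ⊗[ℂ] V) ℤ where
  toFun n := single n (f (p - n) ⊗ₜ[ℂ] g n)
  isPWO_iUnion_support' := by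
    obtain ⟨b, hb⟩ := h.exists_bound p
    refine Set.IsPWO.mono (t := Set.Ici b) (BddBelow.isWF ⟨_, fun _ h => h⟩).isPWO ?_
    refine Set.iUnion_subset fun n g hg => ?_
    rw [HahnSeries.mem_support] at hg
    have h1 : g = n := by
      by_contra hne; exact hg (coeff_single_of_ne hne)
    subst h1
    by_contra hlt
    exact hg (by rw [hb _ (not_le.1 hlt)]; simp)
  finite_co_support' g := by
    refine Set.Finite.subset (Set.finite_singleton g) fun n hn => ?_
    by_contra hne
    exact hn (coeff_single_of_ne (Ne.symm hne))

lemma letter_eq_hsum {f : ℤ → U} {g : ℤ → V} (h : Summable1 f g) (p : ℤ) :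
    letter f g p = (letterFamily f g h p).hsum := by
  ext N
  rw [coeff_letter h, HahnSeries.SummableFamily.coeff_hsum, finsum_eq_single _ N]
  · simp [letterFamily]
  · intro n hn
    exact coeff_single_of_ne (Ne.symm hn)

lemma word_eq_zero {A : Type} [Ring A] [Algebra ℂ A] {f g h : ℤ → A} {i j k : Fin 3}
    {p : Fin 3 → ℤ} (hz : f (p i) = 0 ∨ g (p j) = 0 ∨ h (p k) = 0) : word f i g j h k p = 0 := by
  rcases hz with hz | hz | hz <;> simp [word, hz]

variable {f : Fin 3 → ℤ → U} {f' : Fin 3 → ℤ → V} (h : ∀ i, Summable1 (f i) (f' i))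
  {i j k i' j' k' : Fin 3}

include h in
lemma summable2_word (hij : i ≠ j := by omega) (hik : i ≠ k := by omega)
    (hjk : j ≠ k := by omega) (hij' : i' ≠ j' := by omega) (hik' : i' ≠ k' := by omega)
    (hjk' : j' ≠ k' := by omega) :
    Summable2 (word (f i) i (f j) j (f k) k) (word (f' i') i' (f' j') j' (f' k') k') := by
  intro l
  have h1 : l = i ∨ l = j ∨ l = k := by omega
  have h2 : l = i' ∨ l = j' ∨ l = k' := by omega
  rcases h l with ⟨b, hb⟩ | ⟨b, hb⟩
  · exact Or.inl ⟨b, fun n hn => word_eq_zero (by grind)⟩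
  · exact Or.inr ⟨b, fun n hn => word_eq_zero (by grind)⟩

/-- Triples of integers, indexed by the three elements `i, j, k` of `Fin 3`. -/
def tripleEquiv (hij : i ≠ j) (hik : i ≠ k) (hjk : j ≠ k) : (ℤ × ℤ) × ℤ ≃ (Fin 3 → ℤ) where
  toFun x l := if l = i then x.1.1 else if l = j then x.1.2 else x.2
  invFun n := ((n i, n j), n k)
  left_inv x := by simp [hij.symm, hik.symm, hjk.symm]
  right_inv n := by
    funext l
    have : l = i ∨ l = j ∨ l = k := by omega
    rcases this with rfl | rfl | rfl <;> simp [hij.symm, hik.symm, hjk.symm]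

include h in
lemma word_letter (hij : i ≠ j) (hik : i ≠ k) (hjk : j ≠ k) :
    word (letter (f i) (f' i)) i (letter (f j) (f' j)) j (letter (f k) (f' k)) k =
      hadamard (word (f i) i (f j) j (f k) k) (word (f' i) i (f' j) j (f' k) k) := by
  funext p
  rw [hadamard_apply (summable2_word h), word, letter_eq_hsum (h i), letter_eq_hsum (h j),
    letter_eq_hsum (h k), ← HahnSeries.SummableFamily.hsum_mul,
    ← HahnSeries.SummableFamily.hsum_mul,
    ← HahnSeries.SummableFamily.hsum_equiv (tripleEquiv hij hik hjk)]
  congr 1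
  ext1 n
  change single (n i) (f i (p i - n i) ⊗ₜ[ℂ] f' i (n i)) *
    single (n j) (f j (p j - n j) ⊗ₜ[ℂ] f' j (n j)) *
    single (n k) (f k (p k - n k) ⊗ₜ[ℂ] f' k (n k)) =
    single (∑ l, n l) (word (f i) i (f j) j (f k) k (p - n) ⊗ₜ[ℂ] word (f' i) i (f' j) j (f' k) k n)
  rw [single_mul_single, single_mul_single, sum_fin3 hij hik hjk]
  simp [word, tmul_mul_tmul]

end Letters


/-! ### Relations between letters -/

section HasHadamard

variable {ι : Type} [Fintype ι] [DecidableEq ι] {U V : Type} [Ring U] [Algebra ℂ U] [Ring V]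
  [Algebra ℂ V]

/-- `T` is the Hadamard product of `Φ` and `Ψ`, multiplied by `u ^ d`. -/
def HasHadamard (d : ℕ) (Φ : Dist ι U) (Ψ : Dist ι V) (T : Dist ι (HahnSeries ℤ (U ⊗[ℂ] V))) :
    Prop := Summable2 Φ Ψ ∧ T = uMul d (hadamard Φ Ψ)

namespace HasHadamard

variable {d : ℕ} {Φ Φ' : Dist ι U} {Ψ Ψ' : Dist ι V} {S T : Dist ι (HahnSeries ℤ (U ⊗[ℂ] V))}

lemma add_left (h : HasHadamard d Φ Ψ S) (h' : HasHadamard d Φ' Ψ T) :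
    HasHadamard d (Φ + Φ') Ψ (S + T) :=
  ⟨h.1.add_left h'.1, by rw [h.2, h'.2, hadamard_add_left h.1 h'.1, uMul_add]⟩

lemma add_right (h : HasHadamard d Φ Ψ S) (h' : HasHadamard d Φ Ψ' T) :
    HasHadamard d Φ (Ψ + Ψ') (S + T) :=
  ⟨h.1.add_right h'.1, by rw [h.2, h'.2, hadamard_add_right h.1 h'.1, uMul_add]⟩

lemma smul_left (h : HasHadamard d Φ Ψ S) (P : MvPolynomial ι ℂ) :
    HasHadamard d (P • Φ) Ψ (P • S) :=
  ⟨(h.1.smul_left P).1, by rw [h.2, smul_uMul, (h.1.smul_left P).2]⟩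

lemma smul_right (h : HasHadamard 0 Φ Ψ S) {P : MvPolynomial ι ℂ} (hP : P.IsHomogeneous d) :
    HasHadamard d Φ (P • Ψ) (P • S) := by
  have h0 : uMul 0 (hadamard Φ Ψ) = hadamard Φ Ψ := by
    funext p; exact one_mul _
  refine ⟨?_, by rw [h.2, cast_zero, h0, Summable2.smul_right h.1 hP]⟩
  induction P using induction_on' generalizing d with
  | monomial m c => exact h.1.monomial_right m c
  | add P Q hP' hQ' =>
    intro k
    rcases h.1 k with ⟨b, hb⟩ | hb
    · refine Or.inl ?_
      clear hP' hQ' hP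
      generalize P + Q = R
      induction R using induction_on' with
      | monomial m c =>
        exact ⟨b - m k, fun n hn => by
          rw [Dist.monomial_smul, hb _ (by simp only [Pi.add_apply]; omega), smul_zero]⟩
      | add P Q hP hQ =>
        obtain ⟨c, hc⟩ := hP
        obtain ⟨c', hc'⟩ := hQ
        exact ⟨min c c', fun n hn => by
          rw [add_smul, Dist.add_apply, hc n (lt_of_lt_of_le hn (min_le_left _ _)),
            hc' n (lt_of_lt_of_le hn (min_le_right _ _)), add_zero]⟩
    · exact Or.inr hb

lemma csmul_right (h : HasHadamard d Φ Ψ S) (c : ℂ) : HasHadamard d Φ (c • Ψ) (c • S) := by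
  have h1 : Summable2 Φ (c • Ψ) := by
    have := h.1.monomial_right 0 c
    rwa [← C_apply, Dist.C_smul] at this
  refine ⟨h1, ?_⟩
  rw [h.2]
  funext p
  simp only [Dist.csmul_apply, uMul]
  rw [← mul_smul_comm]
  congr 1
  ext N
  rw [coeff_smul, coeff_hadamard h.1, coeff_hadamard h1, smul_finsum]
  refine finsum_congr fun n => ?_
  rw [Dist.csmul_apply, smul_ite, smul_zero, tmul_smul]

lemma csmul_left (h : HasHadamard d Φ Ψ S) (c : ℂ) : HasHadamard d (c • Φ) Ψ (c • S) := by
  have := h.smul_left (MvPolynomial.C c)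
  rwa [Dist.C_smul, Dist.C_smul] at this

lemma sub_left (h : HasHadamard d Φ Ψ S) (h' : HasHadamard d Φ' Ψ T) :
    HasHadamard d (Φ - Φ') Ψ (S - T) := by
  have := h.add_left (h'.csmul_left (-1))
  rwa [neg_one_smul, neg_one_smul, ← sub_eq_add_neg, ← sub_eq_add_neg] at this

lemma sub_right (h : HasHadamard d Φ Ψ S) (h' : HasHadamard d Φ Ψ' T) :
    HasHadamard d Φ (Ψ - Ψ') (S - T) := by
  have := h.add_right (h'.csmul_right (-1))
  rwa [neg_one_smul, neg_one_smul, ← sub_eq_add_neg, ← sub_eq_add_neg] at this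

lemma eq_zero_left (h : HasHadamard d Φ Ψ S) (h0 : Φ = 0) : S = 0 := by
  rw [h.2, h0, hadamard_zero_left]; funext p; exact mul_zero _

lemma eq_zero_right (h : HasHadamard d Φ Ψ S) (h0 : Ψ = 0) : S = 0 := by
  rw [h.2, h0, hadamard_zero_right]; funext p; exact mul_zero _

end HasHadamard

end HasHadamard

section LetterRelations

variable {U V : Type} [Ring U] [Algebra ℂ U] [Ring V] [Algebra ℂ V]

lemma hasHadamard_word {f : Fin 3 → ℤ → U} {f' : Fin 3 → ℤ → V}
    (h : ∀ i, Summable1 (f i) (f' i)) (i j k : Fin 3) (hij : i ≠ j := by decide)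
    (hik : i ≠ k := by decide) (hjk : j ≠ k := by decide) :
    HasHadamard 0 (word (f i) i (f j) j (f k) k) (word (f' i) i (f' j) j (f' k) k)
      (word (letter (f i) (f' i)) i (letter (f j) (f' j)) j (letter (f k) (f' k)) k) :=
  ⟨summable2_word h, by rw [word_letter h hij hik hjk]; funext p; exact (one_mul _).symm⟩

/-- The family with value `1` at `0` and `0` elsewhere. -/
def deltaFam (A : Type) [Ring A] (n : ℤ) : A := if n = 0 then 1 else 0

lemma summable1_delta_delta : Summable1 (deltaFam U) (deltaFam V) :=
  Or.inl ⟨0, fun _ hn => if_neg hn.ne⟩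

lemma letter_delta_zero : letter (deltaFam U) (deltaFam V) 0 = 1 := by
  ext n
  rw [coeff_letter summable1_delta_delta]
  by_cases h : n = 0
  · subst h; simp [deltaFam, one_def]
  · simp [deltaFam, h, HahnSeries.coeff_one]

lemma exchange_iff_word {A : Type} [Ring A] [Algebra ℂ A] {F G : Poly2}
    {f g h : ℤ → A} (h0 : h 0 = 1) (H : poly2 F 0 1 • word f 0 g 1 h 2 -
      poly2 G 0 1 • word g 1 f 0 h 2 = 0) : Exchange F G f g := by
  intro a b
  have := congrFun (sub_eq_zero.1 H) ![a, b, 0]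
  rw [Dist.rename_smul, Dist.rename_smul] at this
  simpa [word, coeffSum, Pi.single_apply, h0] using this

lemma word_swap1 {A : Type} [Ring A] [Algebra ℂ A] {f g : ℤ → A} (h : ℤ → A)
    (hc : ∀ m n, Commute (f m) (g n)) (i j k : Fin 3) : word f i g j h k = word g j f i h k := by
  funext p; simp only [word, (hc (p i) (p j)).eq]

lemma isHomogeneous_poly2 {P : Poly2} {d : ℕ} (hP : P.IsHomogeneous d)
    (i j : Fin 3) : (poly2 P i j).IsHomogeneous d := hP.rename_isHomogeneous

section Exchange

variable {F G : Poly2} {f1 f2 : ℤ → U} {g1 g2 : ℤ → V} (h₁ : Summable1 f1 g1) (h2 : Summable1 f2 g2)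
include h₁ h2

lemma summable1_delta (i : Fin 3) :
    Summable1 (![f1, f2, deltaFam U] i) (![g1, g2, deltaFam V] i) := by
  fin_cases i
  exacts [h₁, h2, summable1_delta_delta]

lemma Exchange.letter_left (H : Exchange F G f1 f2) (hc : ∀ m n, Commute (g1 m) (g2 n)) :
    Exchange F G (letter f1 g1) (letter f2 g2) := by
  refine exchange_iff_word letter_delta_zero (h := letter (deltaFam U) (deltaFam V)) ?_
  have w1 := hasHadamard_word (summable1_delta h₁ h2) 0 1 2
  have w2 := hasHadamard_word (summable1_delta h₁ h2) 1 0 2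
  simp only [cons_val] at w1 w2
  rw [← word_swap1 _ hc] at w2
  refine ((w1.smul_left (poly2 F 0 1)).sub_left (w2.smul_left (poly2 G 0 1))).eq_zero_left ?_
  rw [H.word_left, sub_self]

lemma Exchange.letter_right {d : ℕ} (hF : F.IsHomogeneous d) (hG : G.IsHomogeneous d)
    (H : Exchange F G g1 g2) (hc : ∀ m n, Commute (f1 m) (f2 n)) :
    Exchange F G (letter f1 g1) (letter f2 g2) := by
  refine exchange_iff_word letter_delta_zero (h := letter (deltaFam U) (deltaFam V)) ?_
  have w1 := hasHadamard_word (summable1_delta h₁ h2) 0 1 2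
  have w2 := hasHadamard_word (summable1_delta h₁ h2) 1 0 2
  simp only [cons_val] at w1 w2
  rw [← word_swap1 _ hc] at w2
  refine ((w1.smul_right (isHomogeneous_poly2 hF 0 1)).sub_right
    (w2.smul_right (isHomogeneous_poly2 hG 0 1))).eq_zero_right ?_
  rw [H.word_left, sub_self]

end Exchange

lemma word_perm {g : Fin 3 → ℤ → V} (hc : ∀ a b m n, Commute (g a m) (g b n)) (i j k : Fin 3)
    (hij : i ≠ j := by decide) (hik : i ≠ k := by decide) (hjk : j ≠ k := by decide) :
    word (g i) i (g j) j (g k) k = word (g 0) 0 (g 1) 1 (g 2) 2 := by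
  funext p
  fin_cases i <;> fin_cases j <;> fin_cases k <;> first | contradiction | simp [word, mul_assoc,
    (hc 1 0 _ _).eq, (hc 2 0 _ _).eq, (hc 2 1 _ _).eq, (hc 1 0 _ _).left_comm]

variable {κ : Type} {f : κ → ℤ → U} {g : κ → ℤ → V} (hs : ∀ i, Summable1 (f i) (g i)) {i j : κ}
  {P : Poly2} {s : ℂ} {d : ℕ}
  {p : Fin 3 → Fin 3 → Fin 3 → Poly3}
include hs

lemma hasHadamard_word_left (hc : ∀ i j m n, Commute (g i m) (g j n)) (l : Fin 3 → κ)
    (i j k : Fin 3) (h : decide [i, j, k].Nodup) : HasHadamard 0 (word (f (l i)) i (f (l j)) j (f (l k)) k)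
      (word (g (l 0)) 0 (g (l 1)) 1 (g (l 2)) 2) (word (letter (f (l i)) (g (l i))) i
        (letter (f (l j)) (g (l j))) j (letter (f (l k)) (g (l k))) k) := by
  obtain ⟨⟨hij, hik⟩, hjk⟩ : (i ≠ j ∧ i ≠ k) ∧ j ≠ k := by simpa using h
  rw [← word_perm (g := fun i => g (l i)) (fun a b => hc _ _) i j k hij hik hjk]
  exact hasHadamard_word (f := fun i => f (l i)) (fun a => hs (l a)) i j k hij hik hjk

lemma hasHadamard_word_right (hc : ∀ i j m n, Commute (f i m) (f j n)) (l : Fin 3 → κ)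
    (i j k : Fin 3) (h : decide [i, j, k].Nodup) : HasHadamard 0 (word (f (l 0)) 0 (f (l 1)) 1 (f (l 2)) 2)
      (word (g (l i)) i (g (l j)) j (g (l k)) k) (word (letter (f (l i)) (g (l i))) i
        (letter (f (l j)) (g (l j))) j (letter (f (l k)) (g (l k))) k) := by
  obtain ⟨⟨hij, hik⟩, hjk⟩ : (i ≠ j ∧ i ≠ k) ∧ j ≠ k := by simpa using h
  rw [← word_perm (g := fun i => f (l i)) (fun a b => hc _ _) i j k hij hik hjk]
  exact hasHadamard_word (f' := fun i => g (l i)) (fun a => hs (l a)) i j k hij hik hjk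

lemma serreDist_letter_left (hc : ∀ i j m n, Commute (g i m) (g j n))
    (H : serreDist P s (f i) 0 (f i) 1 (f j) 2 = 0) :
    serreDist P s (letter (f i) (g i)) 0 (letter (f i) (g i)) 1 (letter (f j) (g j)) 2 = 0 :=
  have w := hasHadamard_word_left hs hc ![i, i, j]
  ((((((w 2 0 1 rfl).sub_left ((w 0 2 1 rfl).csmul_left s)).add_left (w 0 1 2 rfl)).smul_left
    (poly2 P 0 1)).add_left ((((w 2 1 0 rfl).sub_left ((w 1 2 0 rfl).csmul_left s)).add_left
      (w 1 0 2 rfl)).smul_left (poly2 P 1 0))).eq_zero_left H :)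

lemma serreDist_letter_right (hP : P.IsHomogeneous d)
    (hc : ∀ i j m n, Commute (f i m) (f j n)) (H : serreDist P s (g i) 0 (g i) 1 (g j) 2 = 0) :
    serreDist P s (letter (f i) (g i)) 0 (letter (f i) (g i)) 1 (letter (f j) (g j)) 2 = 0 :=
  have w := hasHadamard_word_right hs hc ![i, i, j]
  ((((((w 2 0 1 rfl).sub_right ((w 0 2 1 rfl).csmul_right s)).add_right (w 0 1 2 rfl)).smul_right
    (isHomogeneous_poly2 hP 0 1)).add_right ((((w 2 1 0 rfl).sub_right
      ((w 1 2 0 rfl).csmul_right s)).add_right (w 1 0 2 rfl)).smul_right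
        (isHomogeneous_poly2 hP 1 0))).eq_zero_right H :)

lemma cubicDist_letter_left (hc : ∀ i j m n, Commute (g i m) (g j n))
    (H : cubicDist p (fun _ => f i) 0 1 2 = 0) :
    cubicDist p (fun _ => letter (f i) (g i)) 0 1 2 = 0 :=
  have w := hasHadamard_word_left hs hc (fun _ => i)
  (((((w 0 1 2 rfl).smul_left (p 0 1 2)).add_left ((w 0 2 1 rfl).smul_left (p 0 2 1))).add_left
    ((w 2 0 1 rfl).smul_left (p 2 0 1))).add_left ((((w 1 0 2 rfl).smul_left (p 1 0 2)).add_left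
      ((w 1 2 0 rfl).smul_left (p 1 2 0))).add_left ((w 2 1 0 rfl).smul_left (p 2 1 0)))).eq_zero_left H

lemma cubicDist_letter_right (hp : ∀ i j k, (p i j k).IsHomogeneous d)
    (hc : ∀ i j m n, Commute (f i m) (f j n)) (H : cubicDist p (fun _ => g i) 0 1 2 = 0) :
    cubicDist p (fun _ => letter (f i) (g i)) 0 1 2 = 0 :=
  have w := hasHadamard_word_right hs hc (fun _ => i)
  (((((w 0 1 2 rfl).smul_right (hp 0 1 2)).add_right ((w 0 2 1 rfl).smul_right (hp 0 2 1))).add_right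
    ((w 2 0 1 rfl).smul_right (hp 2 0 1))).add_right ((((w 1 0 2 rfl).smul_right (hp 1 0 2)).add_right
      ((w 1 2 0 rfl).smul_right (hp 1 2 0))).add_right ((w 2 1 0 rfl).smul_right (hp 2 1 0)))).eq_zero_right H

end LetterRelations


section

open MvPolynomial (C)
open MvPolynomial (X)

/-! ### The relations of the algebra -/

/-- The index of the leading mode of `φ_i^ε`. -/
abbrev ld (μ : T.Coweight) (ε : ℤˣ) (i : T.I0) : ℤ := leadIdx 0 μ ε i

namespace Alg

/-- The element `h_{i,m}`. -/
def h (i : T.I0) (m : ℤ) : Alg T t μ := RingQuot.mkAlgHom ℂ (Rel T t 0 μ) (Free.h i m)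

/-- The inverse of the leading mode of `φ_i^ε`. -/
def κ (ε : ℤˣ) (i : T.I0) : Alg T t μ := RingQuot.mkAlgHom ℂ (Rel T t 0 μ) (Free.κ ε i)

/-- The quotient map from the free algebra. -/
def mk : Free T →ₐ[ℂ] Alg T t μ := RingQuot.mkAlgHom ℂ (Rel T t 0 μ)

lemma rel {a b : Free T} (hab : Rel T t 0 μ a b) : (mk a : Alg T t μ) = mk b :=
  RingQuot.mkAlgHom_rel ℂ hab

lemma mk_x (ε : ℤˣ) (i : T.I0) (r : ℤ) : mk (Free.x ε i r) = (x ε i r : Alg T t μ) := rfl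
lemma mk_φ (ε : ℤˣ) (i : T.I0) (r : ℤ) : mk (Free.φ ε i r) = (φ ε i r : Alg T t μ) := rfl
lemma mk_h (i : T.I0) (r : ℤ) : mk (Free.h i r) = (h i r : Alg T t μ) := rfl
lemma mk_κ (ε : ℤˣ) (i : T.I0) : mk (Free.κ ε i) = (κ ε i : Alg T t μ) := rfl

lemma x_eq_zero (ε : ℤˣ) (i : T.I0) {r : ℤ} (hr : ¬ T.InIZ i r) : (x ε i r : Alg T t μ) = 0 := by
  simpa [mk_x] using rel (t := t) (μ := μ) (Rel.x_zero ε i r hr)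

lemma h_eq_zero (i : T.I0) {m : ℤ} (hm : m = 0 ∨ ¬ T.InIZ i m) : (h i m : Alg T t μ) = 0 := by
  simpa [mk_h] using rel (t := t) (μ := μ) (Rel.h_zero i m hm)

lemma lead_mul_κ (ε : ℤˣ) (i : T.I0) : (lead ε i * κ ε i : Alg T t μ) = 1 := by
  simpa [mk_φ, mk_κ, lead] using rel (t := t) (μ := μ) (Rel.lead_inv ε i)

lemma κ_mul_lead (ε : ℤˣ) (i : T.I0) : (κ ε i * lead ε i : Alg T t μ) = 1 := by
  simpa [mk_φ, mk_κ, lead] using rel (t := t) (μ := μ) (Rel.inv_lead ε i)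

lemma φ_eq_zero (ε : ℤˣ) (i : T.I0) (n : ℕ) (hn : 0 < n) :
    (φ ε i (ld μ ε i - ε * n) : Alg T t μ) = 0 := by
  simpa [mk_φ] using rel (t := t) (μ := μ) (Rel.φ_zero ε i n hn)

lemma h_comm (i j : T.I0) (m n : ℤ) : Commute (h i m : Alg T t μ) (h j n) := by
  change _ = _
  simpa [mk_h] using rel (t := t) (μ := μ) (Rel.hh i j m n)

lemma φ_h_comm (ε : ℤˣ) (i j : T.I0) (m n : ℤ) : Commute (φ ε i m : Alg T t μ) (h j n) := by
  change _ = _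
  simpa [mk_h, mk_φ] using rel (t := t) (μ := μ) (Rel.φh ε i j m n)

lemma φ_comm (ε ε' : ℤˣ) (i j : T.I0) (m n : ℤ) : Commute (φ ε i m : Alg T t μ) (φ ε' j n) := by
  change _ = _
  simpa [mk_φ] using rel (t := t) (μ := μ) (Rel.φφ ε ε' i j m n)

/-- The series whose exponential is `φ_i^ε` divided by its leading term. -/
def hSeq (μ : T.Coweight) (t : ℂˣ) (ε : ℤˣ) (i : T.I0) (m : ℕ) : Alg T t μ :=
  (((ε : ℤ) : ℂ) * qdiff T t i) • h i (ε * m)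

lemma φ_eq (ε : ℤˣ) (i : T.I0) (n : ℕ) : (φ ε i (ld μ ε i + ε * n) : Alg T t μ) =
    lead ε i * expCoeff (hSeq μ t ε i) n := by
  have := rel (t := t) (μ := μ) (Rel.φ_exp ε i n)
  rw [map_mul, expCoeff_map] at this
  simp only [map_smul] at this
  exact this

lemma isExp_hSeq (ε : ℤˣ) (i : T.I0) : IsExp (hSeq μ t ε i) (expCoeff (hSeq μ t ε i)) :=
  isExp_expCoeff _ fun _ _ => ((h_comm i i _ _).smul_left _).smul_right _

lemma lead_mul_x (ε ε' : ℤˣ) (i j : T.I0) (r : ℤ) : (lead ε i * x ε' j r : Alg T t μ) =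
    qpow t (ε * ε' * T.sumC i j) • (x ε' j r * lead ε i) := by
  simpa [mk_φ, mk_x, lead] using rel (t := t) (μ := μ) (Rel.lead_x ε ε' i j r)

lemma h_mul_x (ε : ℤˣ) (i j : T.I0) (r m : ℤ) (hm : m ≠ 0) :
    (h i m * x ε j r - x ε j r * h i m : Alg T t μ) =
      ((((ε : ℤ) : ℂ) * (1 / (m : ℂ)) * ∑ s ∈ Finset.Icc 1 T.M,
        (qpow t (m * T.Cσ i j s) - qpow t (-(m * T.Cσ i j s))) / qdiff T t i * T.ζ ^ (m * s)) •
          x ε j (m + r)) := by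
  have := rel (t := t) (μ := μ) (Rel.hx ε i j r m hm)
  rw [map_sub, map_mul, map_mul, map_smul] at this
  exact this

lemma x_comm (i j : T.I0) (r r' : ℤ) : (x 1 i r * x (-1) j r' - x (-1) j r' * x 1 i r : Alg T t μ) =
      ((∑ s ∈ Finset.Icc 1 T.M, open scoped Classical in
            if (T.σ ^ s) i.1 = j.1 then T.ζ ^ ((s : ℤ) * r') else 0) / (T.N i : ℂ) /
            qdiff T t i) • (φ 1 i (r + r') - φ (-1) i (r + r')) := by
  have := rel (t := t) (μ := μ) (Rel.xx_pm i j r r')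
  rw [map_sub, map_mul, map_mul, map_smul, map_sub] at this
  exact this

lemma exchange_x (ε : ℤˣ) (i j : T.I0) :
    Exchange (polyF T t ε i j) (polyG T t ε i j) (x ε i : ℤ → Alg T t μ) (x ε j) := by
  intro a b
  have := rel (t := t) (μ := μ) (Rel.xx ε i j a b)
  rw [coeffSum_map, coeffSum_map] at this
  simpa only [map_mul, mk_x] using this

end Alg

/-! ### Exchange relations between `φ` and `x` -/

section Shift

variable {A : Type} [Ring A] [Algebra ℂ A]

/-- The sum `∑ e_j T (p - j w)`. -/
def seriesAct (w : Fin 2 → ℤ) (e : PowerSeries ℂ) (S : Dist (Fin 2) A) : Dist (Fin 2) A :=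
  fun p => ∑ᶠ j : ℕ, coeff j e • S (p - (j : ℤ) • w)

lemma finsum_nat_succ {f : ℕ → A} (h : f 0 = 0) : ∑ᶠ j, f j = ∑ᶠ j, f (j + 1) := by
  rw [← finsum_mem_range Nat.succ_injective, finsum_mem_def]
  refine finsum_congr fun j => ?_
  cases j with
  | zero => simp [h]
  | succ j => simp

variable {w : Fin 2 → ℤ} {S : Dist (Fin 2) A} (hS : ∀ p, {j : ℕ | S (p - (j : ℤ) • w) ≠ 0}.Finite)

include hS in
lemma seriesAct_finite (e : ℕ → ℂ) (p : Fin 2 → ℤ) :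
    (Function.support fun j : ℕ => e j • S (p - (j : ℤ) • w)).Finite :=
  (hS p).subset fun j hj h0 => hj (by
    change e j • S (p - (j : ℤ) • w) = 0
    rw [h0, smul_zero])

lemma seriesAct_one : seriesAct w 1 S = S := by
  funext p
  rw [seriesAct, finsum_eq_single _ 0]
  · simp
  · intro j hj; simp [coeff_one, hj]

lemma seriesAct_smul (c : ℂ) (e : PowerSeries ℂ) : seriesAct w (c • e) S = c • seriesAct w e S := by
  funext p
  rw [Dist.csmul_apply, seriesAct, seriesAct, smul_finsum]
  simp only [PowerSeries.coeff_smul, smul_smul, smul_eq_mul]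

include hS in
lemma seriesAct_sub (e e' : PowerSeries ℂ) :
    seriesAct w (e - e') S = seriesAct w e S - seriesAct w e' S := by
  funext p
  rw [Dist.sub_apply, seriesAct, seriesAct, seriesAct, ← finsum_sub_distrib
    (seriesAct_finite hS _ p) (seriesAct_finite hS _ p)]
  simp only [map_sub, sub_smul]

lemma X_smul_seriesAct {a b : Fin 2} (hw : w = Pi.single a 1 - Pi.single b 1) (e : PowerSeries ℂ) :
    (X b : Poly2) • seriesAct w e S = (X a : Poly2) • seriesAct w (PowerSeries.X * e) S := by
  funext p
  rw [Dist.X_smul, Dist.X_smul, seriesAct, seriesAct]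
  refine Eq.trans ?_ (finsum_nat_succ (f := fun j : ℕ => coeff j (PowerSeries.X * e) •
    S (p + Pi.single a 1 - (j : ℤ) • w)) ?_).symm
  · refine finsum_congr fun j => ?_
    rw [PowerSeries.coeff_succ_X_mul]
    congr 2
    rw [hw]
    push_cast
    rw [add_smul, one_smul]
    abel
  · rw [PowerSeries.coeff_zero_X_mul, zero_smul]

include hS in
lemma linear_smul_seriesAct {a b : Fin 2} (hw : w = Pi.single a 1 - Pi.single b 1) (κ β : ℂ)
    (e : PowerSeries ℂ) :
    (C κ * X a - C β * X b : Poly2) • seriesAct w e S =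
    (X a : Poly2) • seriesAct w ((PowerSeries.C κ - PowerSeries.C β * PowerSeries.X) * e) S := by
  have h : (PowerSeries.C κ - PowerSeries.C β * PowerSeries.X) * e =
      κ • e - β • (PowerSeries.X * e) := by
    rw [sub_mul, smul_eq_C_mul, smul_eq_C_mul, mul_assoc]
  rw [h, seriesAct_sub hS, seriesAct_smul, seriesAct_smul, sub_smul, mul_smul, mul_smul,
    X_smul_seriesAct hw, ← Dist.C_smul, ← Dist.C_smul, smul_sub, smul_comm, smul_comm (C β)]

include hS in
lemma prod_smul_seriesAct {a b : Fin 2} (hw : w = Pi.single a 1 - Pi.single b 1) {ι : Type*}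
    (s : Finset ι) (κ β : ι → ℂ) (e : PowerSeries ℂ) :
    (∏ k ∈ s, (C (κ k) * X a - C (β k) * X b) : Poly2) • seriesAct w e S =
    (X a ^ s.card : Poly2) •
      seriesAct w ((∏ k ∈ s, (PowerSeries.C (κ k) - PowerSeries.C (β k) * PowerSeries.X)) * e) S := by
  classical
  induction s using induction_on generalizing e with
  | empty => simp
  | insert k s hk ih =>
    rw [prod_insert hk, prod_insert hk, mul_comm, mul_smul,
      linear_smul_seriesAct hS hw, smul_comm, ih, smul_smul, Finset.card_insert_of_notMem hk,
      pow_succ', ← mul_assoc]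
    congr 3
    ring

lemma exchange_of_seriesAct {f g : ℤ → A} {a b : Fin 2} (hw : w = Pi.single a 1 - Pi.single b 1)
    (hfin : ∀ p : Fin 2 → ℤ, {j : ℕ | f (p 0 - j * w 0) ≠ 0}.Finite) {ι : Type*}
    (s : Finset ι) (κ β κ' β' : ι → ℂ) (e : PowerSeries ℂ)
    (he : (∏ k ∈ s, (PowerSeries.C (κ k) - PowerSeries.C (β k) * PowerSeries.X)) * e =
      ∏ k ∈ s, (PowerSeries.C (κ' k) - PowerSeries.C (β' k) * PowerSeries.X))
    (hfg : ∀ p r, f p * g r = ∑ᶠ j : ℕ, coeff j e • (g (r - j * w 1) * f (p - j * w 0))) :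
    Exchange (∏ k ∈ s, (C (κ k) * X a - C (β k) * X b)) (∏ k ∈ s, (C (κ' k) * X a -
        C (β' k) * X b)) f g := by
  intro c d
  rw [coeffSum_eq_smul _ (fun k l => f k * g l), coeffSum_eq_smul _ (fun k l => g l * f k)]
  have h1 : dist₂ (fun k l => f k * g l) = seriesAct w e (dist₂ fun k l => g l * f k) := by
    funext p
    exact hfg (p 0) (p 1)
  have hS : ∀ p, {j : ℕ | dist₂ (fun k l => g l * f k) (p - (j : ℤ) • w) ≠ 0}.Finite := fun p =>
    (hfin p).subset fun j hj h0 => hj (by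
      change g _ * f (p 0 - j * w 0) = 0
      rw [h0, mul_zero])
  rw [h1, prod_smul_seriesAct hS hw, he]
  conv_rhs => rw [← seriesAct_one (w := w) (S := dist₂ fun k l => g l * f k)]
  rw [prod_smul_seriesAct hS hw, mul_one]

end Shift

/-! ### Exponential generating series of power sums -/

lemma isExp_linear (β : ℂ) : IsExp (fun m => -(β ^ m / m) : ℕ → ℂ)
      (fun n => coeff n (1 - PowerSeries.C β * PowerSeries.X)) := by
  rw [isExp_iff_deriv]
  refine ⟨by simp, ?_⟩
  have h1 : PowerSeries.mk (fun n => coeff n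
      (1 - PowerSeries.C β * PowerSeries.X : PowerSeries ℂ)) =
      1 - PowerSeries.C β * PowerSeries.X := by ext n; simp
  rw [h1]
  have h2 : derivative ℂ (PowerSeries.mk fun m : ℕ => -(β ^ m / m)) =
      PowerSeries.mk fun m => -β ^ (m + 1) := by
    ext n
    have hn : ((n : ℂ) + 1) ≠ 0 := by exact_mod_cast succ_ne_zero n
    rw [coeff_derivative, coeff_mk, coeff_mk]
    push_cast
    field_simp
  rw [h2]
  ext n
  rw [mul_sub, mul_one, map_sub, map_sub, map_sub, coeff_mk, ← mul_assoc,
    mul_comm _ (PowerSeries.C β), mul_assoc, PowerSeries.coeff_C_mul, coeff_derivative]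
  cases n with
  | zero => simp [coeff_one]
  | succ n =>
    rw [PowerSeries.coeff_succ_mul_X, coeff_mk]
    simp [coeff_one]
    ring

lemma isExp_prod_linear {ι : Type*} (s : Finset ι) (β : ι → ℂ) :
    IsExp (fun m => -((∑ k ∈ s, β k ^ m) / m) : ℕ → ℂ)
      (fun n => coeff n (∏ k ∈ s, (1 - PowerSeries.C (β k) * PowerSeries.X))) := by
  classical
  induction s using induction_on with
  | empty => exact ⟨by simp, fun n => by simp [coeff_one]⟩
  | insert k s hk ih =>
    have := (isExp_linear (β k)).mul_of_comm ih
    simp only [← coeff_mul] at this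
    rw [prod_insert hk]
    refine this.congr fun m => ?_
    rw [sum_insert hk]
    ring

lemma prod_mul_exp {ι : Type*} (s : Finset ι) (α β : ι → ℂ) {c e : ℕ → ℂ} (he : IsExp c e)
    (hc : ∀ m, c (m + 1) = (∑ k ∈ s, (α k ^ (m + 1) - β k ^ (m + 1))) / ((m + 1 : ℕ) : ℂ)) :
    (∏ k ∈ s, (1 - PowerSeries.C (α k) * PowerSeries.X)) * PowerSeries.mk e =
      ∏ k ∈ s, (1 - PowerSeries.C (β k) * PowerSeries.X) := by
  have h1 := (isExp_prod_linear s α).mul_of_comm he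
  have h2 := (h1.congr (b := fun m => -((∑ k ∈ s, β k ^ m) / m)) fun m => by
    rw [hc, sum_sub_distrib]; ring).unique (isExp_prod_linear s β)
  ext n
  rw [coeff_mul]
  simpa using congrFun h2 n


end

section

open MvPolynomial (C)
open MvPolynomial (X)

lemma qpow_add (t : ℂˣ) (a b : ℤ) : qpow t (a + b) = qpow t a * qpow t b :=
  zpow_add₀ (pow_ne_zero _ t.ne_zero) a b

lemma qpow_neg (t : ℂˣ) (a : ℤ) : qpow t (-a) = (qpow t a)⁻¹ := zpow_neg _ a

lemma qpow_mul_nat (t : ℂˣ) (m : ℕ) (a : ℤ) : qpow t (m * a) = qpow t a ^ m := by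
  rw [qpow, qpow, mul_comm, zpow_mul, zpow_natCast]

lemma qpow_zero (t : ℂˣ) : qpow t 0 = 1 := zpow_zero _

lemma qpow_sum (t : ℂˣ) {ι : Type*} (s : Finset ι) (f : ι → ℤ) :
    qpow t (∑ k ∈ s, f k) = ∏ k ∈ s, qpow t (f k) := by
  classical
  induction s using induction_on with
  | empty => simp [qpow_zero]
  | insert k s hk ih => rw [sum_insert hk, prod_insert hk, qpow_add, ih]

lemma qpow_ne_one (ht : Generic t) {n : ℤ} (hn : n ≠ 0) : qpow t n ≠ 1 := by
  have key (m : ℕ) (hm : 0 < m) : qpow t m ≠ 1 := by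
    intro h
    apply ht m hm
    ext
    rw [qpow, zpow_natCast] at h
    simpa using h
  rcases Int.lt_or_gt_of_ne hn with h | h
  · intro h1
    apply key (-n).toNat (by omega)
    rw [toNat_of_nonneg (by omega), qpow_neg, h1, inv_one]
  · have := key n.toNat (by omega)
    rwa [toNat_of_nonneg h.le] at this

lemma qdiff_ne_zero (ht : Generic t) (i : T.I0) : qdiff T t i ≠ 0 := by
  have h0 : qi T t i ≠ 0 := pow_ne_zero _ t.ne_zero
  have hd : 0 < T.twoD i := by
    rw [TwistedType.twoD]
    split_ifs
    · have := T.M_pos; omega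
    · omega
    · omega
  rw [qdiff, sub_ne_zero]
  intro h
  have h2 : qi T t i * qi T t i = 1 := by
    nth_rewrite 2 [h]; exact mul_inv_cancel₀ h0
  apply ht (T.twoD i) hd
  ext
  rw [qi, ← pow_add] at h2
  push_cast
  rw [← pow_mul, ← h2]
  congr 1; ring

lemma sumC_eq (T : TwistedType) (i j : T.I0) : T.sumC i j = ∑ s ∈ activeSet T i j, T.Cσ i j s := by
  rw [TwistedType.sumC, activeSet, Finset.sum_filter]
  exact sum_congr rfl fun s _ => by by_cases h : T.Cσ i j s = 0 <;> simp [h]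

namespace Alg

lemma φ_eq_zero_of_lt (η : ℤˣ) (i : T.I0) {p : ℤ} (hp : (η : ℤ) * (p - ld μ η i) < 0) :
    (φ η i p : Alg T t μ) = 0 := by
  have := φ_eq_zero (t := t) (μ := μ) η i (η * (ld μ η i - p)).toNat (by
    rcases units_eq_one_or η with rfl | rfl <;> simp at hp ⊢ <;> omega)
  rw [← this]
  congr 1
  rcases units_eq_one_or η with rfl | rfl <;> simp at hp ⊢ <;> omega

lemma exists_index (η : ℤˣ) (l p : ℤ) : (η : ℤ) * (p - l) < 0 ∨ ∃ n : ℕ, p = l + η * n := by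
  by_cases h : (η : ℤ) * (p - l) < 0
  · exact Or.inl h
  · refine Or.inr ⟨(η * (p - l)).toNat, ?_⟩
    rcases units_eq_one_or η with rfl | rfl <;> simp at h ⊢ <;> omega

/-- The coefficients of the logarithm of the exchange series of `φ_i^η` and `x_j^ε`. -/
def exchLog (t : ℂˣ) (η ε : ℤˣ) (i j : T.I0) (m : ℕ) : ℂ :=
  (∑ s ∈ activeSet T i j, ((T.ζ ^ ((η : ℤ) * s) * qpow t (η * ε * T.Cσ i j s)) ^ m -
    (T.ζ ^ ((η : ℤ) * s) * qpow t (-(η * ε * T.Cσ i j s))) ^ m)) / m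

lemma hSeq_mul_x (ht : Generic t) (η ε : ℤˣ) (i j : T.I0) (m : ℕ)
    (hm : 0 < m) (r : ℤ) : (hSeq μ t η i m * x ε j r : Alg T t μ) =
      x ε j r * hSeq μ t η i m + exchLog t η ε i j m • x ε j (r + η * m) := by
  have hη : ((η : ℤ) * (m : ℤ)) ≠ 0 := mul_ne_zero (Units.ne_zero η) (by exact_mod_cast hm.ne')
  have h1 := h_mul_x (t := t) (μ := μ) ε i j r (η * m) hη
  rw [hSeq, smul_mul_assoc, mul_smul_comm, ← sub_eq_iff_eq_add', ← smul_sub, h1, smul_smul,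
    add_comm r]
  congr 1
  have hq := qdiff_ne_zero ht i
  have hm' : (m : ℂ) ≠ 0 := by exact_mod_cast hm.ne'
  rw [exchLog]
  have h2 : ∑ s ∈ Finset.Icc 1 T.M, (qpow t (η * m * T.Cσ i j s) - qpow t (-(η * m * T.Cσ i j s))) /
      qdiff T t i * T.ζ ^ ((η : ℤ) * m * s) = ∑ s ∈ activeSet T i j,
      (qpow t (η * m * T.Cσ i j s) - qpow t (-(η * m * T.Cσ i j s))) /
      qdiff T t i * T.ζ ^ ((η : ℤ) * m * s) := by
    rw [activeSet, Finset.sum_filter]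
    refine sum_congr rfl fun s _ => ?_
    by_cases h : T.Cσ i j s = 0 <;> simp [h]
  rw [h2, mul_sum, mul_sum, Finset.sum_div]
  refine sum_congr rfl fun s _ => ?_
  have e1 : T.ζ ^ ((η : ℤ) * m * s) = (T.ζ ^ ((η : ℤ) * s)) ^ m := by
    rw [← zpow_natCast, ← zpow_mul]; congr 1; ring
  have e2 (a : ℤ) : qpow t a ^ m = qpow t (m * a) := (qpow_mul_nat t m a).symm
  rw [e1, mul_pow, mul_pow, e2, e2]
  rcases units_eq_one_or η with rfl | rfl <;> rcases units_eq_one_or ε with rfl | rfl <;>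
    simp <;> field_simp <;> ring

lemma φ_mul_x (ht : Generic t) (η ε : ℤˣ) (i j : T.I0) {e : ℕ → ℂ}
    (he : IsExp (exchLog t η ε i j) e) (p r : ℤ) : (φ η i p * x ε j r : Alg T t μ) =
      ∑ᶠ k : ℕ, (qpow t (η * ε * T.sumC i j) * e k) • (x ε j (r + k * η) * φ η i (p - k * η)) := by
  rcases exists_index η (ld μ η i) p with hp | ⟨n, rfl⟩
  · rw [φ_eq_zero_of_lt η i hp, zero_mul, finsum_eq_zero_of_forall_eq_zero]
    intro k
    rw [φ_eq_zero_of_lt η i, mul_zero, smul_zero]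
    rcases units_eq_one_or η with rfl | rfl <;> simp at hp ⊢ <;> omega
  · have h1 := (isExp_hSeq (t := t) (μ := μ) η i).mul_shift he (fun k => x ε j (r + η * k))
      (fun m k hm => by
        rw [hSeq_mul_x ht η ε i j m hm]
        congr 3
        push_cast; ring) n 0
    simp only [zero_add, cast_zero, mul_zero, add_zero] at h1
    rw [φ_eq, mul_assoc, h1, mul_sum, Finset.Nat.sum_antidiagonal_eq_sum_range_succ_mk,
      finsum_eq_sum_of_support_subset (s := range n.succ)]
    · refine sum_congr rfl fun k hk => ?_
      have hk' : k ≤ n := Nat.lt_succ_iff.1 (mem_range.1 hk)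
      have hφ : lead η i * expCoeff (hSeq μ t η i) (n - k) = φ η i (ld μ η i + η * n - k * η) := by
        rw [← φ_eq]; congr 1; push_cast [Nat.cast_sub hk']; ring
      rw [mul_smul_comm, ← mul_assoc, lead_mul_x, smul_mul_assoc, smul_smul,
        mul_comm (e k), mul_assoc (x ε j _), hφ, mul_comm (η : ℤ) (k : ℤ)]
    · intro k hk
      rw [Finset.coe_range, Set.mem_Iio]
      by_contra hlt
      apply hk
      beta_reduce
      rw [φ_eq_zero_of_lt η i, mul_zero, smul_zero]
      rcases units_eq_one_or η with rfl | rfl <;> simp <;> omega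

lemma exchange_φ (ht : Generic t) (η ε : ℤˣ) (i j : T.I0) :
    Exchange (polyF T t ε i j) (polyG T t ε i j) (φ η i : ℤ → Alg T t μ) (x ε j) := by
  set e := expCoeff (exchLog (T := T) t η ε i j) with he
  have hexp : IsExp (exchLog (T := T) t η ε i j) e := isExp_expCoeff_of_comm _
  have hprod := prod_mul_exp (activeSet T i j)
    (fun s => T.ζ ^ ((η : ℤ) * s) * qpow t (η * ε * T.Cσ i j s))
    (fun s => T.ζ ^ ((η : ℤ) * s) * qpow t (-(η * ε * T.Cσ i j s))) hexp (fun m => by rw [exchLog])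
  have hfg := fun p r => φ_mul_x (μ := μ) ht η ε i j hexp p r
  have hfin : ∀ q : ℤ, {k : ℕ | (φ η i (q - k * η) : Alg T t μ) ≠ 0}.Finite := fun q => by
    refine (Set.finite_Iic ((η * (q - ld μ η i)).toNat)).subset fun k hk => ?_
    rw [Set.mem_Iic]
    by_contra hlt
    apply hk
    apply φ_eq_zero_of_lt
    rcases units_eq_one_or η with rfl | rfl <;> simp at hlt ⊢ <;> omega
  set E : PowerSeries ℂ := qpow t (η * ε * T.sumC i j) • PowerSeries.mk e with hE
  have hsum : qpow t (η * ε * T.sumC i j) = ∏ s ∈ activeSet T i j, qpow t (η * ε * T.Cσ i j s) := by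
    rw [← qpow_sum, sumC_eq, mul_sum]
  have hcoe (a : ℂ) (P : PowerSeries ℂ) : a • P = PowerSeries.C a * P := smul_eq_C_mul _ _
  have hζ := T.ζ_ne_zero
  rcases units_eq_one_or η with rfl | rfl
  · have := exchange_of_seriesAct (f := (φ 1 i : ℤ → Alg T t μ)) (g := x ε j)
      (w := Pi.single 0 1 - Pi.single 1 1) rfl
      (fun p => by simpa using hfin (p 0)) (activeSet T i j) (fun _ => 1)
      (fun s => T.ζ ^ s * qpow t (ε * T.Cσ i j s)) (fun s => qpow t (ε * T.Cσ i j s))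
      (fun s => T.ζ ^ s) E (by
        rw [hE, hcoe, mul_left_comm, hsum]
        simp only [val_one, one_mul, zpow_natCast] at hprod
        simp only [map_one, val_one, one_mul]
        rw [hprod, map_prod, ← prod_mul_distrib]
        refine prod_congr rfl fun s _ => ?_
        rw [mul_sub, mul_one, ← mul_assoc, ← map_mul, qpow_neg, mul_left_comm,
          mul_inv_cancel₀ (qpow_ne_zero _ _), mul_one])
      (fun p r => by
        rw [hfg]
        simp [hE])
    simpa [polyF, polyG] using this
  · have := exchange_of_seriesAct (f := (φ (-1) i : ℤ → Alg T t μ)) (g := x ε j)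
      (w := Pi.single 1 1 - Pi.single 0 1) rfl
      (fun p => by simpa using hfin (p 0)) (activeSet T i j)
      (fun s => -(T.ζ ^ s * qpow t (ε * T.Cσ i j s))) (fun _ => -1) (fun s => -T.ζ ^ s)
      (fun s => -qpow t (ε * T.Cσ i j s)) E (by
        rw [hE, hcoe, mul_left_comm, hsum]
        have h1 : ∀ s, (PowerSeries.C (-(T.ζ ^ s * qpow t (ε * T.Cσ i j s))) -
            PowerSeries.C (-1) * PowerSeries.X : PowerSeries ℂ) =
            PowerSeries.C (-(T.ζ ^ s * qpow t (ε * T.Cσ i j s))) *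
            (1 - PowerSeries.C (T.ζ ^ (((-1 : ℤˣ) : ℤ) * (s : ℤ)) *
              qpow t (((-1 : ℤˣ) : ℤ) * ε * T.Cσ i j s)) * PowerSeries.X) := fun s => by
          rw [mul_sub, mul_one, ← mul_assoc, ← map_mul]
          congr 3
          simp only [val_neg, val_one, neg_mul, one_mul, zpow_neg, zpow_natCast, qpow_neg]
          have := qpow_ne_zero t (ε * T.Cσ i j s)
          field_simp
        rw [prod_congr rfl fun s _ => h1 s, prod_mul_distrib, mul_assoc, hprod,
          map_prod, ← prod_mul_distrib, ← prod_mul_distrib]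
        refine prod_congr rfl fun s _ => ?_
        rw [← mul_assoc, ← map_mul, mul_sub, mul_one, ← mul_assoc, ← map_mul]
        have := qpow_ne_zero t (ε * T.Cσ i j s)
        simp only [val_neg, val_one, neg_mul, one_mul, zpow_neg, zpow_natCast, qpow_neg]
        congr 2
        · field_simp
        · congr 1; field_simp)
      (fun p r => by
        rw [hfg]
        simp [hE, sub_eq_add_neg])
    have hF : polyF T t ε i j = ∏ k ∈ activeSet T i j,
        (C (-(T.ζ ^ k * qpow t (ε * T.Cσ i j k))) * X 1 - C (-1) * X 0) := by
      refine prod_congr rfl fun s _ => ?_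
      rw [map_neg, map_neg, map_one]; ring
    have hG : polyG T t ε i j = ∏ k ∈ activeSet T i j, (C (-T.ζ ^ k) * X 1 -
          C (-qpow t (ε * T.Cσ i j k)) * X 0) := by
      refine prod_congr rfl fun s _ => ?_
      rw [map_neg, map_neg]; ring
    rw [hF, hG]
    exact this

end Alg


end

/-! ### Combinatorics of the diagrams -/

namespace TwistedType

instance decidableEdge : (T : TwistedType) → (a b : ℕ) → Decidable (T.edge a b)
  | A _ _ _, a, b => inferInstanceAs (Decidable (a + 1 = b))
  | D n _, a, b => inferInstanceAs (Decidable ((a + 1 = b ∧ b < n) ∨ (a + 2 = n ∧ b = n)))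
  | D4, a, b => inferInstanceAs (Decidable ((a + 1 = b ∧ b < 3) ∨ (a = 1 ∧ b = 3)))
  | E6, a, b => inferInstanceAs (Decidable ((a = 0 ∧ b = 1) ∨ (a = 1 ∧ b = 2) ∨ (a = 2 ∧ b = 4) ∨
      (a = 4 ∧ b = 5) ∨ (a = 2 ∧ b = 3)))

/-- Two nodes are joined by an edge. -/
def Adj (T : TwistedType) (i j : Fin T.rank) : Prop := T.edge i j ∨ T.edge j i

instance (T : TwistedType) (i j : Fin T.rank) : Decidable (T.Adj i j) :=
  inferInstanceAs (Decidable (_ ∨ _))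

lemma C_self (i : Fin T.rank) : T.C i i = 2 := if_pos rfl

lemma not_adj_self (i : Fin T.rank) : ¬ T.Adj i i := by
  cases T <;> simp only [Adj, edge] <;> omega

lemma C_eq_neg_one_iff {i j : Fin T.rank} : T.C i j = -1 ↔ T.Adj i j := by
  have := not_adj_self i
  grind [C, Adj]

lemma C_eq_zero_iff {i j : Fin T.rank} : T.C i j = 0 ↔ i ≠ j ∧ ¬ T.Adj i j := by grind [C, Adj]

lemma C_congr {i j k l : Fin T.rank} (h : i = j ↔ k = l) (h' : T.Adj i j ↔ T.Adj k l) :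
    T.C i j = T.C k l := by grind [C, Adj]

lemma C_symm (i j : Fin T.rank) : T.C i j = T.C j i := C_congr eq_comm or_comm

lemma σ_A_val (m : ℕ) (hm hm3) (i : Fin m) : (((A m hm hm3).σ i : Fin m) : ℕ) = m - 1 - i := by
  change ((Fin.rev i : Fin m) : ℕ) = _
  rw [Fin.val_rev]; omega

lemma σ_D_val (n : ℕ) (hn) (i : Fin (n + 1)) : (((D n hn).σ i : Fin (n + 1)) : ℕ) =
    if (i : ℕ) = n - 1 then n else if (i : ℕ) = n then n - 1 else i := by
  change ((Equiv.swap (⟨n - 1, by omega⟩ : Fin (n + 1)) ⟨n, by omega⟩ i : Fin (n + 1)) : ℕ) = _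
  rw [Equiv.swap_apply_def]
  simp only [Fin.ext_iff]
  split_ifs <;> rfl

lemma adj_σ (i j : Fin T.rank) : T.Adj (T.σ i) (T.σ j) ↔ T.Adj i j := by
  cases T with
  | A m hm hm3 =>
    have hi := σ_A_val m hm hm3 i
    have hj := σ_A_val m hm hm3 j
    simp only [rank, Adj, edge] at *
    omega
  | D n hn =>
    have hi := σ_D_val n hn i
    have hj := σ_D_val n hn j
    simp only [rank, Adj, edge] at *
    split_ifs at hi hj <;> omega
  | D4 => revert i j; decide
  | E6 => revert i j; decide

lemma C_σ (i j : Fin T.rank) : T.C (T.σ i) (T.σ j) = T.C i j := C_congr (EmbeddingLike.apply_eq_iff_eq _) (adj_σ i j)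

lemma C_σ_pow (k : ℕ) (i j : Fin T.rank) : T.C ((T.σ ^ k) i) ((T.σ ^ k) j) = T.C i j := by
  induction k with
  | zero => rfl
  | succ k ih => rw [pow_succ', Equiv.Perm.mul_apply, Equiv.Perm.mul_apply, C_σ, ih]

lemma σ_pow_M (T : TwistedType) : T.σ ^ T.M = 1 := by
  cases T with
  | A m hm hm3 =>
    ext i
    change (((A m hm hm3).σ ((A m hm hm3).σ i) : Fin m) : ℕ) = i
    have := i.2
    have h1 := σ_A_val m hm hm3 i
    have h2 := σ_A_val m hm hm3 ((A m hm hm3).σ i)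
    simp only [rank] at *
    omega
  | D n hn =>
    change (Equiv.swap _ _) ^ 2 = 1
    rw [sq, Equiv.swap_mul_self]
  | D4 => decide
  | E6 => decide

lemma isPrimitiveRoot_ζ (T : TwistedType) : IsPrimitiveRoot T.ζ T.M :=
  Complex.isPrimitiveRoot_exp T.M T.M_pos.ne'

lemma M_eq (T : TwistedType) : T.M = 2 ∨ T.M = 3 := by cases T <;> simp [M]

lemma ζ_eq_neg_one (h : T.M = 2) : T.ζ = -1 := by
  have := T.isPrimitiveRoot_ζ
  rw [h] at this
  exact this.eq_neg_one_of_two_right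

lemma σ_pow_fixed {i : T.I0} (hi : T.IsFixed i) (k : ℕ) : (T.σ ^ k) i.1 = i.1 := by
  induction k with
  | zero => rfl
  | succ k ih => rw [pow_succ, Equiv.Perm.mul_apply, hi, ih]

lemma eq_of_σ_pow_eq {i j : T.I0} {s : ℕ} (hs : s ≤ T.M) (h : (T.σ ^ s) i.1 = j.1) : i = j := by
  refine Subtype.ext (le_antisymm (h ▸ i.2 s) ?_)
  have : (T.σ ^ (T.M - s)) j.1 = i.1 := by
    rw [← h, ← Equiv.Perm.mul_apply, ← pow_add, Nat.sub_add_cancel hs, σ_pow_M]; rfl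
  exact this ▸ j.2 _

lemma not_fixed_pow {i : T.I0} (hi : ¬ T.IsFixed i) {s : ℕ} (h1 : 1 ≤ s) (h2 : s < T.M) :
    (T.σ ^ s) i.1 ≠ i.1 := by
  intro h
  rcases M_eq T with hM | hM
  · obtain rfl : s = 1 := by omega
    exact hi h
  · obtain rfl | rfl : s = 1 ∨ s = 2 := by omega
    · exact hi h
    · apply hi
      have h3 := congrArg (fun e => e i.1) T.σ_pow_M
      simp only [hM, Equiv.Perm.one_apply] at h3
      rw [pow_succ', Equiv.Perm.mul_apply, h] at h3
      exact h3

lemma Cσ_of_fixed_left {i j : T.I0} (hi : T.IsFixed i) (s : ℕ) : T.Cσ i j s = T.C i.1 j.1 := by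
  rw [Cσ]
  nth_rewrite 1 [← σ_pow_fixed hi s]
  exact C_σ_pow s _ _

lemma Cσ_of_fixed_right {i j : T.I0} (hj : T.IsFixed j) (s : ℕ) : T.Cσ i j s = T.C i.1 j.1 := by
  rw [Cσ, σ_pow_fixed hj]

lemma Cσ_M : T.Cσ i j T.M = T.C i.1 j.1 := by rw [Cσ, σ_pow_M]; rfl

lemma Cσ_eq_zero {i j : T.I0} (hi : ¬ T.IsFixed i) (hj : ¬ T.IsFixed j) (hij : i ≠ j) {s : ℕ}
    (h1 : 1 ≤ s) (h2 : s < T.M) : T.Cσ i j s = 0 := by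
  rw [Cσ, C_eq_zero_iff]
  have e1 := i.2 1
  have e2 := i.2 2
  have f1 := j.2 1
  have f2 := j.2 2
  have hne : i.1 ≠ j.1 := fun h => hij (Subtype.ext h)
  rw [IsFixed] at hi hj
  generalize i.1 = i at *
  generalize j.1 = j at *
  cases T with
  | A m hm hm3 =>
    obtain rfl : s = 1 := by simp only [M] at h2; omega
    have hi' := σ_A_val m hm hm3 i
    have hj' := σ_A_val m hm hm3 j
    have := i.2; have := j.2
    simp only [pow_one, Fin.ext_iff, Fin.le_def, ne_eq, Adj, edge] at *
    simp only [rank] at *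
    omega
  | D n hn =>
    obtain rfl : s = 1 := by simp only [M] at h2; omega
    have hi' := σ_D_val n hn i
    have hj' := σ_D_val n hn j
    have := i.2; have := j.2
    simp only [pow_one, Fin.ext_iff, Fin.le_def, ne_eq, Adj, edge] at *
    simp only [rank] at *
    split_ifs at hi' hj' <;> omega
  | D4 =>
    obtain rfl | rfl : s = 1 ∨ s = 2 := by simp only [M] at h2; omega
    all_goals clear h1 h2 hij; revert i j; decide
  | E6 =>
    obtain rfl : s = 1 := by simp only [M] at h2; omega
    clear h1 h2 hij; revert i j; decide

lemma short_M {i : T.I0} (hi : T.Cσ i i 1 = -1) : T.M = 2 ∧ ∀ j : T.I0, ¬ T.IsFixed j := by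
  rw [Cσ, C_eq_neg_one_iff, pow_one] at hi
  have hi1 := i.2 1
  have hi2 := i.2 2
  rw [pow_one] at hi1
  generalize i.1 = i at *
  cases T with
  | A m hm hm3 =>
    refine ⟨rfl, fun j hj => ?_⟩
    rw [IsFixed] at hj
    generalize j.1 = j at *
    have hi' := σ_A_val m hm hm3 i
    have hj' := σ_A_val m hm hm3 j
    have := i.2; have := j.2
    simp only [Fin.ext_iff, Adj, edge] at *
    simp only [rank] at *
    omega
  | D n hn =>
    have hi' := σ_D_val n hn i
    have := i.2
    simp only [Fin.le_def, Adj, edge] at *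
    simp only [rank] at *
    split_ifs at hi' <;> omega
  | D4 => exfalso; revert i; decide
  | E6 => exfalso; revert i; decide

lemma Cσ_self_cases {i : T.I0} (hi : ¬ T.IsFixed i) (h : T.Cσ i i 1 ≠ -1) {s : ℕ}
    (h1 : 1 ≤ s) (h2 : s < T.M) : T.Cσ i i s = 0 := by
  have hs : T.Cσ i i 1 = 0 := by
    rw [Cσ, C_eq_zero_iff]
    refine ⟨fun h => hi h.symm, fun hA => h ?_⟩
    rw [Cσ, C_eq_neg_one_iff]; exact hA
  rcases M_eq T with hM | hM
  · obtain rfl : s = 1 := by omega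
    exact hs
  · obtain rfl | rfl : s = 1 ∨ s = 2 := by omega
    · exact hs
    · have h3 : T.σ ^ 3 = 1 := hM ▸ T.σ_pow_M
      rw [← hs, Cσ, Cσ, C_symm, ← C_σ, ← Equiv.Perm.mul_apply, ← pow_succ']
      change T.C ((T.σ ^ 3) i.1) _ = _
      rw [h3]
      rfl

/-- The involution `s ↦ - s` modulo `M` on `{1, …, M}`. -/
def negIdx (T : TwistedType) (s : ℕ) : ℕ := if s = T.M then T.M else T.M - s

lemma negIdx_spec {s : ℕ} (hs : s ∈ Finset.Icc 1 T.M) :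
    T.negIdx s ∈ Finset.Icc 1 T.M ∧ T.negIdx (T.negIdx s) = s ∧ T.M ∣ s + T.negIdx s := by
  rw [mem_Icc] at *
  have := T.M_pos
  simp only [negIdx]
  split_ifs with h1 h2 h3
  · exact ⟨by omega, by omega, ⟨2, by omega⟩⟩
  · omega
  · omega
  · exact ⟨by omega, by omega, ⟨1, by omega⟩⟩

lemma σ_pow_of_dvd {k : ℕ} (h : T.M ∣ k) : T.σ ^ k = 1 := by
  obtain ⟨c, rfl⟩ := h
  rw [pow_mul, σ_pow_M, one_pow]

lemma Cσ_negIdx {i j : T.I0} {s : ℕ} (hs : s ∈ Finset.Icc 1 T.M) :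
    T.Cσ j i (T.negIdx s) = T.Cσ i j s := by
  obtain ⟨-, -, h⟩ := negIdx_spec hs
  rw [Cσ, Cσ, ← C_σ_pow s, ← Equiv.Perm.mul_apply, ← pow_add, σ_pow_of_dvd h, C_symm]; rfl

lemma sumC_symm : T.sumC i j = T.sumC j i := by
  refine sum_nbij' T.negIdx T.negIdx (fun s hs => (negIdx_spec hs).1)
    (fun s hs => (negIdx_spec hs).1) (fun s hs => (negIdx_spec hs).2.1)
    (fun s hs => (negIdx_spec hs).2.1) fun s hs => (Cσ_negIdx hs).symm

end TwistedType


section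

open MvPolynomial (C)
open MvPolynomial (X)
open TwistedFusion.TwistedType (negIdx_spec Cσ_negIdx Cσ_of_fixed_left Cσ_of_fixed_right C_self C_symm Cσ_M
  Cσ_self_cases Cσ_eq_zero short_M ζ_eq_neg_one)

open MvPolynomial in
lemma poly_ext {P Q : Poly2} (h : ∀ x : Fin 2 → ℂ, eval x P = eval x Q) : P = Q :=
  MvPolynomial.funext h

/-! ### Structure polynomials -/

section Structure

variable (ε : ℤˣ)

lemma isHomogeneous_linear (a b : ℂ) : (C a * X 0 - C b * X 1 : Poly2).IsHomogeneous 1 := by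
  have h1 := (isHomogeneous_C (Fin 2) a).mul (isHomogeneous_X ℂ (0 : Fin 2))
  have h2 := (isHomogeneous_C (Fin 2) b).mul (isHomogeneous_X ℂ (1 : Fin 2))
  rw [zero_add] at h1 h2
  exact h1.sub h2

lemma isHomogeneous_polyF (i j : T.I0) :
    (polyF T t ε i j).IsHomogeneous (activeSet T i j).card := by
  have := IsHomogeneous.prod (activeSet T i j) _ (fun _ => 1)
    (fun s _ => isHomogeneous_linear 1 (T.ζ ^ s * qpow t (ε * T.Cσ i j s)))
  simpa [polyF] using this

lemma isHomogeneous_polyG (i j : T.I0) :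
    (polyG T t ε i j).IsHomogeneous (activeSet T i j).card := by
  have := IsHomogeneous.prod (activeSet T i j) _ (fun _ => 1)
    (fun s _ => isHomogeneous_linear (qpow t (ε * T.Cσ i j s)) (T.ζ ^ s))
  simpa [polyG] using this

lemma negIdx_active {i j : T.I0} {s : ℕ} (hs : s ∈ activeSet T i j) :
    T.negIdx s ∈ activeSet T j i := by
  rw [activeSet, mem_filter] at *
  exact ⟨(negIdx_spec hs.1).1, by rw [Cσ_negIdx hs.1]; exact hs.2⟩

lemma mem_Icc_of_active {i j : T.I0} {s : ℕ} (hs : s ∈ activeSet T i j) :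
    s ∈ Finset.Icc 1 T.M := (mem_filter.1 hs).1

lemma ζ_pow_negIdx {s : ℕ} (hs : s ∈ Finset.Icc 1 T.M) : T.ζ ^ s * T.ζ ^ T.negIdx s = 1 := by
  rw [← pow_add]
  exact (T.isPrimitiveRoot_ζ.pow_eq_one_iff_dvd _).2 (negIdx_spec hs).2.2

/-- The constant relating `polyG` for `(i, j)` and `polyF` for `(j, i)`. -/
def swapConst (T : TwistedType) (i j : T.I0) : ℂ := ∏ s ∈ activeSet T i j, -T.ζ ^ s

lemma prod_activeSet {R : Type*} [CommMonoid R] (i j : T.I0) (f : ℕ → R) :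
    ∏ s ∈ activeSet T j i, f s = ∏ s ∈ activeSet T i j, f (T.negIdx s) :=
  have h {i j : T.I0} {s} (hs : s ∈ activeSet T i j) := (negIdx_spec (mem_Icc_of_active hs)).2.1
  Finset.prod_nbij' T.negIdx T.negIdx (fun _ => negIdx_active) (fun _ => negIdx_active)
    (fun _ => h) (fun _ => h) fun s hs => by rw [h hs]

lemma swapConst_mul (i j : T.I0) : swapConst T i j * swapConst T j i = 1 := by
  rw [swapConst, swapConst, prod_activeSet i j, ← prod_mul_distrib]
  exact Finset.prod_eq_one fun s hs => by rw [neg_mul_neg, ζ_pow_negIdx (mem_Icc_of_active hs)]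

lemma polyG_eq (i j : T.I0) : polyG T t ε i j =
    C (swapConst T i j) * swapVars (polyF T t ε j i) := by
  rw [polyF, prod_activeSet i j, polyG, swapConst, map_prod, map_prod, ← prod_mul_distrib]
  refine prod_congr rfl fun s hs => poly_ext fun x => ?_
  have h := ζ_pow_negIdx (mem_Icc_of_active hs)
  rw [Cσ_negIdx (mem_Icc_of_active hs)]
  simp
  linear_combination (qpow t (ε * T.Cσ i j s) * x 0) * (-h)

lemma polyF_eq (i j : T.I0) : polyF T t ε i j =
    C (swapConst T i j) * swapVars (polyG T t ε j i) := by
  rw [polyG_eq ε j i, map_mul, rename_rename, rename_C, ← mul_assoc,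
    ← map_mul, swapConst_mul, map_one, one_mul]
  have : (![1, 0] ∘ ![1, 0] : Fin 2 → Fin 2) = id := by funext k; fin_cases k <;> rfl
  rw [this, rename_id, AlgHom.id_apply]

lemma Exchange.reverse_poly {A : Type} [Ring A] [Algebra ℂ A] {i j : T.I0} {f g : ℤ → A}
    (h : Exchange (polyF T t ε i j) (polyG T t ε i j) f g) :
    Exchange (polyF T t ε j i) (polyG T t ε j i) g f :=
  h.reverse (polyF_eq ε j i) (polyG_eq ε j i)

lemma polyG_eq_polyF_neg (i j : T.I0) : polyG T t ε i j =
    C (qpow t (ε * T.sumC i j)) * polyF T t (-ε) i j := by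
  rw [sumC_eq, mul_sum, qpow_sum, map_prod, polyF, polyG, ← prod_mul_distrib]
  refine prod_congr rfl fun s _ => poly_ext fun x => ?_
  have := qpow_ne_zero t (ε * T.Cσ i j s)
  simp [qpow_neg]
  field_simp

lemma polyF_eq_polyG_neg (i j : T.I0) : polyF T t ε i j =
    C (qpow t (ε * T.sumC i j)) * polyG T t (-ε) i j := by
  rw [polyG_eq_polyF_neg, ← mul_assoc, ← map_mul, ← qpow_add, neg_neg]
  simp [qpow_zero]

variable {ε}

lemma prod_sub_ζ (T : TwistedType) (a b c : ℂ) :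
    ∏ s ∈ Finset.Icc 1 T.M, (c * a - T.ζ ^ s * b) = c ^ T.M * a ^ T.M - b ^ T.M := by
  have h := T.isPrimitiveRoot_ζ
  rcases T.M_eq with hM | hM
  · rw [ζ_eq_neg_one hM, hM, show Finset.Icc 1 2 = {1, 2} by rfl, prod_pair (by decide)]
    ring
  · rw [hM] at h ⊢
    have h3 := h.geom_sum_eq_zero (by norm_num)
    rw [sum_range_succ, sum_range_succ, Finset.sum_range_one] at h3
    rw [show Finset.Icc 1 3 = {1, 2, 3} by rfl, prod_insert (by decide), prod_pair (by decide)]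
    linear_combination (-T.ζ * c ^ 2 * a ^ 2 * b + T.ζ ^ 3 * c * a * b ^ 2 -
      b ^ 3 * (T.ζ - 1) * (T.ζ ^ 3 + 1)) * h3

lemma poly_eq {i j : T.I0} {c : ℤ} (hc : c ≠ 0) (hC : T.C i.1 j.1 = c) {m : ℕ}
    (h : m = T.M ∧ (T.IsFixed i ∨ T.IsFixed j) ∨ m = 1 ∧ ∀ s, 1 ≤ s → s < T.M → T.Cσ i j s = 0) :
    polyF T t ε i j = X 0 ^ m - C (qpow t (ε * c) ^ m) * X 1 ^ m ∧
    polyG T t ε i j = C (qpow t (ε * c) ^ m) * X 0 ^ m - X 1 ^ m := by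
  obtain ⟨rfl, h⟩ | ⟨rfl, h⟩ := h
  · have h s : T.Cσ i j s = c := by
      rcases h with h | h
      exacts [(Cσ_of_fixed_left h s).trans hC, (Cσ_of_fixed_right h s).trans hC]
    have hact : activeSet T i j = Finset.Icc 1 T.M :=
      Finset.filter_true_of_mem fun s _ => by rwa [h s]
    constructor <;> refine poly_ext fun x => ?_
    · have := prod_sub_ζ T (x 0) (qpow t (ε * c) * x 1) 1
      rw [one_mul, one_pow, one_mul, mul_pow] at this
      simp [polyF, hact, h, ← this, mul_assoc]
    · simpa [polyG, hact, h] using prod_sub_ζ T (x 0) (x 1) (qpow t (ε * c))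
  · have hact : activeSet T i j = {T.M} := by
      ext s
      rw [activeSet, mem_filter, mem_Icc, mem_singleton]
      refine ⟨fun ⟨⟨h1, h2⟩, h3⟩ => ?_, ?_⟩
      · by_contra hne; exact h3 (h s h1 (by omega))
      · rintro rfl
        exact ⟨⟨T.M_pos, le_rfl⟩, by rwa [Cσ_M, hC]⟩
    constructor <;> exact poly_ext fun x => by
      simp [polyF, polyG, hact, Cσ_M, hC, T.isPrimitiveRoot_ζ.pow_eq_one]

lemma poly_of_short {i : T.I0} (h : T.Cσ i i 1 = -1) :
    polyF T t ε i i = (X 0 + C (qpow t ε)⁻¹ * X 1) * (X 0 - C (qpow t ε ^ 2) * X 1) ∧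
    polyG T t ε i i = (C (qpow t ε)⁻¹ * X 0 + X 1) * (C (qpow t ε ^ 2) * X 0 - X 1) := by
  have hM := (short_M h).1
  have h2 : T.Cσ i i 2 = 2 := by rw [← hM, Cσ_M, C_self]
  have hact : activeSet T i i = {1, 2} := by
    rw [activeSet, hM, Finset.filter_true_of_mem]
    · rfl
    · intro s hs
      obtain rfl | rfl : s = 1 ∨ s = 2 := by rw [mem_Icc] at hs; omega
      · rw [h]; norm_num
      · rw [h2]; norm_num
  have e1 : qpow t ((ε : ℤ) * -1) = (qpow t ε)⁻¹ := by rw [mul_neg, mul_one, qpow_neg]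
  have e2 : qpow t ((ε : ℤ) * 2) = qpow t ε ^ 2 := by rw [← qpow_mul_nat, mul_comm]; rfl
  constructor
  · rw [polyF, hact, prod_pair (by decide), h, h2, e1, e2, ζ_eq_neg_one hM]
    refine poly_ext fun x => ?_
    simp
  · rw [polyG, hact, prod_pair (by decide), h, h2, e1, e2, ζ_eq_neg_one hM]
    refine poly_ext fun x => ?_
    simp

lemma poly_self {i : T.I0} (hs : T.Cσ i i 1 ≠ -1) :
    ∃ m : ℕ, (m = T.M ∧ T.IsFixed i ∨ m = 1 ∧ ¬ T.IsFixed i) ∧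
      polyF T t ε i i = X 0 ^ m - C (qpow t (ε * 2) ^ m) * X 1 ^ m ∧
      polyG T t ε i i = C (qpow t (ε * 2) ^ m) * X 0 ^ m - X 1 ^ m := by
  by_cases hi : T.IsFixed i
  · exact ⟨_, .inl ⟨rfl, hi⟩, poly_eq (by norm_num) (C_self _) (.inl ⟨rfl, .inl hi⟩)⟩
  · exact ⟨1, .inr ⟨rfl, hi⟩, poly_eq (by norm_num) (C_self _)
      (.inr ⟨rfl, fun s => Cσ_self_cases hi hs⟩)⟩

lemma skew_polyG (i : T.I0) : polyG T t ε i i = -swapVars (polyF T t ε i i) := by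
  by_cases hs : T.Cσ i i 1 = -1
  · obtain ⟨h1, h2⟩ := poly_of_short (t := t) (ε := ε) hs
    rw [h1, h2]
    refine poly_ext fun x => ?_
    simp
    ring
  · obtain ⟨m, -, h1, h2⟩ := poly_self (t := t) (ε := ε) hs
    rw [h1, h2]; simp

open scoped Classical in
lemma serreShape (i j : T.I0) (hij : T.C i.1 j.1 = -1) :
    SerreShape (serreP T t ε i j) (polyF T t ε i i) (polyG T t ε i i) (polyF T t ε i j)
      (polyG T t ε i j) (polyF T t ε j i) (polyG T t ε j i) (qpow t (ε * serreExp T i j))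
      (qpow t (serreExp T i j) + qpow t (-serreExp T i j)) := by
  have hji : T.C j.1 i.1 = -1 := by rw [C_symm, hij]
  have hne : i ≠ j := by
    rintro rfl; rw [C_self] at hij; norm_num at hij
  set Q := qpow t ε with hQ
  have hQ0 : Q ≠ 0 := qpow_ne_zero _ _
  have e1 : qpow t ((ε : ℤ) * -1) = Q⁻¹ := by rw [mul_neg, mul_one, qpow_neg]
  have e3 (n : ℕ) : qpow t ((ε : ℤ) * n) = Q ^ n := by rw [hQ, ← qpow_mul_nat, mul_comm]
  have e2 : qpow t ((ε : ℤ) * 2) = Q ^ 2 := e3 2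
  have e4 : qpow t (2 * (ε : ℤ)) = Q ^ 2 := by rw [mul_comm]; exact e2
  refine ⟨qpow_ne_zero _ _, ?_, skew_polyG i, ?_⟩
  · have h0 := qpow_ne_zero t (serreExp T i j)
    rcases units_eq_one_or ε with rfl | rfl
    · simp only [val_one, one_mul, qpow_neg]; field_simp
    · simp only [val_neg, val_one, neg_mul, one_mul, qpow_neg]; field_simp; ring
  obtain ⟨m, hE, hm⟩ : ∃ m : ℕ, serreExp T i j = m ∧ (m = T.M ∧ (T.IsFixed i ∨ T.IsFixed j) ∨
      m = 1 ∧ ¬ T.IsFixed i ∧ ¬ T.IsFixed j) := by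
    rw [serreExp]
    split_ifs with h1 h2 h3
    exacts [⟨_, rfl, .inl ⟨rfl, .inl h1⟩⟩, ⟨1, rfl, .inr ⟨rfl, h1, (short_M h2).2 j⟩⟩,
      ⟨_, rfl, .inl ⟨rfl, .inr h3⟩⟩, ⟨1, rfl, .inr ⟨rfl, h1, h3⟩⟩]
  obtain ⟨h3, h4⟩ := poly_eq (t := t) (ε := ε) (by norm_num) hij
    (hm.imp_right fun h => ⟨h.1, fun s => Cσ_eq_zero h.2.1 h.2.2 hne⟩)
  obtain ⟨h5, h6⟩ := poly_eq (t := t) (ε := ε) (by norm_num) hji (hm.imp (And.imp_right Or.symm)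
    fun h => ⟨h.1, fun s => Cσ_eq_zero h.2.2 h.2.1 hne.symm⟩)
  suffices ∃ S b : Poly2, swapVars S = S ∧
      serreP T t ε i j * (X 0 ^ m - C (Q ^ m) ^ 2 * X 1 ^ m) = polyF T t ε i i * S ∧
      serreP T t ε i j * swapVars (polyF T t ε i i) = b * (X 1 ^ m - C (Q ^ m) ^ 2 * X 0 ^ m) ∧
      swapVars (serreP T t ε i j) * swapVars (polyG T t ε i i) =
        b * (C (Q ^ m) ^ 2 * X 1 ^ m - X 0 ^ m) by
    obtain ⟨S, b, H⟩ := this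
    rw [hE, e3, h3, h4, h5, h6, e1]
    refine ⟨m, S, b, ?_, ?_, ?_, ?_, H⟩ <;> refine poly_ext fun x => ?_ <;> simp <;> field_simp
  by_cases hs : T.Cσ i i 1 = -1
  · have hi := (short_M hs).2
    obtain ⟨h1, h2⟩ := poly_of_short (t := t) (ε := ε) hs
    obtain rfl : m = 1 := (hm.resolve_left fun h => h.2.elim (hi i) (hi j)).1
    rw [h1, h2, serreP, if_neg (hi i), if_pos hs, ← hQ]
    refine ⟨C Q, (C Q * X 0 + X 1) * (X 1 + C Q⁻¹ * X 0), by simp, ?_, ?_, ?_⟩ <;>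
      refine poly_ext fun x => ?_ <;> simp
    all_goals first | (field_simp; done) | (field_simp; ring)
  · obtain ⟨n, hn, h1, h2⟩ := poly_self (t := t) (ε := ε) hs
    rw [h1, h2, e2, serreP, if_neg hs, e4]
    by_cases hnm : n = m ∧ (T.IsFixed i ∨ ¬ T.IsFixed j)
    · obtain ⟨rfl, h⟩ := hnm
      have : ∀ P : Poly2, (if T.IsFixed i then 1 else
        if T.IsFixed j then P else 1) = 1 := fun P => by split_ifs <;> tauto
      rw [this]
      refine ⟨1, 1, by simp, ?_, ?_, ?_⟩ <;> refine poly_ext fun x => ?_ <;> simp <;> exact .inl (by ring)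
    · obtain ⟨rfl, rfl, hi, hj⟩ : n = 1 ∧ m = T.M ∧ ¬ T.IsFixed i ∧ T.IsFixed j := by grind
      rw [if_neg hi, if_pos hj]
      have hg (a b : ℂ) : (∑ k ∈ range T.M, (Q ^ 2 * a) ^ k * b ^ (T.M - 1 - k)) *
          (Q ^ 2 * a - b) = (Q ^ 2 * a) ^ T.M - b ^ T.M := geom_sum₂_mul _ _ _
      refine ⟨(∑ k ∈ range T.M, (C (Q ^ 2) * X 0) ^ k * X 1 ^ (T.M - 1 - k)) *
        ∑ k ∈ range T.M, (C (Q ^ 2) * X 1) ^ k * X 0 ^ (T.M - 1 - k), 1, ?_, ?_, ?_, ?_⟩ <;>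
        refine poly_ext fun x => ?_ <;> simp
      · ring
      · linear_combination (∑ k ∈ range T.M, (Q ^ 2 * x 0) ^ k * x 1 ^ (T.M - 1 - k)) *
          (hg (x 1) (x 0))
      · linear_combination - hg (x 0) (x 1)
      · linear_combination hg (x 1) (x 0)

lemma exists_isHomogeneous_serreP (i j : T.I0) : ∃ d, (serreP T t ε i j).IsHomogeneous d := by
  have hX0 := isHomogeneous_X ℂ (0 : Fin 2)
  have hX1 := isHomogeneous_X ℂ (1 : Fin 2)
  rw [serreP]
  split_ifs
  · exact ⟨0, MvPolynomial.isHomogeneous_one _ _⟩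
  · have := (isHomogeneous_C (Fin 2) (qpow t ε)).mul hX0
    rw [zero_add] at this
    exact ⟨1, this.add hX1⟩
  · refine ⟨T.M - 1, IsHomogeneous.sum _ _ _ fun k hk => ?_⟩
    have h1 := (((isHomogeneous_C (Fin 2) (qpow t (2 * ε))).mul hX0).pow k).mul
      (hX1.pow (T.M - 1 - k))
    have : (0 + 1) * k + 1 * (T.M - 1 - k) = T.M - 1 := by rw [mem_range] at hk; omega
    rwa [this] at h1
  · exact ⟨0, MvPolynomial.isHomogeneous_one _ _⟩

end Structure


end

/-! ### The cubic relations -/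

section Cubic

open MvPolynomial (C X)

/-- The polynomial of the cubic relations that is linear in the variables. -/
def cubicLin (τ : ℂ) (i j k : Fin 3) : Poly3 := C (τ⁻¹ ^ 3) * X i - C (τ + τ⁻¹) * X j +
    C (τ ^ 3) * X k

/-- The polynomial of the cubic relations that is quadratic in the variables. -/
def cubicQuad (τ : ℂ) (i j k : Fin 3) : Poly3 := C (τ ^ 3) * (X j * X k) -
    C (τ + τ⁻¹) * (X i * X k) +
    C (τ⁻¹ ^ 3) * (X i * X j)

lemma isHomogeneous_cubicLin (τ : ℂ) (i j k : Fin 3) : (cubicLin τ i j k).IsHomogeneous 1 := by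
  have h (c : ℂ) (i : Fin 3) : (C c * X i : Poly3).IsHomogeneous 1 := by
    have := (isHomogeneous_C (Fin 3) c).mul (isHomogeneous_X ℂ i)
    rwa [zero_add] at this
  exact ((h _ _).sub (h _ _)).add (h _ _)

lemma isHomogeneous_cubicQuad (τ : ℂ) (i j k : Fin 3) : (cubicQuad τ i j k).IsHomogeneous 2 := by
  have h (c : ℂ) (i j : Fin 3) : (C c * (X i * X j) : Poly3).IsHomogeneous 2 := by
    have := (isHomogeneous_C (Fin 3) c).mul ((isHomogeneous_X ℂ i).mul (isHomogeneous_X ℂ j))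
    rwa [zero_add] at this
  exact ((h _ _ _).sub (h _ _ _)).add (h _ _ _)

/-- The structure polynomials of a node `i` with `C_{i, σ (i)} = -1`. -/
def shortF (τ : ℂ) : Poly2 := (X 0 + C (τ⁻¹ ^ 2) * X 1) * (X 0 - C (τ ^ 4) * X 1)

/-- The structure polynomials of a node `i` with `C_{i, σ (i)} = -1`. -/
def shortG (τ : ℂ) : Poly2 := (C (τ⁻¹ ^ 2) * X 0 + X 1) * (C (τ ^ 4) * X 0 - X 1)

/-- The quotient in the polynomial identity for the linear cubic relation. -/
def cubicLinS (τ : ℂ) (i j k : Fin 3) : Poly3 := C (τ ^ 3 - τ⁻¹) * ((X i + X j) * X k ^ 2) +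
    C (τ ^ 5 + τ ^ 3 - τ⁻¹ - τ⁻¹ ^ 3) * (X i * X j * X k) +
    C (-τ ^ 7 - τ ^ 5 + τ⁻¹ ^ 3 + τ⁻¹ ^ 5) * X k ^ 3

/-- The quotient in the polynomial identity for the quadratic cubic relation. -/
def cubicQuadS (τ : ℂ) (i j k : Fin 3) : Poly3 := C (τ ^ 3 - τ⁻¹) * ((X i + X j) * X k ^ 3) +
    C (τ ^ 5 + τ ^ 3 - τ⁻¹ - τ⁻¹ ^ 3) * X k ^ 4 +
    C (-τ ^ 7 - τ ^ 5 + τ⁻¹ ^ 3 + τ⁻¹ ^ 5) * (X i * X j * X k ^ 2)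

variable {τ : ℂ} (hτ : τ ≠ 0)
include hτ

lemma cubicLin_xxy (i j k : Fin 3) :
    cubicLin τ i j k * poly2 (shortF τ) k i * poly2 (shortF τ) k j +
      cubicLin τ i k j * poly2 (shortF τ) k i * poly2 (shortG τ) k j +
      cubicLin τ k i j * poly2 (shortG τ) k i * poly2 (shortG τ) k j =
    poly2 (shortF τ) i j * cubicLinS τ i j k := by
  refine MvPolynomial.funext fun x => ?_
  simp [cubicLin, cubicLinS, shortF, shortG]
  field_simp
  ring

lemma cubicLin_xyy (i j k : Fin 3) :
    cubicLin τ i j k * poly2 (shortG τ) i k * poly2 (shortG τ) j k +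
      cubicLin τ i k j * poly2 (shortG τ) i k * poly2 (shortF τ) j k +
      cubicLin τ k i j * poly2 (shortF τ) i k * poly2 (shortF τ) j k =
    poly2 (shortF τ) i j * cubicLinS τ i j k := by
  refine MvPolynomial.funext fun x => ?_
  simp [cubicLin, cubicLinS, shortF, shortG]
  field_simp
  ring

lemma cubicQuad_xxy (i j k : Fin 3) :
    cubicQuad τ i j k * poly2 (shortF τ) k i * poly2 (shortF τ) k j +
      cubicQuad τ i k j * poly2 (shortF τ) k i * poly2 (shortG τ) k j +
      cubicQuad τ k i j * poly2 (shortG τ) k i * poly2 (shortG τ) k j =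
    poly2 (shortF τ) i j * cubicQuadS τ i j k := by
  refine MvPolynomial.funext fun x => ?_
  simp [cubicQuad, cubicQuadS, shortF, shortG]
  field_simp
  ring

lemma cubicQuad_xyy (i j k : Fin 3) :
    cubicQuad τ i j k * poly2 (shortG τ) i k * poly2 (shortG τ) j k +
      cubicQuad τ i k j * poly2 (shortG τ) i k * poly2 (shortF τ) j k +
      cubicQuad τ k i j * poly2 (shortF τ) i k * poly2 (shortF τ) j k =
    poly2 (shortF τ) i j * cubicQuadS τ i j k := by
  refine MvPolynomial.funext fun x => ?_
  simp [cubicQuad, cubicQuadS, shortF, shortG]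
  field_simp
  ring

end Cubic

lemma cubicDist_add_eq_zero {B : Type} [Ring B] [Algebra ℂ B] {F G : Poly2}
    {p S : Fin 3 → Fin 3 → Fin 3 → Poly3}
    (h1 : ∀ i j k, p i j k * poly2 F k i * poly2 F k j + p i k j * poly2 F k i * poly2 G k j
      + p k i j * poly2 G k i * poly2 G k j = poly2 F i j * S i j k)
    (h2 : ∀ i j k, p i j k * poly2 G i k * poly2 G j k + p i k j * poly2 G i k * poly2 F j k
      + p k i j * poly2 F i k * poly2 F j k = poly2 F i j * S i j k)
    (hSs : ∀ i j k, S i j k = S j i k) (hskew : G = -swapVars F)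
    (hc : Cancelling B F) {x y : ℤ → HahnSeries ℤ B} (bx : OrderBound1 0 x) (bY : OrderBound1 1 y)
    (hxx : Exchange F G x x) (hyy : Exchange F G y y) (hyx : Exchange F G y x)
    (hx : cubicDist p (fun _ => x) 0 1 2 = 0) (hy : cubicDist p (fun _ => y) 0 1 2 = 0) :
    cubicDist p (fun _ r => x r + y r) 0 1 2 = 0 := by
  rw [cubicDist_add, hx, hy,
    cubicDist_xxy h1 hSs hskew hc bx bY hxx hyx (L := ![x, x, y]) rfl rfl rfl,
    cubicDist_xxy h1 hSs hskew hc bx bY hxx hyx (L := ![x, y, x]) rfl rfl rfl,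
    cubicDist_xxy h1 hSs hskew hc bx bY hxx hyx (L := ![y, x, x]) rfl rfl rfl,
    cubicDist_xyy h2 hSs hskew hc bx bY hyy hyx (L := ![x, y, y]) rfl rfl rfl,
    cubicDist_xyy h2 hSs hskew hc bx bY hyy hyx (L := ![y, x, y]) rfl rfl rfl,
    cubicDist_xyy h2 hSs hskew hc bx bY hyy hyx (L := ![y, y, x]) rfl rfl rfl]
  simp


/-! ### The Serre and cubic relations as identities of distributions -/

section Apply

variable {A : Type} [Ring A] [Algebra ℂ A]

lemma serreDist_apply (P : Poly2) (s : ℂ) (f g : ℤ → A) (p : Fin 3 → ℤ) :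
    serreDist P s f 0 f 1 g 2 p = coeffSum P (fun k l => g (p 2) * f (p 0 + k) * f (p 1 + l) -
        s • (f (p 0 + k) * g (p 2) * f (p 1 + l)) + f (p 0 + k) * f (p 1 + l) * g (p 2)) +
      coeffSum P (fun k l => g (p 2) * f (p 1 + k) * f (p 0 + l) -
        s • (f (p 1 + k) * g (p 2) * f (p 0 + l)) + f (p 1 + k) * f (p 0 + l) * g (p 2)) := by
  rw [serreDist, Dist.add_apply, Dist.rename_smul, Dist.rename_smul]
  simp [coeffSum, word, Dist.add_apply, Dist.sub_apply, Dist.csmul_apply]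

/-- The left-hand side of a cubic relation for a series `f`. -/
def cubicVal (t c : ℂ) (k : ℤ) (f : ℤ → A) (a : Fin 3 → ℤ) : A := ∑ π : Equiv.Perm (Fin 3),
    (c • (f (a (π 0) + k) * f (a (π 1)) * f (a (π 2))) -
      (t + t⁻¹) • (f (a (π 0)) * f (a (π 1) + k) * f (a (π 2))) +
      c⁻¹ • (f (a (π 0)) * f (a (π 1)) * f (a (π 2) + k)))

lemma perm_ne (π : Equiv.Perm (Fin 3)) : π 0 ≠ π 1 ∧ π 0 ≠ π 2 ∧ π 1 ≠ π 2 := by simp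

lemma cubicDist_lin_apply (τ : ℂ) (f : ℤ → A) (a : Fin 3 → ℤ) :
    cubicDist (cubicLin τ) (fun _ => f) 0 1 2 a = cubicVal τ (τ⁻¹ ^ 3) 1 f a := by
  rw [cubicDist_eq_sum, Dist.sum_apply, cubicVal]
  refine sum_congr rfl fun π _ => ?_
  obtain ⟨h1, h2, h3⟩ := perm_ne π
  rw [cubicLin, add_smul, sub_smul, mul_smul, mul_smul, mul_smul, Dist.add_apply, Dist.sub_apply,
    Dist.C_smul, Dist.C_smul, Dist.C_smul, Dist.csmul_apply, Dist.csmul_apply, Dist.csmul_apply,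
    Dist.X_smul, Dist.X_smul, Dist.X_smul, inv_pow, inv_inv]
  simp only [word, Pi.add_apply, Pi.single_apply, h1, h2, h3, h1.symm, h2.symm, h3.symm, if_true,
    if_false, add_zero]

lemma cubicDist_quad_apply (τ : ℂ) (f : ℤ → A) (a : Fin 3 → ℤ) :
    cubicDist (cubicQuad τ) (fun _ => f) 0 1 2 (fun k => a k - 1) = cubicVal τ (τ ^ 3) (-1) f a := by
  rw [cubicDist_eq_sum, Dist.sum_apply, cubicVal]
  refine sum_congr rfl fun π _ => ?_
  obtain ⟨h1, h2, h3⟩ := perm_ne π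
  rw [cubicQuad, add_smul, sub_smul, mul_smul, mul_smul, mul_smul, mul_smul, mul_smul, mul_smul,
    Dist.add_apply, Dist.sub_apply,
    Dist.C_smul, Dist.C_smul, Dist.C_smul, Dist.csmul_apply, Dist.csmul_apply, Dist.csmul_apply,
    Dist.X_smul, Dist.X_smul, Dist.X_smul, Dist.X_smul, Dist.X_smul, Dist.X_smul, inv_pow]
  simp only [word, Pi.add_apply, Pi.single_apply, h1, h2, h3, h1.symm, h2.symm, h3.symm, if_true,
    if_false, add_zero, sub_add_cancel, ← sub_eq_add_neg]

end Apply

section Families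

/-- Families that satisfy the quadratic, Serre and cubic relations of the `x_i^ε`. -/
structure XRelations (T : TwistedType) (t : ℂˣ) (ε : ℤˣ) {A : Type} [Ring A] [Algebra ℂ A]
    (x : T.I0 → ℤ → A) : Prop where
  exchange : ∀ i j, Exchange (polyF T t ε i j) (polyG T t ε i j) (x i) (x j)
  serre : ∀ i j, T.C i.1 j.1 = -1 → T.σ i.1 ≠ j.1 →
    serreDist (serreP T t ε i j) (qpow t (serreExp T i j) + qpow t (-serreExp T i j))
      (x i) 0 (x i) 1 (x j) 2 = 0
  lin : ∀ i, T.Cσ i i 1 = -1 → cubicDist (cubicLin ((t : ℂ) ^ (ε : ℤ))) (fun _ => x i) 0 1 2 = 0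
  quad : ∀ i, T.Cσ i i 1 = -1 → cubicDist (cubicQuad ((t : ℂ) ^ (ε : ℤ))) (fun _ => x i) 0 1 2 = 0

lemma short_eq {ε : ℤˣ} {i : T.I0} (hi : T.Cσ i i 1 = -1) :
    polyF T t ε i i = shortF ((t : ℂ) ^ (ε : ℤ)) ∧ polyG T t ε i i = shortG ((t : ℂ) ^ (ε : ℤ)) := by
  have h : qpow t ε = ((t : ℂ) ^ (ε : ℤ)) ^ 2 := by
    rw [qpow, ← zpow_natCast, ← zpow_natCast, ← zpow_mul, ← zpow_mul, mul_comm]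
  obtain ⟨h1, h2⟩ := poly_of_short (t := t) (ε := ε) hi
  rw [h1, h2, h, shortF, shortG, inv_pow, ← pow_mul]
  exact ⟨rfl, rfl⟩

lemma XRelations.add {ε : ℤˣ} {B : Type} [Ring B] [Algebra ℂ B]
    {X Y : T.I0 → ℤ → HahnSeries ℤ B} (hX : XRelations T t ε X) (hY : XRelations T t ε Y)
    (bX : ∀ i, OrderBound1 0 (X i)) (bY : ∀ i, OrderBound1 1 (Y i))
    (hYX : ∀ i j, Exchange (polyF T t ε i j) (polyG T t ε i j) (Y i) (X j)) :
    XRelations T t ε (fun i r => X i r + Y i r) where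
  exchange i j := (hX.exchange i j).add ((hYX j i).reverse_poly ε) (hYX i j) (hY.exchange i j)
  serre i j hij hσ := serreDist_add (serreShape (ε := ε) i j hij) (cancelling_polyF ε i i)
    (cancelling_polyF ε i j) (cancelling_polyF ε j i) (bX i) (bX j) (bY i) (bY j)
    (hX.exchange i i) (hX.exchange i j) (hY.exchange i i) (hY.exchange i j) (hYX i i) (hYX i j)
    (hYX j i) (hX.serre i j hij hσ) (hY.serre i j hij hσ)
  lin i hi := by
    have h0 : (t : ℂ) ^ (ε : ℤ) ≠ 0 := zpow_ne_zero _ t.ne_zero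
    obtain ⟨h1, h2⟩ := short_eq (t := t) (ε := ε) hi
    refine cubicDist_add_eq_zero (cubicLin_xxy h0) (cubicLin_xyy h0) (fun i j k => ?_)
      (h1 ▸ h2 ▸ skew_polyG i) (h1 ▸ cancelling_polyF ε i i) (bX i) (bY i)
      (h1 ▸ h2 ▸ hX.exchange i i) (h1 ▸ h2 ▸ hY.exchange i i) (h1 ▸ h2 ▸ hYX i i) (hX.lin i hi)
      (hY.lin i hi)
    rw [cubicLinS, cubicLinS, add_comm (MvPolynomial.X i), mul_comm (MvPolynomial.X i)]
  quad i hi := by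
    have h0 : (t : ℂ) ^ (ε : ℤ) ≠ 0 := zpow_ne_zero _ t.ne_zero
    obtain ⟨h1, h2⟩ := short_eq (t := t) (ε := ε) hi
    refine cubicDist_add_eq_zero (cubicQuad_xxy h0) (cubicQuad_xyy h0) (fun i j k => ?_)
      (h1 ▸ h2 ▸ skew_polyG i) (h1 ▸ cancelling_polyF ε i i) (bX i) (bY i)
      (h1 ▸ h2 ▸ hX.exchange i i) (h1 ▸ h2 ▸ hY.exchange i i) (h1 ▸ h2 ▸ hYX i i) (hX.quad i hi)
      (hY.quad i hi)
    rw [cubicQuadS, cubicQuadS, add_comm (MvPolynomial.X i), mul_comm (MvPolynomial.X i)]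

lemma XRelations.letter_left {ε : ℤˣ} {U V : Type} [Ring U] [Algebra ℂ U] [Ring V] [Algebra ℂ V]
    {x : T.I0 → ℤ → U} {g : T.I0 → ℤ → V} (h : XRelations T t ε x)
    (hc : ∀ i j m n, Commute (g i m) (g j n)) (hs : ∀ i, Summable1 (x i) (g i)) :
    XRelations T t ε (fun i => letter (x i) (g i)) where
  exchange i j := .letter_left (hs i) (hs j) (h.exchange i j) (hc i j)
  serre i j hij hσ := serreDist_letter_left hs hc (h.serre i j hij hσ)
  lin i hi := cubicDist_letter_left hs hc (h.lin i hi)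
  quad i hi := cubicDist_letter_left hs hc (h.quad i hi)

lemma XRelations.letter_right {ε : ℤˣ} {U V : Type} [Ring U] [Algebra ℂ U] [Ring V]
    [Algebra ℂ V] {x : T.I0 → ℤ → V} {f : T.I0 → ℤ → U} (h : XRelations T t ε x)
    (hc : ∀ i j m n, Commute (f i m) (f j n)) (hs : ∀ i, Summable1 (f i) (x i)) :
    XRelations T t ε (fun i => letter (f i) (x i)) where
  exchange i j := .letter_right (hs i) (hs j) (isHomogeneous_polyF ε i j)
    (isHomogeneous_polyG ε i j) (h.exchange i j) (hc i j)
  serre i j hij hσ := by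
    obtain ⟨d, hd⟩ := exists_isHomogeneous_serreP (t := t) (ε := ε) i j
    exact serreDist_letter_right hs hd hc (h.serre i j hij hσ)
  lin i hi := cubicDist_letter_right hs (isHomogeneous_cubicLin _) hc (h.lin i hi)
  quad i hi := cubicDist_letter_right hs (isHomogeneous_cubicQuad _) hc (h.quad i hi)

lemma t_add_inv (t : ℂˣ) (ε : ℤˣ) :
    (t : ℂ) ^ (ε : ℤ) + ((t : ℂ) ^ (ε : ℤ))⁻¹ = (t : ℂ) + (t : ℂ)⁻¹ := by
  rcases units_eq_one_or ε with rfl | rfl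
  · simp
  · simp [add_comm]

lemma cubicVal_zpow {A : Type} [Ring A] [Algebra ℂ A] (t : ℂˣ) (ε : ℤˣ) (c : ℂ) (k : ℤ)
    (f : ℤ → A) (a : Fin 3 → ℤ) : cubicVal ((t : ℂ) ^ (ε : ℤ)) c k f a = cubicVal t c k f a := by
  simp only [cubicVal, t_add_inv]

lemma cubicDist_eq_zero_iff {A : Type} [Ring A] [Algebra ℂ A] (t : ℂˣ) (ε : ℤˣ) (f : ℤ → A) :
    (cubicDist (cubicLin ((t : ℂ) ^ (ε : ℤ))) (fun _ => f) 0 1 2 = 0 ∧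
      cubicDist (cubicQuad ((t : ℂ) ^ (ε : ℤ))) (fun _ => f) 0 1 2 = 0) ↔
    ((∀ a, cubicVal t ((t : ℂ) ^ 3) (-(ε : ℤ)) f a = 0) ∧
      ∀ a, cubicVal t (((t : ℂ) ^ 3)⁻¹) ε f a = 0) := by
  have hl : cubicDist (cubicLin ((t : ℂ) ^ (ε : ℤ))) (fun _ => f) 0 1 2 = 0 ↔
      ∀ a, cubicVal t (((t : ℂ) ^ (ε : ℤ))⁻¹ ^ 3) 1 f a = 0 := by
    refine ⟨fun h a => ?_, fun h => funext fun a => ?_⟩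
    · rw [← cubicVal_zpow t ε, ← cubicDist_lin_apply, h]; rfl
    · rw [cubicDist_lin_apply, cubicVal_zpow, h]; rfl
  have hq : cubicDist (cubicQuad ((t : ℂ) ^ (ε : ℤ))) (fun _ => f) 0 1 2 = 0 ↔
      ∀ a, cubicVal t (((t : ℂ) ^ (ε : ℤ)) ^ 3) (-1) f a = 0 := by
    refine ⟨fun h a => ?_, fun h => funext fun a => ?_⟩
    · rw [← cubicVal_zpow t ε, ← cubicDist_quad_apply, h]; rfl
    · have := cubicDist_quad_apply ((t : ℂ) ^ (ε : ℤ)) f (fun k => a k + 1)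
      simp only [add_sub_cancel_right] at this
      rw [this, cubicVal_zpow, h]; rfl
  rw [hl, hq]
  rcases units_eq_one_or ε with rfl | rfl
  · rw [val_one, zpow_one, inv_pow, and_comm]
  · rw [val_neg, val_one, zpow_neg, zpow_one, inv_inv, inv_pow, neg_neg]

lemma Alg.cubic {ε : ℤˣ} (i : T.I0) (hi : T.Cσ i i 1 = -1) :
    cubicDist (cubicLin ((t : ℂ) ^ (ε : ℤ))) (fun _ => Alg.x (t := t) (μ := μ) ε i) 0 1 2 = 0 ∧
    cubicDist (cubicQuad ((t : ℂ) ^ (ε : ℤ))) (fun _ => Alg.x (t := t) (μ := μ) ε i) 0 1 2 = 0 := by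
  refine (cubicDist_eq_zero_iff t ε _).2 ⟨fun a => ?_, fun a => ?_⟩
  · have := Alg.rel (t := t) (μ := μ) (Rel.cubic₁ ε i hi a)
    rw [map_zero, cubicTerm, map_sum] at this
    simp only [map_add, map_sub, map_mul, map_smul, Alg.mk_x] at this
    exact this
  · have := Alg.rel (t := t) (μ := μ) (Rel.cubic₂ ε i hi a)
    rw [map_zero, cubicTerm, map_sum] at this
    simp only [map_add, map_sub, map_mul, map_smul, Alg.mk_x] at this
    exact this

lemma Alg.xRelations : XRelations T t ε (Alg.x (t := t) (μ := μ) ε) where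
  exchange := Alg.exchange_x ε
  serre i j hij hσ := by
    funext p
    have := Alg.rel (t := t) (μ := μ) (Rel.serre ε i j hij hσ (p 0) (p 1) (p 2))
    rw [map_add, map_zero, serreTerm, serreTerm, coeffSum_map, coeffSum_map] at this
    simp only [map_add, map_sub, map_mul, map_smul, Alg.mk_x] at this
    rw [serreDist_apply, this, Dist.zero_apply]
  lin i hi := (cubic i hi).1
  quad i hi := (cubic i hi).2

end Families


/-! ### Further relations in the algebra -/

section

lemma ld_dvd (μ : T.Coweight) (ε : ℤˣ) {i : T.I0} (hi : T.IsFixed i) : (T.M : ℤ) ∣ ld μ ε i := by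
  rw [ld, leadIdx]
  split_ifs
  · change (T.M : ℤ) ∣ -(0 : ℤ); simp
  · exact μ.2 i hi

lemma ld_one (μ : T.Coweight) (i : T.I0) : ld μ 1 i = 0 := by
  rw [ld, leadIdx, if_pos rfl]; exact neg_zero

lemma ld_neg_one (μ : T.Coweight) (i : T.I0) : ld μ (-1) i = μ.1 i := by
  rw [ld, leadIdx, if_neg (by decide)]

lemma ld_add (μ1 μ2 : T.Coweight) (ε : ℤˣ) (i : T.I0) :
    ld (μ1 + μ2) ε i = ld μ1 ε i + ld μ2 ε i := by
  rcases units_eq_one_or ε with rfl | rfl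
  · simp only [ld_one, add_zero]
  · simp only [ld_neg_one]; rfl

lemma unit_mul_dvd {d : ℤ} (n : ℤ) : d ∣ (ε : ℤ) * n ↔ d ∣ n := by
  rcases units_eq_one_or ε with rfl | rfl <;> simp

namespace Alg

lemma φ_eq_zero_of_not_InIZ {r : ℤ} (hr : ¬ T.InIZ i r) : (φ ε i r : Alg T t μ) = 0 := by
  rw [TwistedType.InIZ, Classical.not_imp] at hr
  rcases exists_index ε (ld μ ε i) r with h | ⟨n, rfl⟩
  · exact φ_eq_zero_of_lt ε i h
  · rw [φ_eq, (isExp_hSeq ε i).eq_zero_of_not_dvd (d := T.M) (fun m hm => ?_), mul_zero]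
    · intro hn
      apply hr.2
      refine dvd_add (ld_dvd μ ε hr.1) ?_
      rw [unit_mul_dvd]; exact_mod_cast hn
    · rw [hSeq, h_eq_zero, smul_zero]
      refine Or.inr fun h => hm ?_
      have := h hr.1
      rw [unit_mul_dvd] at this; exact_mod_cast this

lemma φ_one_of_neg {n : ℤ} (hn : n < 0) : (φ 1 i n : Alg T t μ) = 0 :=
  φ_eq_zero_of_lt 1 i (by rw [ld_one]; simpa using hn)

lemma φ_neg_of_lt {n : ℤ} (hn : μ.1 i < n) : (φ (-1) i n : Alg T t μ) = 0 :=
  φ_eq_zero_of_lt (-1) i (by rw [ld_neg_one]; simp; omega)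

end Alg

open scoped Classical in
lemma commScalar (T : TwistedType) (i j : T.I0) (r : ℤ) :
    (∑ s ∈ Finset.Icc 1 T.M, if (T.σ ^ s) i.1 = j.1 then T.ζ ^ ((s : ℤ) * r) else 0) /
      (T.N i : ℂ) = if i = j ∧ T.InIZ i r then 1 else 0 := by
  have hζ := T.ζ_ne_zero
  have hpow : (T.ζ ^ r) ^ T.M = 1 := by
    rw [← zpow_natCast, ← zpow_mul, mul_comm, zpow_mul, zpow_natCast, T.isPrimitiveRoot_ζ.pow_eq_one,
      one_zpow]
  by_cases hij : i = j
  · subst hij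
    by_cases hi : T.IsFixed i
    · have hsum : ∑ s ∈ Finset.Icc 1 T.M, (if (T.σ ^ s) i.1 = i.1 then T.ζ ^ ((s : ℤ) * r) else 0) =
          ∑ s ∈ Finset.Icc 1 T.M, (T.ζ ^ r) ^ s := by
        refine sum_congr rfl fun s _ => ?_
        rw [if_pos (TwistedType.σ_pow_fixed hi s), mul_comm, zpow_mul, zpow_natCast]
      have hN : T.N i = T.M := by rw [TwistedType.N, if_pos hi]
      have hM0 : (T.M : ℂ) ≠ 0 := by exact_mod_cast T.M_pos.ne'
      rw [hsum, hN]
      by_cases hr : (T.M : ℤ) ∣ r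
      · have : T.ζ ^ r = 1 := (T.isPrimitiveRoot_ζ.zpow_eq_one_iff_dvd r).2 hr
        rw [if_pos ⟨rfl, fun _ => hr⟩, this]
        simp [hM0]
      · have hne : T.ζ ^ r ≠ 1 := fun h => hr ((T.isPrimitiveRoot_ζ.zpow_eq_one_iff_dvd r).1 h)
        rw [if_neg fun h => hr (h.2 hi)]
        have h0 : (T.ζ ^ r - 1) * ∑ s ∈ Finset.Icc 1 T.M, (T.ζ ^ r) ^ s = 0 := by
          have h1 := mul_geom_sum (T.ζ ^ r) T.M
          rw [hpow, sub_self] at h1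
          have h2 : ∑ s ∈ Finset.Icc 1 T.M, (T.ζ ^ r) ^ s =
              ∑ s ∈ range T.M, (T.ζ ^ r) ^ s * T.ζ ^ r := by
            have h3 := Finset.sum_Ico_add' (fun s => (T.ζ ^ r) ^ s) 0 T.M 1
            rw [Finset.range_eq_Ico]
            exact h3.symm.trans (sum_congr rfl fun s _ => pow_succ _ _)
          rw [h2, ← sum_mul, ← mul_assoc, h1, zero_mul]
        rw [(mul_eq_zero.1 h0).resolve_left (sub_ne_zero.2 hne), zero_div]
    · have hN : T.N i = 1 := by rw [TwistedType.N, if_neg hi]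
      rw [if_pos ⟨rfl, fun h => absurd h hi⟩, hN, Nat.cast_one, div_one,
        Finset.sum_eq_single_of_mem T.M (by rw [mem_Icc]; exact ⟨T.M_pos, le_rfl⟩)]
      · rw [if_pos (by rw [TwistedType.σ_pow_M]; rfl), mul_comm, zpow_mul, zpow_natCast, hpow]
      · intro s hs hne
        rw [mem_Icc] at hs
        exact if_neg (TwistedType.not_fixed_pow hi hs.1 (by omega))
  · rw [if_neg fun h => hij h.1, sum_eq_zero, zero_div]
    intro s hs
    rw [mem_Icc] at hs
    exact if_neg fun h => hij (TwistedType.eq_of_σ_pow_eq hs.2 h)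

open scoped Classical in
lemma Alg.x_commutator (r r' : ℤ) : (x 1 i r * x (-1) j r' - x (-1) j r' * x 1 i r : Alg T t μ) =
      if i = j ∧ T.InIZ i r' then
        (qdiff T t i)⁻¹ • (φ 1 i (r + r') - φ (-1) i (r + r')) else 0 := by
  rw [x_comm]
  have := commScalar T i j r'
  rw [this]
  split_ifs
  · rw [one_div]
  · rw [zero_div, zero_smul]

end

/-! ### Laurent series with coefficients in an algebra -/

section Hahn

variable {U V : Type} [Ring U] [Algebra ℂ U] [Ring V] [Algebra ℂ V]

lemma hahn_commute {B : Type} [Ring B] {f g : HahnSeries ℤ B}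
    (h : ∀ m n, Commute (f.coeff m) (g.coeff n)) : Commute f g := by
  ext n
  rw [HahnSeries.coeff_mul, HahnSeries.coeff_mul]
  refine sum_nbij' Prod.swap Prod.swap ?_ ?_ ?_ ?_ ?_
  · rintro ⟨a, b⟩ h
    simp only [Prod.swap_prod_mk, Finset.mem_antidiagonal] at h ⊢
    exact ⟨h.2.1, h.1, by rw [add_comm]; exact h.2.2⟩
  · rintro ⟨a, b⟩ h
    simp only [Prod.swap_prod_mk, Finset.mem_antidiagonal] at h ⊢
    exact ⟨h.2.1, h.1, by rw [add_comm]; exact h.2.2⟩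
  · intro a _; simp
  · intro a _; simp
  · rintro ⟨a, b⟩ _
    exact h a b

lemma coeff_single_mul' {B : Type} [Ring B] (d n : ℤ) (b : B) (f : HahnSeries ℤ B) :
    (single d b * f).coeff n = b * f.coeff (n - d) := by
  conv_lhs => rw [← sub_add_cancel n d]
  rw [HahnSeries.coeff_single_mul_add]

lemma coeff_mul_single' {B : Type} [Ring B] (d n : ℤ) (b : B) (f : HahnSeries ℤ B) :
    (f * single d b).coeff n = f.coeff (n - d) * b := by
  conv_lhs => rw [← sub_add_cancel n d]
  rw [HahnSeries.coeff_mul_single_add]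

/-- Constants of the left factor. -/
def inl : U →ₐ[ℂ] HahnSeries ℤ (U ⊗[ℂ] V) where
  toFun a := single 0 (a ⊗ₜ[ℂ] 1)
  map_one' := rfl
  map_mul' a b := by rw [single_mul_single, add_zero, tmul_mul_tmul, mul_one]
  map_zero' := by simp
  map_add' a b := by rw [add_tmul]; simp
  commutes' c := by rw [HahnSeries.algebraMap_apply, HahnSeries.C_apply]; rfl

/-- Constants of the right factor. -/
def inr : V →ₐ[ℂ] HahnSeries ℤ (U ⊗[ℂ] V) where
  toFun a := single 0 (1 ⊗ₜ[ℂ] a)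
  map_one' := rfl
  map_mul' a b := by rw [single_mul_single, add_zero, tmul_mul_tmul, mul_one]
  map_zero' := by simp
  map_add' a b := by rw [tmul_add]; simp
  commutes' c := by
    rw [HahnSeries.algebraMap_apply, HahnSeries.C_apply,
      ← (Algebra.TensorProduct.includeRight : V →ₐ[ℂ] U ⊗[ℂ] V).commutes c]; rfl

lemma inl_apply (a : U) : (inl a : HahnSeries ℤ (U ⊗[ℂ] V)) = single 0 (a ⊗ₜ[ℂ] 1) := rfl

lemma inr_apply (a : V) : (inr a : HahnSeries ℤ (U ⊗[ℂ] V)) = single 0 (1 ⊗ₜ[ℂ] a) := rfl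

variable {f : ℤ → U} {g : ℤ → V}

lemma single_mul_letter (h : Summable1 f g) {a : U} {b : V} {c c' : ℂ} (d p : ℤ)
    (ha : ∀ r, a * f r = c • (f r * a)) (hb : ∀ r, b * g r = c' • (g r * b)) :
    single d (a ⊗ₜ[ℂ] b) * letter f g p = (c * c') • (letter f g p * single d (a ⊗ₜ[ℂ] b)) := by
  ext n
  rw [coeff_smul, coeff_single_mul', coeff_mul_single', coeff_letter h,
    tmul_mul_tmul, tmul_mul_tmul, ha, hb,
    smul_tmul_smul]

lemma inl_bracket_letter (h : Summable1 f g) {a : U} {c : ℂ} {m : ℤ} (p : ℤ)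
    (ha : ∀ r, a * f r - f r * a = c • f (m + r)) :
    inl a * letter f g p - letter f g p * inl a = c • letter f g (m + p) := by
  ext n
  rw [coeff_sub, coeff_smul, inl_apply, coeff_single_mul',
    coeff_mul_single', coeff_letter h, coeff_letter h, sub_zero,
    tmul_mul_tmul, tmul_mul_tmul, one_mul, mul_one,
    ← sub_tmul, ha, smul_tmul', add_sub_assoc]

lemma inr_bracket_letter (h : Summable1 f g) {a : V} {c : ℂ} {m : ℤ} (p : ℤ)
    (ha : ∀ r, a * g r - g r * a = c • g (m + r)) :
    single m (1 ⊗ₜ[ℂ] a) * letter f g p - letter f g p * single m (1 ⊗ₜ[ℂ] a) =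
      c • letter f g (m + p) := by
  ext n
  rw [coeff_sub, coeff_smul, coeff_single_mul', coeff_mul_single', coeff_letter h, coeff_letter h,
    tmul_mul_tmul, tmul_mul_tmul, one_mul, mul_one,
    ← tmul_sub, ha, tmul_smul]
  congr 3 <;> ring

lemma orderBound1_letter_right {b : ℤ} (hg : ∀ n < b, g n = 0) : OrderBound1 0 (letter f g) := by
  refine ⟨-b, fun p n hn => ?_⟩
  rw [coeff_letter (Or.inl ⟨b, hg⟩), hg n (by simpa using hn), tmul_zero]

lemma orderBound1_letter_left {b : ℤ} (hf : ∀ m, b < m → f m = 0) : OrderBound1 1 (letter f g) := by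
  refine ⟨b, fun p n hn => ?_⟩
  rw [coeff_letter (Or.inr ⟨b, hf⟩), hf _ (by push_cast at hn; omega), zero_tmul]

lemma letter_delta_right (f : ℤ → U) (p : ℤ) : letter f (deltaFam V) p = inl (f p) := by
  have hs : Summable1 f (deltaFam V) := Or.inl ⟨0, fun _ hn => if_neg hn.ne⟩
  ext n
  rw [coeff_letter hs, inl_apply, deltaFam]
  by_cases h : n = 0
  · subst h; simp
  · rw [if_neg h, tmul_zero, coeff_single_of_ne h]

lemma letter_delta_left (g : ℤ → V) (p : ℤ) : letter (deltaFam U) g p = single p (1 ⊗ₜ[ℂ] g p) := by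
  have hs : Summable1 (deltaFam U) g := Or.inr ⟨0, fun _ hn => if_neg hn.ne'⟩
  ext n
  rw [coeff_letter hs, deltaFam]
  by_cases h : n = p
  · subst h; simp
  · rw [if_neg (by omega), zero_tmul, coeff_single_of_ne h]

lemma commute_letter {F G F' G' : Poly2} {f1 f2 : ℤ → U} {g1 g2 : ℤ → V} {c : ℂ}
    {d : ℕ} (hG : G = MvPolynomial.C c * F') (hF : F = MvPolynomial.C c * G')
    (dF : F'.IsHomogeneous d) (dG : G'.IsHomogeneous d)
    (hf : Exchange F G f1 f2) (hg : Exchange F' G' g1 g2) {b b' : ℤ}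
    (b₁ : ∀ m, b < m → f1 m = 0) (b₂ : ∀ m < b', g2 m = 0)
    (hcan : Cancels (U ⊗[ℂ] V) ![1, 0, 0] (poly2 F 0 1))
    (hcan' : Cancels (U ⊗[ℂ] V) ![1, 0, 0] (poly2 F' 0 1)) (p q : ℤ) :
    Commute (letter f1 g1 p) (letter f2 g2 q) := by
  have s1 : Summable1 f1 g1 := Or.inr ⟨b, b₁⟩
  have s2 : Summable1 f2 g2 := Or.inl ⟨b', b₂⟩
  have w1 := hasHadamard_word (summable1_delta s1 s2) 0 1 2
  have w2 := hasHadamard_word (summable1_delta s1 s2) 1 0 2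
  simp only [cons_val] at w1 w2
  set Φ1 := word f1 0 f2 1 (deltaFam U) 2
  set Φ2 := word f2 1 f1 0 (deltaFam U) 2
  set Ψ1 := word g1 0 g2 1 (deltaFam V) 2
  set Ψ2 := word g2 1 g1 0 (deltaFam V) 2
  set W1 := word (letter f1 g1) 0 (letter f2 g2) 1 (letter (deltaFam U) (deltaFam V)) 2 with hW1
  set W2 := word (letter f2 g2) 1 (letter f1 g1) 0 (letter (deltaFam U) (deltaFam V)) 2 with hW2
  have w3 : HasHadamard 0 Φ2 Ψ1 (uMul 0 (hadamard Φ2 Ψ1)) :=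
    ⟨summable2_word (i := 1) (j := 0) (k := 2) (i' := 0) (j' := 1) (k' := 2) (summable1_delta s1 s2), rfl⟩
  set S := uMul 0 (hadamard Φ2 Ψ1)
  have e1 : poly2 F 0 1 • W1 = poly2 G 0 1 • S := by
    have := (w1.smul_left (poly2 F 0 1)).2
    rw [hf.word_left] at this
    rw [this, ← (w3.smul_left (poly2 G 0 1)).2]
  have e2 : poly2 F' 0 1 • S = poly2 G' 0 1 • W2 := by
    have := (w3.smul_right (isHomogeneous_poly2 dF 0 1)).2
    rw [hg.word_left] at this
    rw [this, ← (w2.smul_right (isHomogeneous_poly2 dG 0 1)).2]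
  have e3 : (poly2 F 0 1 * poly2 F' 0 1) • (W1 - W2) = 0 := by
    rw [smul_sub, sub_eq_zero, mul_comm, mul_smul, e1, smul_smul, mul_comm, mul_smul, e2, hF, hG,
      smul_smul]
    congr 1
    simp only [poly2, map_mul]
    ring
  have b1 : OrderBound1 1 (letter f1 g1) := orderBound1_letter_left b₁
  have b2 : OrderBound1 0 (letter f2 g2) := orderBound1_letter_right b₂
  have b3 : OrderBound1 0 (letter (deltaFam U) (deltaFam V)) :=
    orderBound1_letter_right (b := 0) fun n hn => if_neg hn.ne
  have hb : OrderBound ![1, 0, 0] (W1 - W2) := .sub (.word b1 b2 b3) (.word b2 b1 b3)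
  have h0 := hcan.mul hcan' _ hb e3
  have := congrFun h0 ![p, q, 0]
  rw [Dist.sub_apply, Dist.zero_apply, sub_eq_zero] at this
  change _ * _ = _ * _
  simpa [hW1, hW2, word, letter_delta_zero] using this

end Hahn


/-! ### The deformed coproduct -/

lemma IsExp.log_unique {A : Type*} [Ring A] [Algebra ℂ A] {a b E : ℕ → A}
    (ha : IsExp a E) (hb : IsExp b E) (n : ℕ) : a (n + 1) = b (n + 1) := by
  induction n using Nat.strong_induction_on with
  | _ n ih =>
    have h := (ha.succ n).symm.trans (hb.succ n)
    have hm : (n, 0) ∈ antidiagonal n := mem_antidiagonal.2 rfl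
    rw [← Finset.add_sum_erase _ _ hm, ← Finset.add_sum_erase _ _ hm] at h
    have hs : ∑ p ∈ (antidiagonal n).erase (n, 0), ((p.1 : ℂ) + 1) • (a (p.1 + 1) * E p.2) =
        ∑ p ∈ (antidiagonal n).erase (n, 0), ((p.1 : ℂ) + 1) • (b (p.1 + 1) * E p.2) := by
      refine sum_congr rfl fun p hp => ?_
      obtain ⟨h1, h2⟩ := Finset.mem_erase.1 hp
      have h3 := mem_antidiagonal.1 h2
      rw [ih p.1 (by
        rcases p with ⟨p, s⟩
        simp only [ne_eq, Prod.mk.injEq, not_and] at h1 h3 ⊢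
        by_contra h4
        exact h1 (by omega) (by omega))]
    rw [hs] at h
    have hn : ((n : ℂ) + 1) ≠ 0 := by exact_mod_cast succ_ne_zero n
    have := smul_right_injective A hn (add_right_cancel h)
    simpa [ha.zero] using this

section

lemma Alg.hom_ext {B : Type*} [Ring B] [Algebra ℂ B] {f g : Alg T t μ →ₐ[ℂ] B}
    (hx : ∀ ε i r, f (x ε i r) = g (x ε i r)) (hφ : ∀ ε i r, f (φ ε i r) = g (φ ε i r))
    (hh : ∀ i r, f (h i r) = g (h i r)) (hκ : ∀ ε i, f (κ ε i) = g (κ ε i)) : f = g := by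
  refine RingQuot.ringQuot_ext' ℂ _ _ (FreeAlgebra.hom_ext (funext fun a => ?_))
  rcases a with ⟨ε, i, r⟩ | ⟨ε, i, r⟩ | ⟨i, m⟩ | ⟨ε, i⟩
  exacts [hx ε i r, hφ ε i r, hh i m, hκ ε i]

lemma Alg.map_κ_unique {B : Type*} [Ring B] [Algebra ℂ B] {f g : Alg T t μ →ₐ[ℂ] B} (hφ : f (lead ε i) = g (lead ε i)) : f (κ ε i) = g (κ ε i) := by
  refine left_inv_eq_right_inv (a := f (lead ε i)) ?_ ?_
  · rw [← map_mul, κ_mul_lead, map_one]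
  · rw [hφ, ← map_mul, lead_mul_κ, map_one]

lemma Alg.expCoeff_eq (n : ℕ) : expCoeff (hSeq μ t ε i) n = κ ε i * φ ε i (ld μ ε i + ε * n) := by
  rw [φ_eq, ← mul_assoc, κ_mul_lead, one_mul]

lemma Alg.map_h_unique (ht : Generic t) {B : Type*} [Ring B] [Algebra ℂ B]
    {f g : Alg T t μ →ₐ[ℂ] B} (hφ : ∀ ε i r, f (φ ε i r) = g (φ ε i r)) (i : T.I0) (m : ℤ) :
    f (h i m) = g (h i m) := by
  have key (ε : ℤˣ) (n : ℕ) : f (h i (ε * (n + 1 : ℕ))) = g (h i (ε * (n + 1 : ℕ))) := by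
    have hE : (fun n => f (expCoeff (hSeq μ t ε i) n)) =
        fun n => g (expCoeff (hSeq μ t ε i) n) := by
      funext n
      rw [expCoeff_eq, map_mul, map_mul, hφ, map_κ_unique ε i (hφ _ _ _)]
    have := ((isExp_hSeq ε i).map f).log_unique (hE ▸ (isExp_hSeq ε i).map g) n
    simp only [hSeq, map_smul] at this
    refine smul_right_injective B (mul_ne_zero ?_ (qdiff_ne_zero ht i)) this
    exact_mod_cast ε.ne_zero
  rcases lt_trichotomy m 0 with hm | rfl | hm
  · have := key (-1) (-m - 1).toNat
    rwa [show (((-1 : ℤˣ) : ℤ)) * (((-m - 1).toNat + 1 : ℕ) : ℤ) = m by push_cast; omega] at this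
  · rw [h_eq_zero i (Or.inl rfl), map_zero, map_zero]
  · have := key 1 (m - 1).toNat
    rwa [show (((1 : ℤˣ) : ℤ)) * (((m - 1).toNat + 1 : ℕ) : ℤ) = m by push_cast; omega] at this

end

namespace IsDeformedCoproduct

lemma unique (ht : Generic t) {Δ Δ' : Alg T t (μ1 + μ2) →ₐ[ℂ] LT12} (h : IsDeformedCoproduct Δ)
    (h' : IsDeformedCoproduct Δ') : Δ = Δ' := by
  have hφ : ∀ ε i r, Δ (Alg.φ ε i r) = Δ' (Alg.φ ε i r) := fun ε i r => by
    ext n; rw [h.φ, h'.φ]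
  refine Alg.hom_ext (fun ε i r => ?_) hφ (Alg.map_h_unique ht hφ)
    fun ε i => Alg.map_κ_unique ε i (hφ _ _ _)
  rcases units_eq_one_or ε with rfl | rfl
  · ext n; rw [h.x_plus, h'.x_plus]
  · ext n; rw [h.x_minus, h'.x_minus]

end IsDeformedCoproduct

namespace Coproduct

variable (t μ1 μ2) in
/-- The image of `φ_{i,m}^ε`. -/
def imφ (ε : ℤˣ) (i : T.I0) (m : ℤ) : LT12 := letter (Alg.φ ε i) (Alg.φ ε i) m

variable (t μ1 μ2) in
/-- The image of `h_{i,m}`. -/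
def imH (i : T.I0) (m : ℤ) : LT12 := inl (Alg.h i m) + single m (1 ⊗ₜ[ℂ] Alg.h i m)

variable (t μ1 μ2) in
/-- The image of the inverse of the leading mode. -/
def imκ (ε : ℤˣ) (i : T.I0) : LT12 := single (-ld μ2 ε i) (Alg.κ ε i ⊗ₜ[ℂ] Alg.κ ε i)

variable (t μ1 μ2) in
/-- The first summand in the image of `x_{i,r}^ε`. -/
def imX1 (ε : ℤˣ) (i : T.I0) : ℤ → LT12 :=
  if ε = 1 then letter (Alg.x 1 i) (deltaFam _) else letter (Alg.x (-1) i) (Alg.φ 1 i)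

variable (t μ1 μ2) in
/-- The second summand in the image of `x_{i,r}^ε`. -/
def imX2 (ε : ℤˣ) (i : T.I0) : ℤ → LT12 :=
  if ε = 1 then letter (Alg.φ (-1) i) (Alg.x 1 i) else letter (deltaFam _) (Alg.x (-1) i)

variable (t μ1 μ2) in
/-- The image of `x_{i,r}^ε`. -/
def imX (ε : ℤˣ) (i : T.I0) (r : ℤ) : LT12 := imX1 t μ1 μ2 ε i r + imX2 t μ1 μ2 ε i r

lemma summable_φφ : Summable1 (Alg.φ ε i : ℤ → Alg T t μ1) (Alg.φ ε i : ℤ → Alg T t μ2) := by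
  rcases units_eq_one_or ε with rfl | rfl
  · exact Or.inl ⟨0, fun n => Alg.φ_one_of_neg i⟩
  · exact Or.inr ⟨_, fun n => Alg.φ_neg_of_lt i⟩

lemma summable_φ_right (f : ℤ → Alg T t μ1) (i : T.I0) : Summable1 f (Alg.φ 1 i : ℤ → Alg T t μ2) :=
  Or.inl ⟨0, fun _ => Alg.φ_one_of_neg i⟩

lemma summable_φ_left (g : ℤ → Alg T t μ2) : Summable1 (Alg.φ (-1) i : ℤ → Alg T t μ1) g :=
  Or.inr ⟨_, fun _ => Alg.φ_neg_of_lt i⟩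

lemma summable_δ_right {U V : Type} [Ring U] [Algebra ℂ U] [Ring V] [Algebra ℂ V] (f : ℤ → U) :
    Summable1 f (deltaFam V) := Or.inl ⟨0, fun _ hn => if_neg hn.ne⟩

lemma summable_δ_left {U V : Type} [Ring U] [Algebra ℂ U] [Ring V] [Algebra ℂ V] (g : ℤ → V) :
    Summable1 (deltaFam U) g := Or.inr ⟨0, fun _ hn => if_neg hn.ne'⟩

lemma commute_deltaFam {U : Type} [Ring U] [Algebra ℂ U] (m : ℤ) (a : U) :
    Commute (deltaFam U m) a := by
  rw [deltaFam]; split_ifs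
  exacts [Commute.one_left a, Commute.zero_left a]

lemma imX_relations (ht : Generic t) (ε : ℤˣ) : XRelations T t ε (imX t μ1 μ2 ε) := by
  rcases units_eq_one_or ε with rfl | rfl
  · have hX := (Alg.xRelations (t := t) (μ := μ1) (T := T) 1).letter_left
      (V := Alg T t μ2) (g := fun _ => deltaFam _) (fun _ _ m n => commute_deltaFam m _)
      fun i => summable_δ_right _
    have hY := (Alg.xRelations (t := t) (μ := μ2) (T := T) 1).letter_right
      (f := fun i => (Alg.φ (-1) i : ℤ → Alg T t μ1)) (fun i j m n => Alg.φ_comm _ _ _ _ _ _)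
      fun i => summable_φ_left i _
    refine hX.add hY (fun i => orderBound1_letter_right (b := 0) fun _ hn => if_neg hn.ne)
      (fun i => orderBound1_letter_left fun _ => Alg.φ_neg_of_lt i) fun i j => ?_
    exact .letter_left (summable_φ_left i _) (summable_δ_right _) (Alg.exchange_φ ht (-1) 1 i j)
      fun m n => (commute_deltaFam n _).symm
  · have hX := (Alg.xRelations (t := t) (μ := μ1) (T := T) (-1)).letter_left
      (g := fun i => (Alg.φ 1 i : ℤ → Alg T t μ2)) (fun i j m n => Alg.φ_comm _ _ _ _ _ _)
      fun i => summable_φ_right _ i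
    have hY := (Alg.xRelations (t := t) (μ := μ2) (T := T) (-1)).letter_right
      (U := Alg T t μ1) (f := fun i => deltaFam _) (fun _ _ m n => commute_deltaFam m _)
      fun i => summable_δ_left _
    refine hX.add hY (fun i => orderBound1_letter_right fun _ => Alg.φ_one_of_neg i)
      (fun i => orderBound1_letter_left (b := 0) fun _ hn => if_neg hn.ne') fun i j => ?_
    exact .letter_right (summable_δ_left _) (summable_φ_right _ j) (isHomogeneous_polyF _ i j)
      (isHomogeneous_polyG _ i j) ((Alg.exchange_φ ht 1 (-1) j i).reverse_poly (-1))
      fun m n => commute_deltaFam m _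

lemma imφ_add (n : ℕ) : imφ t μ1 μ2 ε i (ld (μ1 + μ2) ε i + ε * n) = ∑ p ∈ antidiagonal n,
      single (ld μ2 ε i + ε * p.2)
        (Alg.φ ε i (ld μ1 ε i + ε * p.1) ⊗ₜ[ℂ] Alg.φ ε i (ld μ2 ε i + ε * p.2)) := by
  ext N
  have hε : ((ε : ℤ)) * ε = 1 := by
    rcases units_eq_one_or ε with rfl | rfl <;> rfl
  have hc : (∑ p ∈ antidiagonal n, single (ld μ2 ε i + ε * p.2)
      ((Alg.φ ε i (ld μ1 ε i + ε * p.1) : Alg T t μ1) ⊗ₜ[ℂ]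
        (Alg.φ ε i (ld μ2 ε i + ε * p.2) : Alg T t μ2))).coeff N =
      ∑ p ∈ antidiagonal n, (single (ld μ2 ε i + ε * p.2)
      ((Alg.φ ε i (ld μ1 ε i + ε * p.1) : Alg T t μ1) ⊗ₜ[ℂ]
        (Alg.φ ε i (ld μ2 ε i + ε * p.2) : Alg T t μ2))).coeff N :=
    map_sum (HahnSeries.coeff.addMonoidHom N) _ _
  have hinj {a b : ℕ} (h : ld μ2 ε i + ε * a = ld μ2 ε i + ε * b) : a = b := by
    rcases units_eq_one_or ε with rfl | rfl <;> simp at h <;> exact h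
  rw [hc, imφ, coeff_letter (summable_φφ ε i)]
  rcases Alg.exists_index ε (ld μ2 ε i) N with h | ⟨k, rfl⟩
  · rw [Alg.φ_eq_zero_of_lt (t := t) ε i h, tmul_zero, sum_eq_zero]
    intro p _
    refine coeff_single_of_ne fun h' => ?_
    rw [h', add_sub_cancel_left, ← mul_assoc, hε] at h
    omega
  · rw [ld_add, show ld μ1 ε i + ld μ2 ε i + (ε : ℤ) * n - (ld μ2 ε i + ε * k) =
      ld μ1 ε i + ε * (n - k) by ring]
    by_cases hk : k ≤ n
    · rw [Finset.sum_eq_single_of_mem (n - k, k) (mem_antidiagonal.2 (by simp [hk])),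
        coeff_single_same]
      · simp [Nat.cast_sub hk]
      · rintro ⟨a, b⟩ hp hne
        refine coeff_single_of_ne fun h' => ?_
        have := hinj h'
        have := mem_antidiagonal.1 hp
        simp only [] at *
        apply hne
        simp only [Prod.mk.injEq]
        omega
    · rw [Alg.φ_eq_zero_of_lt (t := t) ε i (by rw [add_sub_cancel_left, ← mul_assoc, hε]; omega),
        zero_tmul, sum_eq_zero]
      rintro ⟨a, b⟩ hp
      refine coeff_single_of_ne fun h' => ?_
      have := hinj h'
      have := mem_antidiagonal.1 hp
      simp only [] at *
      omega

lemma imφ_lead : imφ t μ1 μ2 ε i (ld (μ1 + μ2) ε i) =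
    single (ld μ2 ε i) (lead ε i ⊗ₜ[ℂ] lead ε i) := by
  have := imφ_add (t := t) (μ1 := μ1) (μ2 := μ2) ε i 0
  simpa [lead] using this

lemma imφ_eq_zero (n : ℕ) (hn : 0 < n) : imφ t μ1 μ2 ε i (ld (μ1 + μ2) ε i - ε * n) = 0 := by
  ext N
  have hε : ((ε : ℤ)) * ε = 1 := by
    rcases units_eq_one_or ε with rfl | rfl <;> rfl
  rw [imφ, coeff_letter (summable_φφ ε i), HahnSeries.coeff_zero, ld_add]
  rcases Alg.exists_index ε (ld μ2 ε i) N with h | ⟨k, rfl⟩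
  · rw [Alg.φ_eq_zero_of_lt (t := t) ε i h, tmul_zero]
  · rw [Alg.φ_eq_zero_of_lt (t := t) ε i, zero_tmul]
    rw [show ld μ1 ε i + ld μ2 ε i - (ε : ℤ) * n - (ld μ2 ε i + ε * k) -
      ld μ1 ε i = ε * (-n - k) by ring, ← mul_assoc, hε]
    omega

lemma imφ_exp (n : ℕ) :
    imφ t μ1 μ2 ε i (ld (μ1 + μ2) ε i + ε * n) = imφ t μ1 μ2 ε i (ld (μ1 + μ2) ε i) *
      expCoeff (fun m : ℕ => (((ε : ℤ) : ℂ) * qdiff T t i) • imH t μ1 μ2 i (ε * m)) n := by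
  have hb (a : Alg T t μ2) (m : ℕ) : single (ε : ℤ) 1 ^ m * inr a =
      (single ((ε : ℤ) * m) (1 ⊗ₜ[ℂ] a) : LT12) := by
    rw [HahnSeries.single_pow, one_pow, inr_apply, single_mul_single, one_mul, add_zero,
      nsmul_eq_mul, mul_comm]
  have h0 : (fun m : ℕ => (((ε : ℤ) : ℂ) * qdiff T t i) • imH t μ1 μ2 i (ε * m)) =
      fun m => inl (Alg.hSeq μ1 t ε i m) + single (ε : ℤ) 1 ^ m * inr (Alg.hSeq μ2 t ε i m) := by
    funext m
    rw [hb, imH, smul_add, ← map_smul, Alg.hSeq, Alg.hSeq, tmul_smul]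
    congr 1
    ext k
    rw [coeff_smul]
    by_cases hk : k = (ε : ℤ) * m
    · subst hk; simp
    · rw [coeff_single_of_ne hk, coeff_single_of_ne hk, smul_zero]
  have hcent (a : LT12) : Commute (single (ε : ℤ) 1) a := by
    refine hahn_commute fun m n => ?_
    by_cases h : m = ε
    · subst h; rw [coeff_single_same]; exact Commute.one_left _
    · rw [coeff_single_of_ne h]; exact Commute.zero_left _
  have hcomm (ν : T.Coweight) (j k : ℕ) : Commute (Alg.hSeq ν t ε i j) (Alg.hSeq ν t ε i k) :=
    ((Alg.h_comm i i _ _).smul_left _).smul_right _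
  have hlr (a : Alg T t μ1) (b : Alg T t μ2) : Commute (inl a) (inr b : LT12) := by
    change _ * _ = _ * _
    rw [inl_apply, inr_apply, single_mul_single, single_mul_single]
    simp
  rw [h0, expCoeff_add, imφ_lead, imφ_add, mul_sum]
  · refine sum_congr rfl fun p _ => ?_
    have e2 := ((Alg.isExp_hSeq (μ := μ2) (t := t) ε i).map (inr (U := Alg T t μ1))).scale _ hcent
    have e2' := congrFun (e2.unique (isExp_expCoeff _ fun j k => ?_)) p.2
    · rw [← e2', hb, ← expCoeff_map, inl_apply, single_mul_single, single_mul_single, tmul_mul_tmul,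
        tmul_mul_tmul, Alg.φ_eq, Alg.φ_eq, zero_add, mul_one, one_mul]
    · exact ((hcent _).pow_left _).mul_left (((hcent _).symm.pow_right _).mul_right
        ((hcomm _ _ _).map inr))
  · intro j k
    exact (hcomm _ _ _).map inl
  · intro j k
    exact ((hcent _).pow_left _).mul_left (((hcent _).symm.pow_right _).mul_right
        ((hcomm _ _ _).map inr))
  · intro j k
    exact ((hcent _).symm.pow_right _).mul_right (hlr _ _)

lemma commute_tmul {U V : Type} [Ring U] [Algebra ℂ U] [Ring V] [Algebra ℂ V] {a b : U} {c d : V}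
    (h : Commute a b) (h' : Commute c d) : Commute (a ⊗ₜ[ℂ] c) (b ⊗ₜ[ℂ] d) := by
  change _ * _ = _ * _
  rw [tmul_mul_tmul, tmul_mul_tmul, h.eq, h'.eq]

lemma imφ_comm (ε ε' : ℤˣ) (i j : T.I0) (r r' : ℤ) :
    Commute (imφ t μ1 μ2 ε i r) (imφ t μ1 μ2 ε' j r') := by
  refine hahn_commute fun m n => ?_
  rw [imφ, imφ, coeff_letter (summable_φφ ε i), coeff_letter (summable_φφ ε' j)]
  exact commute_tmul (Alg.φ_comm _ _ _ _ _ _) (Alg.φ_comm _ _ _ _ _ _)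

lemma coeff_imH (m n : ℤ) : (imH t μ1 μ2 i m).coeff n =
    (if n = 0 then Alg.h i m ⊗ₜ[ℂ] 1 else 0) + if n = m then 1 ⊗ₜ[ℂ] Alg.h i m else 0 := by
  rw [imH, coeff_add, inl_apply]
  congr 1 <;> split_ifs with h
  · subst h; rw [coeff_single_same]
  · rw [coeff_single_of_ne h]
  · subst h; rw [coeff_single_same]
  · rw [coeff_single_of_ne h]

lemma commute_coeff_imH {a : Alg T t μ1 ⊗[ℂ] Alg T t μ2} (m n : ℤ)
    (h1 : Commute a (Alg.h i m ⊗ₜ[ℂ] 1)) (h2 : Commute a (1 ⊗ₜ[ℂ] Alg.h i m)) :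
    Commute a ((imH t μ1 μ2 i m).coeff n) := by
  rw [coeff_imH]
  refine Commute.add_right ?_ ?_ <;> split_ifs
  exacts [h1, Commute.zero_right _, h2, Commute.zero_right _]

lemma imφ_imH (r m : ℤ) : Commute (imφ t μ1 μ2 ε i r) (imH t μ1 μ2 j m) := by
  refine hahn_commute fun k n => commute_coeff_imH _ _ _ ?_ ?_ <;>
    rw [imφ, coeff_letter (summable_φφ ε i)]
  exacts [commute_tmul (Alg.φ_h_comm _ _ _ _ _) (Commute.one_right _),
    commute_tmul (Commute.one_right _) (Alg.φ_h_comm _ _ _ _ _)]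

lemma imH_comm (m m' : ℤ) : Commute (imH t μ1 μ2 i m) (imH t μ1 μ2 j m') := by
  refine hahn_commute fun k n => commute_coeff_imH _ _ _
    (commute_coeff_imH _ _ _ ?_ ?_).symm (commute_coeff_imH _ _ _ ?_ ?_).symm
  exacts [commute_tmul (Alg.h_comm _ _ _ _) (Commute.one_right _),
    commute_tmul (Commute.one_right _) (Commute.one_left _),
    commute_tmul (Commute.one_left _) (Commute.one_right _),
    commute_tmul (Commute.one_right _) (Alg.h_comm _ _ _ _)]

end Coproduct


namespace Coproduct

lemma hahn_zero_smul {B : Type} [Ring B] [Algebra ℂ B] (x : HahnSeries ℤ B) : (0 : ℂ) • x = 0 := by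
  ext n; rw [coeff_smul, zero_smul]; rfl

lemma imX_one (r : ℤ) : imX t μ1 μ2 1 i r =
    letter (Alg.x 1 i) (deltaFam _) r + letter (Alg.φ (-1) i) (Alg.x 1 i) r := rfl

lemma imX_neg (r : ℤ) : imX t μ1 μ2 (-1) i r =
    letter (Alg.x (-1) i) (Alg.φ 1 i) r + letter (deltaFam _) (Alg.x (-1) i) r := rfl

lemma coeff_imX_one (p n : ℤ) : (imX t μ1 μ2 1 i p).coeff n =
    (if n = 0 then Alg.x 1 i p ⊗ₜ[ℂ] 1 else 0) + Alg.φ (-1) i (p - n) ⊗ₜ[ℂ] Alg.x 1 i n := by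
  rw [imX_one, coeff_add, letter_delta_right, coeff_letter (summable_φ_left i _), inl_apply]
  congr 1
  split_ifs with h
  · subst h; rw [coeff_single_same]
  · rw [coeff_single_of_ne h]

lemma coeff_imX_neg (p n : ℤ) : (imX t μ1 μ2 (-1) i p).coeff n =
    (if n = p then 1 ⊗ₜ[ℂ] Alg.x (-1) i p else 0) + Alg.x (-1) i (p - n) ⊗ₜ[ℂ] Alg.φ 1 i n := by
  rw [imX_neg, coeff_add, letter_delta_left, coeff_letter (summable_φ_right _ i), add_comm]
  congr 1
  split_ifs with h
  · subst h; rw [coeff_single_same]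
  · rw [coeff_single_of_ne h]

lemma inIZ_sub {i : T.I0} {a b : ℤ} (ha : T.InIZ i a) (hb : T.InIZ i b) : T.InIZ i (a - b) :=
  fun h => dvd_sub (ha h) (hb h)

lemma inIZ_zero : T.InIZ i 0 := fun _ => dvd_zero _

lemma imX_eq_zero {r : ℤ} (hr : ¬ T.InIZ i r) : imX t μ1 μ2 ε i r = 0 := by
  have key (n : ℤ) : ¬ T.InIZ i (r - n) ∨ ¬ T.InIZ i n := by
    by_contra! h
    refine hr fun hi => ?_
    have := dvd_add (h.1 hi) (h.2 hi)
    rwa [sub_add_cancel] at this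
  rcases units_eq_one_or ε with rfl | rfl
  · ext n
    rw [coeff_imX_one, Alg.x_eq_zero 1 i hr, zero_tmul, ite_self, zero_add]
    rcases key n with h | h
    · rw [Alg.φ_eq_zero_of_not_InIZ _ i h, zero_tmul]; rfl
    · rw [Alg.x_eq_zero _ i h, tmul_zero]; rfl
  · ext n
    rw [coeff_imX_neg, Alg.x_eq_zero (-1) i hr, tmul_zero, ite_self, zero_add]
    rcases key n with h | h
    · rw [Alg.x_eq_zero _ i h, zero_tmul]; rfl
    · rw [Alg.φ_eq_zero_of_not_InIZ _ i h, tmul_zero]; rfl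

lemma imφ_lead_mul_imX (ε ε' : ℤˣ) (i j : T.I0) (r : ℤ) :
    imφ t μ1 μ2 ε i (ld (μ1 + μ2) ε i) * imX t μ1 μ2 ε' j r =
      qpow t (ε * ε' * T.sumC i j) • (imX t μ1 μ2 ε' j r * imφ t μ1 μ2 ε i (ld (μ1 + μ2) ε i)) := by
  have hφ (ν : T.Coweight) (η : ℤˣ) (s : ℤ) : (lead ε i * Alg.φ η j s : Alg T t ν) =
      (1 : ℂ) • (Alg.φ η j s * lead ε i) := by
    rw [one_smul, lead, Alg.φ_comm]
  have hδ (ν : T.Coweight) (s : ℤ) : (lead ε i * deltaFam (Alg T t ν) s : Alg T t ν) =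
      (1 : ℂ) • (deltaFam (Alg T t ν) s * lead ε i) := by
    rw [one_smul, (commute_deltaFam s _).eq]
  rw [imφ_lead]
  rcases units_eq_one_or ε' with rfl | rfl
  · rw [imX_one, mul_add, add_mul, smul_add,
      single_mul_letter (summable_δ_right _) _ _ (Alg.lead_mul_x ε 1 i j) (hδ _),
      single_mul_letter (summable_φ_left j _) _ _ (hφ _ _) (Alg.lead_mul_x ε 1 i j),
      mul_one, one_mul]
  · rw [imX_neg, mul_add, add_mul, smul_add,
      single_mul_letter (summable_φ_right _ j) _ _ (Alg.lead_mul_x ε (-1) i j) (hφ _ _),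
      single_mul_letter (summable_δ_left _) _ _ (hδ _) (Alg.lead_mul_x ε (-1) i j),
      mul_one, one_mul]

lemma imH_bracket_left {f : ℤ → Alg T t μ1} {g : ℤ → Alg T t μ2} (hs : Summable1 f g) (i : T.I0)
    {c : ℂ} {m : ℤ} (p : ℤ) (hf : ∀ r, Alg.h i m * f r - f r * Alg.h i m = c • f (m + r))
    (hg : ∀ r, Commute (Alg.h i m) (g r)) :
    imH t μ1 μ2 i m * letter f g p - letter f g p * imH t μ1 μ2 i m = c • letter f g (m + p) := by
  have h2 := inr_bracket_letter hs (a := Alg.h i m) (c := 0) (m := m) p fun r => by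
    rw [(hg r).eq, sub_self, zero_smul]
  rw [imH, add_mul, mul_add, add_sub_add_comm, inl_bracket_letter hs p hf, h2, hahn_zero_smul, add_zero]

lemma imH_bracket_right {f : ℤ → Alg T t μ1} {g : ℤ → Alg T t μ2} (hs : Summable1 f g) (i : T.I0)
    {c : ℂ} {m : ℤ} (p : ℤ) (hg : ∀ r, Alg.h i m * g r - g r * Alg.h i m = c • g (m + r))
    (hf : ∀ r, Commute (Alg.h i m) (f r)) :
    imH t μ1 μ2 i m * letter f g p - letter f g p * imH t μ1 μ2 i m = c • letter f g (m + p) := by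
  have h2 := inl_bracket_letter hs (a := Alg.h i m) (c := 0) (m := m) p fun r => by
    rw [(hf r).eq, sub_self, zero_smul]
  rw [imH, add_mul, mul_add, add_sub_add_comm, inr_bracket_letter hs p hg, h2, hahn_zero_smul, zero_add]

lemma imH_mul_imX (r m : ℤ) (hm : m ≠ 0) :
    imH t μ1 μ2 i m * imX t μ1 μ2 ε j r - imX t μ1 μ2 ε j r * imH t μ1 μ2 i m =
      ((((ε : ℤ) : ℂ) * (1 / (m : ℂ)) * ∑ s ∈ Finset.Icc 1 T.M,
        (qpow t (m * T.Cσ i j s) - qpow t (-(m * T.Cσ i j s))) / qdiff T t i * T.ζ ^ (m * s)) •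
          imX t μ1 μ2 ε j (m + r)) := by
  rcases units_eq_one_or ε with rfl | rfl
  · rw [imX_one, imX_one, mul_add, add_mul, add_sub_add_comm, smul_add]
    congr 1
    · exact imH_bracket_left (summable_δ_right _) i r (fun s => Alg.h_mul_x 1 i j s m hm)
        fun s => (commute_deltaFam s _).symm
    · exact imH_bracket_right (summable_φ_left j _) i r (fun s => Alg.h_mul_x 1 i j s m hm)
        fun s => (Alg.φ_h_comm _ _ _ _ _).symm
  · rw [imX_neg, imX_neg, mul_add, add_mul, add_sub_add_comm, smul_add]
    congr 1
    · exact imH_bracket_left (summable_φ_right _ j) i r (fun s => Alg.h_mul_x (-1) i j s m hm)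
        fun s => (Alg.φ_h_comm _ _ _ _ _).symm
    · exact imH_bracket_right (summable_δ_left _) i r (fun s => Alg.h_mul_x (-1) i j s m hm)
        fun s => (commute_deltaFam s _).symm

lemma commute_imX2_imX1 (ht : Generic t) (i j : T.I0) (r r' : ℤ) :
    Commute (letter (Alg.φ (-1) i) (Alg.x 1 i) r : LT12) (letter (Alg.x (-1) j) (Alg.φ 1 j) r') :=
  commute_letter (polyG_eq_polyF_neg (-1) i j) (polyF_eq_polyG_neg (-1) i j)
    (isHomogeneous_polyF _ i j) (isHomogeneous_polyG _ i j) (Alg.exchange_φ ht (-1) (-1) i j)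
    ((Alg.exchange_φ ht 1 1 j i).reverse_poly 1) (fun _ => Alg.φ_neg_of_lt i)
    (fun _ => Alg.φ_one_of_neg j) (cancelling_polyF _ i j rfl rfl)
    (cancelling_polyF _ i j rfl rfl) r r'

open scoped Classical in
lemma imX_commutator (ht : Generic t) (i j : T.I0) (r r' : ℤ) :
    imX t μ1 μ2 1 i r * imX t μ1 μ2 (-1) j r' - imX t μ1 μ2 (-1) j r' * imX t μ1 μ2 1 i r =
      if i = j ∧ T.InIZ i r' then
        (qdiff T t i)⁻¹ • (imφ t μ1 μ2 1 i (r + r') - imφ t μ1 μ2 (-1) i (r + r')) else 0 := by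
  have h1 := (commute_imX2_imX1 (μ1 := μ1) (μ2 := μ2) ht i j r r').eq
  have h2 : (letter (Alg.x 1 i) (deltaFam _) r : LT12) *
      letter (deltaFam _) (Alg.x (-1) j) r' = letter (deltaFam _) (Alg.x (-1) j) r' *
        letter (Alg.x 1 i) (deltaFam _) r := by
    rw [letter_delta_left, letter_delta_right, inl_apply, single_mul_single,
      single_mul_single, add_comm]
    simp
  rw [imX_one, imX_neg, add_mul, mul_add, mul_add, add_mul, mul_add, mul_add, h1, h2]
  set P1 := (letter (Alg.x 1 i) (deltaFam _) r : LT12) with hP1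
  set P2 := (letter (Alg.φ (-1) i) (Alg.x 1 i) r : LT12) with hP2
  set Q1 := (letter (Alg.x (-1) j) (Alg.φ 1 j) r' : LT12) with hQ1
  set Q2 := (letter (deltaFam _) (Alg.x (-1) j) r' : LT12) with hQ2
  have h3 : P1 * Q1 + Q2 * P1 + (Q1 * P2 + P2 * Q2) - (Q1 * P1 + Q1 * P2 + (Q2 * P1 + Q2 * P2)) =
      (P1 * Q1 - Q1 * P1) + (P2 * Q2 - Q2 * P2) := by abel
  rw [h3]
  ext n
  have e1 : (P1 * Q1 - Q1 * P1).coeff n =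
      (Alg.x 1 i r * Alg.x (-1) j (r' - n) - Alg.x (-1) j (r' - n) * Alg.x 1 i r) ⊗ₜ[ℂ]
        Alg.φ 1 j n := by
    rw [hP1, hQ1, letter_delta_right, inl_apply, coeff_sub, coeff_single_mul',
      coeff_mul_single', coeff_letter (summable_φ_right _ j), sub_zero,
      tmul_mul_tmul, tmul_mul_tmul, one_mul, mul_one,
      sub_tmul]
  have e2 : (P2 * Q2 - Q2 * P2).coeff n =
      Alg.φ (-1) i (r - (n - r')) ⊗ₜ[ℂ] (Alg.x 1 i (n - r') * Alg.x (-1) j r' -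
        Alg.x (-1) j r' * Alg.x 1 i (n - r')) := by
    rw [hP2, hQ2, letter_delta_left, coeff_sub, coeff_single_mul',
      coeff_mul_single', coeff_letter (summable_φ_left i _),
      tmul_mul_tmul, tmul_mul_tmul, one_mul, mul_one,
      tmul_sub]
  rw [coeff_add, e1, e2, Alg.x_commutator, Alg.x_commutator]
  by_cases hij : i = j
  swap
  · rw [if_neg fun h => hij h.1, if_neg fun h => hij h.1, if_neg fun h => hij h.1,
      zero_tmul, tmul_zero, add_zero, HahnSeries.coeff_zero]
  subst hij
  have hdvd (h : T.InIZ i r') : T.InIZ i (r' - n) ↔ T.InIZ i n := by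
    refine ⟨fun h' => ?_, fun h' => inIZ_sub h h'⟩
    have := inIZ_sub h h'
    rwa [sub_sub_cancel] at this
  by_cases hr : T.InIZ i r'
  · rw [if_pos (⟨rfl, hr⟩ : i = i ∧ T.InIZ i r'), if_pos (⟨rfl, hr⟩ : i = i ∧ T.InIZ i r'),
      coeff_smul, coeff_sub, imφ, imφ, coeff_letter (summable_φφ 1 i),
      coeff_letter (summable_φφ (-1) i), sub_add_cancel, show r - (n - r') = r + r' - n by ring]
    by_cases hn : T.InIZ i n
    · rw [if_pos ⟨rfl, (hdvd hr).2 hn⟩, show r + (r' - n) = r + r' - n by ring,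
        ← smul_tmul', tmul_smul, ← smul_add, sub_tmul,
        tmul_sub]
      congr 1
      abel
    · rw [Alg.φ_eq_zero_of_not_InIZ (t := t) (μ := μ2) 1 i hn,
        Alg.φ_eq_zero_of_not_InIZ (t := t) (μ := μ2) (-1) i hn]
      simp
  · have hn0 : ¬ (i = i ∧ T.InIZ i r') := fun h => hr h.2
    rw [if_neg hn0, if_neg hn0, tmul_zero, add_zero, HahnSeries.coeff_zero]
    by_cases hn : T.InIZ i n
    · rw [if_neg, zero_tmul]
      intro h
      apply hr
      have := inIZ_sub h.2 (inIZ_sub (inIZ_zero i) hn)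
      simpa using this
    · rw [Alg.φ_eq_zero_of_not_InIZ (t := t) (μ := μ2) 1 i hn, tmul_zero]

variable (t μ1 μ2) in
/-- The images of the generators. -/
def imGen : Gen T → LT12
  | .x ε i r => imX t μ1 μ2 ε i r
  | .φ ε i r => imφ t μ1 μ2 ε i r
  | .h i m => imH t μ1 μ2 i m
  | .κ ε i => imκ t μ1 μ2 ε i

variable (t μ1 μ2) in
/-- The homomorphism from the free algebra. -/
def imFree : Free T →ₐ[ℂ] LT12 := FreeAlgebra.lift ℂ (imGen t μ1 μ2)

lemma imFree_x (r : ℤ) : imFree t μ1 μ2 (Free.x ε i r) = imX t μ1 μ2 ε i r := lift_ι_apply _ _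
lemma imFree_φ (r : ℤ) : imFree t μ1 μ2 (Free.φ ε i r) = imφ t μ1 μ2 ε i r := lift_ι_apply _ _
lemma imFree_h (r : ℤ) : imFree t μ1 μ2 (Free.h i r) = imH t μ1 μ2 i r := lift_ι_apply _ _
lemma imFree_κ : imFree t μ1 μ2 (Free.κ ε i) = imκ t μ1 μ2 ε i := lift_ι_apply _ _

lemma imFree_rel (ht : Generic t) {a b : Free T}
    (hab : Rel T t 0 (μ1 + μ2) a b) : imFree t μ1 μ2 a = imFree t μ1 μ2 b := by
  have hX := imX_relations (T := T) (μ1 := μ1) (μ2 := μ2) ht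
  have hcub (ε : ℤˣ) (i : T.I0) (hi : T.Cσ i i 1 = -1) :=
    (cubicDist_eq_zero_iff t ε (imX t μ1 μ2 ε i)).1 ⟨(hX ε).lin i hi, (hX ε).quad i hi⟩
  cases hab with
  | x_zero ε i r hr => rw [imFree_x, imX_eq_zero ε i hr, map_zero]
  | h_zero i m hm =>
    rw [imFree_h, imH, Alg.h_eq_zero i hm, Alg.h_eq_zero i hm, map_zero, map_zero,
      tmul_zero, HahnSeries.single_eq_zero, add_zero]
  | lead_inv ε i =>
    rw [map_mul, map_one, imFree_φ, imFree_κ, imφ_lead, imκ, single_mul_single,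
      add_neg_cancel, tmul_mul_tmul, Alg.lead_mul_κ, Alg.lead_mul_κ]
    rfl
  | inv_lead ε i =>
    rw [map_mul, map_one, imFree_φ, imFree_κ, imφ_lead, imκ, single_mul_single,
      neg_add_cancel, tmul_mul_tmul, Alg.κ_mul_lead, Alg.κ_mul_lead]
    rfl
  | φ_zero ε i n hn => rw [imFree_φ, imφ_eq_zero ε i n hn, map_zero]
  | φ_exp ε i n =>
    rw [map_mul, expCoeff_map, imFree_φ, imFree_φ, imφ_exp]
    simp only [map_smul, imFree_h]
  | φφ ε ε' i j r r' => rw [map_mul, map_mul, imFree_φ, imFree_φ, imφ_comm]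
  | φh ε i j r m => rw [map_mul, map_mul, imFree_φ, imFree_h, imφ_imH]
  | hh i j m m' => rw [map_mul, map_mul, imFree_h, imFree_h, imH_comm]
  | lead_x ε ε' i j r => rw [map_smul, map_mul, map_mul, imFree_φ, imFree_x, imφ_lead_mul_imX]
  | hx ε i j r m hm =>
    rw [map_smul, map_sub, map_mul, map_mul, imFree_h, imFree_x, imFree_x, imH_mul_imX _ _ _ _ _ hm]
  | xx_pm i j r r' =>
    have := commScalar T i j r'
    rw [map_smul, map_sub, map_sub, map_mul, map_mul, imFree_x, imFree_x, imFree_φ, imFree_φ,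
      imX_commutator ht, this]
    split_ifs
    · rw [one_div]
    · rw [zero_div, hahn_zero_smul]
  | xx ε i j a b =>
    rw [coeffSum_map, coeffSum_map]
    simp only [map_mul, imFree_x]
    exact (hX ε).exchange i j a b
  | serre ε i j hij hσ a b c =>
    have := congrFun ((hX ε).serre i j hij hσ) ![a, b, c]
    rw [serreDist_apply] at this
    rw [map_add, serreTerm, serreTerm, coeffSum_map, coeffSum_map, map_zero]
    simp only [map_add, map_sub, map_mul, map_smul, imFree_x]
    exact this
  | cubic₁ ε i hi a =>
    rw [cubicTerm, map_sum, map_zero]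
    simp only [map_add, map_sub, map_mul, map_smul, imFree_x]
    exact (hcub ε i hi).1 a
  | cubic₂ ε i hi a =>
    rw [cubicTerm, map_sum, map_zero]
    simp only [map_add, map_sub, map_mul, map_smul, imFree_x]
    exact (hcub ε i hi).2 a

end Coproduct

open Coproduct in
lemma exists_isDeformedCoproduct (ht : Generic t) : ∃ Δ : Alg T t (μ1 + μ2) →ₐ[ℂ] LT12,
      IsDeformedCoproduct Δ ∧ ∀ a, Δ (Alg.mk a) = imFree t μ1 μ2 a := by
  let Δ : Alg T t (μ1 + μ2) →ₐ[ℂ] LT12 :=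
    RingQuot.liftAlgHom ℂ ⟨imFree t μ1 μ2, fun _ _ h => imFree_rel ht h⟩
  have hmk (a : Free T) : Δ (Alg.mk a) = imFree t μ1 μ2 a :=
    RingQuot.liftAlgHom_mkAlgHom_apply ℂ _ _ a
  refine ⟨Δ, ⟨fun i p n => ?_, fun i p n => ?_, fun ε i m n => ?_⟩, hmk⟩
  · rw [← Alg.mk_x, hmk, imFree_x, coeff_imX_one]
  · rw [← Alg.mk_x, hmk, imFree_x, coeff_imX_neg]
  · rw [← Alg.mk_φ, hmk, imFree_φ, imφ, coeff_letter (summable_φφ ε i)]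

lemma existsUnique_isDeformedCoproduct (ht : Generic t) :
    ∃! Δ : Alg T t (μ1 + μ2) →ₐ[ℂ] LT12, IsDeformedCoproduct Δ := by
  obtain ⟨Δ, hΔ, -⟩ := exists_isDeformedCoproduct (μ1 := μ1) (μ2 := μ2) ht
  exact ⟨Δ, hΔ, fun _ h => h.unique ht hΔ⟩

lemma IsDeformedCoproduct.map_mk (hΔ : IsDeformedCoproduct Δ) (ht : Generic t) (a : Free T) :
    Δ (Alg.mk a) = Coproduct.imFree t μ1 μ2 a := by
  obtain ⟨Δ', hΔ', h⟩ := exists_isDeformedCoproduct (μ1 := μ1) (μ2 := μ2) ht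
  rw [hΔ.unique ht hΔ', h]


/-! ### The ring of rational functions regular at one -/

section RegOne

open Polynomial

/-- Polynomials are regular at one. -/
def polyRegOne : ℂ[X] →+* regOne where
  toFun p := ⟨algebraMap ℂ[X] (RatFunc ℂ) p, by
    change (algebraMap ℂ[X] (RatFunc ℂ) p).denom.eval 1 ≠ 0
    rw [RatFunc.denom_algebraMap]; simp⟩
  map_one' := Subtype.ext (map_one _)
  map_mul' p q := Subtype.ext (map_mul _ p q)
  map_zero' := Subtype.ext (map_zero _)
  map_add' p q := Subtype.ext (map_add _ p q)

instance : Algebra ℂ[X] regOne := polyRegOne.toAlgebra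

lemma coe_algebraMap_regOne (p : ℂ[X]) :
    ((algebraMap ℂ[X] regOne p : regOne) : RatFunc ℂ) = algebraMap ℂ[X] (RatFunc ℂ) p := rfl

instance : IsScalarTower ℂ[X] regOne (RatFunc ℂ) := IsScalarTower.of_algebraMap_eq fun _ => rfl

/-- The polynomials that do not vanish at one. -/
def nonvanishing : Submonoid ℂ[X] where
  carrier := {p | p.eval 1 ≠ 0}
  one_mem' := by simp
  mul_mem' hp hq := by
    simp only [Set.mem_ofPred_eq, eval_mul] at *
    exact mul_ne_zero hp hq

lemma ne_zero_of_mem_nonvanishing {p : ℂ[X]} (hp : p ∈ nonvanishing) : p ≠ 0 := by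
  rintro rfl
  exact hp eval_zero

lemma inv_mem_regOne {p : ℂ[X]} (hp : p ∈ nonvanishing) :
    (algebraMap ℂ[X] (RatFunc ℂ) p)⁻¹ ∈ regOne := by
  change ((algebraMap ℂ[X] (RatFunc ℂ) p)⁻¹).denom.eval 1 ≠ 0
  have h := RatFunc.denom_div_dvd 1 p
  rw [map_one, one_div] at h
  obtain ⟨w, hw⟩ := h
  intro h0
  apply hp
  rw [hw, eval_mul, h0, zero_mul]

instance : IsLocalization nonvanishing regOne where
  map_units := by
    rintro ⟨p, hp⟩
    refine IsUnit.of_mul_eq_one ⟨_, inv_mem_regOne hp⟩ (Subtype.ext ?_)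
    exact mul_inv_cancel₀ (algebraMap_ne_zero (ne_zero_of_mem_nonvanishing hp))
  surj := by
    rintro ⟨f, hf⟩
    refine ⟨(f.num, ⟨f.denom, hf⟩), Subtype.ext ?_⟩
    change f * algebraMap ℂ[X] (RatFunc ℂ) f.denom = algebraMap ℂ[X] (RatFunc ℂ) f.num
    nth_rewrite 1 [← RatFunc.num_div_denom f]
    exact div_mul_cancel₀ _ (algebraMap_ne_zero f.denom_ne_zero)
  exists_of_eq := by
    intro p q h
    refine ⟨1, ?_⟩
    have h' := congrArg Subtype.val h
    rw [coe_algebraMap_regOne, coe_algebraMap_regOne] at h'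
    rw [RatFunc.algebraMap_injective _ h']

lemma nonvanishing_le : nonvanishing ≤ nonZeroDivisors ℂ[X] := fun _ hp =>
  mem_nonZeroDivisors_of_ne_zero (ne_zero_of_mem_nonvanishing hp)

instance : IsFractionRing regOne (RatFunc ℂ) :=
  IsFractionRing.isFractionRing_of_isDomain_of_isLocalization nonvanishing regOne (RatFunc ℂ)

instance : IsPrincipalIdealRing regOne := by
  refine ⟨fun I => ?_⟩
  rw [← IsLocalization.map_under nonvanishing regOne I]
  exact (IsPrincipalIdealRing.principal (I.comap (algebraMap ℂ[X] regOne))).map_ringHom _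

/-- Evaluation at one. -/
def evOne : regOne →+* ℂ :=
  IsLocalization.lift (M := nonvanishing) (g := evalRingHom (1 : ℂ)) fun p => IsUnit.mk0 _ p.2

lemma evOne_poly (p : ℂ[X]) : evOne (algebraMap ℂ[X] regOne p) = p.eval 1 :=
  IsLocalization.lift_eq _ p

lemma algebraMap_C_regOne (c : ℂ) : algebraMap ℂ[X] regOne (C c) = algebraMap ℂ regOne c :=
  Subtype.ext (RatFunc.algebraMap_C c)

lemma evOne_algebraMap (c : ℂ) : evOne (algebraMap ℂ regOne c) = c := by
  rw [← algebraMap_C_regOne, evOne_poly, eval_C]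

lemma uSubOne_eq : uSubOne = algebraMap ℂ[X] regOne (X - C 1) := Subtype.ext (by
    rw [coe_algebraMap_regOne, map_sub, RatFunc.algebraMap_X, RatFunc.algebraMap_C]; rfl)

lemma evOne_uSubOne : evOne uSubOne = 0 := by rw [uSubOne_eq, evOne_poly]; simp

lemma uSubOne_ne_zero : uSubOne ≠ 0 := by
  rw [uSubOne_eq, Ne, ← map_zero (algebraMap ℂ[X] regOne),
    (IsLocalization.injective regOne nonvanishing_le).eq_iff]
  exact X_sub_C_ne_zero 1

lemma exists_eq_uSubOne_mul {c : regOne} (hc : evOne c = 0) : ∃ d, c = uSubOne * d := by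
  obtain ⟨p, s, rfl⟩ := IsLocalization.exists_mk'_eq nonvanishing c
  rw [evOne, IsLocalization.lift_mk', Units.mul_inv_eq_iff_eq_mul, zero_mul] at hc
  obtain ⟨w, rfl⟩ := dvd_iff_isRoot.2 hc
  exact ⟨IsLocalization.mk' regOne w s, by rw [uSubOne_eq, IsLocalization.mul_mk'_eq_mk'_of_mul]⟩

lemma exists_eq_add_uSubOne_mul (c : regOne) :
    ∃ d, c = algebraMap ℂ regOne (evOne c) + uSubOne * d := by
  obtain ⟨d, hd⟩ := exists_eq_uSubOne_mul (c := c - algebraMap ℂ regOne (evOne c))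
    (by rw [map_sub, evOne_algebraMap, sub_self])
  exact ⟨d, by rw [← hd]; ring⟩

/-- The invertible element `u`. -/
def uUnit : regOneˣ := IsUnit.unit (IsLocalization.map_units regOne (⟨X, by
    change (X : ℂ[X]).eval 1 ≠ 0
    simp⟩ : nonvanishing))

lemma coe_uUnit : ((uUnit : regOne) : RatFunc ℂ) = RatFunc.X := RatFunc.algebraMap_X

lemma evOne_uUnit : evOne uUnit = 1 := by
  change evOne (algebraMap ℂ[X] regOne X) = 1
  rw [evOne_poly, eval_X]

lemma evOne_uUnit_zpow (n : ℤ) : evOne ((uUnit ^ n : regOneˣ) : regOne) = 1 := by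
  have h : Units.map evOne.toMonoidHom uUnit = 1 := Units.ext evOne_uUnit
  have h2 : Units.map evOne.toMonoidHom (uUnit ^ n) = 1 := by rw [map_zpow, h, one_zpow]
  exact congrArg Units.val h2

end RegOne

section LaurentVec

instance : IsScalarTower regOne (RatFunc ℂ) (LaurentVec W) := inferInstance

/-- The coefficient of `u ^ n`. -/
def lcoeff (n : ℤ) : LaurentVec W →ₗ[ℂ] W where
  toFun f := ((HahnModule.of ℂ).symm f).coeff n
  map_add' _ _ := rfl
  map_smul' _ _ := rfl

lemma laurentVec_ext {f g : LaurentVec W} (h : ∀ n, lcoeff n f = lcoeff n g) : f = g :=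
  HahnModule.ext _ _ (funext h)

lemma lcoeff_constVec (n : ℤ) (w : W) : lcoeff n (constVec w) = if n = 0 then w else 0 := by
  change (single (0 : ℤ) w).coeff n = _
  split_ifs with h
  · rw [h, coeff_single_same]
  · rw [coeff_single_of_ne h]

/-- The constant series as a linear map. -/
def constHom : W →ₗ[ℂ] LaurentVec W where
  toFun := constVec
  map_add' a b := laurentVec_ext fun n => by
    rw [map_add, lcoeff_constVec, lcoeff_constVec, lcoeff_constVec]; split_ifs <;> simp
  map_smul' c a := laurentVec_ext fun n => by
    rw [map_smul, lcoeff_constVec, lcoeff_constVec]; split_ifs <;> simp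

lemma constHom_apply (w : W) : constHom w = constVec w := rfl

lemma expandZero_X_zpow (m : ℤ) : expandZero ℂ (RatFunc.X ^ m) = single m (1 : ℂ) := by
  have h : expandZero ℂ RatFunc.X = single (1 : ℤ) (1 : ℂ) := RatFunc.coe_X
  rw [map_zpow₀, h, ← RatFunc.single_zpow]

lemma lcoeff_single_smul (m n : ℤ) (c : ℂ) (f : LaurentVec W) :
    lcoeff n ((single m c : LaurentSeries ℂ) • f) = c • lcoeff (n - m) f := by
  have := HahnModule.coeff_single_smul_vadd (r := c) (x := f) (a := n - m) (b := m)
  rw [vadd_eq_add, add_sub_cancel] at this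
  exact this

lemma lcoeff_X_zpow_smul (m n : ℤ) (f : LaurentVec W) :
    lcoeff n ((RatFunc.X ^ m : RatFunc ℂ) • f) = lcoeff (n - m) f := by
  rw [ratFunc_smul_def, expandZero_X_zpow, lcoeff_single_smul, one_smul]

end LaurentVec


/-! ### Rational Laurent series -/

lemma inf_iSup_eq {α ι : Type*} [CompleteLattice α] [IsModularLattice α] {A B : ι → α}
    (hA : iSupIndep A) (h : ∀ i, B i ≤ A i) (i : ι) : A i ⊓ ⨆ j, B j = B i := by
  refine le_antisymm ?_ (le_inf (h i) (le_iSup B i))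
  have h1 : ⨆ j, B j ≤ B i ⊔ ⨆ (j) (_ : j ≠ i), A j := iSup_le fun j => by
    by_cases hj : j = i
    · exact hj ▸ le_sup_left
    · exact le_sup_of_le_right (le_iSup₂_of_le j hj (h j))
  calc A i ⊓ ⨆ j, B j ≤ (B i ⊔ ⨆ (j) (_ : j ≠ i), A j) ⊓ A i :=
        le_inf (inf_le_right.trans h1) inf_le_left
    _ = B i ⊔ (⨆ (j) (_ : j ≠ i), A j) ⊓ A i := sup_inf_assoc_of_le _ (h i)
    _ ≤ B i := sup_le le_rfl (by rw [inf_comm, (hA i).eq_bot]; exact bot_le)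

lemma eq_of_iSup_eq_top {α ι : Type*} [CompleteLattice α] [IsModularLattice α] {A B : ι → α}
    (hA : iSupIndep A) (h : ∀ i, B i ≤ A i) (hB : ⨆ j, B j = ⊤) : B = A :=
  funext fun i => by rw [← inf_iSup_eq hA h i, hB, inf_top_eq]

section

lemma exists_lcoeff_eq_zero (f : LaurentVec W) : ∃ n0 : ℤ, ∀ n < n0, lcoeff n f = 0 :=
  ⟨((HahnModule.of ℂ).symm f).order, fun _ h => HahnSeries.coeff_eq_zero_of_lt_order h⟩

/-- The rational Laurent series with coefficients in a subspace. -/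
def ratSub (P : Submodule ℂ W) : Submodule (RatFunc ℂ) (LaurentVec W) :=
  span (RatFunc ℂ) (constVec '' (P : Set W))

/-- The constant lattice of a subspace. -/
def constLattice (P : Submodule ℂ W) : Submodule regOne (LaurentVec W) :=
  span regOne (constVec '' (P : Set W))

lemma ratSub_top : ratSub (⊤ : Submodule ℂ W) = ratVec W := by
  rw [ratSub, ratVec, Submodule.top_coe, Set.image_univ]

lemma constVec_mem_ratSub {P : Submodule ℂ W} {w : W} (hw : w ∈ P) : constVec w ∈ ratSub P :=
  subset_span ⟨w, hw, rfl⟩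

lemma constVec_mem_constLattice {P : Submodule ℂ W} {w : W} (hw : w ∈ P) :
    constVec w ∈ constLattice P :=
  subset_span ⟨w, hw, rfl⟩

lemma ratSub_mono {P Q : Submodule ℂ W} (h : P ≤ Q) : ratSub P ≤ ratSub Q :=
  span_mono (Set.image_mono h)

lemma ratSub_le_ratVec (P : Submodule ℂ W) : ratSub P ≤ ratVec W :=
  ratSub_top (W := W) ▸ ratSub_mono le_top

lemma regOne_smul_def (c : regOne) (f : LaurentVec W) : c • f = (c : RatFunc ℂ) • f := rfl

lemma constLattice_subset (P : Submodule ℂ W) {f : LaurentVec W} (hf : f ∈ constLattice P) :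
    f ∈ ratSub P := by
  have : constLattice P ≤ (ratSub P).restrictScalars regOne := span_le.2 subset_span
  exact this hf

lemma algebraMap_smul_regOne (c : ℂ) (f : LaurentVec W) : algebraMap ℂ regOne c • f = c • f :=
  algebraMap_smul regOne c f

lemma mem_ratSub_of_recurrence {P : Submodule ℂ W} {f : LaurentVec W}
    (hf : ∀ n, lcoeff n f ∈ P) {p : Polynomial ℂ} (hp : p ≠ 0) {N : ℤ}
    (h : ∀ n, N ≤ n → ∑ k ∈ p.support, p.coeff k • lcoeff (n + k) f = 0) : f ∈ ratSub P := by
  set D : RatFunc ℂ := ∑ k ∈ p.support, RatFunc.C (p.coeff k) * RatFunc.X ^ (-(k : ℤ)) with hD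
  have hDf (n : ℤ) : lcoeff n (D • f) = ∑ k ∈ p.support, p.coeff k • lcoeff (n + k) f := by
    rw [hD, sum_smul, map_sum]
    refine sum_congr rfl fun k _ => ?_
    rw [mul_smul, ratFunc_smul_def, expandZero_C, lcoeff_single_smul, lcoeff_X_zpow_smul, sub_zero,
      sub_neg_eq_add]
  have hD0 : D ≠ 0 := by
    obtain ⟨k0, hk0⟩ := Polynomial.nonempty_support_iff.2 hp
    intro h0
    have h1 : (expandZero ℂ D).coeff (-(k0 : ℤ)) = p.coeff k0 := by
      have hs : expandZero ℂ D = ∑ k ∈ p.support, single (-(k : ℤ)) (p.coeff k) := by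
        rw [hD, map_sum]
        refine sum_congr rfl fun k _ => ?_
        rw [map_mul, expandZero_C, expandZero_X_zpow, single_mul_single, zero_add, mul_one]
      have h2 : (∑ k ∈ p.support, single (-(k : ℤ)) (p.coeff k)).coeff (-(k0 : ℤ)) =
          ∑ k ∈ p.support, (single (-(k : ℤ)) (p.coeff k)).coeff (-(k0 : ℤ)) :=
        map_sum (HahnSeries.coeff.addMonoidHom (-(k0 : ℤ))) _ _
      rw [hs, h2, Finset.sum_eq_single_of_mem k0 hk0, coeff_single_same]
      intro k _ hk
      exact coeff_single_of_ne (by omega)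
    rw [h0, map_zero, HahnSeries.coeff_zero] at h1
    exact Polynomial.mem_support_iff.1 hk0 h1.symm
  obtain ⟨n0, hn₀⟩ := exists_lcoeff_eq_zero f
  have hlow (n : ℤ) (hn : n < n0 - p.natDegree) : lcoeff n (D • f) = 0 := by
    rw [hDf]
    refine sum_eq_zero fun k hk => ?_
    have := Polynomial.le_natDegree_of_mem_supp k hk
    rw [hn₀ _ (by omega), smul_zero]
  have hfin : D • f = ∑ n ∈ Finset.Ico (n0 - p.natDegree) N,
      (RatFunc.X ^ n : RatFunc ℂ) • constVec (lcoeff n (D • f)) := by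
    refine laurentVec_ext fun n => ?_
    rw [map_sum]
    simp only [lcoeff_X_zpow_smul, lcoeff_constVec, sub_eq_zero]
    rw [sum_ite_eq]
    simp only [Finset.mem_Ico]
    split_ifs with hn
    · rfl
    · by_cases h1 : n < n0 - p.natDegree
      · exact hlow n h1
      · rw [hDf, h n (by omega)]
  have hmem : D • f ∈ ratSub P := by
    rw [hfin]
    refine Submodule.sum_mem _ fun n _ => smul_mem _ _ (constVec_mem_ratSub ?_)
    rw [hDf]
    exact Submodule.sum_mem _ fun k _ => smul_mem _ _ (hf _)
  have := smul_mem _ D⁻¹ hmem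
  rwa [smul_smul, inv_mul_cancel₀ hD0, one_smul] at this

lemma exists_smul_mem_of_mem_span {s : Set (LaurentVec W)} {f : LaurentVec W}
    (hf : f ∈ span (RatFunc ℂ) s) :
    ∃ D : regOne, D ≠ 0 ∧ D • f ∈ span regOne s := by
  induction hf using span_induction with
  | mem x hx => exact ⟨1, one_ne_zero, by rw [one_smul]; exact subset_span hx⟩
  | zero => exact ⟨1, one_ne_zero, by rw [smul_zero]; exact Submodule.zero_mem _⟩
  | add x y _ _ hx hy =>
    obtain ⟨D, hD, h⟩ := hx
    obtain ⟨D', hD', h'⟩ := hy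
    refine ⟨D * D', mul_ne_zero hD hD', ?_⟩
    rw [smul_add]
    refine Submodule.add_mem _ ?_ ?_
    · rw [mul_comm, mul_smul]; exact smul_mem _ _ h
    · rw [mul_smul]; exact smul_mem _ _ h'
  | smul c x _ hx =>
    obtain ⟨D, hD, h⟩ := hx
    obtain ⟨a, b, hb, rfl⟩ := IsFractionRing.div_surjective (A := regOne) c
    have hb0 := nonZeroDivisors.ne_zero hb
    refine ⟨b * D, mul_ne_zero hb0 hD, ?_⟩
    have : (b * D) • (algebraMap regOne (RatFunc ℂ) a / algebraMap regOne (RatFunc ℂ) b) • x =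
        a • D • x := by
      have hb1 : (b : RatFunc ℂ) ≠ 0 := fun h => hb0 (Subtype.ext h)
      change ((b * D : regOne) : RatFunc ℂ) • ((a : RatFunc ℂ) / (b : RatFunc ℂ)) • x =
        (a : RatFunc ℂ) • (D : RatFunc ℂ) • x
      rw [smul_smul, smul_smul, Subalgebra.coe_mul]
      congr 1
      field_simp
    rw [this]
    exact smul_mem _ _ h

lemma exists_smul_mem_constLattice {P : Submodule ℂ W} {f : LaurentVec W} (hf : f ∈ ratSub P) :
    ∃ D : regOne, D ≠ 0 ∧ D • f ∈ constLattice P :=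
  exists_smul_mem_of_mem_span hf

lemma lcoeff_smul_of_le {c : LaurentSeries ℂ} {f : LaurentVec W} {m : ℤ}
    (hc : ∀ n < m, c.coeff n = 0) (hf : ∀ n < 0, lcoeff n f = 0) :
    lcoeff m (c • f) = c.coeff m • lcoeff 0 f := by
  change ((HahnModule.of ℂ).symm (c • f)).coeff m = _
  rw [HahnModule.coeff_smul, sum_subset (s₂ := {(m, 0)})]
  · rw [sum_singleton]; rfl
  · rintro ⟨a, b⟩ h
    rw [mem_vaddAntidiagonal] at h
    obtain ⟨h1, h2, h3⟩ := h
    simp only [vadd_eq_add] at h3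
    have ha : m ≤ a := by
      by_contra h; exact h1 (hc a (by omega))
    have hb : 0 ≤ b := by
      by_contra h; exact h2 (hf b (by omega))
    simp only [mem_singleton, Prod.mk.injEq]
    omega
  · intro x hx hx'
    rw [mem_singleton] at hx
    subst hx
    by_contra h
    apply hx'
    rw [mem_vaddAntidiagonal]
    refine ⟨fun h0 => h ?_, fun h0 => h ?_, by simp⟩
    · change c.coeff m = 0 at h0; rw [h0, zero_smul]
    · rw [h0, smul_zero]

lemma linearIndependent_of_leading {ι : Type*} {e : ι → W} (he : LinearIndependent ℂ e)
    {f : ι → LaurentVec W} (hf : ∀ k, ∀ n < 0, lcoeff n (f k) = 0)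
    (hfe : ∀ k, lcoeff 0 (f k) = e k) : LinearIndependent (RatFunc ℂ) f := by
  classical
  rw [linearIndependent_iff']
  intro s c hc
  by_contra! hne
  obtain ⟨k1, hk1, hk1'⟩ := hne
  obtain ⟨k0, hk0, hmin⟩ := (s.filter fun k => c k ≠ 0).exists_min_image
    (fun k => (expandZero ℂ (c k)).order) ⟨k1, by simp [hk1, hk1']⟩
  set m := (expandZero ℂ (c k0)).order with hm
  have hlow (k : ι) (hk : k ∈ s) (n : ℤ) (hn : n < m) : (expandZero ℂ (c k)).coeff n = 0 := by
    by_cases h0 : c k = 0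
    · rw [h0, map_zero]; rfl
    · exact HahnSeries.coeff_eq_zero_of_lt_order (hn.trans_le (hmin k (mem_filter.2 ⟨hk, h0⟩)))
  have h1 : ∑ k ∈ s, (expandZero ℂ (c k)).coeff m • e k = 0 := by
    have := congrArg (lcoeff m) hc
    rw [map_sum, map_zero] at this
    rw [← this]
    refine sum_congr rfl fun k hk => ?_
    rw [ratFunc_smul_def, lcoeff_smul_of_le (hlow k hk) (hf k), hfe]
  obtain ⟨hk0s, hk00⟩ := mem_filter.1 hk0
  have h2 := linearIndependent_iff'.1 he s _ h1 k0 hk0s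
  have h3 : expandZero ℂ (c k0) ≠ 0 := by
    rw [Ne, ← map_zero (expandZero ℂ), (expandZero ℂ).injective.eq_iff]; exact hk00
  exact HahnSeries.coeff_order_eq_zero.not.2 h3 h2

lemma constVec_mem_span {S ι : Type*} [CommRing S] [Algebra ℂ S] [Module S (LaurentVec W)]
    [IsScalarTower ℂ S (LaurentVec W)] [Fintype ι] {P : Submodule ℂ W} (b : Module.Basis ι ℂ P)
    {w : W} (hw : w ∈ P) :
    constVec w ∈ span S (Set.range fun k => constVec (b k : W)) := by
  have h1 : w = ∑ k, b.repr ⟨w, hw⟩ k • (b k : W) := by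
    conv_lhs => rw [show w = P.subtype ⟨w, hw⟩ from rfl, ← b.sum_repr ⟨w, hw⟩, map_sum]
    rfl
  rw [h1, ← constHom_apply, map_sum]
  refine Submodule.sum_mem _ fun k _ => ?_
  rw [map_smul, ← algebraMap_smul S]
  exact smul_mem _ _ (subset_span ⟨k, rfl⟩)

lemma ratSub_eq_span {ι : Type*} [Fintype ι] {P : Submodule ℂ W} (b : Module.Basis ι ℂ P) :
    ratSub P = span (RatFunc ℂ) (Set.range fun k => constVec (b k : W)) := by
  refine le_antisymm (span_le.2 ?_) (span_le.2 ?_)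
  · rintro _ ⟨w, hw, rfl⟩
    exact constVec_mem_span b hw
  · rintro _ ⟨k, rfl⟩
    exact constVec_mem_ratSub (b k).2

lemma constLattice_eq_span {ι : Type*} [Fintype ι] {P : Submodule ℂ W} (b : Module.Basis ι ℂ P) :
    constLattice P = span regOne (Set.range fun k => constVec (b k : W)) := by
  refine le_antisymm (span_le.2 ?_) (span_le.2 ?_)
  · rintro _ ⟨w, hw, rfl⟩
    exact constVec_mem_span b hw
  · rintro _ ⟨k, rfl⟩
    exact constVec_mem_constLattice (b k).2

lemma linearIndependent_constVec {ι : Type*} {e : ι → W} (he : LinearIndependent ℂ e) :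
    LinearIndependent (RatFunc ℂ) fun k => constVec (e k) :=
  linearIndependent_of_leading he (fun k n hn => by rw [lcoeff_constVec, if_neg hn.ne])
    fun k => by rw [lcoeff_constVec, if_pos rfl]

lemma eq_ratSub_of_leading {P : Submodule ℂ W} [FiniteDimensional ℂ P]
    {N : Submodule (RatFunc ℂ) (LaurentVec W)} (hN : N ≤ ratSub P)
    (h : ∀ w ∈ P, ∃ f ∈ N, (∀ n < 0, lcoeff n f = 0) ∧ lcoeff 0 f = w) : N = ratSub P := by
  set b := finBasis ℂ P
  choose f hfN hf hfe using fun k => h (b k) (b k).2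
  have he : LinearIndependent ℂ fun k => ((b k : P) : W) :=
    b.linearIndependent.map' P.subtype P.ker_subtype
  have hli := linearIndependent_of_leading he hf hfe
  have hspan := ratSub_eq_span b
  have : Module.Finite (RatFunc ℂ) (ratSub P) := by
    rw [hspan]; exact Module.Finite.span_of_finite _ (Set.finite_range _)
  refine Submodule.eq_of_le_of_finrank_le hN ?_
  have h1 : finrank (RatFunc ℂ) (ratSub P) ≤ finrank ℂ P := by
    rw [hspan]
    exact (finrank_range_le_card _).trans (by simp)
  have h2 : span (RatFunc ℂ) (Set.range f) ≤ N := span_le.2 (by rintro _ ⟨k, rfl⟩; exact hfN k)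
  have h3 := finrank_span_eq_card hli
  have : Module.Finite (RatFunc ℂ) N := finiteDimensional_of_le hN
  have h4 := Submodule.finrank_mono h2
  rw [h3, Fintype.card_fin] at h4
  exact h1.trans h4

lemma constLattice_fg (P : Submodule ℂ W) [FiniteDimensional ℂ P] : (constLattice P).FG := by
  rw [constLattice_eq_span (finBasis ℂ P)]
  exact Submodule.fg_span (Set.finite_range _)

end


/-! ### Vectors generated by a singular vector -/

lemma IsExp.mem_of_log_mem {A : Type*} [Ring A] [Algebra ℂ A] {a E : ℕ → A} (h : IsExp a E)
    (B : Subalgebra ℂ A) (ha : ∀ n, a (n + 1) ∈ B) (n : ℕ) : E n ∈ B := by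
  induction n using Nat.strong_induction_on with
  | _ n ih =>
    cases n with
    | zero => rw [h.zero]; exact one_mem B
    | succ n =>
      have hn : ((n : ℂ) + 1) ≠ 0 := by exact_mod_cast succ_ne_zero n
      have h1 : ((n : ℂ) + 1) • E (n + 1) ∈ B := by
        rw [h.succ]
        refine sum_mem fun p hp => B.smul_mem (B.mul_mem (ha _) (ih _ ?_)) _
        have := mem_antidiagonal.1 hp; omega
      have := B.smul_mem h1 ((n : ℂ) + 1)⁻¹
      rwa [smul_smul, inv_mul_cancel₀ hn, one_smul] at this

lemma IsExp.log_mem_of_mem {A : Type*} [Ring A] [Algebra ℂ A] {a E : ℕ → A} (h : IsExp a E)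
    (B : Subalgebra ℂ A) (hE : ∀ n, E n ∈ B) (n : ℕ) : a (n + 1) ∈ B := by
  induction n using Nat.strong_induction_on with
  | _ n ih =>
    have hm : (n, 0) ∈ antidiagonal n := mem_antidiagonal.2 rfl
    have h1 := h.succ n
    rw [← Finset.add_sum_erase _ _ hm, h.zero, mul_one] at h1
    have hn : ((n : ℂ) + 1) ≠ 0 := by exact_mod_cast succ_ne_zero n
    have h2 : ((n : ℂ) + 1) • a (n + 1) ∈ B := by
      rw [eq_sub_of_add_eq h1.symm]
      refine B.sub_mem (B.smul_mem (hE _) _) (sum_mem fun p hp => B.smul_mem (B.mul_mem (ih _ ?_)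
        (hE _)) _)
      obtain ⟨h3, h4⟩ := Finset.mem_erase.1 hp
      have h5 := mem_antidiagonal.1 h4
      rcases p with ⟨p, s⟩
      simp only [ne_eq, Prod.mk.injEq, not_and] at h3 h5 ⊢
      by_contra h6
      exact h3 (by omega) (by omega)
    have := B.smul_mem h2 ((n : ℂ) + 1)⁻¹
    rwa [smul_smul, inv_mul_cancel₀ hn, one_smul] at this

lemma Alg.mem_of_generators (B : Subalgebra ℂ (Alg T t μ)) (hx : ∀ ε i r, x ε i r ∈ B)
    (hφ : ∀ ε i r, φ ε i r ∈ B) (hh : ∀ i r, h i r ∈ B) (hκ : ∀ ε i, κ ε i ∈ B) (a : Alg T t μ) :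
    a ∈ B := by
  obtain ⟨a, rfl⟩ := RingQuot.mkAlgHom_surjective ℂ (Rel T t 0 μ) a
  change mk a ∈ B
  induction a using FreeAlgebra.induction with
  | grade0 r => rw [AlgHom.commutes]; exact B.algebraMap_mem r
  | grade1 a =>
    rcases a with ⟨ε, i, r⟩ | ⟨ε, i, r⟩ | ⟨i, m⟩ | ⟨ε, i⟩
    exacts [hx ε i r, hφ ε i r, hh i m, hκ ε i]
  | mul a b ha hb => rw [map_mul]; exact B.mul_mem ha hb
  | add a b ha hb => rw [map_add]; exact B.add_mem ha hb

lemma Alg.κ_mul_x (ε ε' : ℤˣ) (i j : T.I0) (r : ℤ) : (κ ε i * x ε' j r : Alg T t μ) =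
    qpow t (-(ε * ε' * T.sumC i j)) • (x ε' j r * κ ε i) := by
  have h : (κ ε i * (lead ε i * x ε' j r) * κ ε i : Alg T t μ) =
      κ ε i * (qpow t (ε * ε' * T.sumC i j) • (x ε' j r * lead ε i)) * κ ε i := by
    rw [lead_mul_x]
  rw [← mul_assoc, κ_mul_lead, one_mul, mul_smul_comm, smul_mul_assoc, mul_assoc (κ ε i),
    mul_assoc (x ε' j r), lead_mul_κ, mul_one] at h
  rw [h, smul_smul, ← qpow_add, neg_add_cancel, qpow_zero, one_smul]

section Words

variable {S : Type*} [CommRing S] [Algebra ℂ S] {M : Type*} [AddCommGroup M] [Module S M] [Module ℂ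
  M] [IsScalarTower ℂ S M] (R : Alg T t μ →ₐ[ℂ] End S M) (v : M)

lemma end_map_csmul (f : End S M) (c : ℂ) (y : M) : f (c • y) = c • f y := by
  rw [← algebraMap_smul S, map_smul, algebraMap_smul]

/-- The operators that preserve a submodule. -/
def stabilizer (N : Submodule S M) : Subalgebra ℂ (End S M) where
  carrier := {f | ∀ y ∈ N, f y ∈ N}
  mul_mem' hf hg y hy := hf _ (hg y hy)
  add_mem' hf hg y hy := N.add_mem (hf y hy) (hg y hy)
  algebraMap_mem' c _ hy := by
    rw [algebraMap_end_apply, ← algebraMap_smul S]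
    exact N.smul_mem _ hy

lemma mem_stabilizer_span {s : Set M} {f : End S M}
    (h : ∀ y ∈ s, f y ∈ span S s) : f ∈ stabilizer (span S s) :=
  fun _ hy => (span_le (p := (span S s).comap f)).2 h hy

/-- The result of applying a word in the lowering operators. -/
def wordVec : List (T.I0 × ℤ) → M
  | [] => v
  | p :: l => R (Alg.x (-1) p.1 p.2) (wordVec l)

/-- The span of the words. -/
def wordSpan : Submodule S M := span S (Set.range (wordVec R v))

/-- The span of the words of a given type. -/
def wordSpace (l : List T.I0) : Submodule S M := span S (wordVec R v '' {L | L.map Prod.fst = l})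

lemma wordSpan_eq_iSup : wordSpan R v = ⨆ l, wordSpace R v l := by
  refine le_antisymm (span_le.2 ?_) (iSup_le fun l => span_mono (Set.image_subset_range _ _))
  rintro _ ⟨L, rfl⟩
  exact mem_iSup_of_mem (L.map Prod.fst) (subset_span ⟨L, rfl, rfl⟩)

/-- A vector killed by the raising operators and an eigenvector of the Cartan part. -/
structure IsSingular : Prop where
  x_plus : ∀ i r, R (Alg.x 1 i r) v = 0
  φ_mem : ∀ ε i m, R (Alg.φ ε i m) v ∈ span S {v}
  κ_mem : ∀ ε i, R (Alg.κ ε i) v ∈ span S {v}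

variable {R v} (ht : Generic t)

include ht in
lemma h_mem_of_φ_mem (B : Subalgebra ℂ (Alg T t μ)) (hφ : ∀ ε i m, Alg.φ ε i m ∈ B)
    (hκ : ∀ ε i, Alg.κ ε i ∈ B) (i : T.I0) (m : ℤ) : Alg.h i m ∈ B := by
  have key (ε : ℤˣ) (n : ℕ) : Alg.h i (ε * (n + 1 : ℕ)) ∈ B := by
    have h1 := (Alg.isExp_hSeq (μ := μ) (t := t) ε i).log_mem_of_mem B (fun n => by
      rw [Alg.expCoeff_eq]; exact B.mul_mem (hκ _ _) (hφ _ _ _)) n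
    rw [Alg.hSeq] at h1
    have hc : ((ε : ℤ) : ℂ) * qdiff T t i ≠ 0 :=
      mul_ne_zero (by exact_mod_cast ε.ne_zero) (qdiff_ne_zero ht i)
    have := B.smul_mem h1 (((ε : ℤ) : ℂ) * qdiff T t i)⁻¹
    rwa [smul_smul, inv_mul_cancel₀ hc, one_smul] at this
  rcases lt_trichotomy m 0 with hm | rfl | hm
  · have := key (-1) (-m - 1).toNat
    rwa [show (((-1 : ℤˣ) : ℤ)) * (((-m - 1).toNat + 1 : ℕ) : ℤ) = m by push_cast; omega] at this
  · rw [Alg.h_eq_zero i (Or.inl rfl)]; exact B.zero_mem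
  · have := key 1 (m - 1).toNat
    rwa [show (((1 : ℤˣ) : ℤ)) * (((m - 1).toNat + 1 : ℕ) : ℤ) = m by push_cast; omega] at this

lemma φ_mem_of_h_mem (B : Subalgebra ℂ (Alg T t μ)) (hl : ∀ ε i, lead ε i ∈ B)
    (hh : ∀ i m, Alg.h i m ∈ B) (ε : ℤˣ) (i : T.I0) (m : ℤ) : Alg.φ ε i m ∈ B := by
  rcases Alg.exists_index ε (ld μ ε i) m with h | ⟨n, rfl⟩
  · rw [Alg.φ_eq_zero_of_lt ε i h]; exact B.zero_mem
  · rw [Alg.φ_eq]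
    exact B.mul_mem (hl _ _) ((Alg.isExp_hSeq ε i).mem_of_log_mem B
      (fun n => B.smul_mem (hh _ _) _) n)

include ht in
lemma IsSingular.mem_stabilizer (hv : IsSingular R v) (a : Alg T t μ) :
    R a ∈ stabilizer (wordSpan R v) := by
  have hword (L : List (T.I0 × ℤ)) : wordVec R v L ∈ wordSpan R v := subset_span ⟨L, rfl⟩
  have hx (i : T.I0) (r : ℤ) : R (Alg.x (-1) i r) ∈ stabilizer (wordSpan R v) :=
    mem_stabilizer_span (by rintro _ ⟨L, rfl⟩; exact hword ((i, r) :: L))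
  have hv1 : span S {v} ≤ wordSpan R v := span_le.2 (Set.singleton_subset_iff.2 (hword []))
  have hstep {f : End S M} (h0 : f v ∈ wordSpan R v)
      (h1 : ∀ j r L, f (wordVec R v L) ∈ wordSpan R v →
        f (R (Alg.x (-1) j r) (wordVec R v L)) ∈ wordSpan R v) :
      f ∈ stabilizer (wordSpan R v) := by
    refine mem_stabilizer_span ?_
    rintro _ ⟨L, rfl⟩
    induction L with
    | nil => exact h0
    | cons p L ih => exact h1 _ _ L ih
  have hmul (a b : Alg T t μ) (y : M) : R a (R b y) = R (a * b) y := by rw [map_mul]; rfl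
  have hh : ∀ i m, R (Alg.h i m) ∈ stabilizer (wordSpan R v) := by
    intro i m
    have h0 : R (Alg.h i m) ∈ stabilizer (span S {v}) :=
      h_mem_of_φ_mem ht ((stabilizer (span S {v})).comap R)
        (fun ε i m => mem_stabilizer_span (by rintro _ rfl; exact hv.φ_mem ε i m))
        (fun ε i => mem_stabilizer_span (by rintro _ rfl; exact hv.κ_mem ε i)) i m
    by_cases hm : m = 0
    · rw [hm, Alg.h_eq_zero i (Or.inl rfl), map_zero]
      exact (stabilizer _).zero_mem
    refine hstep (hv1 (h0 v (Submodule.mem_span_singleton_self v))) fun j r L hL => ?_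
    rw [hmul, sub_eq_iff_eq_add.1 (Alg.h_mul_x (-1) i j r m hm), map_add, map_smul,
      LinearMap.add_apply, LinearMap.smul_apply, ← hmul, ← algebraMap_smul S]
    exact Submodule.add_mem _ (smul_mem _ _ (hword ((j, m + r) :: L))) (hx _ _ _ hL)
  have hl : ∀ ε i, R (lead ε i) ∈ stabilizer (wordSpan R v) := fun ε i =>
    hstep (hv1 (hv.φ_mem _ _ _)) fun j r L hL => by
      rw [hmul, Alg.lead_mul_x, map_smul, LinearMap.smul_apply, ← hmul, ← algebraMap_smul S]
      exact smul_mem _ _ (hx _ _ _ hL)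
  have hκ : ∀ ε i, R (Alg.κ ε i) ∈ stabilizer (wordSpan R v) := fun ε i =>
    hstep (hv1 (hv.κ_mem _ _)) fun j r L hL => by
      rw [hmul, Alg.κ_mul_x, map_smul, LinearMap.smul_apply, ← hmul, ← algebraMap_smul S]
      exact smul_mem _ _ (hx _ _ _ hL)
  have hφ : ∀ ε i m, R (Alg.φ ε i m) ∈ stabilizer (wordSpan R v) :=
    φ_mem_of_h_mem ((stabilizer (wordSpan R v)).comap R) hl hh
  refine Alg.mem_of_generators ((stabilizer (wordSpan R v)).comap R) (fun ε i r => ?_) hφ hh hκ a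
  rcases units_eq_one_or ε with rfl | rfl
  · change R (Alg.x 1 i r) ∈ stabilizer (wordSpan R v)
    refine hstep (by rw [hv.x_plus]; exact Submodule.zero_mem _) fun j s L hL => ?_
    rw [hmul, sub_eq_iff_eq_add.1 (Alg.x_commutator i j r s), map_add, LinearMap.add_apply, ← hmul]
    refine Submodule.add_mem _ ?_ (hx _ _ _ hL)
    split_ifs
    · rw [map_smul, map_sub, LinearMap.smul_apply, LinearMap.sub_apply, ← algebraMap_smul S]
      exact smul_mem _ _ (Submodule.sub_mem _ (hφ _ _ _ _ (hword L)) (hφ _ _ _ _ (hword L)))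
    · rw [map_zero]; exact Submodule.zero_mem _
  · exact hx i r

include ht in
lemma IsSingular.apply_mem (hv : IsSingular R v) (a : Alg T t μ) : R a v ∈ wordSpan R v :=
  hv.mem_stabilizer ht a v (subset_span ⟨[], rfl⟩)

/-- The product of the simple roots in a list. -/
def typeWeight (t : ℂˣ) (l : List T.I0) : Weight T := (l.map (rootWeight T t)).prod

lemma typeWeight_cons (j : T.I0) (l : List T.I0) :
    typeWeight t (j :: l) = rootWeight T t j * typeWeight t l := List.prod_cons

lemma coe_rootWeight (ε : ℤ) :
    (((rootWeight T t j i)⁻¹ ^ ε : ℂˣ) : ℂ) = qpow t (-(ε * T.sumC i j)) := by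
  rw [rootWeight, T.sumC_symm, inv_zpow', ← zpow_mul, qpow]
  push_cast
  congr 1
  ring

lemma lead_wordVec {ω : ℤˣ → Weight T}
    (hl : ∀ ε i, R (lead ε i) v = (((ω ε i) ^ (ε : ℤ) : ℂˣ) : ℂ) • v) (ε : ℤˣ) (i : T.I0)
    (L : List (T.I0 × ℤ)) : R (lead ε i) (wordVec R v L) =
      (((ω ε * (typeWeight t (L.map Prod.fst))⁻¹) i ^ (ε : ℤ) : ℂˣ) : ℂ) • wordVec R v L := by
  induction L with
  | nil =>
    rw [wordVec, hl]
    simp [typeWeight]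
  | cons p L ih =>
    have h1 : R (lead ε i) (R (Alg.x (-1) p.1 p.2) (wordVec R v L)) =
        R (lead ε i * Alg.x (-1) p.1 p.2) (wordVec R v L) := by rw [map_mul]; rfl
    rw [wordVec, h1, Alg.lead_mul_x, map_smul, map_mul, LinearMap.smul_apply, End.mul_apply,
      ih, end_map_csmul, smul_smul]
    congr 1
    rw [List.map_cons, typeWeight_cons]
    simp only [Pi.mul_apply, Pi.inv_apply, mul_inv, mul_zpow, val_mul, coe_rootWeight]
    rw [show ((ε : ℤ) * ((-1 : ℤˣ) : ℤ) * T.sumC i p.1) = -(ε * T.sumC i p.1) by push_cast; ring]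
    ring

end Words


namespace TwistedType

/-- A vector of positive integers whose image under the Cartan matrix is positive, a multiple of
the half sum of the positive coroots. -/
def height : TwistedType → ℕ → ℤ
  | A m _ _, k => (k + 1) * (m - k)
  | D n _, k => if k + 1 < n then 2 * (k + 1) * (2 * n - k) else n * (n + 1)
  | D4, k => if k = 1 then 10 else 6
  | E6, k => if k = 0 then 16 else if k = 1 then 30 else if k = 2 then 42 else
      if k = 3 then 22 else if k = 4 then 30 else 16

lemma C_eq_ite (i j : Fin T.rank) : T.C i j = if i = j then 2 else if T.Adj i j then -1 else 0 := by
  rw [C]; congr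

lemma sum_C_mul_ge (i : Fin T.rank) (f : ℕ → ℤ) (s : Finset ℕ) (hs : ∀ j, T.Adj i j → j.1 ∈ s)
    (hf : ∀ k ∈ s, 0 ≤ f k) : 2 * f i - ∑ k ∈ s, f k ≤ ∑ j, T.C i j * f j := by
  have h1 : ∀ j, T.C i j * f j = (if i = j then 2 * f j else 0) - if T.Adj i j then f j else 0 := by
    intro j
    by_cases hij : i = j
    · subst hij
      rw [C_self, if_pos rfl, if_neg (not_adj_self i), sub_zero]
    · rw [C_eq_ite, if_neg hij, if_neg hij]
      split_ifs <;> ring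
  rw [sum_congr rfl fun j _ => h1 j, sum_sub_distrib, sum_ite_eq,
    if_pos (mem_univ _), ← Finset.sum_filter]
  refine sub_le_sub_left ?_ _
  rw [← Finset.sum_image (s := univ.filter (T.Adj i)) (g := fun j : Fin T.rank => j.1)
    (f := f) fun a _ b _ h => Fin.ext h]
  refine Finset.sum_le_sum_of_subset_of_nonneg (fun k hk => ?_) fun k hk _ => hf k hk
  obtain ⟨j, hj, rfl⟩ := Finset.mem_image.1 hk
  exact hs j (mem_filter.1 hj).2

lemma height_nonneg {k : ℕ} (hk : k ≤ T.rank) : 0 ≤ T.height k := by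
  cases T <;> simp only [height, rank] at *
  · exact mul_nonneg (by omega) (by omega)
  · split_ifs
    · exact mul_nonneg (by positivity) (by omega)
    · positivity
  all_goals split_ifs <;> norm_num

lemma sum_C_mul_height_pos (i : Fin T.rank) : 0 < ∑ j, T.C i j * T.height j := by
  have key (s : Finset ℕ) (h : 0 < 2 * T.height i - ∑ k ∈ s, T.height k)
      (hf : ∀ k ∈ s, k ≤ T.rank) (hs : ∀ j, T.Adj i j → j.1 ∈ s) :
      0 < ∑ j, T.C i j * T.height j :=
    lt_of_lt_of_le h (sum_C_mul_ge i T.height s hs fun k hk => height_nonneg (hf k hk))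
  obtain ⟨i, hi⟩ := i
  cases T with
  | A m hm hm3 =>
    simp only [rank] at hi
    obtain _ | i := i
    on_goal 1 => refine key {1} ?_ ?_ fun j hj => ?_
    on_goal 4 => refine key {i, i + 2} ?_ ?_ fun j hj => ?_
    · simp only [sum_singleton, height]; push_cast; linarith
    on_goal 3 => rw [sum_pair (by omega)]; simp only [height]; push_cast; ring_nf; norm_num
    all_goals simp [Adj, edge, rank] at *; omega
  | D n hn =>
    simp only [rank] at hi
    rcases lt_or_ge (i + 1) n with h1 | h1
    · rcases lt_or_ge (i + 2) n with h2 | h2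
      · obtain _ | i := i
        on_goal 1 => refine key {1} ?_ ?_ fun j hj => ?_
        on_goal 4 => refine key {i, i + 2} ?_ ?_ fun j hj => ?_
        · simp only [sum_singleton, height, if_pos h1, if_pos h2]; push_cast; linarith
        on_goal 3 =>
          rw [sum_pair (by omega)]
          simp only [height]
          rw [if_pos h1, if_pos (by omega), if_pos (by omega)]
          push_cast; ring_nf; norm_num
        all_goals simp [Adj, edge, rank] at * <;> omega
      · obtain rfl : n = i + 2 := by omega
        obtain _ | i := i
        on_goal 1 => refine key {1, 2} ?_ ?_ fun j hj => ?_
        on_goal 4 => refine key {i, i + 2, i + 3} ?_ ?_ fun j hj => ?_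
        · simp [height]
        on_goal 3 =>
          rw [sum_insert (by simp), sum_pair (by omega)]
          simp only [height]
          rw [if_pos h1, if_pos (by omega), if_neg (by omega), if_neg (by omega)]
          push_cast; ring_nf; norm_num
        all_goals simp [Adj, edge, rank] at * <;> omega
    · refine key {n - 2} ?_ ?_ fun j hj => ?_
      · obtain ⟨n, rfl⟩ : ∃ k, n = k + 2 := ⟨n - 2, by omega⟩
        simp only [sum_singleton, height]
        rw [if_neg (by omega), if_pos (by omega), Nat.add_sub_cancel]
        push_cast; ring_nf; norm_num
      · simp [rank]; omega
      · have := j.2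
        simp [Adj, edge, rank] at *; omega
  | D4 =>
    simp only [C_eq_ite]
    exact (by decide : ∀ i : Fin D4.rank, 0 < ∑ j, (if i = j then 2 else
      if D4.Adj i j then -1 else (0 : ℤ)) * D4.height j) ⟨i, hi⟩
  | E6 =>
    simp only [C_eq_ite]
    exact (by decide : ∀ i : Fin E6.rank, 0 < ∑ j, (if i = j then 2 else
      if E6.Adj i j then -1 else (0 : ℤ)) * E6.height j) ⟨i, hi⟩

lemma exists_repr (j : Fin T.rank) : ∃ (r : T.I0) (k : ℕ), (T.σ ^ k) r.1 = j := by
  obtain ⟨_, ⟨a, rfl⟩, ha⟩ := Set.exists_min_image (Set.range fun k : ℕ => (T.σ ^ k) j) id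
    (Set.toFinite _) ⟨_, 0, rfl⟩
  refine ⟨⟨(T.σ ^ a) j, fun k => ?_⟩, a * (T.M - 1), ?_⟩
  · rw [← Equiv.Perm.mul_apply, ← pow_add]
    exact ha _ ⟨k + a, rfl⟩
  · have := T.M_pos
    rw [← Equiv.Perm.mul_apply, ← pow_add, σ_pow_of_dvd]
    · rfl
    · exact ⟨a, by obtain ⟨m, hm⟩ := Nat.exists_eq_add_of_lt this; rw [hm]; simp; ring⟩

lemma sum_C_σ_pow (i j : Fin T.rank) (k : ℕ) : ∑ s ∈ range T.M, T.C i ((T.σ ^ s) ((T.σ ^ k) j)) =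
      ∑ s ∈ range T.M, T.C i ((T.σ ^ s) j) := by
  induction k with
  | zero => rfl
  | succ k ih =>
    rw [← ih]
    have h := (Finset.sum_range_succ' (fun s => T.C i ((T.σ ^ s) ((T.σ ^ k) j))) T.M).symm.trans
      (sum_range_succ _ _)
    rw [σ_pow_M, pow_zero, add_left_inj] at h
    rw [← h]
    refine sum_congr rfl fun s _ => ?_
    rw [← Equiv.Perm.mul_apply, ← Equiv.Perm.mul_apply, ← pow_add, ← pow_add]
    congr 3
    ring

/-- The node in `I₀` on the orbit of a node. -/
def repr (j : Fin T.rank) : T.I0 := (exists_repr j).choose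

lemma sumC_repr (j : Fin T.rank) : T.sumC i (repr j) = ∑ s ∈ range T.M, T.C i.1 ((T.σ ^ s) j) := by
  obtain ⟨k, hk⟩ := (exists_repr j).choose_spec
  have h2 := sum_C_σ_pow i.1 (repr j).1 k
  rw [show (T.σ ^ k) (repr j).1 = j from hk] at h2
  have h := (Finset.sum_range_succ' (fun s => T.C i.1 ((T.σ ^ s) (repr j).1)) T.M).symm.trans
      (sum_range_succ _ _)
  rw [σ_pow_M, pow_zero, add_left_inj] at h
  rw [h2, ← h, sumC, Finset.range_eq_Ico,
    Finset.sum_Ico_add' (fun s => T.C i.1 ((T.σ ^ s) (repr j).1))]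
  rfl

/-- The height of a simple root of `I₀`. -/
def rootHeight (i : T.I0) : ℤ := ∑ j, T.sumC i (repr j) * T.height j

lemma rootHeight_pos : 0 < rootHeight i := by
  have h : rootHeight i = ∑ s ∈ range T.M, ∑ j, T.C ((T.σ ^ s)⁻¹ i.1) j * T.height j := by
    rw [rootHeight, Finset.sum_comm]
    refine sum_congr rfl fun j _ => ?_
    rw [sumC_repr, sum_mul]
    refine sum_congr rfl fun s _ => ?_
    rw [← C_σ_pow s ((T.σ ^ s)⁻¹ i.1)]
    exact congrArg (fun a => T.C a _ * _) ((T.σ ^ s).apply_symm_apply i.1).symm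
  rw [h]
  exact Finset.sum_pos (fun s _ => sum_C_mul_height_pos _) ⟨0, mem_range.2 T.M_pos⟩

end TwistedType

/-- The homomorphism on weights that measures the height. -/
def heightHom (T : TwistedType) : Weight T →* ℂˣ where
  toFun ω := ∏ j, ω (TwistedType.repr j) ^ T.height j
  map_one' := by simp
  map_mul' a b := by simp [mul_zpow, prod_mul_distrib]

lemma heightHom_rootWeight :
    heightHom T (rootWeight T t i) = (t ^ 2) ^ TwistedType.rootHeight i := by
  change ∏ j, ((t ^ 2) ^ T.sumC i (TwistedType.repr j)) ^ T.height j = _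
  rw [TwistedType.rootHeight, prod_congr rfl fun j _ => (zpow_mul _ _ _).symm]
  exact (map_sum (zpowersHom ℂˣ (t ^ 2)).toAdditiveRight _ _).symm

lemma heightHom_typeWeight (l : List T.I0) :
    heightHom T (typeWeight t l) = (t ^ 2) ^ (l.map TwistedType.rootHeight).sum := by
  induction l with
  | nil => simp [typeWeight]
  | cons i l ih => rw [typeWeight_cons, map_mul, heightHom_rootWeight, ih, List.map_cons,
      List.sum_cons, zpow_add]

lemma length_le_height (l : List T.I0) : (l.length : ℤ) ≤ (l.map TwistedType.rootHeight).sum := by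
  induction l with
  | nil => simp
  | cons i l ih =>
    have := TwistedType.rootHeight_pos i
    simp only [List.length_cons, List.map_cons, List.sum_cons]
    push_cast
    omega

lemma finite_typeWeight_eq (ht : Generic t) (ω : Weight T) :
    {l : List T.I0 | typeWeight t l = ω}.Finite := by
  rcases Set.eq_empty_or_nonempty {l : List T.I0 | typeWeight t l = ω} with h | ⟨l0, rfl⟩
  · rw [h]; exact Set.finite_empty
  refine (List.finite_length_le T.I0 (l0.map TwistedType.rootHeight).sum.toNat).subset fun l hl => ?_
  have h1 := congrArg (heightHom T) (show typeWeight t l = typeWeight t l0 from hl)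
  rw [heightHom_typeWeight, heightHom_typeWeight] at h1
  have h2 : Function.Injective fun n : ℤ => (t ^ 2) ^ n := by
    rw [injective_zpow_iff_not_isOfFinOrder, isOfFinOrder_iff_pow_eq_one]
    rintro ⟨n, hn, h⟩
    exact ht n hn h
  have h3 := h2 h1
  have := length_le_height l
  change l.length ≤ _
  omega


/-! ### Recurrent sequences -/

section Recurrent

variable {A B D : Type*} [AddCommGroup A] [Module ℂ A] [AddCommGroup B] [Module ℂ B] [AddCommGroup
  D] [Module ℂ D]

/-- A sequence that lies in a finite-dimensional space of sequences stable under the shift. -/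
def Recurrent (a : ℤ → A) : Prop :=
  ∃ F : Submodule ℂ (ℤ → A), FiniteDimensional ℂ F ∧ (∀ f ∈ F, (fun n => f (n + 1)) ∈ F) ∧ a ∈ F

lemma shift_inv_mem {F : Submodule ℂ (ℤ → A)} [FiniteDimensional ℂ F]
    (hF : ∀ f ∈ F, (fun n => f (n + 1)) ∈ F) {f : ℤ → A} (hf : f ∈ F) :
    (fun n => f (n - 1)) ∈ F := by
  let S : F →ₗ[ℂ] F := (funLeft ℂ A fun n : ℤ => n + 1).restrict hF
  have hS1 (f : F) (n : ℤ) : (S f).1 n = f.1 (n + 1) := rfl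
  have hS : Function.Injective S := fun f g h => Subtype.ext (funext fun n => by
    have := congrFun (congrArg Subtype.val h) (n - 1)
    rwa [hS1, hS1, sub_add_cancel] at this)
  obtain ⟨g, hg⟩ := LinearMap.surjective_of_injective hS ⟨f, hf⟩
  convert g.2 using 1
  funext n
  have := congrFun (congrArg Subtype.val hg) (n - 1)
  rw [hS1, sub_add_cancel] at this
  exact this.symm

lemma Recurrent.zero : Recurrent fun _ : ℤ => (0 : A) :=
  ⟨⊥, inferInstance, fun f hf => by rw [Submodule.mem_bot] at *; subst hf; rfl,
    Submodule.zero_mem _⟩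

lemma Recurrent.add {a b : ℤ → A} (ha : Recurrent a) (hb : Recurrent b) :
    Recurrent fun n => a n + b n := by
  obtain ⟨F, hF, hS, haF⟩ := ha
  obtain ⟨G, hG, hT, hbG⟩ := hb
  refine ⟨F ⊔ G, inferInstance, fun f hf => ?_, Submodule.add_mem_sup haF hbG⟩
  obtain ⟨f', hf', g', hg', rfl⟩ := Submodule.mem_sup.1 hf
  exact Submodule.add_mem_sup (hS f' hf') (hT g' hg')

lemma Recurrent.map {a : ℤ → A} (ha : Recurrent a) (g : A →ₗ[ℂ] B) :
    Recurrent fun n => g (a n) := by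
  obtain ⟨F, hF, hS, haF⟩ := ha
  refine ⟨F.map (g.compLeft ℤ), inferInstance, ?_, ⟨a, haF, rfl⟩⟩
  rintro _ ⟨f, hf, rfl⟩
  exact ⟨_, hS f hf, rfl⟩

lemma Recurrent.reflect {a : ℤ → A} (ha : Recurrent a) (c : ℤ) : Recurrent fun n => a (c - n) := by
  obtain ⟨F, hF, hS, haF⟩ := ha
  refine ⟨F.map (funLeft ℂ A fun n : ℤ => c - n), inferInstance, ?_, ⟨a, haF, rfl⟩⟩
  rintro _ ⟨f, hf, rfl⟩
  refine ⟨_, shift_inv_mem hS hf, funext fun n => ?_⟩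
  change f (c - n - 1) = f (c - (n + 1))
  rw [sub_sub]

lemma Recurrent.bilin {a : ℤ → A} {b : ℤ → B} (ha : Recurrent a) (hb : Recurrent b)
    (g : A →ₗ[ℂ] B →ₗ[ℂ] D) : Recurrent fun n => g (a n) (b n) := by
  obtain ⟨F, hF, hS, haF⟩ := ha
  obtain ⟨G, hG, hT, hbG⟩ := hb
  let β : (ℤ → A) →ₗ[ℂ] (ℤ → B) →ₗ[ℂ] (ℤ → D) :=
    LinearMap.mk₂ ℂ (fun f h n => g (f n) (h n)) (fun f f' h => by ext; simp)
      (fun c f h => by ext; simp) (fun f h h' => by ext; simp) (fun c f h => by ext; simp)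
  refine ⟨map₂ β F G, ?_, fun f hf => ?_, Submodule.apply_mem_map₂ β haF hbG⟩
  · exact iff_fg.2 ((iff_fg.1 hF).map₂ β (iff_fg.1 hG))
  · have : map₂ β F G ≤ (map₂ β F G).comap (funLeft ℂ D fun n : ℤ => n + 1) :=
      map₂_le.2 fun f hf h hh => Submodule.apply_mem_map₂ β (hS f hf) (hT h hh)
    exact this hf

lemma Recurrent.exists_polynomial {a : ℤ → A} (ha : Recurrent a) :
    ∃ p : Polynomial ℂ, p ≠ 0 ∧ ∀ n, ∑ k ∈ p.support, p.coeff k • a (n + k) = 0 := by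
  obtain ⟨F, hF, hS, haF⟩ := ha
  let S : F →ₗ[ℂ] F := (funLeft ℂ A fun n : ℤ => n + 1).restrict hS
  have hpow (k : ℕ) (f : F) (n : ℤ) : ((S ^ k) f).1 n = f.1 (n + k) := by
    induction k generalizing n with
    | zero => simp
    | succ k ih =>
      rw [pow_succ', End.mul_apply]
      change ((S ^ k) f).1 (n + 1) = _
      rw [ih]
      push_cast
      ring_nf
  refine ⟨minpoly ℂ S, minpoly.ne_zero (Algebra.IsIntegral.isIntegral S), fun n => ?_⟩
  have h := congrFun (congrArg Subtype.val (LinearMap.congr_fun (minpoly.aeval ℂ S) ⟨a, haF⟩)) n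
  rw [Polynomial.aeval_eq_sum_range, LinearMap.sum_apply] at h
  rw [← Polynomial.sum_def (p := minpoly ℂ S) (f := fun k c => c • a (n + (k : ℤ))),
    Polynomial.sum_over_range _ (by simp)]
  refine Eq.trans ?_ h
  rw [AddSubmonoidClass.coe_finsetSum, Finset.sum_apply]
  refine sum_congr rfl fun k _ => ?_
  rw [LinearMap.smul_apply, coe_smul, Pi.smul_apply, hpow]

lemma Recurrent.mem_of_neg {a : ℤ → A} (ha : Recurrent a) {P : Submodule ℂ A}
    (h : ∀ n < 0, a n ∈ P) (n : ℤ) : a n ∈ P := by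
  obtain ⟨F, hF, hS, haF⟩ := ha
  let G : Submodule ℂ (ℤ → A) :=
    { carrier := {f | f ∈ F ∧ ∀ n < 0, f n ∈ P}
      zero_mem' := ⟨F.zero_mem, fun _ _ => P.zero_mem⟩
      add_mem' := fun hf hg => ⟨F.add_mem hf.1 hg.1, fun n hn => P.add_mem (hf.2 n hn) (hg.2 n hn)⟩
      smul_mem' := fun c f hf => ⟨F.smul_mem c hf.1, fun n hn => P.smul_mem c (hf.2 n hn)⟩ }
  have hGF : G ≤ F := fun f hf => hf.1
  have hG : FiniteDimensional ℂ G := finiteDimensional_of_le hGF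
  have hGS : ∀ f ∈ G, (fun n => f (n + 1)) ∈ G := by
    let S : G →ₗ[ℂ] G := (funLeft ℂ A fun n : ℤ => n - 1).restrict fun f hf =>
      ⟨shift_inv_mem hS hf.1, fun n hn => hf.2 (n - 1) (by omega)⟩
    have hS1 (f : G) (n : ℤ) : (S f).1 n = f.1 (n - 1) := rfl
    have hSi : Function.Injective S := fun f g h => Subtype.ext (funext fun n => by
      have := congrFun (congrArg Subtype.val h) (n + 1)
      rwa [hS1, hS1, add_sub_cancel_right] at this)
    intro f hf
    obtain ⟨g, hg⟩ := LinearMap.surjective_of_injective hSi ⟨f, hf⟩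
    convert g.2 using 1
    funext n
    have := congrFun (congrArg Subtype.val hg) (n + 1)
    rw [hS1, add_sub_cancel_right] at this
    exact this.symm
  have key (k : ℕ) : (fun n => a (n + k)) ∈ G := by
    induction k with
    | zero => simpa using ⟨haF, h⟩
    | succ k ih =>
      convert hGS _ ih using 2
      push_cast
      ring_nf
  rcases lt_or_ge n 0 with hn | hn
  · exact h n hn
  · have := (key (n + 1).toNat).2 (-1) (by norm_num)
    simpa [toNat_of_nonneg (show 0 ≤ n + 1 by omega)] using this

lemma Recurrent.mem_of_pos {a : ℤ → A} (ha : Recurrent a) {P : Submodule ℂ A}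
    (h : ∀ n, 0 < n → a n ∈ P) (n : ℤ) : a n ∈ P := by
  have := (ha.reflect 0).mem_of_neg (P := P) (fun n hn => h _ (by omega)) (-n)
  simpa using this

end Recurrent

/-! ### Recurrence of the modes of the currents -/

lemma qpow_sub_ne_zero (ht : Generic t) {n : ℤ} (hn : n ≠ 0) : qpow t n - qpow t (-n) ≠ 0 := by
  intro h
  apply qpow_ne_one ht (n := n + n) (by omega)
  rw [qpow_add]
  nth_rewrite 1 [sub_eq_zero.1 h]
  rw [← qpow_add, neg_add_cancel, qpow_zero]

lemma sum_qpow_Cσ_ne_zero (ht : Generic t) (i : T.I0) {m : ℤ} (hm : m ≠ 0) :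
    ∑ s ∈ Finset.Icc 1 T.M, (qpow t (m * T.Cσ i i s) - qpow t (-(m * T.Cσ i i s))) ≠ 0 := by
  by_cases hi : T.IsFixed i
  · rw [sum_congr rfl fun s _ => by rw [TwistedType.Cσ_of_fixed_left hi,
      TwistedType.C_self], Finset.sum_const, nsmul_eq_mul]
    refine mul_ne_zero ?_ (qpow_sub_ne_zero ht (by omega))
    have := T.M_pos
    simp only [Nat.card_Icc]
    exact_mod_cast (by omega)
  have hM : T.Cσ i i T.M = 2 := by rw [TwistedType.Cσ_M, TwistedType.C_self]
  by_cases hs : T.Cσ i i 1 = -1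
  · have h2 := (TwistedType.short_M hs).1
    rw [h2] at hM ⊢
    rw [show Finset.Icc 1 2 = {1, 2} from rfl, sum_pair (by norm_num), hs, hM]
    intro h
    apply qpow_ne_one ht (n := 6 * m) (by omega)
    have hQ := qpow_ne_zero t m
    have h6 : qpow t (6 * m) = qpow t m ^ 6 := qpow_mul_nat t 6 m
    have e2 : qpow t (m * 2) = qpow t m ^ 2 := by rw [mul_comm]; exact qpow_mul_nat t 2 m
    rw [mul_neg_one, neg_neg, qpow_neg, qpow_neg, e2] at h
    rw [h6]
    have hne : qpow t m ^ 2 - 1 ≠ 0 := fun h => by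
      apply qpow_ne_one ht (n := 2 * m) (by omega)
      rw [mul_comm, e2]
      exact sub_eq_zero.1 h
    have h3 : (qpow t m ^ 2 - 1) * (qpow t m ^ 2 - qpow t m + 1) = 0 := by
      field_simp at h
      linear_combination h
    have h4 := (mul_eq_zero.1 h3).resolve_left hne
    linear_combination (qpow t m - 1) * (qpow t m + 1) * (qpow t m ^ 2 + qpow t m + 1) * h4
  · rw [Finset.sum_eq_single T.M]
    · rw [hM]; exact qpow_sub_ne_zero ht (by omega)
    · intro s hs1 hs2
      rw [mem_Icc] at hs1
      rw [TwistedType.Cσ_self_cases hi hs hs1.1 (lt_of_le_of_ne hs1.2 hs2)]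
      simp
    · intro h
      exact absurd (mem_Icc.2 ⟨T.M_pos, le_rfl⟩) h

lemma exists_ad_h (ht : Generic t) (ε : ℤˣ) (i : T.I0) (k : ℤ) (hk : k ≠ 0) : ∃ c : ℂ, c ≠ 0 ∧ ∀ r,
      c • (Alg.x ε i (r + T.M * k) : Alg T t μ) =
        Alg.h i (T.M * k) * Alg.x ε i r - Alg.x ε i r * Alg.h i (T.M * k) := by
  have hM : (T.M : ℤ) * k ≠ 0 := mul_ne_zero (by exact_mod_cast T.M_pos.ne') hk
  refine ⟨_, ?_, fun r => by rw [Alg.h_mul_x ε i i r _ hM, add_comm r]⟩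
  refine mul_ne_zero (mul_ne_zero (by exact_mod_cast ε.ne_zero)
    (one_div_ne_zero (by exact_mod_cast hM))) ?_
  have h1 : ∀ s : ℕ, T.ζ ^ (T.M * k * (s : ℤ)) = 1 := fun s => by
    rw [mul_assoc, zpow_mul, zpow_natCast, T.isPrimitiveRoot_ζ.pow_eq_one, one_zpow]
  rw [sum_congr rfl fun s _ => by rw [h1, mul_one], ← Finset.sum_div]
  exact div_ne_zero (sum_qpow_Cσ_ne_zero ht i hM) (qdiff_ne_zero ht i)

lemma recurrent_of_finite (ht : Generic t)
    (ρ : Alg T t μ →ₐ[ℂ] End ℂ V) {E E' : Submodule ℂ V} [FiniteDimensional ℂ E]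
    [FiniteDimensional ℂ E'] (ε : ℤˣ) (i : T.I0) (hE : ∀ m, ∀ w ∈ E, ρ (Alg.h i m) w ∈ E)
    (hE' : ∀ m, ∀ w ∈ E', ρ (Alg.h i m) w ∈ E')
    (hx : ∀ r, ∀ w ∈ E, ρ (Alg.x ε i r) w ∈ E') {w : V} (hw : w ∈ E) :
    Recurrent fun r => ρ (Alg.x ε i r) w := by
  obtain ⟨c, hc, hcx⟩ := exists_ad_h (μ := μ) ht ε i 1 one_ne_zero
  obtain ⟨d, hd, hdx⟩ := exists_ad_h (μ := μ) ht ε i (-1) (by norm_num)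
  rw [mul_one] at hcx
  rw [mul_neg_one] at hdx
  let ad (m : ℤ) : (E →ₗ[ℂ] E') →ₗ[ℂ] (E →ₗ[ℂ] E') :=
    LinearMap.compRight ℂ ((ρ (Alg.h i m)).restrict (hE' m)) -
      LinearMap.lcomp ℂ E' ((ρ (Alg.h i m)).restrict (hE m))
  let X (r : ℤ) : E →ₗ[ℂ] E' := (ρ (Alg.x ε i r)).restrict (hx r)
  have hX (c : ℂ) (r s m : ℤ) (h : c • (Alg.x ε i s : Alg T t μ) =
      Alg.h i m * Alg.x ε i r - Alg.x ε i r * Alg.h i m) : c • X s = ad m (X r) := by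
    ext w
    have := congrArg (fun a => ρ a (w : V)) h
    simpa [ad, X] using this
  let F : Submodule ℂ (ℤ → (E →ₗ[ℂ] E')) :=
    { carrier := {f | ∀ n, c • f (n + T.M) = ad T.M (f n) ∧ d • f (n + -T.M) = ad (-T.M) (f n)}
      zero_mem' := fun n => by simp
      add_mem' := fun {f g} hf hg n => by
        simp only [Pi.add_apply, smul_add, map_add, (hf n).1, (hf n).2, (hg n).1, (hg n).2,
          and_self]
      smul_mem' := fun a f hf n => by
        simp only [Pi.smul_apply, smul_comm _ a, map_smul, (hf n).1, (hf n).2, and_self] }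
  let ev : F →ₗ[ℂ] (Fin T.M → (E →ₗ[ℂ] E')) :=
    (funLeft ℂ (E →ₗ[ℂ] E') fun n : Fin T.M => (n : ℤ)).comp F.subtype
  have hev : Function.Injective ev := by
    rw [injective_iff_map_eq_zero]
    intro f hf
    apply Subtype.ext
    funext n
    have h1 (k : ℤ) : ∀ r : Fin T.M, f.1 (r + T.M * k) = 0 := by
      induction k using Int.induction_on with
      | zero => intro r; rw [mul_zero, add_zero]; exact congrFun hf r
      | succ k ih =>
        intro r
        have := (f.2 (r + T.M * k)).1
        rw [ih, map_zero, add_assoc, ← mul_add_one] at this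
        exact (smul_eq_zero.1 this).resolve_left hc
      | pred k ih =>
        intro r
        have := (f.2 (r + T.M * -k)).2
        rw [ih, map_zero, add_assoc, ← sub_eq_add_neg (_ * _), ← mul_sub_one] at this
        exact (smul_eq_zero.1 this).resolve_left hd
    have hM : (0 : ℤ) < T.M := by exact_mod_cast T.M_pos
    have := h1 (n / T.M) ⟨(n % T.M).toNat, by
      have := Int.emod_lt_of_pos n hM; have := Int.emod_nonneg n hM.ne'; omega⟩
    rwa [toNat_of_nonneg (Int.emod_nonneg n hM.ne'), Int.emod_add_mul_ediv] at this
  have hF : Recurrent X := by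
    refine ⟨F, FiniteDimensional.of_injective ev hev, fun f hf n => ?_, fun n =>
      ⟨hX c n _ _ (hcx n), hX d n _ _ (hdx n)⟩⟩
    have := hf (n + 1)
    rw [show n + 1 + T.M = n + T.M + 1 by ring, show n + 1 + -T.M = n + -T.M + 1 by ring] at this
    exact this
  exact hF.map (E'.subtype.comp (LinearMap.applyₗ ⟨w, hw⟩))


/-! ### Weight spaces and highest weight modules -/

section WeightSpaces

lemma mem_weightSpace {ε : ℤˣ} {ω : Weight T} {w : V} : w ∈ weightSpace ρ ε ω ↔
    ∀ i, ρ (lead ε i) w = (((ω i) ^ (ε : ℤ) : ℂˣ) : ℂ) • w := by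
  simp [weightSpace]

lemma x_mem_weightSpace {ε : ℤˣ} {ω : Weight T} {w : V} (hw : w ∈ weightSpace ρ ε ω)
    (ε' : ℤˣ) (j : T.I0) (r : ℤ) :
    ρ (Alg.x ε' j r) w ∈ weightSpace ρ ε (ω * rootWeight T t j ^ (ε' : ℤ)) := by
  rw [mem_weightSpace] at hw ⊢
  intro i
  have h : ρ (lead ε i) (ρ (Alg.x ε' j r) w) = ρ (lead ε i * Alg.x ε' j r) w := by rw [map_mul]; rfl
  rw [h, Alg.lead_mul_x, map_smul, map_mul, LinearMap.smul_apply, End.mul_apply, hw,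
    map_smul, smul_smul]
  congr 1
  have h2 : (((rootWeight T t j ^ (ε' : ℤ)) i ^ (ε : ℤ) : ℂˣ) : ℂ) =
      qpow t (ε * ε' * T.sumC i j) := by
    have := coe_rootWeight (t := t) i j (-(ε * ε'))
    rw [neg_mul, neg_neg, inv_zpow', neg_neg] at this
    rw [← this, Pi.pow_apply, ← zpow_mul, mul_comm (ε' : ℤ)]
  rw [Pi.mul_apply, mul_zpow, val_mul, h2, mul_comm]

lemma mem_weightSpace_of_commute {ε : ℤˣ} {ω : Weight T} {w : V} (hw : w ∈ weightSpace ρ ε ω)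
    {a : Alg T t μ} (ha : ∀ i, lead ε i * a = a * lead ε i) :
    ρ a w ∈ weightSpace ρ ε ω := by
  rw [mem_weightSpace] at hw ⊢
  intro i
  have h : ρ (lead ε i) (ρ a w) = ρ (lead ε i * a) w := by rw [map_mul]; rfl
  rw [h, ha, map_mul, End.mul_apply, hw, map_smul]

lemma h_mem_weightSpace {ε : ℤˣ} {ω : Weight T} {w : V} (hw : w ∈ weightSpace ρ ε ω)
    (i : T.I0) (m : ℤ) : ρ (Alg.h i m) w ∈ weightSpace ρ ε ω :=
  mem_weightSpace_of_commute hw fun _ => Alg.φ_h_comm _ _ _ _ _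

lemma φ_mem_weightSpace {ε : ℤˣ} {ω : Weight T} {w : V} (hw : w ∈ weightSpace ρ ε ω)
    (ε' : ℤˣ) (i : T.I0) (m : ℤ) : ρ (Alg.φ ε' i m) w ∈ weightSpace ρ ε ω :=
  mem_weightSpace_of_commute hw fun _ => Alg.φ_comm _ _ _ _ _ _

lemma commute_φ (ε ε' : ℤˣ) (i j : T.I0) (m n : ℤ) :
    Commute (ρ (Alg.φ ε i m)) (ρ (Alg.φ ε' j n)) := by
  rw [commute_iff_eq, ← map_mul, Alg.φ_comm, map_mul]

lemma InO.induction (hO : InO ρ) {p : V → Prop} (h : ∀ ω, ∀ w ∈ weightSpace ρ 1 ω, p w)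
    (h0 : p 0) (hadd : ∀ w w', p w → p w' → p (w + w')) (w : V) : p w :=
  Submodule.iSup_induction (weightSpace ρ 1) (motive := p) (hO.iSup_eq_top 1 ▸ mem_top) h h0 hadd

lemma InO.recurrent_x (hO : InO ρ) (ht : Generic t) (ε : ℤˣ) (i : T.I0)
    (w : V) : Recurrent fun r => ρ (Alg.x ε i r) w := by
  refine hO.induction (p := fun w => Recurrent fun r => ρ (Alg.x ε i r) w) (fun ω w hw => ?_) ?_
    (fun w w' h h' => ?_) w
  · have := hO.finite 1 ω
    have := hO.finite 1 (ω * rootWeight T t i ^ (ε : ℤ))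
    exact recurrent_of_finite ht ρ ε i (fun m w hw => h_mem_weightSpace hw i m)
      (fun m w hw => h_mem_weightSpace hw i m) (fun r w hw => x_mem_weightSpace hw ε i r) hw
  · simpa using Recurrent.zero
  · simpa using h.add h'

lemma φ_sub_φ (ht : Generic t) (i : T.I0) (m : ℤ) (w : V) :
    ρ (Alg.φ 1 i m) w - ρ (Alg.φ (-1) i m) w =
      qdiff T t i • (ρ (Alg.x 1 i m) (ρ (Alg.x (-1) i 0) w) -
        ρ (Alg.x (-1) i 0) (ρ (Alg.x 1 i m) w)) := by
  have h := congrArg (fun a => ρ a w) (Alg.x_commutator (t := t) (μ := μ) i i m 0)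
  rw [if_pos ⟨rfl, fun _ => dvd_zero _⟩] at h
  simp only [map_sub, map_smul, map_mul, LinearMap.sub_apply, LinearMap.smul_apply,
    End.mul_apply, add_zero] at h
  rw [h, smul_smul, mul_inv_cancel₀ (qdiff_ne_zero ht i), one_smul]

lemma InO.recurrent_φ (hO : InO ρ) (ht : Generic t) (i : T.I0) (w : V) :
    Recurrent fun m => ρ (Alg.φ 1 i m) w - ρ (Alg.φ (-1) i m) w := by
  have h1 := (hO.recurrent_x ht 1 i (ρ (Alg.x (-1) i 0) w)).map
    (qdiff T t i • LinearMap.id : V →ₗ[ℂ] V)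
  have h2 := (hO.recurrent_x ht 1 i w).map (-(qdiff T t i • ρ (Alg.x (-1) i 0)))
  convert h1.add h2 using 2 with m
  rw [φ_sub_φ ht, smul_sub, sub_eq_add_neg]
  rfl

/-! ### Joint generalized eigenspaces -/

/-- The joint generalized eigenspace of a family of endomorphisms. -/
def jointGen {ι : Type*} (f : ι → End ℂ V) (χ : ι → ℂ) : Submodule ℂ V :=
  ⨅ i, (f i).maxGenEigenspace (χ i)

lemma iSupIndep_jointGen {ι : Type*} {f : ι → End ℂ V} (hf : ∀ i j, Commute (f i) (f j)) :
    iSupIndep (jointGen f) :=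
  End.independent_iInf_maxGenEigenspace_of_forall_mapsTo f fun i j _ =>
    End.mapsTo_maxGenEigenspace_of_comm (hf j i) _

lemma weightSpace_le_jointGen (ω : Weight T) : weightSpace ρ ε ω ≤ jointGen (fun i => ρ (lead ε i))
      fun i => (((ω i) ^ (ε : ℤ) : ℂˣ) : ℂ) :=
  iInf_mono fun i => (genEigenspace _ _).mono (by simp)

lemma injective_weight :
    Function.Injective fun (ω : Weight T) i => (((ω i) ^ (ε : ℤ) : ℂˣ) : ℂ) := by
  intro ω ω' h
  funext i
  have := Units.ext (congrFun h i)
  rcases units_eq_one_or ε with rfl | rfl <;> simpa using this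

lemma iSupIndep_jointGen_lead : iSupIndep fun ω : Weight T =>
    jointGen (fun i => ρ (lead ε i)) fun i => (((ω i) ^ (ε : ℤ) : ℂˣ) : ℂ) :=
  (iSupIndep_jointGen (f := fun i => ρ (lead ε i)) fun _ _ => commute_φ _ _ _ _ _ _).comp
    (injective_weight ε)

lemma iSupIndep_weightSpace : iSupIndep (weightSpace ρ ε) :=
  (iSupIndep_jointGen_lead ε).mono (weightSpace_le_jointGen ε)

lemma InO.weightSpace_eq (hO : InO ρ) (ε : ℤˣ) (ω : Weight T) : weightSpace ρ ε ω =
    jointGen (fun i => ρ (lead ε i)) fun i => (((ω i) ^ (ε : ℤ) : ℂˣ) : ℂ) :=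
  congrFun (eq_of_iSup_eq_top (iSupIndep_jointGen_lead ε) (weightSpace_le_jointGen ε)
    (hO.iSup_eq_top ε)) ω

/-! ### Modules generated by a singular vector -/

variable {v : V} {ω : ℤˣ → Weight T}

lemma wordSpace_le_weightSpace
    (hl : ∀ ε i, ρ (lead ε i) v = (((ω ε i) ^ (ε : ℤ) : ℂˣ) : ℂ) • v) (ε : ℤˣ)
    (l : List T.I0) : wordSpace ρ v l ≤ weightSpace ρ ε (ω ε * (typeWeight t l)⁻¹) := by
  refine span_le.2 ?_
  rintro _ ⟨L, rfl, rfl⟩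
  exact mem_weightSpace.2 fun i => lead_wordVec hl ε i L

lemma IsSingular.wordSpan_eq_top (hv : IsSingular ρ v)
    (ht : Generic t) (hgen : ∀ w : V, ∃ a : Alg T t μ, ρ a v = w) :
    wordSpan ρ v = ⊤ := by
  refine eq_top_iff.2 fun w _ => ?_
  obtain ⟨a, rfl⟩ := hgen w
  exact hv.apply_mem ht a

lemma IsSingular.weightSpace_eq_iSup (hv : IsSingular ρ v)
    (ht : Generic t) (hgen : ∀ w : V, ∃ a : Alg T t μ, ρ a v = w)
    (hl : ∀ ε i, ρ (lead ε i) v = (((ω ε i) ^ (ε : ℤ) : ℂˣ) : ℂ) • v) (ε : ℤˣ)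
    (ω' : Weight T) : weightSpace ρ ε ω' =
      ⨆ (l : List T.I0) (_ : ω ε * (typeWeight t l)⁻¹ = ω'), wordSpace ρ v l := by
  refine (congrFun (eq_of_iSup_eq_top (B := fun ω' => ⨆ (l : List T.I0)
    (_ : ω ε * (typeWeight t l)⁻¹ = ω'), wordSpace ρ v l) (iSupIndep_weightSpace ε)
    (fun ω' => iSup₂_le fun l hl' => ?_) ?_) ω').symm
  · exact hl' ▸ wordSpace_le_weightSpace hl ε l
  · rw [eq_top_iff, ← hv.wordSpan_eq_top ht hgen, wordSpan_eq_iSup]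
    exact iSup_le fun l => le_iSup_of_le _ (le_iSup₂_of_le l rfl le_rfl)

lemma finite_weight (ht : Generic t) (ω0 ω' : Weight T) :
    {l : List T.I0 | ω0 * (typeWeight t l)⁻¹ = ω'}.Finite := by
  refine (finite_typeWeight_eq ht (ω'⁻¹ * ω0)).subset fun l hl => ?_
  have hl : ω0 * (typeWeight t l)⁻¹ = ω' := hl
  change typeWeight t l = _
  rw [← hl]
  group

lemma typeWeight_eq_prod (l : List T.I0) :
    ∃ n : T.I0 → ℕ, typeWeight t l = ∏ i, rootWeight T t i ^ n i := by
  induction l with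
  | nil => exact ⟨0, by simp [typeWeight]⟩
  | cons j l ih =>
    obtain ⟨n, hn⟩ := ih
    refine ⟨n + Pi.single j 1, ?_⟩
    rw [typeWeight_cons, hn]
    simp_rw [Pi.add_apply, pow_add, prod_mul_distrib]
    rw [mul_comm, Finset.prod_eq_single j (f := fun i => rootWeight T t i ^
      (Pi.single j 1 : T.I0 → ℕ) i) (fun i _ hi => by rw [Pi.single_eq_of_ne hi, pow_zero])
      (by simp), Pi.single_eq_same, pow_one]

lemma IsSingular.inO (hv : IsSingular ρ v)
    (ht : Generic t) (hgen : ∀ w : V, ∃ a : Alg T t μ, ρ a v = w)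
    (hl : ∀ ε i, ρ (lead ε i) v = (((ω ε i) ^ (ε : ℤ) : ℂˣ) : ℂ) • v)
    (hfin : ∀ l, FiniteDimensional ℂ (wordSpace ρ v l)) : InO ρ where
  indep := iSupIndep_weightSpace
  iSup_eq_top ε := by
    rw [eq_top_iff, ← hv.wordSpan_eq_top ht hgen, wordSpan_eq_iSup]
    exact iSup_le fun l => le_iSup_of_le _ (wordSpace_le_weightSpace hl ε l)
  finite ε ω' := by
    rw [hv.weightSpace_eq_iSup ht hgen hl, iSup_subtype']
    have : Finite {l : List T.I0 // ω ε * (typeWeight t l)⁻¹ = ω'} :=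
      (finite_weight ht (ω ε) ω').to_subtype
    exact Submodule.finite_iSup _
  cone := by
    classical
    refine ⟨{ω 1, ω (-1)}, fun ε ω' h => ?_⟩
    rw [hv.weightSpace_eq_iSup ht hgen hl, ne_eq, iSup_eq_bot, not_forall] at h
    obtain ⟨l, h⟩ := h
    rw [iSup_eq_bot, not_forall] at h
    obtain ⟨rfl, -⟩ := h
    refine ⟨ω ε, ?_, ?_⟩
    · rcases units_eq_one_or ε with rfl | rfl <;> simp
    · obtain ⟨n, hn⟩ := typeWeight_eq_prod (t := t) l
      exact ⟨n, by rw [← hn, mul_inv_rev, inv_inv, mul_comm, mul_assoc, inv_mul_cancel, mul_one]⟩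

variable {Ψ : LWeight T μ}

lemma IsHighest.exists_weight (hv : IsHighest ρ Ψ v) : ∃ ω : ℤˣ → Weight T,
    ∀ ε i, ρ (lead ε i) v = (((ω ε i) ^ (ε : ℤ) : ℂˣ) : ℂ) • v := by
  have h (ε : ℤˣ) (i : T.I0) : ∃ c : ℂˣ, ρ (lead ε i) v = ((c ^ (ε : ℤ) : ℂˣ) : ℂ) • v := by
    obtain ⟨c, hc⟩ : ∃ c : ℂ, ρ (lead ε i) v = c • v := by
      rcases units_eq_one_or ε with rfl | rfl
      · exact ⟨_, hv.φ_plus _ _⟩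
      · exact ⟨_, hv.φ_minus _ _⟩
    have h0 : c ≠ 0 := by
      rintro rfl
      apply hv.ne_zero
      have h1 : ρ (Alg.κ ε i * lead ε i) v = v := by rw [Alg.κ_mul_lead, map_one]; rfl
      rw [map_mul, End.mul_apply, hc, zero_smul, map_zero] at h1
      exact h1.symm
    refine ⟨mk0 c h0 ^ (ε : ℤ), hc.trans ?_⟩
    rw [← zpow_mul]
    rcases units_eq_one_or ε with rfl | rfl <;> simp
  choose ω hω using h
  exact ⟨ω, hω⟩

lemma κ_mem_span {S M : Type*} [CommRing S] [Algebra ℂ S] [AddCommGroup M] [Module S M]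
    [Module ℂ M] [IsScalarTower ℂ S M] {R : Alg T t μ →ₐ[ℂ] End S M} {v : M} {ε : ℤˣ}
    {i : T.I0} {c : Sˣ} (h : R (lead ε i) v = (c : S) • v) : R (Alg.κ ε i) v ∈ span S {v} := by
  have h1 : R (Alg.κ ε i * lead ε i) v = v := by rw [Alg.κ_mul_lead, map_one]; rfl
  rw [map_mul, End.mul_apply, h, map_smul] at h1
  refine mem_span_singleton.2 ⟨(c⁻¹ : Sˣ), ?_⟩
  nth_rewrite 1 [← h1]
  rw [smul_smul, Units.inv_mul, one_smul]

lemma IsHighest.isSingular (hv : IsHighest ρ Ψ v) : IsSingular ρ v where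
  x_plus := hv.x_plus
  φ_mem ε i m := by
    rcases units_eq_one_or ε with rfl | rfl
    · rw [hv.φ_plus]; exact mem_span_singleton.2 ⟨_, rfl⟩
    · rw [hv.φ_minus]; exact mem_span_singleton.2 ⟨_, rfl⟩
  κ_mem ε i := by
    obtain ⟨ω, hω⟩ := hv.exists_weight
    exact κ_mem_span (hω ε i)

end WeightSpaces


/-! ### The deformed action -/

section Restrict

/-- Operators linear over Laurent series are linear over rational functions. -/
def ratEnd : End (LaurentSeries ℂ) (LaurentVec W) →ₐ[ℂ] End (RatFunc ℂ) (LaurentVec W) where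
  toFun f :=
    { toFun := f
      map_add' := map_add f
      map_smul' := fun c x => map_smul f (expandZero ℂ c) x }
  map_one' := rfl
  map_mul' _ _ := rfl
  map_zero' := rfl
  map_add' _ _ := rfl
  commutes' c := by
    ext1 x
    change algebraMap ℂ (End (LaurentSeries ℂ) (LaurentVec W)) c x = _
    rw [algebraMap_end_apply, algebraMap_end_apply]

/-- Operators linear over Laurent series are linear over the rational functions regular at `1`. -/
def regEnd : End (LaurentSeries ℂ) (LaurentVec W) →ₐ[ℂ] End regOne (LaurentVec W) where
  toFun f :=
    { toFun := f
      map_add' := map_add f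
      map_smul' := fun c x => map_smul f (expandZero ℂ c.1) x }
  map_one' := rfl
  map_mul' _ _ := rfl
  map_zero' := rfl
  map_add' _ _ := rfl
  commutes' c := by
    ext1 x
    change algebraMap ℂ (End (LaurentSeries ℂ) (LaurentVec W)) c x = _
    rw [algebraMap_end_apply, algebraMap_end_apply]

lemma ratEnd_apply (f : End (LaurentSeries ℂ) (LaurentVec W)) (x : LaurentVec W) :
    ratEnd f x = f x := rfl

lemma lcoeff_laurentAct (A : HahnSeries ℤ (End ℂ W)) (f : LaurentVec W) (n : ℤ)
    (s : Finset ℤ) (h : ∀ a, a ∉ s → A.coeff a (lcoeff (n - a) f) = 0) :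
    lcoeff n (laurentAct A f) = ∑ a ∈ s, A.coeff a (lcoeff (n - a) f) := by
  have h0 : lcoeff n (laurentAct A f) = ((HahnModule.of (End ℂ W)).symm
    (A • HahnModule.of (End ℂ W) ((HahnModule.of ℂ).symm f))).coeff n := rfl
  rw [h0, HahnModule.coeff_smul]
  refine Finset.sum_bij_ne_zero (fun ij _ _ => ij.1) (fun ij hij h1 => ?_) (fun ij hij _ ij' hij' _
    h1 => ?_) (fun a ha h1 => ?_) (fun ij hij _ => ?_)
  · rw [mem_vaddAntidiagonal] at hij
    by_contra h2
    apply h1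
    have := h _ h2
    rwa [show n - ij.1 = ij.2 by have := hij.2.2; simp only [vadd_eq_add] at this; omega] at this
  · rw [mem_vaddAntidiagonal] at hij hij'
    have e1 := hij.2.2
    have e2 := hij'.2.2
    simp only [vadd_eq_add] at e1 e2
    exact Prod.ext h1 (by omega)
  · refine ⟨(a, n - a), ?_, h1, rfl⟩
    rw [mem_vaddAntidiagonal]
    refine ⟨fun h2 => h1 ?_, fun h2 => h1 ?_, by simp⟩
    · rw [show A.coeff a = 0 from h2, LinearMap.zero_apply]
    · rw [show lcoeff (n - a) f = 0 from h2, map_zero]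
  · rw [mem_vaddAntidiagonal] at hij
    have := hij.2.2
    simp only [vadd_eq_add] at this
    rw [show n - ij.1 = ij.2 by omega]
    rfl

lemma uUnit_zpow_smul (m : ℤ) (f : LaurentVec W) :
    ((uUnit ^ m : regOneˣ) : regOne) • f = (RatFunc.X ^ m : RatFunc ℂ) • f := by
  rw [regOne_smul_def]
  congr 1
  have h := congrArg Units.val (map_zpow (Units.map (regOne.val : regOne →* RatFunc ℂ)) uUnit m)
  rw [Units.val_zpow_eq_zpow_val] at h
  exact h.trans (congrArg (· ^ m) coe_uUnit)

lemma lcoeff_uUnit_zpow_smul (m n : ℤ) (f : LaurentVec W) :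
    lcoeff n (((uUnit ^ m : regOneˣ) : regOne) • f) = lcoeff (n - m) f := by
  rw [uUnit_zpow_smul, lcoeff_X_zpow_smul]

end Restrict

section DeformedAct

variable (ρ1) (ρ2)

/-- The action of the tensor product of the algebras on the tensor product of the modules. -/
def tensorOp : Alg T t μ1 ⊗[ℂ] Alg T t μ2 →ₐ[ℂ] End ℂ V12 :=
  Module.endTensorEndAlgHom.comp (Algebra.TensorProduct.map ρ1 ρ2)

lemma tensorOp_tmul (a : Alg T t μ1) (b : Alg T t μ2) (v : V1) (w : V2) :
    tensorOp ρ1 ρ2 (a ⊗ₜ b) (v ⊗ₜ w) = ρ1 a v ⊗ₜ ρ2 b w := rfl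

variable {ρ1 ρ2}

section

variable (Δ) (a : Alg T t (μ1 + μ2))

lemma lcoeff_deformedAct (f : LaurentVec V12) (n : ℤ) (s : Finset ℤ)
    (h : ∀ k, k ∉ s → tensorOp ρ1 ρ2 ((Δ a).coeff k) (lcoeff (n - k) f) = 0) :
    lcoeff n (ρΔ a f) = ∑ k ∈ s, tensorOp ρ1 ρ2 ((Δ a).coeff k) (lcoeff (n - k) f) :=
  lcoeff_laurentAct (laurentMap (tensorOp ρ1 ρ2) (Δ a)) f n s h

lemma lcoeff_deformedAct_constVec (w : V12) (n : ℤ) :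
    lcoeff n (ρΔ a (constVec w)) = tensorOp ρ1 ρ2 ((Δ a).coeff n) w := by
  rw [lcoeff_deformedAct Δ a _ n {n}, sum_singleton, sub_self, lcoeff_constVec, if_pos rfl]
  intro k hk
  rw [lcoeff_constVec, if_neg (by rw [mem_singleton] at hk; omega), map_zero]

lemma lcoeff_deformedAct_leading {f : LaurentVec V12} {m : ℤ}
    (ha : ∀ n < m, (Δ a).coeff n = 0) (hf : ∀ n < 0, lcoeff n f = 0) :
    (∀ n < m, lcoeff n (ρΔ a f) = 0) ∧
      lcoeff m (ρΔ a f) = tensorOp ρ1 ρ2 ((Δ a).coeff m) (lcoeff 0 f) := by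
  constructor
  · intro n hn
    rw [lcoeff_deformedAct Δ a _ n ∅, Finset.sum_empty]
    intro k _
    rcases lt_or_ge k m with hk | hk
    · rw [ha k hk, map_zero]; rfl
    · rw [hf _ (by omega), map_zero]
  · rw [lcoeff_deformedAct Δ a _ m {m}, sum_singleton, sub_self]
    intro k hk
    rw [mem_singleton] at hk
    rcases lt_or_ge k m with hk' | hk'
    · rw [ha k hk', map_zero]; rfl
    · rw [hf _ (by omega), map_zero]

end

variable (hΔ : IsDeformedCoproduct Δ) (ht : Generic t)

include hΔ

include ht in
lemma deformedAct_h (i : T.I0) (m : ℤ) (w : V12) : ρΔ (Alg.h i m) (constVec w) =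
      constVec (tensorOp ρ1 ρ2 (Alg.h i m ⊗ₜ 1) w) +
        ((uUnit ^ m : regOneˣ) : regOne) • constVec (tensorOp ρ1 ρ2 (1 ⊗ₜ Alg.h i m) w) := by
  refine laurentVec_ext fun n => ?_
  rw [lcoeff_deformedAct_constVec, ← Alg.mk_h, hΔ.map_mk ht, Coproduct.imFree_h,
    Coproduct.coeff_imH, map_add, map_add, lcoeff_uUnit_zpow_smul, lcoeff_constVec,
    lcoeff_constVec, LinearMap.add_apply]
  simp only [sub_eq_zero]
  congr 1 <;> split_ifs <;> simp

/-- The range of summation in the image of `φ_{i,m}^ε`. -/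
def φRange (μ1 μ2 : T.Coweight) (ε : ℤˣ) (i : T.I0) (m : ℤ) : Finset ℤ :=
  if ε = 1 then Finset.Icc 0 m else Finset.Icc (m - μ1.1 i) (μ2.1 i)

omit hΔ in
lemma φ_tmul_φ_eq_zero (ε : ℤˣ) (i : T.I0) {m n : ℤ} (hn : n ∉ φRange μ1 μ2 ε i m) :
    (Alg.φ ε i (m - n) ⊗ₜ Alg.φ ε i n : Alg T t μ1 ⊗[ℂ] Alg T t μ2) = 0 := by
  rcases units_eq_one_or ε with rfl | rfl
  · rw [φRange, if_pos rfl, mem_Icc] at hn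
    rcases lt_or_ge n 0 with h | h
    · rw [Alg.φ_one_of_neg i h, tmul_zero]
    · rw [Alg.φ_one_of_neg i (show m - n < 0 by omega), zero_tmul]
  · rw [φRange, if_neg (by decide), mem_Icc] at hn
    rcases lt_or_ge (μ2.1 i) n with h | h
    · rw [Alg.φ_neg_of_lt i h, tmul_zero]
    · rw [Alg.φ_neg_of_lt i (show μ1.1 i < m - n by omega), zero_tmul]

lemma deformedAct_φ (ε : ℤˣ) (i : T.I0) (m : ℤ) (w : V12) : ρΔ (Alg.φ ε i m) (constVec w) =
      ∑ n ∈ φRange μ1 μ2 ε i m, ((uUnit ^ n : regOneˣ) : regOne) •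
        constVec (tensorOp ρ1 ρ2 (Alg.φ ε i (m - n) ⊗ₜ Alg.φ ε i n) w) := by
  refine laurentVec_ext fun n => ?_
  rw [lcoeff_deformedAct_constVec, hΔ.φ, map_sum]
  simp only [lcoeff_uUnit_zpow_smul, lcoeff_constVec, sub_eq_zero]
  rw [sum_ite_eq]
  split_ifs with h
  · rfl
  · rw [φ_tmul_φ_eq_zero ε i h, map_zero]; rfl

lemma coeff_lead (ε : ℤˣ) (i : T.I0) (n : ℤ) : (Δ (lead ε i)).coeff n =
    if n = ld μ2 ε i then lead ε i ⊗ₜ lead ε i else 0 := by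
  change (Δ (Alg.φ ε i (ld (μ1 + μ2) ε i))).coeff n = _
  rw [hΔ.φ]
  split_ifs with h
  · rw [h, ld_add, add_sub_cancel_right]; rfl
  · refine φ_tmul_φ_eq_zero ε i fun hn => h ?_
    rcases units_eq_one_or ε with rfl | rfl
    · rw [φRange, if_pos rfl, mem_Icc, ld_one] at hn
      rw [ld_one]; omega
    · rw [φRange, if_neg (by decide), mem_Icc, ld_neg_one] at hn
      rw [ld_neg_one]
      have : (μ1 + μ2).1 i = μ1.1 i + μ2.1 i := rfl
      omega

lemma lcoeff_deformedAct_lead (ε : ℤˣ) (i : T.I0) (f : LaurentVec V12) (n : ℤ) :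
    lcoeff n (ρΔ (lead ε i) f) =
      tensorOp ρ1 ρ2 (lead ε i ⊗ₜ lead ε i) (lcoeff (n - ld μ2 ε i) f) := by
  rw [lcoeff_deformedAct Δ _ f n {ld μ2 ε i}, sum_singleton, coeff_lead hΔ, if_pos rfl]
  intro k hk
  rw [coeff_lead hΔ, if_neg (by simpa using hk), map_zero]
  rfl

end DeformedAct


/-- A module of the category `𝒪` generated by a singular vector whose weights are given. -/
structure IsHighestWeight {T : TwistedType} {t : ℂˣ} {μ : T.Coweight} {V : Type*} [AddCommGroup V]
    [Module ℂ V] (ρ : Alg T t μ →ₐ[ℂ] End ℂ V) (v : V) (ω : ℤˣ → Weight T) : Prop where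
  inO : InO ρ
  singular : IsSingular ρ v
  generates : ∀ w : V, ∃ a : Alg T t μ, ρ a v = w
  lead : ∀ ε i, ρ (Alg.lead ε i) v = (((ω ε i) ^ (ε : ℤ) : ℂˣ) : ℂ) • v

lemma IsHighest.exists_isHighestWeight {v : V} {Ψ : LWeight T μ}
    (hv : IsHighest ρ Ψ v) (hO : InO ρ) : ∃ ω, IsHighestWeight ρ v ω := by
  obtain ⟨ω, hω⟩ := hv.exists_weight
  exact ⟨ω, hO, hv.isSingular, hv.generates, hω⟩

section

variable (ρ1) (ρ2)

/-! ### Weight spaces of the tensor product -/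

/-- The weight spaces of the tensor product. -/
def tensorWeight (ω : Weight T) : Submodule ℂ V12 :=
  ⨅ i, End.eigenspace (tensorOp ρ1 ρ2 (lead 1 i ⊗ₜ lead 1 i)) (ω i : ℂ)

variable {ρ1 ρ2}

local notation "tensW" => tensorWeight ρ1 ρ2

lemma mem_tensorWeight {w : V12} : w ∈ tensW ω ↔
    ∀ i, tensorOp ρ1 ρ2 (lead 1 i ⊗ₜ lead 1 i) w = (ω i : ℂ) • w := by
  simp [tensorWeight]

lemma tmul_mem_tensorWeight {ω ω' : Weight T} {v : V1} {w : V2} (hv : v ∈ weightSpace ρ1 1 ω)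
    (hw : w ∈ weightSpace ρ2 1 ω') : v ⊗ₜ w ∈ tensW (ω * ω') := by
  rw [mem_tensorWeight]
  rw [mem_weightSpace] at hv hw
  intro i
  rw [tensorOp_tmul, hv, hw, smul_tmul_smul]
  simp

lemma tensorOp_mul_apply (b c : Alg T t μ1 ⊗[ℂ] Alg T t μ2) (w : V12) :
    tensorOp ρ1 ρ2 b (tensorOp ρ1 ρ2 c w) = tensorOp ρ1 ρ2 (b * c) w := by
  rw [map_mul]; rfl

lemma tensorOp_mem_tensorWeight {b : Alg T t μ1 ⊗[ℂ] Alg T t μ2} {α ω : Weight T}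
    (h : ∀ i, (lead 1 i ⊗ₜ lead 1 i) * b = (α i : ℂ) • (b * (lead 1 i ⊗ₜ lead 1 i)))
    {w : V12} (hw : w ∈ tensW ω) :
    tensorOp ρ1 ρ2 b w ∈ tensW (ω * α) := by
  rw [mem_tensorWeight] at hw ⊢
  intro i
  rw [tensorOp_mul_apply, h, map_smul, LinearMap.smul_apply, ← tensorOp_mul_apply, hw, map_smul,
    smul_smul, Pi.mul_apply, val_mul, mul_comm]

lemma tensorOp_mem_tensorWeight_of_commute {a : Alg T t μ1} {b : Alg T t μ2} (ha : ∀ i, lead 1 i * a = a * lead 1 i) (hb : ∀ i, lead 1 i * b = b * lead 1 i)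
    {w : V12} (hw : w ∈ tensW ω) :
    tensorOp ρ1 ρ2 (a ⊗ₜ b) w ∈ tensW ω := by
  rw [← mul_one ω]
  refine tensorOp_mem_tensorWeight (fun i => ?_) hw
  rw [tmul_mul_tmul, tmul_mul_tmul, ha, hb]
  simp

lemma lead_mul_x_neg (r : ℤ) : (lead 1 i * Alg.x (-1) j r : Alg T t μ) =
      (((rootWeight T t j)⁻¹ i : ℂˣ) : ℂ) • (Alg.x (-1) j r * lead 1 i) := by
  have h := coe_rootWeight (t := t) i j 1
  rw [zpow_one] at h
  rw [Alg.lead_mul_x, Pi.inv_apply, h]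
  congr 2
  push_cast
  ring

lemma x_tmul_mem {w : V12} (hw : w ∈ tensW ω) (j : T.I0)
    (r : ℤ) {b : Alg T t μ2} (hb : ∀ i, lead 1 i * b = b * lead 1 i) :
    tensorOp ρ1 ρ2 (Alg.x (-1) j r ⊗ₜ b) w ∈ tensW (ω * (rootWeight T t j)⁻¹) := by
  refine tensorOp_mem_tensorWeight (fun i => ?_) hw
  rw [tmul_mul_tmul, tmul_mul_tmul, lead_mul_x_neg, hb, smul_tmul']

lemma tmul_x_mem {w : V12} (hw : w ∈ tensW ω) (j : T.I0)
    (r : ℤ) {b : Alg T t μ1} (hb : ∀ i, lead 1 i * b = b * lead 1 i) :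
    tensorOp ρ1 ρ2 (b ⊗ₜ Alg.x (-1) j r) w ∈ tensW (ω * (rootWeight T t j)⁻¹) := by
  refine tensorOp_mem_tensorWeight (fun i => ?_) hw
  rw [tmul_mul_tmul, tmul_mul_tmul, lead_mul_x_neg, hb, tmul_smul]

lemma iSupIndep_tensorWeight : iSupIndep tensW := by
  have h : ∀ i j : T.I0, Commute (tensorOp ρ1 ρ2 (lead 1 i ⊗ₜ lead 1 i))
      (tensorOp ρ1 ρ2 (lead 1 j ⊗ₜ lead 1 j)) := fun i j => by
    rw [commute_iff_eq, ← map_mul, ← map_mul, tmul_mul_tmul, tmul_mul_tmul]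
    rw [show (lead 1 i * lead 1 j : Alg T t μ1) = _ from Alg.φ_comm _ _ _ _ _ _,
      show (lead 1 i * lead 1 j : Alg T t μ2) = _ from Alg.φ_comm _ _ _ _ _ _]
    rfl
  have hinj : Function.Injective fun (ω : Weight T) i => (ω i : ℂ) :=
    fun ω ω' h => funext fun i => Units.ext (congrFun h i)
  exact ((iSupIndep_jointGen h).comp hinj).mono fun ω => iInf_mono fun i =>
    (genEigenspace _ _).mono (by simp)

lemma finite_append_eq {α : Type*} (l : List α) :
    {p : List α × List α | p.1 ++ p.2 = l}.Finite := by
  refine ((List.finite_toSet l.inits).prod (List.finite_toSet l.tails)).subset ?_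
  rintro ⟨a, b⟩ rfl
  exact ⟨(List.mem_inits _ _).2 (List.prefix_append a b),
    (List.mem_tails _ _).2 (List.suffix_append a b)⟩

lemma typeWeight_append (l l' : List T.I0) :
    typeWeight t (l ++ l') = typeWeight t l * typeWeight t l' := by
  rw [typeWeight, List.map_append, List.prod_append]; rfl

lemma finite_weight_pairs (ht : Generic t) (ω1 ω2 ω : Weight T) :
    {p : List T.I0 × List T.I0 | (ω1 * (typeWeight t p.1)⁻¹) * (ω2 * (typeWeight t p.2)⁻¹) =
      ω}.Finite := by
  refine ((finite_weight ht (ω1 * ω2) ω).biUnion fun l _ => finite_append_eq l).subset fun p hp => ?_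
  have hp : (ω1 * (typeWeight t p.1)⁻¹) * (ω2 * (typeWeight t p.2)⁻¹) = ω := hp
  refine Set.mem_biUnion (x := p.1 ++ p.2) ?_ rfl
  change ω1 * ω2 * (typeWeight t (p.1 ++ p.2))⁻¹ = ω
  rw [← hp, typeWeight_append, mul_inv]
  exact mul_mul_mul_comm _ _ _ _

lemma tensorWeight_eq_iSup (h1 : IsHighestWeight ρ1 v1 ω1) (h2 : IsHighestWeight ρ2 v2 ω2)
    (ht : Generic t) (ω : Weight T) : tensW ω = ⨆ (p : List T.I0 × List T.I0)
        (_ : (ω1 1 * (typeWeight t p.1)⁻¹) * (ω2 1 * (typeWeight t p.2)⁻¹) = ω),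
        map₂ (TensorProduct.mk ℂ V1 V2) (wordSpace ρ1 v1 p.1) (wordSpace ρ2 v2 p.2) := by
  refine (congrFun (eq_of_iSup_eq_top (B := fun ω => ⨆ (p : List T.I0 × List T.I0)
    (_ : (ω1 1 * (typeWeight t p.1)⁻¹) * (ω2 1 * (typeWeight t p.2)⁻¹) = ω),
    map₂ (TensorProduct.mk ℂ V1 V2) (wordSpace ρ1 v1 p.1) (wordSpace ρ2 v2 p.2))
    iSupIndep_tensorWeight (fun ω => iSup₂_le fun p hp => ?_) ?_) ω).symm
  · rw [← hp]
    exact map₂_le.2 fun v hv w hw => tmul_mem_tensorWeight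
      (wordSpace_le_weightSpace h1.lead 1 _ hv) (wordSpace_le_weightSpace h2.lead 1 _ hw)
  · rw [eq_top_iff, ← map₂_mk_top_top_eq_top,
      ← h1.singular.wordSpan_eq_top ht h1.generates, ← h2.singular.wordSpan_eq_top ht h2.generates,
      wordSpan_eq_iSup, wordSpan_eq_iSup, map₂_iSup_left]
    refine iSup_le fun l => ?_
    rw [map₂_iSup_right]
    exact iSup_le fun l' => le_iSup_of_le _ (le_iSup₂_of_le (l, l') rfl le_rfl)

lemma finite_wordSpace (h1 : IsHighestWeight ρ1 v1 ω1) (l : List T.I0) :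
    FiniteDimensional ℂ (wordSpace ρ1 v1 l) :=
  have := h1.inO.finite 1 (ω1 1 * (typeWeight t l)⁻¹)
  finiteDimensional_of_le (wordSpace_le_weightSpace h1.lead 1 l)

lemma finite_tensorWeight (h1 : IsHighestWeight ρ1 v1 ω1) (h2 : IsHighestWeight ρ2 v2 ω2)
    (ht : Generic t) (ω : Weight T) :
    FiniteDimensional ℂ (tensW ω) := by
  rw [tensorWeight_eq_iSup h1 h2 ht, iSup_subtype']
  have : Finite {p : List T.I0 × List T.I0 //
      (ω1 1 * (typeWeight t p.1)⁻¹) * (ω2 1 * (typeWeight t p.2)⁻¹) = ω} :=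
    (finite_weight_pairs ht (ω1 1) (ω2 1) ω).to_subtype
  have (p : {p : List T.I0 × List T.I0 //
      (ω1 1 * (typeWeight t p.1)⁻¹) * (ω2 1 * (typeWeight t p.2)⁻¹) = ω}) :
      Module.Finite ℂ (map₂ (TensorProduct.mk ℂ V1 V2) (wordSpace ρ1 v1 p.1.1)
        (wordSpace ρ2 v2 p.1.2)) :=
    have := finite_wordSpace h1 p.1.1
    have := finite_wordSpace h2 p.1.2
    iff_fg.2 ((iff_fg.1 inferInstance).map₂ _ (iff_fg.1 inferInstance))
  exact Submodule.finite_iSup _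

lemma iSup_tensorWeight (h1 : IsHighestWeight ρ1 v1 ω1) (h2 : IsHighestWeight ρ2 v2 ω2)
    : ⨆ ω, tensW ω = ⊤ := by
  rw [eq_top_iff, ← map₂_mk_top_top_eq_top, ← h1.inO.iSup_eq_top 1,
    ← h2.inO.iSup_eq_top 1, map₂_iSup_left]
  refine iSup_le fun ω => ?_
  rw [map₂_iSup_right]
  exact iSup_le fun ω' => le_iSup_of_le (ω * ω')
    (map₂_le.2 fun v hv w hw => tmul_mem_tensorWeight hv hw)

/-! ### Rationality of the action of the lowering operators -/

lemma recurrent_tensor (hO1 : InO ρ1) (hO2 : InO ρ2) (ht : Generic t)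
    (i : T.I0) (r : ℤ) (w : V12) : Recurrent fun n =>
      tensorOp ρ1 ρ2 (Alg.x (-1) i (r - n) ⊗ₜ (Alg.φ 1 i n - Alg.φ (-1) i n)) w := by
  induction w with
  | zero => simpa using Recurrent.zero
  | tmul v w =>
    have := ((hO1.recurrent_x ht (-1) i v).reflect r).bilin (hO2.recurrent_φ ht i w)
      (TensorProduct.mk ℂ V1 V2)
    simpa [tensorOp_tmul] using this
  | add w w' h h' => simpa using h.add h'

variable (hΔ : IsDeformedCoproduct Δ) (ht : Generic t)

include hΔ ht

lemma deformedAct_x_constVec_mem (hO1 : InO ρ1) (hO2 : InO ρ2) (i : T.I0) (r : ℤ) {w : V12} (hw : w ∈ tensW ω) :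
    ρΔ (Alg.x (-1) i r) (constVec w) ∈ ratSub (tensW (ω * (rootWeight T t i)⁻¹)) := by
  obtain ⟨p, hp, hrec⟩ := (recurrent_tensor hO1 hO2 ht i r w).exists_polynomial
  refine mem_ratSub_of_recurrence (N := max (r + 1) (μ2.1 i + 1)) (fun n => ?_) hp fun n hn => ?_
  · rw [lcoeff_deformedAct_constVec, hΔ.x_minus, map_add, LinearMap.add_apply]
    refine Submodule.add_mem _ ?_ (x_tmul_mem hw i _ fun _ => Alg.φ_comm _ _ _ _ _ _)
    split_ifs
    · exact tmul_x_mem hw i r fun _ => by rw [mul_one, one_mul]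
    · rw [map_zero]; exact Submodule.zero_mem _
  · refine (sum_congr rfl fun k _ => ?_).trans (hrec n)
    have h1 := le_of_max_le_left hn
    have h2 := le_of_max_le_right hn
    rw [lcoeff_deformedAct_constVec, hΔ.x_minus, if_neg (by omega), zero_add,
      Alg.φ_neg_of_lt i (by omega), sub_zero]

lemma deformedAct_x_mem (hO1 : InO ρ1) (hO2 : InO ρ2) (i : T.I0) (r : ℤ) {f : LaurentVec V12} (hf : f ∈ ratSub (tensW ω)) :
    ρΔ (Alg.x (-1) i r) f ∈ ratSub (tensW (ω * (rootWeight T t i)⁻¹)) := by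
  have h : ratSub (tensW ω) ≤ (ratSub (tensW (ω * (rootWeight T t i)⁻¹))).comap
        (ratEnd (ρΔ (Alg.x (-1) i r))) := by
    refine span_le.2 ?_
    rintro _ ⟨w, hw, rfl⟩
    exact deformedAct_x_constVec_mem hΔ ht hO1 hO2 i r hw
  exact h hf

omit hΔ ht in
lemma mem_constLattice_of_forall {P Q : Submodule ℂ V12}
    (g : End (LaurentSeries ℂ) (LaurentVec V12)) (c : regOne)
    (h : ∀ w ∈ P, c • g (constVec w) ∈ constLattice Q) {f : LaurentVec V12}
    (hf : f ∈ constLattice P) : c • g f ∈ constLattice Q := by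
  have h : constLattice P ≤ (constLattice Q).comap (c • regEnd g) := by
    refine span_le.2 ?_
    rintro _ ⟨w, hw, rfl⟩
    exact h w hw
  exact h hf

omit hΔ ht in
lemma mem_constLattice_of_basis {ι : Type*} [Fintype ι] {P Q : Submodule ℂ V12}
    (b : Module.Basis ι ℂ P) (g : End (LaurentSeries ℂ) (LaurentVec V12))
    (c : regOne) (h : ∀ k, c • g (constVec (b k : V12)) ∈ constLattice Q)
    {f : LaurentVec V12} (hf : f ∈ constLattice P) : c • g f ∈ constLattice Q := by
  rw [constLattice_eq_span b] at hf
  have h : span regOne (Set.range fun k => constVec (b k : V12)) ≤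
      (constLattice Q).comap (c • regEnd g) := by
    refine span_le.2 ?_
    rintro _ ⟨k, rfl⟩
    exact h k
  exact h hf

lemma deformedAct_h_mem (i : T.I0) (m : ℤ) {f : LaurentVec V12} (hf : f ∈ constLattice (tensW ω)) :
    ρΔ (Alg.h i m) f ∈ constLattice (tensW ω) := by
  rw [← one_smul regOne (ρΔ (Alg.h i m) f)]
  refine mem_constLattice_of_forall _ _ (fun w hw => ?_) hf
  rw [one_smul, deformedAct_h hΔ ht]
  refine Submodule.add_mem _ (constVec_mem_constLattice ?_)
    (smul_mem _ _ (constVec_mem_constLattice ?_))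
  · exact tensorOp_mem_tensorWeight_of_commute (fun _ => Alg.φ_h_comm _ _ _ _ _)
      (fun _ => by rw [mul_one, one_mul]) hw
  · exact tensorOp_mem_tensorWeight_of_commute (fun _ => by rw [mul_one, one_mul])
      (fun _ => Alg.φ_h_comm _ _ _ _ _) hw

omit ht in
lemma deformedAct_φ_mem (ε : ℤˣ) (i : T.I0) (m : ℤ) {f : LaurentVec V12} (hf : f ∈ constLattice (tensW ω)) :
    ρΔ (Alg.φ ε i m) f ∈ constLattice (tensW ω) := by
  rw [← one_smul regOne (ρΔ (Alg.φ ε i m) f)]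
  refine mem_constLattice_of_forall _ _ (fun w hw => ?_) hf
  rw [one_smul, deformedAct_φ hΔ]
  exact Submodule.sum_mem _ fun n _ => smul_mem _ _ (constVec_mem_constLattice
    (tensorOp_mem_tensorWeight_of_commute (fun _ => Alg.φ_comm _ _ _ _ _ _)
      (fun _ => Alg.φ_comm _ _ _ _ _ _) hw))

omit hΔ ht in
lemma exists_common_smul_mem {W ι : Type*} [AddCommGroup W] [Module ℂ W] {Q : Submodule ℂ W}
    (s : Finset ι) (f : ι → LaurentVec W) (h : ∀ k, f k ∈ ratSub Q) :
    ∃ D : regOne, D ≠ 0 ∧ ∀ k ∈ s, D • f k ∈ constLattice Q := by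
  classical
  induction s using induction_on with
  | empty => exact ⟨1, one_ne_zero, fun k hk => absurd hk (Finset.notMem_empty k)⟩
  | insert a s ha ih =>
    obtain ⟨D, hD, hs⟩ := ih
    obtain ⟨E, hE, hEa⟩ := exists_smul_mem_constLattice (h a)
    refine ⟨D * E, mul_ne_zero hD hE, fun k hk => ?_⟩
    rcases mem_insert.1 hk with rfl | hk
    · rw [mul_smul]; exact smul_mem _ _ hEa
    · rw [mul_comm, mul_smul]; exact smul_mem _ _ (hs k hk)

omit hΔ ht in
lemma smul_commutator {S M : Type*} [CommRing S] [Algebra ℂ S] [AddCommGroup M] [Module S M]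
    [Module ℂ M] [IsScalarTower ℂ S M] (A X : End S M) (D : S) (c : ℂ) (f : M) :
    D • c • (A (X f) - X (A f)) = algebraMap ℂ S c • (A (D • X f) - D • X (A f)) := by
  rw [map_smul, ← smul_sub, ← algebraMap_smul S c, smul_comm]

lemma smul_deformedAct_add_mem (D : regOne) (i : T.I0) {k : ℤ} (hk : k ≠ 0) (r : ℤ)
    {ω ω' : Weight T} (hr : ∀ f ∈ constLattice (tensW ω),
      D • ρΔ (Alg.x (-1) i r) f ∈ constLattice (tensW ω'))
    {f : LaurentVec V12} (hf : f ∈ constLattice (tensW ω)) :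
    D • ρΔ (Alg.x (-1) i (r + T.M * k)) f ∈ constLattice (tensW ω') := by
  obtain ⟨c, hc, hcx⟩ := exists_ad_h (μ := μ1 + μ2) ht (-1) i k hk
  have e : (Alg.x (-1) i (r + T.M * k) : Alg T t (μ1 + μ2)) = c⁻¹ •
      (Alg.h i (T.M * k) * Alg.x (-1) i r - Alg.x (-1) i r * Alg.h i (T.M * k)) := by
    rw [← hcx, smul_smul, inv_mul_cancel₀ hc, one_smul]
  have e2 : D • ρΔ (Alg.x (-1) i (r + T.M * k)) f = algebraMap ℂ regOne c⁻¹ •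
      (ρΔ (Alg.h i (T.M * k)) (D • ρΔ (Alg.x (-1) i r) f) -
        D • ρΔ (Alg.x (-1) i r) (ρΔ (Alg.h i (T.M * k)) f)) := by
    refine Eq.trans ?_ (smul_commutator (regEnd (ρΔ (Alg.h i (T.M * k))))
      (regEnd (ρΔ (Alg.x (-1) i r))) D c⁻¹ f)
    rw [e, map_smul, map_sub, map_mul, map_mul]
    rfl
  rw [e2]
  exact smul_mem _ _ (Submodule.sub_mem _ (deformedAct_h_mem hΔ ht i _ (hr f hf))
    (hr _ (deformedAct_h_mem hΔ ht i _ hf)))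

omit hΔ ht in
lemma exists_common_denominator {ι κ : Type*} [Fintype ι] [Fintype κ]
    {P Q : Submodule ℂ V12} (b : Module.Basis ι ℂ P)
    (g : κ → End (LaurentSeries ℂ) (LaurentVec V12))
    (h : ∀ r, ∀ w ∈ P, g r (constVec w) ∈ ratSub Q) : ∃ D : regOne, D ≠ 0 ∧
      ∀ r, ∀ f ∈ constLattice P, D • g r f ∈ constLattice Q := by
  obtain ⟨D, hD, h⟩ := exists_common_smul_mem (univ : Finset (κ × ι))
    (fun p => g p.1 (constVec (b p.2 : V12))) (fun p => h p.1 _ (b p.2).2)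
  exact ⟨D, hD, fun r f hf => mem_constLattice_of_basis b (g r) D
    (fun k => h (r, k) (mem_univ (r, k))) hf⟩

omit hΔ ht in
lemma forall_of_residues {m : ℕ} (hm : 0 < m) {p : ℤ → Prop} (h0 : ∀ r : Fin m, p (r : ℕ))
    (hs : ∀ k : ℤ, k ≠ 0 → ∀ r, p r → p (r + m * k)) (r : ℤ) : p r := by
  have hM : (0 : ℤ) < m := by exact_mod_cast hm
  have h1 : p (r % m) := by
    have := h0 ⟨(r % m).toNat, by
      have := Int.emod_lt_of_pos r hM; have := Int.emod_nonneg r hM.ne'; omega⟩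
    rwa [toNat_of_nonneg (Int.emod_nonneg r hM.ne')] at this
  rw [← Int.emod_add_mul_ediv r m]
  by_cases hk : r / m = 0
  · rwa [hk, mul_zero, add_zero]
  · exact hs _ hk _ h1

lemma exists_denominator (h1 : IsHighestWeight ρ1 v1 ω1) (h2 : IsHighestWeight ρ2 v2 ω2)
    (i : T.I0) (ω : Weight T) : ∃ D : regOne, D ≠ 0 ∧ ∀ r,
      ∀ f ∈ constLattice (tensW ω), D • ρΔ (Alg.x (-1) i r) f ∈
        constLattice (tensW (ω * (rootWeight T t i)⁻¹)) := by
  have := finite_tensorWeight h1 h2 ht ω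
  obtain ⟨D, hD, h0⟩ := exists_common_denominator (Q := tensW (ω * (rootWeight T t i)⁻¹))
    (finBasis ℂ (tensW ω))
    (fun r : Fin T.M => ρΔ (Alg.x (-1) i ((r : ℕ) : ℤ)))
    (fun r w hw => deformedAct_x_constVec_mem hΔ ht h1.inO h2.inO i _ hw)
  exact ⟨D, hD, forall_of_residues T.M_pos h0 fun k hk r hr f hf =>
    smul_deformedAct_add_mem hΔ ht D i hk r hr hf⟩

end


local notation "tensW" => tensorWeight ρ1 ρ2
section

section AForm

variable (Δ ρ1 ρ2) in
/-- The deformed action as an action on a module over the ring `𝒜`. -/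
def regAct : Alg T t (μ1 + μ2) →ₐ[ℂ] End regOne (LaurentVec V12) := regEnd.comp ρΔ

local notation "ρReg" => regAct Δ ρ1 ρ2

lemma regAct_apply (a : Alg T t (μ1 + μ2)) (f : LaurentVec V12) : ρReg a f = ρΔ a f := rfl

lemma constVec_smul (c : ℂ) (w : W) : constVec (c • w) = c • constVec w := map_smul constHom c w

variable (hΔ : IsDeformedCoproduct Δ) (h₁ : IsHighestWeight ρ1 v1 ω1)
  (h₂ : IsHighestWeight ρ2 v2 ω2) (ht : Generic t)

include hΔ h₁ h₂ in
lemma deformedAct_lead (ε : ℤˣ) (i : T.I0) : ρΔ (lead ε i) (constVec v12) =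
      ((uUnit ^ ld μ2 ε i * Units.map (algebraMap ℂ regOne).toMonoidHom
        ((ω1 ε i * ω2 ε i) ^ (ε : ℤ)) : regOneˣ) : regOne) • constVec v12 := by
  refine laurentVec_ext fun n => ?_
  rw [lcoeff_deformedAct_lead hΔ, val_mul, mul_smul, lcoeff_uUnit_zpow_smul]
  have : ((Units.map (algebraMap ℂ regOne).toMonoidHom ((ω1 ε i * ω2 ε i) ^ (ε : ℤ)) : regOneˣ) :
      regOne) = algebraMap ℂ regOne (((ω1 ε i * ω2 ε i) ^ (ε : ℤ) : ℂˣ) : ℂ) := rfl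
  rw [this, algebraMap_smul_regOne, map_smul, lcoeff_constVec]
  split_ifs
  · rw [tensorOp_tmul, h₁.lead, h₂.lead, smul_tmul_smul, mul_zpow, val_mul]
  · rw [map_zero, smul_zero]

include hΔ h₁ h₂ in
lemma isSingular_regAct : IsSingular ρReg (constVec v12) where
  x_plus i r := by
    refine laurentVec_ext fun n => ?_
    rw [regAct_apply, lcoeff_deformedAct_constVec, hΔ.x_plus, map_add, map_zero,
      LinearMap.add_apply, tensorOp_tmul, h₂.singular.x_plus, tmul_zero, add_zero]
    split_ifs
    · rw [tensorOp_tmul, h₁.singular.x_plus, zero_tmul]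
    · rw [map_zero]; rfl
  φ_mem ε i m := by
    rw [regAct_apply, deformedAct_φ hΔ]
    refine Submodule.sum_mem _ fun n _ => smul_mem _ _ ?_
    obtain ⟨a, ha⟩ := mem_span_singleton.1 (h₁.singular.φ_mem ε i (m - n))
    obtain ⟨b, hb⟩ := mem_span_singleton.1 (h₂.singular.φ_mem ε i n)
    rw [tensorOp_tmul, ← ha, ← hb, smul_tmul_smul, constVec_smul, ← algebraMap_smul_regOne]
    exact smul_mem _ _ (Submodule.mem_span_singleton_self _)
  κ_mem ε i := κ_mem_span (R := ρReg) (deformedAct_lead hΔ h₁ h₂ ε i)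

include hΔ h₁ h₂ ht in
lemma lattice_eq_wordSpan : lattice ρΔ v12 = wordSpan ρReg (constVec v12) := by
  refine le_antisymm (span_le.2 ?_) (span_le.2 ?_)
  · rintro _ ⟨a, rfl⟩
    exact (isSingular_regAct hΔ h₁ h₂).apply_mem ht a
  · rintro _ ⟨L, rfl⟩
    induction L with
    | nil => exact subset_span ⟨1, by beta_reduce; rw [map_one]; rfl⟩
    | cons p L ih => exact lattice_stable _ _ (Alg.x (-1) p.1 p.2) ih

include hΔ h₁ h₂ ht in
lemma exists_smul_wordVec_mem (l : List T.I0) :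
    ∃ D : regOne, D ≠ 0 ∧ ∀ L : List (T.I0 × ℤ), L.map Prod.fst = l →
      D • wordVec ρReg (constVec v12) L ∈
        constLattice (tensW (ω1 1 * ω2 1 * (typeWeight t l)⁻¹)) := by
  induction l with
  | nil =>
    refine ⟨1, one_ne_zero, fun L hL => ?_⟩
    rw [List.map_eq_nil_iff.1 hL, one_smul, show (typeWeight t ([] : List T.I0))⁻¹ = 1 by
      simp [typeWeight], mul_one]
    exact constVec_mem_constLattice (tmul_mem_tensorWeight (mem_weightSpace.2 (h₁.lead 1))
      (mem_weightSpace.2 (h₂.lead 1)))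
  | cons j l ih =>
    obtain ⟨D, hD, h⟩ := ih
    obtain ⟨E, hE, hx⟩ := exists_denominator hΔ ht h₁ h₂ j (ω1 1 * ω2 1 * (typeWeight t l)⁻¹)
    refine ⟨E * D, mul_ne_zero hE hD, fun L hL => ?_⟩
    obtain _ | ⟨p, L⟩ := L
    · simp at hL
    rw [List.map_cons, List.cons_eq_cons] at hL
    obtain ⟨rfl, hL⟩ := hL
    have := hx p.2 _ (h L hL)
    rw [act_smul, smul_smul, mul_assoc, ← mul_inv_rev, ← typeWeight_cons] at this
    exact this

include hΔ h₁ h₂ ht in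
lemma exists_smul_wordSpace_le (l : List T.I0) :
    ∃ D : regOne, D ≠ 0 ∧ ∀ f ∈ wordSpace ρReg (constVec v12) l,
      D • f ∈ constLattice (tensW (ω1 1 * ω2 1 * (typeWeight t l)⁻¹)) := by
  obtain ⟨D, hD, h⟩ := exists_smul_wordVec_mem hΔ h₁ h₂ ht l
  refine ⟨D, hD, fun f hf => ?_⟩
  induction hf using span_induction with
  | mem x hx =>
    obtain ⟨L, hL, rfl⟩ := hx
    exact h L hL
  | zero => rw [smul_zero]; exact Submodule.zero_mem _
  | add x y _ _ hx hy => rw [smul_add]; exact Submodule.add_mem _ hx hy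
  | smul c x _ hx => rw [smul_comm]; exact smul_mem _ _ hx

lemma regOne_smul_injective {D : regOne} (hD : D ≠ 0) :
    Function.Injective fun f : LaurentVec W => D • f := by
  intro f g h
  have hD' : (D : RatFunc ℂ) ≠ 0 := fun h => hD (Subtype.ext h)
  have h' : (D : RatFunc ℂ) • f = (D : RatFunc ℂ) • g := h
  exact smul_right_injective (LaurentVec W) hD' h'

instance : Module.IsTorsionFree regOne (LaurentVec W) :=
  ⟨fun _ hD => regOne_smul_injective hD.ne_zero⟩

lemma fg_of_smul_mem {N C : Submodule regOne (LaurentVec W)}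
    (hC : C.FG) {D : regOne} (hD : D ≠ 0) (h : ∀ f ∈ N, D • f ∈ C) : N.FG := by
  have h1 : (N.map (LinearMap.lsmul regOne (LaurentVec W) D)) ≤ C := by
    rintro _ ⟨f, hf, rfl⟩
    exact h f hf
  have := isNoetherian_of_fg_of_noetherian C hC
  exact Submodule.fg_of_fg_map_injective _ (regOne_smul_injective hD)
    (isNoetherian_submodule.1 this _ h1)

include hΔ h₁ h₂ ht in
lemma wordSpace_fg (l : List T.I0) : (wordSpace ρReg (constVec v12) l).FG := by
  obtain ⟨D, hD, h⟩ := exists_smul_wordSpace_le hΔ h₁ h₂ ht l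
  have := finite_tensorWeight h₁ h₂ ht (ω1 1 * ω2 1 * (typeWeight t l)⁻¹)
  exact fg_of_smul_mem (constLattice_fg _) hD h

lemma mem_ratSub_of_smul_mem {P : Submodule ℂ W}
    {D : regOne} (hD : D ≠ 0) {f : LaurentVec W} (h : D • f ∈ constLattice P) : f ∈ ratSub P := by
  have hD' : (D : RatFunc ℂ) ≠ 0 := fun h => hD (Subtype.ext h)
  have := (ratSub P).smul_mem (D : RatFunc ℂ)⁻¹ (constLattice_subset P h)
  rwa [regOne_smul_def, smul_smul, inv_mul_cancel₀ hD', one_smul] at this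

include hΔ h₁ h₂ ht in
lemma wordSpace_subset_ratSub {l : List T.I0} {f : LaurentVec V12}
    (hf : f ∈ wordSpace ρReg (constVec v12) l) :
    f ∈ ratSub (tensW (ω1 1 * ω2 1 * (typeWeight t l)⁻¹)) := by
  obtain ⟨D, hD, h⟩ := exists_smul_wordSpace_le hΔ h₁ h₂ ht l
  exact mem_ratSub_of_smul_mem hD (h f hf)

/-! ### Weight spaces of the rational module -/

lemma lead_apply_of_mem_ratSub (hΔ : IsDeformedCoproduct Δ) {f : LaurentVec V12} (hf : f ∈ ratSub (tensW ω)) (i : T.I0) :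
    ρΔ (lead 1 i) f = (ω i : ℂ) • f := by
  have h : ratSub (tensW ω) ≤ LinearMap.eqLocus (ratEnd (ρΔ (lead 1 i)))
      (algebraMap ℂ (End (RatFunc ℂ) (LaurentVec V12)) (ω i : ℂ)) := by
    refine span_le.2 ?_
    rintro _ ⟨w, hw, rfl⟩
    refine laurentVec_ext fun n => ?_
    rw [algebraMap_end_apply, map_smul, ratEnd_apply, lcoeff_deformedAct_lead hΔ, ld_one,
      sub_zero, lcoeff_constVec]
    split_ifs
    · exact mem_tensorWeight.1 hw i
    · rw [map_zero, smul_zero]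
  exact (h hf).trans (algebraMap_end_apply ℂ (RatFunc ℂ) _ _ _)

lemma ratSub_subset_ratWeightSpace (hΔ : IsDeformedCoproduct Δ) {f : LaurentVec V12} (hf : f ∈ ratSub (tensW ω)) :
    f ∈ ratWeightSpace ρΔ ω :=
  ⟨ratSub_le_ratVec _ hf, lead_apply_of_mem_ratSub hΔ hf⟩

lemma iSupIndep_ratWeightSpace : iSupIndep (ratWeightSpace ρΔ) := by
  have h := End.independent_iInf_maxGenEigenspace_of_forall_mapsTo
    (fun i : T.I0 => ρReg (lead 1 i)) fun i j _ =>
      End.mapsTo_maxGenEigenspace_of_comm (by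
        rw [commute_iff_eq, ← map_mul, ← map_mul]
        exact congrArg _ (Alg.φ_comm _ _ _ _ _ _)) _
  have hinj : Function.Injective fun (ω : Weight T) i => algebraMap ℂ regOne (ω i) :=
    fun ω ω' h => funext fun i => Units.ext ((algebraMap ℂ regOne).injective (congrFun h i))
  refine (h.comp hinj).mono fun ω f hf => ?_
  rw [Function.comp_apply, mem_iInf]
  refine fun i => (genEigenspace _ _).mono (show (1 : ℕ∞) ≤ ⊤ by simp) ?_
  rw [End.mem_genEigenspace_one, algebraMap_smul_regOne]
  exact hf.2 i

include hΔ h₁ h₂ ht in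
lemma lattice_inf_ratWeightSpace (ω : Weight T) : lattice ρΔ v12 ⊓ ratWeightSpace ρΔ ω =
      ⨆ (l : List T.I0) (_ : ω1 1 * ω2 1 * (typeWeight t l)⁻¹ = ω),
        wordSpace ρReg (constVec v12) l := by
  rw [inf_comm, ← inf_iSup_eq (A := ratWeightSpace ρΔ) (B := fun ω =>
    ⨆ (l : List T.I0) (_ : ω1 1 * ω2 1 * (typeWeight t l)⁻¹ = ω),
      wordSpace ρReg (constVec v12) l) iSupIndep_ratWeightSpace ?_ ω]
  · congr 1
    rw [lattice_eq_wordSpan hΔ h₁ h₂ ht, wordSpan_eq_iSup]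
    exact le_antisymm (iSup_le fun l => le_iSup_of_le _ (le_iSup₂_of_le l rfl le_rfl))
      (iSup_le fun ω => iSup₂_le fun l _ => le_iSup _ l)
  · exact fun ω => iSup₂_le fun l hl f hf => hl ▸ ratSub_subset_ratWeightSpace hΔ
      (wordSpace_subset_ratSub hΔ h₁ h₂ ht hf)

include hΔ h₁ h₂ ht in
lemma lattice_inf_ratWeightSpace_fg (ω : Weight T) : (lattice ρΔ v12 ⊓ ratWeightSpace ρΔ ω).FG := by
  rw [lattice_inf_ratWeightSpace hΔ h₁ h₂ ht, iSup_subtype']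
  have : Finite {l : List T.I0 // ω1 1 * ω2 1 * (typeWeight t l)⁻¹ = ω} :=
    (finite_weight ht (ω1 1 * ω2 1) ω).to_subtype
  exact Submodule.fg_iSup _ fun l => wordSpace_fg hΔ h₁ h₂ ht l.1

end AForm


end

local notation "ρReg" => regAct Δ ρ1 ρ2
section Leading

variable (Δ) (ρ1) (ρ2) (v1) (v2)

/-- The rational span of the lattice generated by a pure tensor. -/
def ratLattice : Submodule (RatFunc ℂ) (LaurentVec V12) := span (RatFunc ℂ) (lattice ρΔ v12)

/-- The leading coefficients of the series of weight `ω` in the rational span of the lattice. -/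
def leadSpace (ω : Weight T) : Submodule ℂ V12 where
  carrier := {w | ∃ f ∈ ratLattice Δ ρ1 ρ2 v1 v2 ⊓ ratSub (tensW ω),
    (∀ n < 0, lcoeff n f = 0) ∧ lcoeff 0 f = w}
  zero_mem' := ⟨0, Submodule.zero_mem _, fun n _ => map_zero _, map_zero _⟩
  add_mem' := by
    rintro _ _ ⟨f, hf, hf0, rfl⟩ ⟨g, hg, hg0, rfl⟩
    exact ⟨f + g, Submodule.add_mem _ hf hg, fun n hn => by
      rw [map_add, hf0 n hn, hg0 n hn, add_zero], map_add _ _ _⟩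
  smul_mem' := by
    rintro c _ ⟨f, hf, hf0, rfl⟩
    exact ⟨c • f, Submodule.smul_of_tower_mem _ c hf, fun n hn => by
      rw [map_smul, hf0 n hn, smul_zero], map_smul _ _ _⟩

variable {Δ ρ1 ρ2 v1 v2}

lemma ratLattice_stable (a : Alg T t (μ1 + μ2)) {f : LaurentVec V12}
    (hf : f ∈ ratLattice Δ ρ1 ρ2 v1 v2) :
    ρΔ a f ∈ ratLattice Δ ρ1 ρ2 v1 v2 := by
  have h : ratLattice Δ ρ1 ρ2 v1 v2 ≤ (ratLattice Δ ρ1 ρ2 v1 v2).comap (ratEnd (ρΔ a)) :=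
    span_le.2 fun f hf => subset_span (lattice_stable _ _ a hf)
  exact h hf

variable (hΔ : IsDeformedCoproduct Δ) (h1 : IsHighestWeight ρ1 v1 ω1) (h₂ : IsHighestWeight ρ2 v2
  ω2) (ht : Generic t)

include h1 h₂ in
lemma tmul_mem_leadSpace : v1 ⊗ₜ v2 ∈ leadSpace Δ ρ1 ρ2 v1 v2 (ω1 1 * ω2 1) :=
  ⟨constVec v12, ⟨subset_span (subset_span
    ⟨1, by beta_reduce; rw [map_one]; rfl⟩), constVec_mem_ratSub (tmul_mem_tensorWeight
      (mem_weightSpace.2 (h1.lead 1)) (mem_weightSpace.2 (h₂.lead 1)))⟩,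
    fun n hn => by rw [lcoeff_constVec, if_neg hn.ne], by rw [lcoeff_constVec, if_pos rfl]⟩

include hΔ h1 h₂ ht

lemma one_tmul_x_mem_leadSpace {w : V12}
    (hw : w ∈ leadSpace Δ ρ1 ρ2 v1 v2 ω) (j : T.I0) {p : ℤ} (hp : p < 0) :
    tensorOp ρ1 ρ2 (1 ⊗ₜ Alg.x (-1) j p) w ∈
      leadSpace Δ ρ1 ρ2 v1 v2 (ω * (rootWeight T t j)⁻¹) := by
  obtain ⟨f, hf, hf0, rfl⟩ := hw
  have hlow : ∀ n < p, (Δ (Alg.x (-1) j p)).coeff n = 0 := fun n hn => by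
    rw [hΔ.x_minus, if_neg hn.ne, Alg.φ_one_of_neg j (by omega), tmul_zero, add_zero]
  obtain ⟨ha, hb⟩ := lcoeff_deformedAct_leading (ρ1 := ρ1) (ρ2 := ρ2) Δ _ hlow hf0
  rw [hΔ.x_minus, if_pos rfl, Alg.φ_one_of_neg j hp, tmul_zero, add_zero] at hb
  refine ⟨(RatFunc.X ^ (-p) : RatFunc ℂ) • ρΔ (Alg.x (-1) j p) f,
    smul_mem _ _ ⟨ratLattice_stable _ hf.1,
      deformedAct_x_mem hΔ ht h1.inO h₂.inO j p hf.2⟩, fun n hn => ?_, ?_⟩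
  · rw [lcoeff_X_zpow_smul]; exact ha _ (by omega)
  · rw [lcoeff_X_zpow_smul, ← hb]; congr 1; ring_nf

lemma x_tmul_lead_mem_leadSpace {w : V12}
    (hw : w ∈ leadSpace Δ ρ1 ρ2 v1 v2 ω) (j : T.I0) {p : ℤ} (hp : 0 < p) :
    tensorOp ρ1 ρ2 (Alg.x (-1) j p ⊗ₜ lead 1 j) w ∈
      leadSpace Δ ρ1 ρ2 v1 v2 (ω * (rootWeight T t j)⁻¹) := by
  obtain ⟨f, hf, hf0, rfl⟩ := hw
  have hlow : ∀ n < 0, (Δ (Alg.x (-1) j p)).coeff n = 0 := fun n hn => by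
    rw [hΔ.x_minus, if_neg (by omega), Alg.φ_one_of_neg j hn, tmul_zero, add_zero]
  obtain ⟨ha, hb⟩ := lcoeff_deformedAct_leading (ρ1 := ρ1) (ρ2 := ρ2) Δ _ hlow hf0
  rw [hΔ.x_minus, if_neg hp.ne, sub_zero, zero_add] at hb
  refine ⟨ρΔ (Alg.x (-1) j p) f, ⟨ratLattice_stable _ hf.1,
      deformedAct_x_mem hΔ ht h1.inO h₂.inO j p hf.2⟩, ha, hb.trans ?_⟩
  rw [lead, show leadIdx 0 μ2 1 j = 0 from ld_one μ2 j]

lemma tmul_wordVec_mem_leadSpace (L : List (T.I0 × ℤ)) : v1 ⊗ₜ wordVec ρ2 v2 L ∈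
    leadSpace Δ ρ1 ρ2 v1 v2 (ω1 1 * ω2 1 * (typeWeight t (L.map Prod.fst))⁻¹) := by
  induction L with
  | nil =>
    rw [show (typeWeight t (List.map Prod.fst ([] : List (T.I0 × ℤ))))⁻¹ = 1 by simp [typeWeight],
      mul_one]
    exact tmul_mem_leadSpace h1 h₂
  | cons p L ih =>
    have hrec := (h₂.inO.recurrent_x ht (-1) p.1 (wordVec ρ2 v2 L)).map (TensorProduct.mk ℂ V1 V2 v1)
    refine hrec.mem_of_neg (fun n hn => ?_) p.2
    have := one_tmul_x_mem_leadSpace hΔ h1 h₂ ht ih p.1 hn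
    rw [tensorOp_tmul, map_one, mul_assoc, ← mul_inv_rev, ← typeWeight_cons] at this
    exact this

lemma wordVec_tmul_mem_leadSpace (L L' : List (T.I0 × ℤ)) :
    wordVec ρ1 v1 L ⊗ₜ wordVec ρ2 v2 L' ∈ leadSpace Δ ρ1 ρ2 v1 v2
      ((ω1 1 * (typeWeight t (L.map Prod.fst))⁻¹) *
        (ω2 1 * (typeWeight t (L'.map Prod.fst))⁻¹)) := by
  rw [mul_mul_mul_comm, mul_comm (typeWeight t (L.map Prod.fst))⁻¹, ← mul_assoc]
  induction L with
  | nil =>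
    rw [show (typeWeight t (List.map Prod.fst ([] : List (T.I0 × ℤ))))⁻¹ = 1 by simp [typeWeight],
      mul_one]
    exact tmul_wordVec_mem_leadSpace hΔ h1 h₂ ht L'
  | cons p L ih =>
    have hrec := (h1.inO.recurrent_x ht (-1) p.1 (wordVec ρ1 v1 L)).map
      ((TensorProduct.mk ℂ V1 V2).flip (wordVec ρ2 v2 L'))
    refine hrec.mem_of_pos (fun n hn => ?_) p.2
    have := x_tmul_lead_mem_leadSpace hΔ h1 h₂ ht ih p.1 hn
    rw [tensorOp_tmul, lead_wordVec h₂.lead 1, tmul_smul, mul_assoc _ _ (_)⁻¹,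
      ← mul_inv_rev, ← typeWeight_cons] at this
    exact (Submodule.smul_mem_iff _ (Units.ne_zero _)).1 this

lemma tensorWeight_le_leadSpace (ω : Weight T) : tensW ω ≤ leadSpace Δ ρ1 ρ2 v1 v2 ω := by
  rw [tensorWeight_eq_iSup h1 h₂ ht]
  refine iSup₂_le fun p hp => ?_
  rw [wordSpace, wordSpace, Submodule.map₂_span_span, span_le]
  rintro _ ⟨_, ⟨L, hL, rfl⟩, _, ⟨L', hL', rfl⟩, rfl⟩
  have := wordVec_tmul_mem_leadSpace hΔ h1 h₂ ht L L'
  rw [show L.map Prod.fst = p.1 from hL, show L'.map Prod.fst = p.2 from hL', hp] at this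
  exact this

lemma ratSub_le_ratLattice (ω : Weight T) : ratSub (tensW ω) ≤ ratLattice Δ ρ1 ρ2 v1 v2 := by
  have := finite_tensorWeight h1 h₂ ht ω
  have h := eq_ratSub_of_leading (P := tensW ω)
    (N := ratLattice Δ ρ1 ρ2 v1 v2 ⊓ ratSub (tensW ω)) inf_le_right
    fun w hw => tensorWeight_le_leadSpace hΔ h1 h₂ ht ω hw
  exact h ▸ inf_le_left

omit hΔ in
lemma ratVec_eq_iSup : ratVec V12 = ⨆ ω, ratSub (tensW ω) := by
  refine le_antisymm (span_le.2 ?_) (iSup_le fun ω => ratSub_le_ratVec _)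
  rintro _ ⟨w, rfl⟩
  have hw : w ∈ ⨆ ω, tensW ω := by rw [iSup_tensorWeight h1 h₂]; exact mem_top
  induction hw using iSup_induction' with
  | mem ω w hw => exact mem_iSup_of_mem ω (constVec_mem_ratSub hw)
  | zero => rw [SetLike.mem_coe, ← constHom_apply, map_zero]; exact Submodule.zero_mem _
  | add w w' _ _ h h' =>
    rw [SetLike.mem_coe, ← constHom_apply, map_add]; exact Submodule.add_mem _ h h'

lemma ratLattice_eq : ratLattice Δ ρ1 ρ2 v1 v2 = ratVec V12 := by
  refine le_antisymm (span_le.2 fun f hf => ?_) ?_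
  · rw [lattice_eq_wordSpan hΔ h1 h₂ ht, wordSpan_eq_iSup] at hf
    induction hf using iSup_induction' with
    | mem l f hf => exact ratSub_le_ratVec _ (wordSpace_subset_ratSub hΔ h1 h₂ ht hf)
    | zero => exact Submodule.zero_mem _
    | add f g _ _ h h' => exact Submodule.add_mem _ h h'
  · rw [ratVec_eq_iSup h1 h₂ ht]
    exact iSup_le fun ω => ratSub_le_ratLattice hΔ h1 h₂ ht ω

lemma isAForm_lattice : IsAForm ρΔ (lattice ρΔ v12) where
  stable a _ hf := lattice_stable _ _ a hf
  span_eq := ratLattice_eq hΔ h1 h₂ ht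
  fg ω := lattice_inf_ratWeightSpace_fg hΔ h1 h₂ ht ω

lemma ratSub_eq_span_inf (ω : Weight T) : ratSub (tensW ω) = span (RatFunc ℂ) ((lattice ρΔ v12 ⊓
      ratWeightSpace ρΔ ω : Submodule regOne (LaurentVec V12)) : Set (LaurentVec V12)) := by
  refine le_antisymm (fun f hf => ?_) (span_le.2 fun f hf => ?_)
  · obtain ⟨D, hD, h⟩ := exists_smul_mem_of_mem_span (ratSub_le_ratLattice hΔ h1 h₂ ht ω hf)
    rw [Submodule.span_eq] at h
    have hD' : (D : RatFunc ℂ) ≠ 0 := fun h => hD (Subtype.ext h)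
    have h2 : D • f ∈ lattice ρΔ v12 ⊓ ratWeightSpace ρΔ ω :=
      ⟨h, smul_mem _ D (ratSub_subset_ratWeightSpace hΔ hf)⟩
    have := smul_mem _ (D : RatFunc ℂ)⁻¹ (subset_span (R := RatFunc ℂ) h2)
    rwa [regOne_smul_def, smul_smul, inv_mul_cancel₀ hD', one_smul] at this
  · rw [SetLike.mem_coe, lattice_inf_ratWeightSpace hΔ h1 h₂ ht, iSup_subtype'] at hf
    induction hf using iSup_induction' with
    | mem l _ hf =>
      obtain ⟨l, hl⟩ := l
      have := wordSpace_subset_ratSub hΔ h1 h₂ ht hf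
      rwa [hl] at this
    | zero => exact Submodule.zero_mem _
    | add f g _ _ h h' => exact Submodule.add_mem _ h h'

end Leading


/-! ### The specialization at `u = 1` -/

section Specialization

variable {U : Type*} [Ring U] [Algebra ℂ U] {R : U →ₐ[ℂ] End (LaurentSeries ℂ) (LaurentVec W)} {w :
  W}

instance : SMul regOne (lattice R w) := (Submodule.module (lattice R w)).toSMul

lemma fusionMk_eq_zero {f : lattice R w} : fusionMk R w f = 0 ↔ ∃ g, uSubOne • g = f :=
  Submodule.Quotient.mk_eq_zero _

lemma regOne_smul_fusion (c : regOne) (x : Fusion R w) : c • x = evOne c • x := by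
  obtain ⟨d, hd⟩ := exists_eq_add_uSubOne_mul c
  obtain ⟨f, rfl⟩ := fusionMk_surjective R w x
  have h : (uSubOne * d) • fusionMk R w f = 0 := by
    rw [← map_smul, fusionMk_eq_zero]
    exact ⟨d • f, smul_smul _ _ _⟩
  nth_rewrite 1 [hd]
  rw [add_smul, h, add_zero]
  rfl

lemma mem_span_regOne_fusion {s : Set (Fusion R w)} {x : Fusion R w}
    (hx : x ∈ span regOne s) : x ∈ span ℂ s := by
  induction hx using span_induction with
  | mem x hx => exact subset_span hx
  | zero => exact Submodule.zero_mem _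
  | add x y _ _ hx hy => exact Submodule.add_mem _ hx hy
  | smul c x _ hx => rw [regOne_smul_fusion]; exact smul_mem _ _ hx

lemma fusionRep_mk (a : U) (f : lattice R w) :
    fusionRep R w a (fusionMk R w f) = fusionMk R w (latticeAct R w a f) := rfl

lemma constVec_mem_lattice : constVec w ∈ lattice R w :=
  subset_span ⟨1, by beta_reduce; rw [map_one]; rfl⟩

lemma fusionRep_fusionVec {a : U} {c : regOne} (h : R a (constVec w) = c • constVec w) :
    fusionRep R w a (fusionVec R w) = evOne c • fusionVec R w := by
  rw [← regOne_smul_fusion]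
  exact congrArg (fusionMk R w) (Subtype.ext h)

lemma fusionRep_generates (x : Fusion R w) : ∃ a, fusionRep R w a (fusionVec R w) = x := by
  obtain ⟨⟨f, hf⟩, rfl⟩ := fusionMk_surjective R w x
  induction hf using span_induction with
  | mem x hx =>
    obtain ⟨a, rfl⟩ := hx
    exact ⟨a, rfl⟩
  | zero => exact ⟨0, by rw [map_zero]; exact (map_zero (fusionMk R w)).symm⟩
  | add x y hx hy ihx ihy =>
    obtain ⟨a, ha⟩ := ihx
    obtain ⟨b, hb⟩ := ihy
    exact ⟨a + b, by
      rw [map_add, LinearMap.add_apply, ha, hb]; exact (map_add (fusionMk R w) _ _).symm⟩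
  | smul c x hx ih =>
    obtain ⟨a, ha⟩ := ih
    exact ⟨evOne c • a, by
      rw [map_smul, LinearMap.smul_apply, ha, ← regOne_smul_fusion]
      exact (map_smul (fusionMk R w) c _).symm⟩

end Specialization

section FusionModule

lemma wordVec_mem_lattice (L : List (T.I0 × ℤ)) : wordVec ρReg (constVec v12) L ∈
      lattice ρΔ v12 := by
  induction L with
  | nil => exact constVec_mem_lattice
  | cons p L ih => exact lattice_stable _ _ (Alg.x (-1) p.1 p.2) ih

lemma wordVec_fusion (L : List (T.I0 × ℤ)) : wordVec (fusionRep ρΔ v12) (fusionVec ρΔ v12) L =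
        fusionMk _ _ ⟨_, wordVec_mem_lattice L⟩ := by
  induction L with
  | nil => rfl
  | cons p L ih => rw [wordVec, ih]; rfl

lemma wordSpace_fusion_eq_map (l : List T.I0) {x} (hx : x ∈ wordSpace (fusionRep ρΔ v12)
      (fusionVec ρΔ v12) l) :
    x ∈ ((wordSpace ρReg (constVec v12) l).comap (lattice ρΔ v12).subtype).map (fusionMk _ _) := by
  induction hx using span_induction with
  | mem x hx =>
    obtain ⟨L, hL, rfl⟩ := hx
    rw [wordVec_fusion]
    exact ⟨_, subset_span ⟨L, hL, rfl⟩, rfl⟩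
  | zero => exact Submodule.zero_mem _
  | add x y _ _ hx hy => exact Submodule.add_mem _ hx hy
  | smul c x _ hx => exact smul_mem _ (algebraMap ℂ regOne c) hx

variable (hΔ : IsDeformedCoproduct Δ) (h₁ : IsHighestWeight ρ1 v1 ω1) (h₂ : IsHighestWeight ρ2 v2
  ω2) (ht : Generic t)

include hΔ h₁ h₂ ht in
lemma finite_wordSpace_fusion (l : List T.I0) : FiniteDimensional ℂ (wordSpace (fusionRep ρΔ v12)
      (fusionVec ρΔ v12) l) := by
  have hfg : ((wordSpace ρReg (constVec v12) l).comap (lattice ρΔ v12).subtype).FG := by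
    refine Submodule.fg_of_fg_map_injective _ (Submodule.injective_subtype _) ?_
    rw [Submodule.map_comap_subtype, inf_eq_right.2]
    · exact wordSpace_fg hΔ h₁ h₂ ht l
    · rw [lattice_eq_wordSpan hΔ h₁ h₂ ht, wordSpan_eq_iSup]
      exact le_iSup _ l
  obtain ⟨s, hs⟩ := hfg.map (fusionMk ρΔ v12)
  have := FiniteDimensional.span_finset ℂ s
  refine finiteDimensional_of_le (S₂ := span ℂ (s : Set _)) fun x hx => ?_
  refine mem_span_regOne_fusion ?_
  rw [hs]
  exact wordSpace_fusion_eq_map l hx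

include hΔ in
lemma deformedAct_φ_tmul {ε : ℤˣ} {i : T.I0} {a b : ℤ → ℂ}
    (ha : ∀ m, ρ1 (Alg.φ ε i m) v1 = a m • v1) (hb : ∀ m, ρ2 (Alg.φ ε i m) v2 = b m • v2) (m : ℤ) :
    ρΔ (Alg.φ ε i m) (constVec v12) = (∑ n ∈ φRange μ1 μ2 ε i m, ((uUnit ^ n : regOneˣ) : regOne) *
        algebraMap ℂ regOne (a (m - n) * b n)) • constVec v12 := by
  rw [deformedAct_φ hΔ, sum_smul]
  refine sum_congr rfl fun n _ => ?_
  rw [tensorOp_tmul, ha, hb, smul_tmul_smul, mul_smul (_ : regOne),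
    algebraMap_smul_regOne, constVec_smul]

include hΔ in
lemma fusionRep_φ_fusionVec {ε : ℤˣ} {i : T.I0} {a b : ℤ → ℂ}
    (ha : ∀ m, ρ1 (Alg.φ ε i m) v1 = a m • v1) (hb : ∀ m, ρ2 (Alg.φ ε i m) v2 = b m • v2) (m : ℤ) :
    fusionRep ρΔ v12 (Alg.φ ε i m) (fusionVec _ _) = (∑ n ∈ φRange μ1 μ2 ε i m, a (m - n) * b n) •
        fusionVec ρΔ v12 := by
  rw [fusionRep_fusionVec (deformedAct_φ_tmul hΔ ha hb m), map_sum]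
  simp only [map_mul, evOne_uUnit_zpow, evOne_algebraMap, one_mul]

include hΔ h₁ h₂ in
lemma fusionRep_lead_fusionVec (ε : ℤˣ) (i : T.I0) : fusionRep ρΔ v12 (lead ε i) (fusionVec _ _) =
      ((((ω1 * ω2) ε i) ^ (ε : ℤ) : ℂˣ) : ℂ) • fusionVec ρΔ v12 := by
  rw [fusionRep_fusionVec (deformedAct_lead hΔ h₁ h₂ ε i), val_mul, map_mul,
    evOne_uUnit_zpow, one_mul]
  congr 1
  exact evOne_algebraMap _

include hΔ h₁ h₂ in
lemma isSingular_fusion : IsSingular (fusionRep ρΔ v12) (fusionVec ρΔ v12) where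
  x_plus i r := by
    rw [fusionRep_fusionVec (c := 0), map_zero, zero_smul]
    rw [zero_smul]
    exact (isSingular_regAct hΔ h₁ h₂).x_plus i r
  φ_mem ε i m := by
    obtain ⟨c, hc⟩ := mem_span_singleton.1 ((isSingular_regAct hΔ h₁ h₂).φ_mem ε i m)
    exact mem_span_singleton.2 ⟨_, (fusionRep_fusionVec hc.symm).symm⟩
  κ_mem ε i := κ_mem_span (fusionRep_lead_fusionVec hΔ h₁ h₂ ε i)

include hΔ h₁ h₂ ht in
lemma isHighestWeight_fusion : IsHighestWeight (fusionRep ρΔ v12) (fusionVec ρΔ v12) (ω1 * ω2) where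
  inO := (isSingular_fusion hΔ h₁ h₂).inO ht fusionRep_generates
    (fusionRep_lead_fusionVec hΔ h₁ h₂) (finite_wordSpace_fusion hΔ h₁ h₂ ht)
  singular := isSingular_fusion hΔ h₁ h₂
  generates := fusionRep_generates
  lead := fusionRep_lead_fusionVec hΔ h₁ h₂

lemma mem_ratWeightSpace_of_smul {R : Alg T t μ →ₐ[ℂ] End (LaurentSeries ℂ) (LaurentVec W)} {D : regOne}
    (hD : D ≠ 0) {f : LaurentVec W} (hf : D • f ∈ ratWeightSpace R ω) : f ∈ ratWeightSpace R ω := by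
  have hD' : (D : RatFunc ℂ) ≠ 0 := fun h => hD (Subtype.ext h)
  refine ⟨?_, fun i => regOne_smul_injective hD ?_⟩
  · have := smul_mem _ (D : RatFunc ℂ)⁻¹ hf.1
    rwa [regOne_smul_def, smul_smul, inv_mul_cancel₀ hD', one_smul] at this
  · beta_reduce
    rw [← act_smul, hf.2 i, smul_comm]

lemma typeWeight_eq_one (ht : Generic t) {l : List T.I0} (h : typeWeight t l = 1) : l = [] := by
  have h1 := congrArg (heightHom T) h
  rw [heightHom_typeWeight, map_one] at h1
  have h2 := length_le_height l
  by_contra h3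
  have h4 := List.length_pos_iff.2 h3
  obtain ⟨n, hn⟩ := Int.eq_ofNat_of_zero_le (show 0 ≤ (l.map TwistedType.rootHeight).sum by omega)
  rw [hn, zpow_natCast] at h1
  refine ht n (by omega) ?_
  exact_mod_cast congrArg Units.val h1

include hΔ h₁ h₂ ht in
lemma fusionVec_ne_zero (hv₁ : v1 ≠ 0) (hv2 : v2 ≠ 0) : fusionVec ρΔ v12 ≠ 0 := by
  intro h
  obtain ⟨⟨f, hf⟩, hfe⟩ := fusionMk_eq_zero.1 h
  have hfe : uSubOne • f = constVec v12 := congrArg Subtype.val hfe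
  have hv : v12 ∈ tensW (ω1 1 * ω2 1) := by
    refine mem_tensorWeight.2 fun i => ?_
    rw [tensorOp_tmul, h₁.lead, h₂.lead, smul_tmul_smul]
    simp
  have h0 : v12 ≠ 0 := by
    intro h
    obtain ⟨f, hf⟩ := not_forall.1 (mt (Module.forall_dual_apply_eq_zero_iff ℂ v1).1 hv₁)
    obtain ⟨g, hg⟩ := not_forall.1 (mt (Module.forall_dual_apply_eq_zero_iff ℂ v2).1 hv2)
    have := congrArg (TensorProduct.dualDistrib ℂ V1 V2 (f ⊗ₜ g)) h
    rw [TensorProduct.dualDistrib_apply, map_zero] at this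
    exact mul_ne_zero hf hg this
  have hw := mem_ratWeightSpace_of_smul (R := ρΔ) uSubOne_ne_zero
    (hfe ▸ ratSub_subset_ratWeightSpace hΔ (constVec_mem_ratSub hv))
  have hfw : f ∈ wordSpace ρReg (constVec v12) [] := by
    have := Submodule.mem_inf.2 ⟨hf, hw⟩
    rw [lattice_inf_ratWeightSpace hΔ h₁ h₂ ht] at this
    refine (iSup₂_le fun l hl => ?_ :
      _ ≤ wordSpace ρReg (constVec v12) []) this
    rw [typeWeight_eq_one ht (inv_eq_one.1 (mul_eq_left.1 hl))]
  obtain ⟨c, rfl⟩ : ∃ c : regOne, c • constVec v12 = f := by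
    rw [← mem_span_singleton]
    refine span_mono ?_ hfw
    rintro _ ⟨L, hL, rfl⟩
    rw [List.map_eq_nil_iff.1 hL]
    rfl
  have hc : (uSubOne * c - 1) • constVec v12 = 0 := by
    rw [sub_smul, mul_smul, hfe, one_smul, sub_self]
  have h3 : constVec v12 ≠ 0 := fun h => h0 (by
    have := congrArg (lcoeff 0) h
    rwa [lcoeff_constVec, if_pos rfl, map_zero] at this)
  have h4 : uSubOne * c - 1 = 0 := by
    by_contra h5
    exact h3 (regOne_smul_injective h5 (hc.trans (smul_zero _).symm))
  have := congrArg evOne h4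
  rw [map_sub, map_mul, evOne_uSubOne, zero_mul, map_one, map_zero] at this
  norm_num at this

end FusionModule


/-! ### Expansions of rational functions -/

section Expansions

open Polynomial

lemma expandZero_algebraMap (p : ℂ[X]) : expandZero ℂ (algebraMap ℂ[X] (RatFunc ℂ) p) =
    ofPowerSeries ℤ ℂ (p : PowerSeries ℂ) :=
  (RatFunc.coe_coe p).symm

lemma laurent_coeff_mul {F G : LaurentSeries ℂ} {a b : ℤ} (hF : ∀ n < a, F.coeff n = 0)
    (hG : ∀ n < b, G.coeff n = 0) (m : ℤ) :
    (F * G).coeff m = ∑ n ∈ Finset.Icc b (m - a), F.coeff (m - n) * G.coeff n := by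
  rw [HahnSeries.coeff_mul]
  refine Finset.sum_bij_ne_zero (fun p _ _ => p.2) (fun p hp _ => ?_) (fun p hp _ q hq _ h => ?_)
    (fun n hn h => ?_) fun p hp _ => ?_
  · rw [Finset.mem_antidiagonal] at hp
    rw [mem_Icc]
    constructor
    · by_contra h
      exact hp.2.1 (hG _ (by omega))
    · by_contra h
      exact hp.1 (hF _ (by omega))
  · rw [Finset.mem_antidiagonal] at hp hq
    refine Prod.ext ?_ h
    have := hp.2.2
    have := hq.2.2
    omega
  · refine ⟨(m - n, n), ?_, h, rfl⟩
    rw [Finset.mem_antidiagonal]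
    exact ⟨left_ne_zero_of_mul h, right_ne_zero_of_mul h, by simp⟩
  · rw [Finset.mem_antidiagonal] at hp
    rw [← hp.2.2, add_sub_cancel_right]

lemma coeffAtZero_mul {f g : RatFunc ℂ} (hf : ∀ n < 0, coeffAtZero f n = 0)
    (hg : ∀ n < 0, coeffAtZero g n = 0) (m : ℤ) : coeffAtZero (f * g) m =
      ∑ n ∈ Finset.Icc 0 m, coeffAtZero f (m - n) * coeffAtZero g n := by
  rw [coeffAtZero, map_mul, laurent_coeff_mul hf hg, sub_zero]
  rfl

lemma eval2_single_neg_ne_zero {p : ℂ[X]} (hp : p ≠ 0) :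
    p.eval₂ (algebraMap ℂ (LaurentSeries ℂ)) (single (-1 : ℤ) (1 : ℂ)) ≠ 0 := by
  intro h
  apply hp
  ext k
  have h1 := congrArg (fun F : LaurentSeries ℂ => F.coeff (-k)) h
  rw [eval₂_eq_sum, Polynomial.sum] at h1
  have h2 (e : ℕ) : algebraMap ℂ (LaurentSeries ℂ) (p.coeff e) *
      single (-1 : ℤ) (1 : ℂ) ^ e = single (-e : ℤ) (p.coeff e) := by
    have h3 : algebraMap ℂ (LaurentSeries ℂ) (p.coeff e) = single (0 : ℤ) (p.coeff e) := by
      simp [HahnSeries.algebraMap_apply']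
    rw [HahnSeries.single_pow, h3, single_mul_single]
    simp
  simp only [h2, HahnSeries.coeff_sum, HahnSeries.coeff_single, neg_inj, Nat.cast_inj,
    HahnSeries.coeff_zero] at h1
  rw [sum_ite_eq] at h1
  split_ifs at h1 with h3
  · rw [h1, coeff_zero]
  · rw [notMem_support_iff.1 h3, coeff_zero]

lemma coeffAtInfty_mul {f g : RatFunc ℂ} {a b : ℤ} (hf : ∀ n, a < n → coeffAtInfty f n = 0)
    (hg : ∀ n, b < n → coeffAtInfty g n = 0) (m : ℤ) : coeffAtInfty (f * g) m =
      ∑ n ∈ Finset.Icc (m - a) b, coeffAtInfty f (m - n) * coeffAtInfty g n := by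
  rw [coeffAtInfty, RatFunc.eval_mul _ _ (eval2_single_neg_ne_zero f.denom_ne_zero)
    (eval2_single_neg_ne_zero g.denom_ne_zero), laurent_coeff_mul (a := -a) (b := -b)]
  · refine sum_nbij' (fun n => -n) (fun n => -n) ?_ ?_ ?_ ?_ ?_
    · intro n hn; rw [mem_Icc] at hn ⊢; omega
    · intro n hn; rw [mem_Icc] at hn ⊢; omega
    · intro n _; exact neg_neg n
    · intro n _; exact neg_neg n
    · intro n _
      rw [coeffAtInfty, coeffAtInfty, neg_neg]
      congr 2
      ring
  · intro n hn
    have := hf (-n) (by omega)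
    rwa [coeffAtInfty, neg_neg] at this
  · intro n hn
    have := hg (-n) (by omega)
    rwa [coeffAtInfty, neg_neg] at this

lemma exists_expansion {f : RatFunc ℂ} (hf : f.denom.eval 0 ≠ 0) : ∃ F : PowerSeries ℂ,
    expandZero ℂ f = ofPowerSeries ℤ ℂ F ∧ F * (f.denom : PowerSeries ℂ) = f.num := by
  have h0 : PowerSeries.constantCoeff (f.denom : PowerSeries ℂ) ≠ 0 := by
    rwa [constantCoeff_coe, coeff_zero_eq_eval_zero]
  have h1 : (f.num * (f.denom : PowerSeries ℂ)⁻¹) * (f.denom : PowerSeries ℂ) = f.num := by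
    rw [mul_assoc, PowerSeries.inv_mul_cancel _ h0, mul_one]
  refine ⟨f.num * (f.denom : PowerSeries ℂ)⁻¹, ?_, h1⟩
  have hd : expandZero ℂ (algebraMap ℂ[X] (RatFunc ℂ) f.denom) ≠ 0 :=
    (_root_.map_ne_zero _).2 (algebraMap_ne_zero f.denom_ne_zero)
  refine mul_right_cancel₀ hd ?_
  rw [← map_mul, expandZero_algebraMap f.denom, ← map_mul, h1, ← expandZero_algebraMap]
  congr 1
  nth_rewrite 1 [← RatFunc.num_div_denom f]
  exact div_mul_cancel₀ _ (algebraMap_ne_zero f.denom_ne_zero)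

lemma coeffAtZero_of_neg {f : RatFunc ℂ} (hf : f.denom.eval 0 ≠ 0) {n : ℤ} (hn : n < 0) :
    coeffAtZero f n = 0 := by
  obtain ⟨F, hF, -⟩ := exists_expansion hf
  rw [coeffAtZero, hF, PowerSeries.coeff_coe, if_pos hn]

lemma coeffAtZero_zero_ne_zero {f : RatFunc ℂ} (hf : f.denom.eval 0 ≠ 0)
    (hf' : f.num.eval 0 ≠ 0) : coeffAtZero f 0 ≠ 0 := by
  obtain ⟨F, hF, h⟩ := exists_expansion hf
  have h1 := congrArg PowerSeries.constantCoeff h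
  rw [map_mul, constantCoeff_coe, constantCoeff_coe,
    coeff_zero_eq_eval_zero, coeff_zero_eq_eval_zero] at h1
  rw [coeffAtZero, hF, PowerSeries.coeff_coe, if_neg (lt_irrefl _)]
  intro h2
  apply hf'
  rw [← h1]
  rw [Int.natAbs_zero, PowerSeries.coeff_zero_eq_constantCoeff_apply] at h2
  rw [h2, zero_mul]

lemma coeffAtZero_injective {f g : RatFunc ℂ} (hf : f.denom.eval 0 ≠ 0)
    (hg : g.denom.eval 0 ≠ 0) (h : ∀ m : ℕ, coeffAtZero f m = coeffAtZero g m) : f = g := by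
  refine (expandZero ℂ).injective (HahnSeries.ext (funext fun n => ?_))
  rcases lt_or_ge n 0 with hn | hn
  · exact (coeffAtZero_of_neg hf hn).trans (coeffAtZero_of_neg hg hn).symm
  · obtain ⟨m, rfl⟩ := Int.eq_ofNat_of_zero_le hn
    exact h m

lemma exists_ratFunc {a b : ℤ → ℂ} {d : ℤ} (ha : ∀ n < 0, a n = 0) (ha0 : a 0 ≠ 0)
    (hb : ∀ n, d < n → b n = 0) (hbd : b d ≠ 0) {p : ℂ[X]} (hp : p ≠ 0)
    (h : ∀ n : ℤ, ∑ k ∈ p.support, p.coeff k * (a (n + k) - b (n + k)) = 0) :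
    ∃ f : RatFunc ℂ, f.denom.eval 0 ≠ 0 ∧ f.num.eval 0 ≠ 0 ∧ f.intDegree = d ∧
      ∀ m : ℕ, coeffAtZero f m = a m := by
  set D := p.natDegree
  set A := p.reverse
  have hA0 : A.coeff 0 ≠ 0 := by rw [coeff_zero_reverse]; exact leadingCoeff_ne_zero.2 hp
  have hA : A ≠ 0 := fun h => hA0 (by rw [h, coeff_zero])
  have hAD : A.natDegree ≤ D := reverse_natDegree_le p
  have hconv (N : ℤ) : ∑ j ∈ range (D + 1), A.coeff j * a (N - j) =
      ∑ j ∈ range (D + 1), A.coeff j * b (N - j) := by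
    have h1 := h (N - D)
    rw [sum_subset (s₂ := range (D + 1)) (fun k hk => Finset.mem_range_succ_iff.2
      (le_natDegree_of_mem_supp k hk)) (fun k _ hk => by
        rw [notMem_support_iff.1 hk, zero_mul])] at h1
    rw [← sub_eq_zero, ← sum_sub_distrib, ← Finset.sum_range_reflect, ← h1]
    refine sum_congr rfl fun k hk => ?_
    have hk : k ≤ D := Finset.mem_range_succ_iff.1 hk
    have h2 : A.coeff (D + 1 - 1 - k) = p.coeff k := by
      rw [coeff_reverse, revAt_le (by omega)]
      congr 1
      omega
    have h3 : (N - ((D + 1 - 1 - k : ℕ) : ℤ)) = N - D + k := by omega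
    rw [h2, h3, mul_sub]
  have hmul (N : ℕ) : PowerSeries.coeff N ((A : PowerSeries ℂ) * PowerSeries.mk fun n => a n) =
      ∑ j ∈ range (D + 1), A.coeff j * a (N - j) := by
    rw [PowerSeries.coeff_mul, Finset.Nat.sum_antidiagonal_eq_sum_range_succ_mk]
    have h1 : ∀ j ∈ range (N + 1), PowerSeries.coeff j (A : PowerSeries ℂ) *
        PowerSeries.coeff (N - j) (PowerSeries.mk fun n => a n) = A.coeff j * a (N - j) := by
      intro j hj
      have hj := Finset.mem_range_succ_iff.1 hj
      rw [Polynomial.coeff_coe, PowerSeries.coeff_mk, Nat.cast_sub hj]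
    refine ((sum_congr rfl h1).trans (sum_subset
      (Finset.range_mono (show N + 1 ≤ N + D + 1 by omega)) fun j _ hj => ?_)).trans
      (sum_subset (Finset.range_mono (show D + 1 ≤ N + D + 1 by omega)) fun j _ hj => ?_).symm
    · rw [mem_range] at hj
      rw [ha _ (by omega), mul_zero]
    · rw [mem_range] at hj
      rw [coeff_eq_zero_of_natDegree_lt (by omega), zero_mul]
  have hhigh (N : ℤ) (hN : A.natDegree + d < N) :
      ∑ j ∈ range (D + 1), A.coeff j * a (N - j) = 0 := by
    rw [hconv]
    refine sum_eq_zero fun j _ => ?_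
    rcases le_or_gt j A.natDegree with hj | hj
    · rw [hb _ (by omega), mul_zero]
    · rw [coeff_eq_zero_of_natDegree_lt hj, zero_mul]
  have htop : ∑ j ∈ range (D + 1), A.coeff j * a (A.natDegree + d - j) ≠ 0 := by
    rw [hconv, Finset.sum_eq_single A.natDegree]
    · rw [add_sub_cancel_left]
      exact mul_ne_zero (leadingCoeff_ne_zero.2 hA) hbd
    · intro j _ hj
      rcases lt_or_gt_of_ne hj with hj | hj
      · rw [hb _ (by omega), mul_zero]
      · rw [coeff_eq_zero_of_natDegree_lt hj, zero_mul]
    · intro hj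
      exact absurd (Finset.mem_range_succ_iff.2 hAD) hj
  obtain ⟨e, he⟩ := Int.eq_ofNat_of_zero_le (a := A.natDegree + d) (by
    by_contra hneg
    exact htop (sum_eq_zero fun j _ => by rw [ha _ (by omega), mul_zero]))
  set B := ((A : PowerSeries ℂ) * PowerSeries.mk fun n => a n).trunc (e + 1) with hB
  have hBe : B.natDegree = e := by
    refine le_antisymm (Nat.lt_succ_iff.1 (PowerSeries.natDegree_trunc_lt _ _))
      (le_natDegree_of_ne_zero ?_)
    rw [hB, PowerSeries.coeff_trunc, if_pos (Nat.lt_succ_self e), hmul]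
    rwa [he] at htop
  have hBA : (B : PowerSeries ℂ) = A * PowerSeries.mk fun n => a n := by
    ext N
    rw [Polynomial.coeff_coe, hB, PowerSeries.coeff_trunc]
    split_ifs with hN
    · rfl
    · rw [hmul, hhigh _ (by omega)]
  have hB0 : B.eval 0 ≠ 0 := by
    have := congrArg PowerSeries.constantCoeff hBA
    rw [map_mul, constantCoeff_coe, constantCoeff_coe] at this
    rw [← coeff_zero_eq_eval_zero, this]
    exact mul_ne_zero hA0 (by simpa using ha0)
  have hBne : B ≠ 0 := fun h => hB0 (by rw [h, eval_zero])
  rw [coeff_zero_eq_eval_zero] at hA0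
  refine ⟨algebraMap ℂ[X] (RatFunc ℂ) B / algebraMap ℂ[X] (RatFunc ℂ) A, fun h0 => ?_, fun h0 => ?_,
    ?_, fun m => ?_⟩
  · obtain ⟨w, hw⟩ := RatFunc.denom_div_dvd B A
    exact hA0 (by rw [hw, eval_mul, h0, zero_mul])
  · obtain ⟨w, hw⟩ := RatFunc.num_div_dvd B hA
    exact hB0 (by rw [hw, eval_mul, h0, zero_mul])
  · rw [div_eq_mul_inv, RatFunc.intDegree_mul (algebraMap_ne_zero hBne)
      (inv_ne_zero (algebraMap_ne_zero hA)), RatFunc.intDegree_inv,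
      RatFunc.intDegree_polynomial, RatFunc.intDegree_polynomial, hBe]
    omega
  · have hA' := (_root_.map_ne_zero (expandZero ℂ)).2 (algebraMap_ne_zero hA)
    rw [expandZero_algebraMap] at hA'
    rw [coeffAtZero, map_div₀, expandZero_algebraMap, expandZero_algebraMap, hBA, map_mul,
      mul_div_cancel_left₀ _ hA', HahnSeries.ofPowerSeries_apply_coeff, PowerSeries.coeff_mk]

end Expansions

section

lemma IsHighest.coeffAtInfty_of_lt {Ψ1 : LWeight T μ1} (h : IsHighest ρ1 Ψ1 v1) (i : T.I0)
    {n : ℤ} (hn : μ1.1 i < n) : coeffAtInfty (Ψ1.1 i) n = 0 := by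
  have := h.φ_minus i n
  rw [Alg.φ_neg_of_lt i hn, map_zero, LinearMap.zero_apply, eq_comm, smul_eq_zero] at this
  exact this.resolve_right h.ne_zero

lemma isHighest_fusion (hΔ : IsDeformedCoproduct Δ) (ht : Generic t)
    (hO1 : InO ρ1) (hO2 : InO ρ2) {Ψ1 : LWeight T μ1} {Ψ2 : LWeight T μ2}
    (hv₁ : IsHighest ρ1 Ψ1 v1) (hv2 : IsHighest ρ2 Ψ2 v2) :
    IsHighest (fusionRep ρΔ v12) (Ψ1.mul Ψ2) (fusionVec ρΔ v12) := by
  obtain ⟨ω1, h1⟩ := hv₁.exists_isHighestWeight hO1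
  obtain ⟨ω2, h2⟩ := hv2.exists_isHighestWeight hO2
  exact {
    ne_zero := fusionVec_ne_zero hΔ h1 h2 ht hv₁.ne_zero hv2.ne_zero
    generates := fusionRep_generates
    x_plus := (isSingular_fusion hΔ h1 h2).x_plus
    φ_plus := fun i m => by
      rw [fusionRep_φ_fusionVec hΔ (hv₁.φ_plus i) (hv2.φ_plus i), φRange, if_pos rfl]
      congr 1
      exact (coeffAtZero_mul (fun _ => coeffAtZero_of_neg (Ψ1.2 i).1)
        (fun _ => coeffAtZero_of_neg (Ψ2.2 i).1) m).symm
    φ_minus := fun i m => by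
      rw [fusionRep_φ_fusionVec hΔ (hv₁.φ_minus i) (hv2.φ_minus i), φRange, if_neg (by decide)]
      congr 1
      exact (coeffAtInfty_mul (fun _ => hv₁.coeffAtInfty_of_lt i)
        (fun _ => hv2.coeffAtInfty_of_lt i) m).symm }

end


/-! ### The `ℓ`-weights of a module of the category `𝒪` -/

lemma mem_jointGen_of_commute {V ι : Type*} [AddCommGroup V] [Module ℂ V]
    {f : ι → End ℂ V} {χ : ι → ℂ} {g : End ℂ V} (hg : ∀ i, Commute (f i) g) {w : V}
    (hw : w ∈ jointGen f χ) : g w ∈ jointGen f χ := by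
  rw [jointGen, mem_iInf] at hw ⊢
  exact fun i => End.mapsTo_maxGenEigenspace_of_comm (hg i) _ (hw i)

lemma exists_joint_eigenvector {ι : Type*} {f : ι → End ℂ V} (hf : ∀ i j, Commute (f i) (f j)) {E : Submodule ℂ V}
    [FiniteDimensional ℂ E] (hE : E ≠ ⊥) (hfE : ∀ i, ∀ w ∈ E, f i w ∈ E) :
    ∃ w ∈ E, w ≠ 0 ∧ ∃ c : ι → ℂ, ∀ i, f i w = c i • w := by
  obtain ⟨F, ⟨hF, hfF⟩, hmin⟩ := IsArtinian.set_has_minimal (R := ℂ) (M := E)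
    {F : Submodule ℂ E | F ≠ ⊥ ∧ ∀ i, ∀ w : E, w ∈ F → (⟨f i w, hfE i w w.2⟩ : E) ∈ F}
    ⟨⊤, fun h => hE (Submodule.subsingleton_iff_eq_bot.1
      ((Submodule.subsingleton_iff ℂ).1 (subsingleton_of_bot_eq_top h.symm))), fun _ _ _ => mem_top⟩
  let g (i : ι) : End ℂ E := (f i).restrict (hfE i)
  have key (i : ι) : ∃ c : ℂ, ∀ w ∈ F, g i w = c • w := by
    have hgF : ∀ w ∈ F, g i w ∈ F := hfF i
    have : Nontrivial F := Submodule.nontrivial_iff_ne_bot.2 hF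
    obtain ⟨c, hc⟩ := End.exists_eigenvalue ((g i).restrict hgF)
    obtain ⟨w, hw, hw0⟩ := hc.exists_hasEigenvector
    rw [End.mem_genEigenspace_one] at hw
    refine ⟨c, ?_⟩
    by_contra hne
    push Not at hne
    obtain ⟨y, hy, hyc⟩ := hne
    refine hmin (F ⊓ (g i).eigenspace c) ⟨?_, fun j w hw => ⟨hfF j w hw.1, ?_⟩⟩ ?_
    · refine (ne_bot_iff _).2 ⟨w, ⟨w.2, ?_⟩, fun h => hw0 (Subtype.ext h)⟩
      exact mem_eigenspace_iff.2 (congrArg Subtype.val hw)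
    · have h1 := mem_eigenspace_iff.1 hw.2
      refine mem_eigenspace_iff.2 (Subtype.ext ?_)
      have h2 : f i (f j w) = f j (f i w) := congrArg (fun g => g (w : V)) (hf i j).eq
      have h3 : f i w = c • (w : V) := congrArg Subtype.val h1
      exact h2.trans (by rw [h3, map_smul]; rfl)
    · exact lt_of_le_of_ne inf_le_left fun h => hyc (mem_eigenspace_iff.1 (h.ge hy).2)
  choose c hc using key
  obtain ⟨w, hwF, hw⟩ := (ne_bot_iff _).1 hF
  exact ⟨w, w.2, fun h => hw (Subtype.ext h), c, fun i => congrArg Subtype.val (hc i w hwF)⟩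

section LWeights

/-- The operators that define the `ℓ`-weight spaces. -/
def φOps (ρ : Alg T t μ →ₐ[ℂ] End ℂ V) (p : T.I0 × ℕ) : End ℂ V := ρ (Alg.φ 1 p.1 p.2)

/-- The coefficients of the expansions at `0` of an `ℓ`-weight. -/
def LWeight.coeffs (Ψ : LWeight T μ) (p : T.I0 × ℕ) : ℂ := coeffAtZero (Ψ.1 p.1) p.2

lemma lWeightSpace_eq (Ψ : LWeight T μ) : lWeightSpace ρ Ψ = jointGen (φOps ρ) Ψ.coeffs := by
  rw [jointGen, iInf_prod]
  rfl

lemma commute_φOps (p q : T.I0 × ℕ) : Commute (φOps ρ p) (φOps ρ q) := commute_φ _ _ _ _ _ _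

lemma LWeight.coeffs_injective : Function.Injective (LWeight.coeffs (T := T) (μ := μ)) :=
  fun Ψ Ψ' h => Subtype.ext (funext fun i => coeffAtZero_injective (Ψ.2 i).1 (Ψ'.2 i).1
    fun m => congrFun h (i, m))

lemma lead_one : (lead 1 i : Alg T t μ) = Alg.φ 1 i 0 := by rw [← ld_one μ i]; rfl

lemma InO.jointGen_le_weightSpace (hO : InO ρ) {χ : T.I0 × ℕ → ℂ} (ω : Weight T)
    (hω : ∀ i, (ω i : ℂ) = χ (i, 0)) : jointGen (φOps ρ) χ ≤ weightSpace ρ 1 ω := by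
  rw [hO.weightSpace_eq]
  refine le_iInf fun i => (iInf_le _ (i, 0)).trans (le_of_eq ?_)
  beta_reduce
  rw [φOps, lead_one, val_one, zpow_one, hω]
  rfl

lemma ne_zero_of_jointGen_ne_bot {χ : T.I0 × ℕ → ℂ} (h : jointGen (φOps ρ) χ ≠ ⊥) (i : T.I0) :
    χ (i, 0) ≠ 0 := by
  intro h0
  obtain ⟨w, hw, hw0⟩ := (ne_bot_iff _).1 h
  have h1 := (mem_iInf _).1 hw (i, 0)
  rw [h0, End.mem_maxGenEigenspace] at h1
  obtain ⟨k, hk⟩ := h1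
  rw [zero_smul, sub_zero] at hk
  have h2 : ρ (Alg.κ 1 i) * φOps ρ (i, 0) = 1 := by
    have := congrArg ρ (Alg.κ_mul_lead (t := t) (μ := μ) 1 i)
    rwa [lead_one, map_mul, map_one] at this
  have h3 : ρ (Alg.κ 1 i) ^ k * φOps ρ (i, 0) ^ k = 1 := by
    have hc : Commute (ρ (Alg.κ 1 i)) (φOps ρ (i, 0)) := by
      rw [commute_iff_eq, h2]
      have := congrArg ρ (Alg.lead_mul_κ (t := t) (μ := μ) 1 i)
      rwa [lead_one, map_mul, map_one, eq_comm] at this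
    rw [← hc.mul_pow, h2, one_pow]
  have h4 := congrArg (fun f => f w) h3
  simp only [End.mul_apply, hk, map_zero, End.one_apply] at h4
  exact hw0 h4.symm

lemma InO.finite_jointGen (hO : InO ρ) (χ : T.I0 × ℕ → ℂ) :
    FiniteDimensional ℂ (jointGen (φOps ρ) χ) := by
  by_cases h : jointGen (φOps ρ) χ = ⊥
  · rw [h]; infer_instance
  · let ω : Weight T := fun i => mk0 _ (ne_zero_of_jointGen_ne_bot h i)
    have := hO.finite 1 ω
    exact finiteDimensional_of_le (hO.jointGen_le_weightSpace ω fun _ => rfl)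

lemma InO.finite_lWeightSpace (hO : InO ρ) (Ψ : LWeight T μ) :
    Module.Finite ℂ (lWeightSpace ρ Ψ) := by
  rw [lWeightSpace_eq]
  exact hO.finite_jointGen _

lemma jointGen_eigenvalue {ι : Type*} {f : ι → End ℂ V} {χ : ι → ℂ} {w : V}
    (hw : w ∈ jointGen f χ) (hw0 : w ≠ 0) {i : ι} {c : ℂ} (hc : f i w = c • w) : c = χ i := by
  by_contra hne
  have h1 : w ∈ (f i).maxGenEigenspace c := (genEigenspace _ _).mono (show (1 : ℕ∞) ≤ ⊤ by simp)
      (End.mem_genEigenspace_one.2 hc)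
  have h2 := ((End.independent_maxGenEigenspace (f i)).pairwiseDisjoint hne).le_bot
    ⟨h1, (mem_iInf _).1 hw i⟩
  exact hw0 h2

lemma InO.exists_lWeight (hO : InO ρ) (ht : Generic t)
    {χ : T.I0 × ℕ → ℂ} (h : jointGen (φOps ρ) χ ≠ ⊥) : ∃ Ψ : LWeight T μ, Ψ.coeffs = χ := by
  have := hO.finite_jointGen χ
  obtain ⟨w, hw, hw0, c, hc⟩ := exists_joint_eigenvector
    (f := fun p : ℤˣ × T.I0 × ℤ => ρ (Alg.φ p.1 p.2.1 p.2.2))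
    (fun _ _ => commute_φ _ _ _ _ _ _) h
    fun p w hw => mem_jointGen_of_commute (fun _ => commute_φ _ _ _ _ _ _) hw
  have hne (ε : ℤˣ) (i : T.I0) : c (ε, i, ld μ ε i) ≠ 0 := by
    intro h0
    have h1 := congrArg (fun a => ρ a w) (Alg.κ_mul_lead ε i)
    have h2 : ρ (lead ε i) w = 0 := by simpa [h0, lead] using hc (ε, i, ld μ ε i)
    exact hw0 (by simpa [h2] using h1.symm)
  have hex (i : T.I0) : ∃ f : RatFunc ℂ, f.denom.eval 0 ≠ 0 ∧ f.num.eval 0 ≠ 0 ∧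
      f.intDegree = μ.1 i ∧ ∀ m : ℕ, coeffAtZero f m = c (1, i, m) := by
    obtain ⟨p, hp, hrec⟩ := (hO.recurrent_φ ht i w).exists_polynomial
    refine exists_ratFunc (a := fun n => c (1, i, n)) (b := fun n => c (-1, i, n))
      (fun n hn => ?_) ?_ (fun n hn => ?_) ?_ hp fun n => ?_
    · simpa [Alg.φ_one_of_neg i hn, hw0, eq_comm (a := (0 : V))] using hc (1, i, n)
    · simpa only [ld_one] using hne 1 i
    · simpa [Alg.φ_neg_of_lt i hn, hw0, eq_comm (a := (0 : V))] using hc (-1, i, n)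
    · simpa only [ld_neg_one] using hne (-1) i
    · have h1 := hrec n
      have h2 (m : ℤ) : ρ (Alg.φ 1 i m) w - ρ (Alg.φ (-1) i m) w =
          (c (1, i, m) - c (-1, i, m)) • w :=
        (congrArg₂ _ (hc (1, i, m)) (hc (-1, i, m))).trans (sub_smul _ _ _).symm
      simp only [h2, smul_smul, ← sum_smul] at h1
      exact (smul_eq_zero.1 h1).resolve_right hw0
  choose Ψ h1 h2 h3 h4 using hex
  refine ⟨⟨Ψ, fun i => ⟨h1 i, h2 i, h3 i⟩⟩, funext fun p => ?_⟩
  exact (h4 p.1 p.2).trans (jointGen_eigenvalue hw hw0 (i := p) (hc (1, p.1, p.2)))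

end LWeights


/-! ### Traces of commuting families -/

section Traces

open Module.End LinearMap

variable {ι : Type*}

lemma maxGenEigenspace_sub {f : End ℂ V} {a : ℂ} :
    (f - algebraMap ℂ _ a).maxGenEigenspace 0 = f.maxGenEigenspace a := by
  ext w
  simp only [mem_maxGenEigenspace, zero_smul, sub_zero, Algebra.algebraMap_eq_smul_one]

lemma maxGenEigenspace_inf_le_mul {f g : End ℂ V} (h : Commute f g) (a b : ℂ) :
    f.maxGenEigenspace a ⊓ g.maxGenEigenspace b ≤ (f * g).maxGenEigenspace (a * b) := by
  have hfa : Commute (f - algebraMap ℂ _ a) g := h.sub_left (Algebra.commutes _ _)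
  have hz {p q : End ℂ V} (h : Commute p q) :
      p.maxGenEigenspace 0 ≤ (p * q).maxGenEigenspace 0 := by
    intro w hw
    rw [mem_maxGenEigenspace] at hw ⊢
    obtain ⟨k, hk⟩ := hw
    refine ⟨k, ?_⟩
    rw [zero_smul, sub_zero] at hk ⊢
    rw [h.mul_pow, (h.pow_pow k k).eq, End.mul_apply, hk, map_zero]
  have h1 : f * g - algebraMap ℂ _ (a * b) =
      (f - algebraMap ℂ _ a) * g + (g - algebraMap ℂ _ b) * algebraMap ℂ _ a := by
    rw [← (Algebra.commutes a (g - algebraMap ℂ _ b)), map_mul]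
    noncomm_ring
  rw [← maxGenEigenspace_sub, ← maxGenEigenspace_sub (f := g), ← maxGenEigenspace_sub (f := f * g),
    h1]
  refine (inf_le_inf (hz hfa) (hz (Algebra.commutes a _).symm)).trans
    ((genEigenspace_inf_le_add _ _ 0 0 ⊤ ⊤ ?_).trans (le_of_eq (by rw [add_zero, top_add])))
  have hc (x : End ℂ V) (c : ℂ) : Commute x (algebraMap ℂ _ c) := (Algebra.commutes _ _).symm
  exact (((h.sub_left (Algebra.commutes _ _)).sub_right (hc _ _)).mul_right (hc _ _)).mul_left
    ((((Commute.refl g).sub_right (hc _ _)).mul_right (hc _ _)))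

lemma jointGen_le_lift {f : ι → End ℂ V} (hf : ∀ i j, Commute (f i) (f j)) (χ : ι → ℂ)
    (a : FreeAlgebra ℂ ι) : jointGen f χ ≤
      (FreeAlgebra.lift ℂ f a).maxGenEigenspace (FreeAlgebra.lift ℂ χ a) := by
  have hcomm (a b : FreeAlgebra ℂ ι) :
      Commute (FreeAlgebra.lift ℂ f a) (FreeAlgebra.lift ℂ f b) := by
    induction a with
    | grade0 r => rw [AlgHom.commutes]; exact Algebra.commutes _ _
    | grade1 i =>
      induction b with
      | grade0 r => rw [AlgHom.commutes]; exact (Algebra.commutes _ _).symm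
      | grade1 j => simpa using hf i j
      | mul a b ha hb => rw [map_mul]; exact ha.mul_right hb
      | add a b ha hb => rw [map_add]; exact ha.add_right hb
    | mul a b ha hb => rw [map_mul]; exact ha.mul_left hb
    | add a b ha hb => rw [map_add]; exact ha.add_left hb
  induction a with
  | grade0 r =>
    intro w _
    rw [mem_maxGenEigenspace]
    exact ⟨1, by simp [Algebra.algebraMap_eq_smul_one]⟩
  | grade1 i =>
    rw [lift_ι_apply, lift_ι_apply]
    exact iInf_le (fun i => (f i).maxGenEigenspace (χ i)) i
  | mul a b ha hb =>
    rw [map_mul, map_mul]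
    exact (le_inf ha hb).trans (maxGenEigenspace_inf_le_mul (hcomm a b) _ _)
  | add a b ha hb =>
    rw [map_add, map_add]
    exact (le_inf ha hb).trans ((genEigenspace_inf_le_add _ _ _ _ ⊤ ⊤ (hcomm a b)).trans
      (le_of_eq (by rw [top_add])))

lemma lift_mem_jointGen {f : ι → End ℂ V} (hf : ∀ i j, Commute (f i) (f j)) {χ : ι → ℂ}
    (a : FreeAlgebra ℂ ι) {w : V} (hw : w ∈ jointGen f χ) :
    FreeAlgebra.lift ℂ f a w ∈ jointGen f χ := by
  refine mem_jointGen_of_commute (fun i => ?_) hw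
  induction a with
  | grade0 r => rw [AlgHom.commutes]; exact (Algebra.commutes _ _).symm
  | grade1 j => simpa using hf i j
  | mul a b ha hb => rw [map_mul]; exact ha.mul_right hb
  | add a b ha hb => rw [map_add]; exact ha.add_right hb

lemma trace_restrict_of_le {g : End ℂ V} {c : ℂ} {N : Submodule ℂ V}
    [FiniteDimensional ℂ N] (hN : N ≤ g.maxGenEigenspace c) (hg : ∀ w ∈ N, g w ∈ N) :
    trace ℂ N (g.restrict hg) = finrank ℂ N * c := by
  have h : IsNilpotent (g.restrict hg - algebraMap ℂ _ c) := by
    rw [isNilpotent_iff_of_finite]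
    intro w
    obtain ⟨k, hk⟩ := mem_maxGenEigenspace .. |>.1 (hN w.2)
    refine ⟨k, Subtype.ext ?_⟩
    rw [← Algebra.algebraMap_eq_smul_one] at hk
    have (n : ℕ) (y : N) : ((((g.restrict hg - algebraMap ℂ _ c) ^ n) y : N) : V) =
        ((g - algebraMap ℂ _ c) ^ n) y := by
      induction n with
      | zero => rfl
      | succ n ih => rw [pow_succ', pow_succ', End.mul_apply, End.mul_apply, ← ih]; rfl
    rw [this, hk]
    rfl
  have h1 := (isNilpotent_trace_of_isNilpotent h).eq_zero
  rwa [map_sub, sub_eq_zero, Algebra.algebraMap_eq_smul_one, map_smul, trace_one, smul_eq_mul,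
    mul_comm] at h1

lemma iSup_jointGen [FiniteDimensional ℂ V] {f : ι → End ℂ V}
    (hf : ∀ i j, Commute (f i) (f j)) : ⨆ χ, jointGen f χ = ⊤ :=
  iSup_iInf_maxGenEigenspace_eq_top_of_forall_mapsTo f
    (fun i j _ => mapsTo_maxGenEigenspace_of_comm (hf j i) _)
    fun i => iSup_maxGenEigenspace_eq_top (f i)

lemma exists_trace_eq [FiniteDimensional ℂ V] {f : ι → End ℂ V}
    (hf : ∀ i j, Commute (f i) (f j)) : ∃ s : Finset (ι → ℂ), ∀ s', s ⊆ s' →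
      ∀ a : FreeAlgebra ℂ ι, trace ℂ V (FreeAlgebra.lift ℂ f a) =
        ∑ χ ∈ s', (finrank ℂ (jointGen f χ) : ℂ) * FreeAlgebra.lift ℂ χ a := by
  classical
  have hfin := WellFoundedGT.finite_ne_bot_of_iSupIndep (iSupIndep_jointGen hf)
  refine ⟨hfin.toFinset, fun s' hs' a => ?_⟩
  rw [trace_eq_sum_trace_restrict' (DirectSum.isInternal_submodule_of_iSupIndep_of_iSup_eq_top
    (iSupIndep_jointGen hf) (iSup_jointGen hf)) hfin fun χ w hw => lift_mem_jointGen hf a hw]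
  refine (sum_congr rfl fun χ _ => trace_restrict_of_le (jointGen_le_lift hf χ a) _).trans
    (sum_subset hs' fun χ _ h => ?_)
  have h : jointGen f χ = ⊥ := by simpa using h
  rw [h, finrank_bot, cast_zero, zero_mul]

lemma finrank_jointGen_eq [FiniteDimensional ℂ V]
    [FiniteDimensional ℂ W] {f : ι → End ℂ V} {g : ι → End ℂ W}
    (hf : ∀ i j, Commute (f i) (f j)) (hg : ∀ i j, Commute (g i) (g j))
    (h : ∀ a : FreeAlgebra ℂ ι,
      trace ℂ V (FreeAlgebra.lift ℂ f a) = trace ℂ W (FreeAlgebra.lift ℂ g a)) (χ : ι → ℂ) :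
    finrank ℂ (jointGen f χ) = finrank ℂ (jointGen g χ) := by
  classical
  obtain ⟨s, hs⟩ := exists_trace_eq hf
  obtain ⟨s', hs'⟩ := exists_trace_eq hg
  have hinj : Function.Injective fun χ : ι → ℂ =>
      ((FreeAlgebra.lift ℂ χ : FreeAlgebra ℂ ι →ₐ[ℂ] ℂ) : FreeAlgebra ℂ ι →* ℂ) := by
    intro χ χ' h
    funext i
    simpa using congrFun (congrArg DFunLike.coe h) (FreeAlgebra.ι ℂ i)
  have hli := (linearIndependent_monoidHom (FreeAlgebra ℂ ι) ℂ).comp _ hinj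
  have h1 := linearIndependent_iff'.1 hli (insert χ (s ∪ s'))
    (fun χ => (finrank ℂ (jointGen f χ) : ℂ) - finrank ℂ (jointGen g χ))
    (funext fun a => by
      have h2 := h a
      rw [hs _ (Finset.subset_union_left.trans (Finset.subset_insert χ (s ∪ s'))),
        hs' _ (Finset.subset_union_right.trans (Finset.subset_insert χ (s ∪ s'))), ← sub_eq_zero,
        ← sum_sub_distrib] at h2
      rw [Finset.sum_apply]
      exact (sum_congr rfl fun χ _ => sub_mul _ _ _).trans h2) χ (Finset.mem_insert_self _ _)
  exact_mod_cast sub_eq_zero.1 h1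

end Traces

/-! ### Traces on lattices -/

section LatticeTrace

open LinearMap

instance (M : Submodule regOne (LaurentVec W)) : SMul regOne M := (Submodule.module M).toSMul

lemma free_of_fg {M : Submodule regOne (LaurentVec W)} (hM : M.FG) : Module.Free regOne M :=
  have : Module.Finite regOne M := iff_fg.2 hM
  Module.free_of_finite_type_torsion_free'

lemma algebraMap_trace {M : Submodule regOne (LaurentVec W)} (hM : M.FG)
    {X : Submodule (RatFunc ℂ) (LaurentVec W)} (hX : X = span (RatFunc ℂ) (M : Set _))
    (G : End (LaurentSeries ℂ) (LaurentVec W)) (hGM : ∀ m ∈ M, regEnd G m ∈ M)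
    (hGX : ∀ x ∈ X, ratEnd G x ∈ X) :
    algebraMap regOne (RatFunc ℂ) (trace regOne M ((regEnd G).restrict hGM)) =
      trace (RatFunc ℂ) X ((ratEnd G).restrict hGX) := by
  have : Module.Finite regOne M := iff_fg.2 hM
  have := free_of_fg hM
  set b := Module.Free.chooseBasis regOne M
  have hbX (k) : (b k : LaurentVec W) ∈ X := hX ▸ subset_span (b k).2
  have hli : LinearIndependent (RatFunc ℂ) fun k => (⟨b k, hbX k⟩ : X) := by
    refine LinearIndependent.of_comp X.subtype ?_
    exact (LinearIndependent.iff_fractionRing (R := regOne) (K := RatFunc ℂ)).1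
      (b.linearIndependent.map' M.subtype M.ker_subtype)
  have hsum (m : M) (x : X) (h : (m : LaurentVec W) = x) :
      x = ∑ k, algebraMap regOne (RatFunc ℂ) (b.repr m k) • (⟨b k, hbX k⟩ : X) := by
    apply Subtype.ext
    rw [← h]
    conv_lhs => rw [← b.sum_repr m]
    rw [Submodule.coe_sum, Submodule.coe_sum]
    rfl
  have hsp : ⊤ ≤ span (RatFunc ℂ) (Set.range fun k => (⟨b k, hbX k⟩ : X)) := by
    rintro ⟨x, hx⟩ -
    have key : X ≤ (span (RatFunc ℂ) (Set.range fun k => (⟨b k, hbX k⟩ : X))).map X.subtype := by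
      refine hX.le.trans (span_le.2 fun m hm => ?_)
      refine ⟨⟨m, hX ▸ subset_span hm⟩, ?_, rfl⟩
      rw [SetLike.mem_coe, hsum ⟨m, hm⟩ ⟨m, _⟩ rfl]
      exact Submodule.sum_mem _ fun k _ => smul_mem _ _ (subset_span ⟨k, rfl⟩)
    obtain ⟨y, hy, h⟩ := key hx
    exact (Subtype.ext h : y = ⟨x, hx⟩) ▸ hy
  set c := Module.Basis.mk hli hsp
  have hc (k) : c k = ⟨b k, hbX k⟩ := Module.Basis.mk_apply hli hsp k
  rw [trace_eq_matrix_trace regOne b, trace_eq_matrix_trace (RatFunc ℂ) c, Matrix.trace,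
    Matrix.trace, map_sum]
  refine sum_congr rfl fun k _ => ?_
  rw [diag_apply, diag_apply, toMatrix_apply, toMatrix_apply,
    hsum ((regEnd G).restrict hGM (b k)) ((ratEnd G).restrict hGX (c k)) (by rw [hc]; rfl)]
  simp only [← hc]
  rw [c.repr_sum_self]

lemma evOne_trace {M : Type*} [AddCommGroup M] [Module regOne M] {N : Type*} [AddCommGroup N]
    [Module ℂ N] {κ : Type*} [Fintype κ] (b : Module.Basis κ regOne M) (d : Module.Basis κ ℂ N)
    (r : M →+ N) (hr : ∀ c m, r (c • m) = evOne c • r m) (hbd : ∀ k, r (b k) = d k)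
    (g : End regOne M) (g' : End ℂ N) (h : ∀ m, r (g m) = g' (r m)) :
    evOne (trace regOne M g) = trace ℂ N g' := by
  classical
  rw [trace_eq_matrix_trace regOne b, trace_eq_matrix_trace ℂ d, Matrix.trace, Matrix.trace,
    map_sum]
  refine sum_congr rfl fun k _ => ?_
  rw [diag_apply, diag_apply, toMatrix_apply, toMatrix_apply, ← hbd, ← h]
  conv_rhs => rw [← b.sum_repr (g (b k)), map_sum]
  simp only [hr, hbd]
  rw [d.repr_sum_self]

lemma evOne_trace_of_surjective {M : Type*} [AddCommGroup M] [Module regOne M]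
    [Module.Free regOne M] [Module.Finite regOne M] {N : Type*} [AddCommGroup N]
    [Module ℂ N] (r : M →+ N) (hr : ∀ c m, r (c • m) = evOne c • r m)
    (hsurj : Function.Surjective r) (hker : ∀ m, r m = 0 → ∃ m', uSubOne • m' = m)
    (g : End regOne M) (g' : End ℂ N) (h : ∀ m, r (g m) = g' (r m)) :
    evOne (trace regOne M g) = trace ℂ N g' := by
  set b := Module.Free.chooseBasis regOne M
  have hli : LinearIndependent ℂ fun k => r (b k) := by
    refine Fintype.linearIndependent_iff.2 fun c hc k => ?_
    obtain ⟨m', hm'⟩ := hker (∑ k, algebraMap ℂ regOne (c k) • b k) (by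
      rw [map_sum, ← hc]
      exact sum_congr rfl fun k _ => by rw [hr, evOne_algebraMap])
    have := congrArg (fun m => evOne (b.repr m k)) hm'
    simp only [map_smul, Finsupp.smul_apply, smul_eq_mul, map_mul, evOne_uSubOne, zero_mul] at this
    rw [b.repr_sum_self, evOne_algebraMap] at this
    exact this.symm
  have hsp : ⊤ ≤ span ℂ (Set.range fun k => r (b k)) := by
    rintro x -
    obtain ⟨m, rfl⟩ := hsurj x
    rw [← b.sum_repr m, map_sum]
    refine Submodule.sum_mem _ fun k _ => ?_
    rw [hr]
    exact smul_mem _ _ (subset_span ⟨k, rfl⟩)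
  exact evOne_trace b (Module.Basis.mk hli hsp) r hr
    (fun k => (Module.Basis.mk_apply hli hsp k).symm) g g' h

lemma exists_evConst (P : Submodule ℂ W) [FiniteDimensional ℂ P] :
    ∃ (κ : Type) (_ : Fintype κ) (b : Module.Basis κ regOne (constLattice P))
      (d : Module.Basis κ ℂ P) (r : constLattice P →+ P),
      (∀ c m, r (c • m) = evOne c • r m) ∧ (∀ k, r (b k) = d k) ∧
      ∀ (w : W) (hw : w ∈ P), r ⟨constVec w, constVec_mem_constLattice hw⟩ = ⟨w, hw⟩ := by
  set d := finBasis ℂ P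
  have hli : LinearIndependent regOne fun k => constVec (d k : W) :=
    (LinearIndependent.iff_fractionRing (R := regOne) (K := RatFunc ℂ)).2
      (linearIndependent_constVec (d.linearIndependent.map' P.subtype P.ker_subtype))
  let b : Module.Basis _ regOne (constLattice P) :=
    (Module.Basis.span hli).map (LinearEquiv.ofEq _ _ (constLattice_eq_span d).symm)
  have hb (k) : b k = ⟨constVec (d k : W), constVec_mem_constLattice (d k).2⟩ := by
    apply Subtype.ext
    change ((Module.Basis.span hli k : _) : LaurentVec W) = _
    rw [Module.Basis.span_apply]
  let r : constLattice P →+ P :=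
    { toFun := fun f => ∑ k, evOne (b.repr f k) • d k
      map_zero' := by simp
      map_add' := fun f g => by simp [add_smul, sum_add_distrib] }
  have hr (c m) : r (c • m) = evOne c • r m := by
    change ∑ k, evOne (b.repr (c • m) k) • d k = evOne c • ∑ k, evOne (b.repr m k) • d k
    simp [smul_sum, mul_smul]
  have hbd (k) : r (b k) = d k := by
    change ∑ j, evOne (b.repr (b k) j) • d j = d k
    rw [Finset.sum_eq_single k]
    · simp
    · intro j _ hj
      simp [hj.symm]
    · simp
  refine ⟨_, inferInstance, b, d, r, hr, hbd, fun w hw => ?_⟩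
  have h1 : (⟨constVec w, constVec_mem_constLattice hw⟩ : constLattice P) =
      ∑ k, algebraMap ℂ regOne (d.repr ⟨w, hw⟩ k) • b k := by
    apply Subtype.ext
    have h2 : w = ∑ k, d.repr ⟨w, hw⟩ k • (d k : W) := by
      conv_lhs => rw [show w = P.subtype ⟨w, hw⟩ from rfl, ← d.sum_repr ⟨w, hw⟩, map_sum]
      rfl
    change constVec w = _
    conv_lhs => rw [h2, ← constHom_apply, map_sum]
    rw [Submodule.coe_sum]
    refine sum_congr rfl fun k _ => ?_
    rw [map_smul, Submodule.coe_smul, hb, algebraMap_smul_regOne]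
    rfl
  rw [h1, map_sum]
  simp only [hr, hbd, evOne_algebraMap]
  exact d.sum_repr _

end LatticeTrace


/-! ### Multiplicities of the specialization -/

section Restriction

variable {ι : Type*} {f : ι → End ℂ V} {N : Submodule ℂ V}

lemma coe_lift_restrict (hf : ∀ i, ∀ w ∈ N, f i w ∈ N) (a : FreeAlgebra ℂ ι) (w : N) :
    (FreeAlgebra.lift ℂ (fun i => (f i).restrict (hf i)) a w : V) = FreeAlgebra.lift ℂ f a w := by
  induction a generalizing w with
  | grade0 r => rw [AlgHom.commutes, AlgHom.commutes]; rfl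
  | grade1 i => rw [lift_ι_apply, lift_ι_apply]; rfl
  | mul a b ha hb => rw [map_mul, map_mul, End.mul_apply, End.mul_apply, ha, hb]
  | add a b ha hb =>
    rw [map_add, map_add, LinearMap.add_apply, LinearMap.add_apply, ← ha, ← hb]; rfl

lemma finrank_jointGen_restrict (hf : ∀ i, ∀ w ∈ N, f i w ∈ N) {χ : ι → ℂ}
    (h : jointGen f χ ≤ N) : finrank ℂ (jointGen (fun i => (f i).restrict (hf i)) χ) =
      finrank ℂ (jointGen f χ) := by
  have h1 := Submodule.inf_iInf_maxGenEigenspace_of_forall_mapsTo (f := f) (μ := χ) N hf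
  have h2 : jointGen f χ = (jointGen (fun i => (f i).restrict (hf i)) χ).map N.subtype :=
    (inf_eq_right.2 h).symm.trans h1
  rw [h2, Submodule.finrank_map_subtype_eq]

end Restriction

section Multiplicities

/-- The coefficients of `φ_i^+ (z) ⊗ φ_i^+ (z)`. -/
def convElt (T : TwistedType) (t : ℂˣ) (μ1 μ2 : T.Coweight) (p : T.I0 × ℕ) :
    Alg T t μ1 ⊗[ℂ] Alg T t μ2 :=
  ∑ n ∈ Finset.Icc (0 : ℤ) p.2, Alg.φ 1 p.1 (p.2 - n) ⊗ₜ Alg.φ 1 p.1 n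

variable (ρ1 ρ2) in
/-- The action of the coefficients of `φ_i^+ (z) ⊗ φ_i^+ (z)`. -/
def convOp (p : T.I0 × ℕ) : End ℂ V12 := tensorOp ρ1 ρ2 (convElt T t μ1 μ2 p)

lemma commute_convOp (p q : T.I0 × ℕ) : Commute (convOp ρ1 ρ2 p) (convOp ρ1 ρ2 q) := by
  refine Commute.map (Commute.sum_left _ _ _ fun m _ => Commute.sum_right _ _ _ fun n _ => ?_)
    (tensorOp ρ1 ρ2)
  rw [commute_iff_eq, tmul_mul_tmul, tmul_mul_tmul, Alg.φ_comm, Alg.φ_comm (μ := μ2)]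

lemma convOp_mem {ω : Weight T} (p : T.I0 × ℕ) {w : V12}
    (hw : w ∈ tensW ω) : convOp ρ1 ρ2 p w ∈ tensW ω := by
  rw [convOp, convElt, map_sum, LinearMap.sum_apply]
  exact Submodule.sum_mem _ fun n _ => tensorOp_mem_tensorWeight_of_commute
    (fun _ => Alg.φ_comm _ _ _ _ _ _) (fun _ => Alg.φ_comm _ _ _ _ _ _) hw

variable (T t μ1) in
/-- The elements of the algebra that are polynomials in the coefficients of `φ_i^+ (z)`. -/
def φFree : FreeAlgebra ℂ (T.I0 × ℕ) →ₐ[ℂ] Alg T t μ1 := FreeAlgebra.lift ℂ fun p => Alg.φ 1 p.1 p.2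

lemma lift_φOps (a : FreeAlgebra ℂ (T.I0 × ℕ)) :
    FreeAlgebra.lift ℂ (φOps ρ1) a = ρ1 (φFree T t μ1 a) := by
  have : FreeAlgebra.lift ℂ (φOps ρ1) = ρ1.comp (φFree T t μ1) := by
    ext p
    simp [φFree, φOps]
  rw [this]; rfl

variable (hΔ : IsDeformedCoproduct Δ)

include hΔ in
lemma deformedAct_φFree_mem (a : FreeAlgebra ℂ (T.I0 × ℕ)) {ω : Weight T} :
    ∀ f ∈ constLattice (tensW ω), regEnd (ρΔ (φFree T t (μ1 + μ2) a)) f ∈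
        constLattice (tensW ω) := by
  let B : Subalgebra ℂ (FreeAlgebra ℂ (T.I0 × ℕ)) := (stabilizer (constLattice (tensW ω))).comap
      ((ρReg).comp (φFree T t (μ1 + μ2)))
  suffices h : a ∈ B from h
  induction a with
  | grade0 r => exact B.algebraMap_mem r
  | grade1 p =>
    change φFree T t (μ1 + μ2) _ ∈ (stabilizer (constLattice (tensW ω))).comap ρReg
    rw [φFree, lift_ι_apply]
    exact fun f hf => deformedAct_φ_mem hΔ _ _ _ hf
  | mul a b ha hb => exact B.mul_mem ha hb
  | add a b ha hb => exact B.add_mem ha hb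

lemma ratSub_eq_span_constLattice (P : Submodule ℂ W) :
    ratSub P = span (RatFunc ℂ) (constLattice P : Set (LaurentVec W)) :=
  le_antisymm (span_mono subset_span) (span_le.2 fun _ hf => constLattice_subset P hf)

lemma ratEnd_mem_ratSub {P : Submodule ℂ W} {G : End (LaurentSeries ℂ) (LaurentVec W)}
    (h : ∀ f ∈ constLattice P, regEnd G f ∈ constLattice P) :
    ∀ f ∈ ratSub P, ratEnd G f ∈ ratSub P := by
  have h1 : ratSub P ≤ (ratSub P).comap (ratEnd G) := by
    refine span_le.2 ?_
    rintro _ ⟨w, hw, rfl⟩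
    exact constLattice_subset P (h _ (constVec_mem_constLattice hw))
  exact h1

lemma specialization_intertwines {W ι N : Type*} [AddCommGroup W] [Module ℂ W] [AddCommGroup N]
    [Module ℂ N] {C : Submodule regOne (LaurentVec W)} {r : C →+ N}
    (hr : ∀ c m, r (c • m) = evOne c • r m)
    (G : FreeAlgebra ℂ ι →ₐ[ℂ] End (LaurentSeries ℂ) (LaurentVec W))
    (hG : ∀ a, ∀ f ∈ C, G a f ∈ C) (g : ι → End ℂ N)
    (h : ∀ i, ∀ f f' : C, (f' : LaurentVec W) = G (FreeAlgebra.ι ℂ i) f → r f' = g i (r f))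
    (a : FreeAlgebra ℂ ι) (f f' : C) (hf : (f' : LaurentVec W) = G a f) :
    r f' = FreeAlgebra.lift ℂ g a (r f) := by
  induction a generalizing f f' with
  | grade0 c =>
    have : f' = algebraMap ℂ regOne c • f := by
      refine Subtype.ext ?_
      rw [hf, AlgHom.commutes, algebraMap_end_apply, coe_smul, algebraMap_smul_regOne]
    rw [this, hr, evOne_algebraMap, AlgHom.commutes, algebraMap_end_apply]
  | grade1 i => rw [lift_ι_apply]; exact h i f f' hf
  | mul a b ha hb =>
    rw [map_mul, End.mul_apply, ← hb f ⟨_, hG b f f.2⟩ rfl]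
    refine ha _ _ (hf.trans ?_)
    rw [map_mul]
    rfl
  | add a b ha hb =>
    rw [map_add, LinearMap.add_apply, ← ha f ⟨_, hG a f f.2⟩ rfl, ← hb f ⟨_, hG b f f.2⟩ rfl,
      ← map_add]
    refine congrArg r (Subtype.ext (hf.trans ?_))
    rw [map_add]
    rfl

lemma specialization_eq_of_span {W N : Type*} [AddCommGroup W] [Module ℂ W] [AddCommGroup N]
    [Module ℂ N] {s : Set (LaurentVec W)} {r : span regOne s →+ N}
    (hr : ∀ c m, r (c • m) = evOne c • r m) (G : End (LaurentSeries ℂ) (LaurentVec W))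
    (hG : ∀ f ∈ span regOne s, G f ∈ span regOne s) (g : End ℂ N)
    (h : ∀ f (hf : f ∈ s), r ⟨_, hG f (subset_span hf)⟩ =
      g (r ⟨f, subset_span hf⟩)) (f f' : span regOne s)
    (hf : (f' : LaurentVec W) = G f) : r f' = g (r f) := by
  obtain ⟨f, hfs⟩ := f
  induction hfs using span_induction generalizing f' with
  | mem f hfs => rw [← h f hfs]; exact congrArg r (Subtype.ext hf)
  | zero =>
    have h0 : (⟨0, Submodule.zero_mem _⟩ : span regOne s) = 0 := rfl
    have h1 : f' = 0 := Subtype.ext (hf.trans (map_zero _))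
    rw [h0, h1, map_zero, map_zero]
  | add x y hx hy ihx ihy =>
    have h0 : (⟨x + y, Submodule.add_mem _ hx hy⟩ : span regOne s) = ⟨x, hx⟩ + ⟨y, hy⟩ := rfl
    have h1 : f' = ⟨_, hG x hx⟩ + ⟨_, hG y hy⟩ := Subtype.ext (hf.trans (map_add _ x y))
    rw [h0, h1, map_add, map_add, map_add, ihx ⟨_, hG x hx⟩ rfl, ihy ⟨_, hG y hy⟩ rfl]
  | smul c x hx ih =>
    have h0 : (⟨c • x, smul_mem _ c hx⟩ : span regOne s) = c • ⟨x, hx⟩ := rfl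
    have h1 : f' = c • ⟨_, hG x hx⟩ := Subtype.ext (hf.trans (map_smul (regEnd G) c x))
    rw [h0, h1, hr, hr, map_smul, ih ⟨_, hG x hx⟩ rfl]

include hΔ in
lemma deformedAct_φ_one (p : T.I0 × ℕ) (w : V12) :
    ρΔ (φFree T t (μ1 + μ2) (FreeAlgebra.ι ℂ p)) (constVec w) =
      ∑ n ∈ Finset.Icc (0 : ℤ) p.2, ((uUnit ^ n : regOneˣ) : regOne) •
        constVec (tensorOp ρ1 ρ2 (Alg.φ 1 p.1 (p.2 - n) ⊗ₜ Alg.φ 1 p.1 n) w) := by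
  have := deformedAct_φ (ρ1 := ρ1) (ρ2 := ρ2) hΔ 1 p.1 p.2 w
  rw [φRange, if_pos rfl] at this
  rw [φFree, lift_ι_apply, this]

lemma specialization_sum {W κ : Type*} [AddCommGroup W] [Module ℂ W] {P : Submodule ℂ W}
    {r : constLattice P →+ P} (hr : ∀ c m, r (c • m) = evOne c • r m)
    (hconst : ∀ (w : W) (hw : w ∈ P), r ⟨constVec w, constVec_mem_constLattice hw⟩ = ⟨w, hw⟩)
    (s : Finset κ) (c : κ → regOne) (w : κ → W) (hw : ∀ k, w k ∈ P) (f : constLattice P)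
    (hf : (f : LaurentVec W) = ∑ k ∈ s, c k • constVec (w k)) :
    (r f : W) = ∑ k ∈ s, evOne (c k) • w k := by
  have h1 : f = ∑ k ∈ s, c k • (⟨_, constVec_mem_constLattice (hw k)⟩ : constLattice P) :=
    Subtype.ext (by rw [hf, coe_sum]; rfl)
  rw [h1, map_sum, coe_sum]
  refine sum_congr rfl fun k _ => ?_
  rw [hr, hconst _ (hw k)]
  rfl

lemma tensorOp_φ_mem (i : T.I0) {ω : Weight T} (m n : ℤ) {w : V12} (hw : w ∈ tensW ω) :
    tensorOp ρ1 ρ2 (Alg.φ 1 i m ⊗ₜ Alg.φ 1 i n) w ∈ tensW ω :=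
  tensorOp_mem_tensorWeight_of_commute (fun _ => Alg.φ_comm _ _ _ _ _ _)
    (fun _ => Alg.φ_comm _ _ _ _ _ _) hw

include hΔ in
lemma evOne_trace_constLattice (ω : Weight T) [FiniteDimensional ℂ (tensW ω)]
    (a : FreeAlgebra ℂ (T.I0 × ℕ)) :
    evOne (LinearMap.trace regOne _ (LinearMap.restrict _
      (deformedAct_φFree_mem (ρ1 := ρ1) (ρ2 := ρ2) hΔ a (ω := ω)))) =
      LinearMap.trace ℂ (tensW ω) (FreeAlgebra.lift ℂ
        (fun p => (convOp ρ1 ρ2 p).restrict fun _ => convOp_mem (ω := ω) p) a) := by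
  obtain ⟨κ, _, b, d, r, hr, hbd, hconst⟩ := exists_evConst (tensW ω)
  refine evOne_trace b d r hr hbd _ _ fun m => specialization_intertwines hr
    ((ρΔ).comp (φFree T t (μ1 + μ2))) (fun a => deformedAct_φFree_mem hΔ a) _
    (fun p => specialization_eq_of_span hr _ (deformedAct_φFree_mem hΔ _) _ ?_) a m _ rfl
  rintro _ ⟨w, hw, rfl⟩
  refine Eq.trans ?_ (congrArg _ (hconst w hw)).symm
  refine Subtype.ext ((specialization_sum hr hconst _ _ _
    (fun n => tensorOp_φ_mem p.1 _ _ hw) _ (deformedAct_φ_one hΔ p w)).trans ?_)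
  change _ = convOp ρ1 ρ2 p w
  rw [convOp, convElt, map_sum, LinearMap.sum_apply]
  exact sum_congr rfl fun n _ => by rw [evOne_uUnit_zpow, one_smul]

variable (h₁ : IsHighestWeight ρ1 v1 ω1) (h₂ : IsHighestWeight ρ2 v2 ω2) (ht : Generic t)

section

variable (R : Alg T t μ →ₐ[ℂ] End (LaurentSeries ℂ) (LaurentVec W)) (w : W) (ω : Weight T)

/-- The weight spaces of the lattice. -/
def latticeWeight : Submodule regOne (LaurentVec W) := lattice R w ⊓ ratWeightSpace R ω

/-- The specialization of the weight spaces of the lattice. -/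
def latticeWeightMk : latticeWeight R w ω →+ weightSpace (fusionRep R w) 1 ω where
  toFun f := ⟨fusionMk R w ⟨f, f.2.1⟩, mem_weightSpace.2 fun i => by
    rw [fusionRep_mk, val_one, zpow_one]
    exact congrArg (fusionMk R w) (Subtype.ext ((f.2.2.2 i).trans
      (algebraMap_smul_regOne _ _).symm))⟩
  map_zero' := Subtype.ext (map_zero (fusionMk R w))
  map_add' f g := Subtype.ext (map_add (fusionMk R w) ⟨(f : LaurentVec W), f.2.1⟩
    ⟨(g : LaurentVec W), g.2.1⟩)

variable {R w ω}

lemma coe_latticeWeightMk (f : latticeWeight R w ω) :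
    (latticeWeightMk R w ω f : Fusion R w) = fusionMk R w ⟨f, f.2.1⟩ := rfl

lemma eq_uSubOne_smul_of_latticeWeightMk (f : latticeWeight R w ω)
    (hf : latticeWeightMk R w ω f = 0) : ∃ g, uSubOne • g = f := by
  have h0 : fusionMk R w ⟨(f : LaurentVec W), f.2.1⟩ = 0 := congrArg Subtype.val hf
  obtain ⟨g, hg⟩ := fusionMk_eq_zero.1 h0
  have hg : uSubOne • (g : LaurentVec W) = f := congrArg Subtype.val hg
  have h1 : uSubOne • (g : LaurentVec W) ∈ ratWeightSpace R ω := by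
    rw [hg]
    exact f.2.2
  exact ⟨⟨g, g.2, mem_ratWeightSpace_of_smul uSubOne_ne_zero h1⟩, Subtype.ext hg⟩

lemma latticeWeightMk_smul (c : regOne) (f : latticeWeight R w ω) :
    latticeWeightMk R w ω (c • f) = evOne c • latticeWeightMk R w ω f := by
  have h : (latticeWeightMk R w ω (c • f) : Fusion R w) =
      c • fusionMk R w ⟨(f : LaurentVec W), f.2.1⟩ := by
    rw [← map_smul, coe_latticeWeightMk]
    rfl
  rw [regOne_smul_fusion, ← coe_latticeWeightMk f] at h
  exact Subtype.ext h

end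

include hΔ h₁ h₂ ht in
lemma deformedAct_φFree_mem_latticeWeight (a : FreeAlgebra ℂ (T.I0 × ℕ)) {ω : Weight T} :
    ∀ f ∈ latticeWeight ρΔ v12 ω, regEnd (ρΔ (φFree T t (μ1 + μ2) a)) f ∈
        latticeWeight ρΔ v12 ω := by
  intro f hf
  refine ⟨lattice_stable _ _ _ hf.1, ratSub_subset_ratWeightSpace hΔ
    (ratEnd_mem_ratSub (fun f hf => deformedAct_φFree_mem hΔ a f hf) f ?_)⟩
  rw [ratSub_eq_span_inf hΔ h₁ h₂ ht ω]
  exact subset_span hf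

include hΔ h₁ h₂ ht in
lemma latticeWeightMk_surjective (ω : Weight T) :
    Function.Surjective (latticeWeightMk ρΔ v12 ω) := by
  suffices h : ∀ x ∈ weightSpace (fusionRep ρΔ v12) 1 ω,
      ∃ f, (latticeWeightMk ρΔ v12 ω f : Fusion ρΔ v12) = x from
    fun x => (h x x.2).imp fun f hf => Subtype.ext hf
  intro x hx
  have h := isHighestWeight_fusion hΔ h₁ h₂ ht
  rw [h.singular.weightSpace_eq_iSup ht h.generates h.lead, iSup_subtype'] at hx
  induction hx using iSup_induction' with
  | mem l x hx =>
    obtain ⟨f, hf, rfl⟩ := wordSpace_fusion_eq_map l.1 hx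
    refine ⟨⟨f, ?_⟩, rfl⟩
    rw [latticeWeight, lattice_inf_ratWeightSpace hΔ h₁ h₂ ht, iSup_subtype']
    exact mem_iSup_of_mem (p := fun l : {l : List T.I0 //
      ω1 1 * ω2 1 * (typeWeight t l)⁻¹ = ω} => wordSpace _ _ l.1) l hf
  | zero => exact ⟨0, by rw [map_zero]; rfl⟩
  | add x y _ _ hx hy =>
    obtain ⟨f, rfl⟩ := hx
    obtain ⟨g, rfl⟩ := hy
    exact ⟨f + g, by rw [map_add]; rfl⟩

lemma φOps_mem_weightSpace {ω : Weight T} (p : T.I0 × ℕ) :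
    ∀ w ∈ weightSpace ρ 1 ω, φOps ρ p w ∈ weightSpace ρ 1 ω :=
  fun _ hw => φ_mem_weightSpace hw _ _ _

lemma evOne_trace_latticeWeight (ω : Weight T) (a : FreeAlgebra ℂ (T.I0 × ℕ)) :
    evOne (LinearMap.trace regOne _ (LinearMap.restrict _
      (deformedAct_φFree_mem_latticeWeight hΔ h₁ h₂ ht a (ω := ω)))) =
      LinearMap.trace ℂ _ (FreeAlgebra.lift ℂ (fun p => (φOps (fusionRep ρΔ
        v12) p).restrict (φOps_mem_weightSpace (ω := ω) p)) a) := by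
  have hfg := lattice_inf_ratWeightSpace_fg hΔ h₁ h₂ ht ω
  have : Module.Free regOne (latticeWeight ρΔ v12 ω) := free_of_fg hfg
  have : Module.Finite regOne (latticeWeight ρΔ v12 ω) := iff_fg.2 hfg
  refine evOne_trace_of_surjective (latticeWeightMk ρΔ v12 ω) latticeWeightMk_smul
    (latticeWeightMk_surjective hΔ h₁ h₂ ht ω) eq_uSubOne_smul_of_latticeWeightMk _ _ fun m => ?_
  refine Subtype.ext ?_
  rw [coe_lift_restrict, lift_φOps]
  rfl

include hΔ h₁ h₂ ht in
lemma trace_fusion (ω : Weight T) (a : FreeAlgebra ℂ (T.I0 × ℕ)) :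
    LinearMap.trace ℂ _ (FreeAlgebra.lift ℂ (fun p => (φOps (fusionRep ρΔ
        v12) p).restrict (φOps_mem_weightSpace (ω := ω) p)) a) =
      LinearMap.trace ℂ (tensW ω) (FreeAlgebra.lift ℂ
        (fun p => (convOp ρ1 ρ2 p).restrict fun _ => convOp_mem (ω := ω) p) a) := by
  have := finite_tensorWeight h₁ h₂ ht ω
  rw [← evOne_trace_latticeWeight hΔ h₁ h₂ ht, ← evOne_trace_constLattice hΔ]
  congr 1
  refine IsFractionRing.injective regOne (RatFunc ℂ) ?_
  have hX := ratEnd_mem_ratSub (deformedAct_φFree_mem (ρ1 := ρ1) (ρ2 := ρ2) hΔ a (ω := ω))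
  exact (algebraMap_trace (lattice_inf_ratWeightSpace_fg hΔ h₁ h₂ ht ω)
    (ratSub_eq_span_inf hΔ h₁ h₂ ht ω) _ _ hX).trans
    (algebraMap_trace (constLattice_fg _) (ratSub_eq_span_constLattice _) _ _ hX).symm

include h₁ h₂ ht in
lemma jointGen_convOp_le (ω : Weight T) {χ : T.I0 × ℕ → ℂ} (hχ : ∀ i, (ω i : ℂ) = χ (i, 0)) :
    jointGen (convOp ρ1 ρ2) χ ≤ tensW ω := by
  have h := iSupIndep_jointGen (f := fun i => convOp ρ1 ρ2 (i, 0)) fun _ _ => commute_convOp _ _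
  have h0 (i : T.I0) : convOp ρ1 ρ2 (i, 0) = tensorOp ρ1 ρ2 (lead 1 i ⊗ₜ lead 1 i) := by
    rw [convOp, convElt, lead_one, lead_one]
    simp
  have hinj : Function.Injective fun (ω : Weight T) i => (ω i : ℂ) :=
    fun ω ω' h => funext fun i => Units.ext (congrFun h i)
  have heq := congrFun (eq_of_iSup_eq_top (h.comp hinj) (fun ω => iInf_mono fun i => by
    beta_reduce; rw [h0]; exact (genEigenspace _ _).mono (by simp)) (iSup_tensorWeight h₁ h₂)) ω
  refine le_trans (le_iInf fun i => ?_) heq.ge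
  have := iInf_le (fun p => (convOp ρ1 ρ2 p).maxGenEigenspace (χ p)) (i, 0)
  beta_reduce at this
  rwa [← hχ] at this

include hΔ h₁ h₂ ht in
lemma finrank_jointGen_fusion (ω : Weight T) {χ : T.I0 × ℕ → ℂ} (hχ : ∀ i, (ω i : ℂ) = χ (i, 0)) :
    finrank ℂ (jointGen (φOps (fusionRep ρΔ v12)) χ) = finrank ℂ (jointGen (convOp ρ1 ρ2) χ) := by
  have hO := (isHighestWeight_fusion hΔ h₁ h₂ ht).inO
  have := finite_tensorWeight h₁ h₂ ht ω
  have := hO.finite 1 ω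
  rw [← finrank_jointGen_restrict φOps_mem_weightSpace (hO.jointGen_le_weightSpace ω hχ),
    ← finrank_jointGen_restrict (fun p _ => convOp_mem p) (jointGen_convOp_le h₁ h₂ ht ω hχ)]
  exact finrank_jointGen_eq (fun p q => LinearMap.ext fun w => Subtype.ext
      (congrArg (fun g => g (w : Fusion ρΔ v12)) (commute_φOps p q).eq))
    (fun p q => LinearMap.ext fun w => Subtype.ext
      (congrArg (fun g => g (w : V12)) (commute_convOp p q).eq))
    (trace_fusion hΔ h₁ h₂ ht ω) χ

end Multiplicities


section TensorJoint

variable {ι κ J : Type*} {f : ι → End ℂ V} {g : κ → End ℂ W} {γ : ι → ℂ} {δ : κ → ℂ}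

variable (f g) in
/-- The operators of two families on the tensor factors. -/
def tensorFam : ι ⊕ κ → End ℂ (V ⊗[ℂ] W) :=
  Sum.elim (fun i => (f i).rTensor W) fun j => (g j).lTensor V

lemma commute_tensorFam (hf : ∀ i j, Commute (f i) (f j)) (hg : ∀ i j, Commute (g i) (g j)) :
    ∀ p q, Commute (tensorFam f g p) (tensorFam f g q)
  | .inl i, .inl j => by
    rw [commute_iff_eq]
    exact (LinearMap.rTensor_mul _ _ _).symm.trans
      ((congrArg _ (hf i j).eq).trans (LinearMap.rTensor_mul _ _ _))
  | .inr i, .inr j => by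
    rw [commute_iff_eq]
    exact (LinearMap.lTensor_mul _ _ _).symm.trans
      ((congrArg _ (hg i j).eq).trans (LinearMap.lTensor_mul _ _ _))
  | .inl i, .inr j => ext' fun _ _ => rfl
  | .inr i, .inl j => ext' fun _ _ => rfl

lemma map2_le_jointGen_tensorFam : map₂ (TensorProduct.mk ℂ V W) (jointGen f γ)
    (jointGen g δ) ≤ jointGen (tensorFam f g) (Sum.elim γ δ) := by
  refine map₂_le.2 fun v hv w hw => (mem_iInf _).2 fun p => ?_
  cases p with
  | inl i =>
    obtain ⟨k, hk⟩ := End.mem_maxGenEigenspace _ _ _ |>.1 ((mem_iInf _).1 hv i)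
    refine (End.mem_maxGenEigenspace _ _ _).2 ⟨k, ?_⟩
    have h : tensorFam f g (.inl i) - γ i • 1 = (f i - γ i • 1).rTensor W :=
      ext' fun v w => by simp [tensorFam, smul_tmul']
    rw [Sum.elim_inl, h, LinearMap.rTensor_pow, mk_apply, LinearMap.rTensor_tmul, hk, zero_tmul]
  | inr i =>
    obtain ⟨k, hk⟩ := End.mem_maxGenEigenspace _ _ _ |>.1 ((mem_iInf _).1 hw i)
    refine (End.mem_maxGenEigenspace _ _ _).2 ⟨k, ?_⟩
    have h : tensorFam f g (.inr i) - δ i • 1 = (g i - δ i • 1).lTensor V :=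
      ext' fun v w => by simp [tensorFam]
    rw [Sum.elim_inr, h, LinearMap.lTensor_pow, mk_apply, LinearMap.lTensor_tmul, hk, tmul_zero]

lemma finrank_map2_mk (P : Submodule ℂ V) (Q : Submodule ℂ W) :
    finrank ℂ (map₂ (TensorProduct.mk ℂ V W) P Q) = finrank ℂ P * finrank ℂ Q := by
  have h : map₂ (TensorProduct.mk ℂ V W) P Q =
      LinearMap.range (TensorProduct.map P.subtype Q.subtype) := by
    rw [TensorProduct.range_map, Submodule.range_subtype, Submodule.range_subtype]
  rw [h, LinearMap.finrank_range_of_inj, Module.finrank_tensorProduct]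
  exact TensorProduct.map_injective_of_flat_flat _ _ Subtype.val_injective Subtype.val_injective

lemma finite_and_finrank_eq_of_iSupIndep {A : J → Submodule ℂ V} (hA : iSupIndep A)
    [hfin : FiniteDimensional ℂ (⨆ j, A j : Submodule ℂ V)] :
    {j | A j ≠ ⊥}.Finite ∧ finrank ℂ (⨆ j, A j : Submodule ℂ V) = ∑ᶠ j, finrank ℂ (A j) := by
  classical
  have hB : iSupIndep fun j : {j // A j ≠ ⊥} => A j := hA.comp Subtype.val_injective
  have hle (j : J) : A j ≤ ⨆ j, A j := le_iSup A j
  have hfinite : Finite {j // A j ≠ ⊥} := by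
    choose x hx hx0 using fun j : {j // A j ≠ ⊥} => (ne_bot_iff _).1 j.2
    have h := hB.linearIndependent _ hx hx0
    have h1 : LinearIndependent ℂ fun j => (⟨x j, hle j (hx j)⟩ : (⨆ j, A j : Submodule ℂ V)) :=
      LinearIndependent.of_comp (⨆ j, A j : Submodule ℂ V).subtype h
    exact h1.finite_of_isNoetherian
  have : Fintype {j // A j ≠ ⊥} := Fintype.ofFinite _
  have (j : J) : FiniteDimensional ℂ (A j) := finiteDimensional_of_le (hle j)
  have hset : {j | A j ≠ ⊥}.Finite := hfinite
  refine ⟨hset, ?_⟩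
  let e : DirectSum {j // A j ≠ ⊥} (fun j => A j) ≃ₗ[ℂ]
      (⨆ j : {j // A j ≠ ⊥}, A j : Submodule ℂ V) :=
    (LinearEquiv.ofInjective (DirectSum.coeLinearMap fun j : {j // A j ≠ ⊥} => A j)
      hB.dfinsupp_lsum_injective).trans (LinearEquiv.ofEq _ _ DirectSum.range_coeLinearMap)
  rw [← iSup_ne_bot_subtype A, ← e.finrank_eq, Module.finrank_directSum,
    finsum_eq_sum_of_support_subset (s := hset.toFinset) _ fun j hj => ?_,
    Finset.sum_subtype hset.toFinset (p := fun j => A j ≠ ⊥) (by simp)]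
  rw [Set.Finite.coe_toFinset]
  rintro (h : A j = ⊥)
  exact hj (by beta_reduce; rw [h, finrank_bot])

lemma finite_and_finsum_eq_of_iSupIndep {A : J → Submodule ℂ V} (hA : iSupIndep A)
    {N : Submodule ℂ V} (hN : N = ⨆ j, A j) (hfin : FiniteDimensional ℂ N) {d : J → ℤ}
    (hd : ∀ j, d j = (finrank ℂ (A j) : ℤ)) :
    {j | d j ≠ 0}.Finite ∧ (finrank ℂ N : ℤ) = ∑ᶠ j, d j := by
  subst hN
  obtain rfl : d = fun j => (finrank ℂ (A j) : ℤ) := funext hd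
  obtain ⟨h1, h2⟩ := finite_and_finrank_eq_of_iSupIndep hA
  refine ⟨h1.subset fun j hj h => hj (by beta_reduce; rw [h, finrank_bot, cast_zero]), ?_⟩
  rw [h2]
  refine (Nat.castAddMonoidHom ℤ).map_finsum (h1.subset fun j hj h => hj ?_)
  beta_reduce
  rw [h, finrank_bot]

lemma jointGen_eq_iSup {h : κ → End ℂ V} (hh : ∀ i j, Commute (h i) (h j))
    {A : J → Submodule ℂ V} {c : J → κ → ℂ} (hA : ∀ j, A j ≤ jointGen h (c j))
    (htop : ⨆ j, A j = ⊤) {χ : κ → ℂ} {P : J → Prop} (hP : ∀ j, c j = χ ↔ P j) :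
    jointGen h χ = ⨆ j : {j // P j}, A j := by
  obtain rfl : (fun j => c j = χ) = P := funext fun j => propext (hP j)
  refine (congrFun (eq_of_iSup_eq_top (iSupIndep_jointGen hh)
    (B := fun χ => ⨆ j : {j // c j = χ}, A j) (fun χ => iSup_le ?_) ?_) χ).symm
  · rintro ⟨j, rfl⟩
    exact hA j
  · rw [eq_top_iff, ← htop]
    exact iSup_le fun j => le_iSup_of_le (c j) (le_iSup (fun i : {i // c i = c j} => A i) ⟨j, rfl⟩)

end TensorJoint

section Character

lemma InO.iSup_lWeightSpace (hO : InO ρ) (ht : Generic t) : ⨆ Ψ, lWeightSpace ρ Ψ = ⊤ := by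
  rw [eq_top_iff, ← hO.iSup_eq_top 1]
  refine iSup_le fun ω => ?_
  have := hO.finite 1 ω
  have hm := φOps_mem_weightSpace (ρ := ρ) (ω := ω)
  have h := congrArg (Submodule.map (weightSpace ρ 1 ω).subtype) (iSup_jointGen
    (f := fun p => (φOps ρ p).restrict (hm p)) fun p q => LinearMap.ext fun w => Subtype.ext
      (congrArg (fun g => g (w : V)) (commute_φOps p q).eq))
  rw [Submodule.map_iSup, Submodule.map_subtype_top] at h
  rw [← h]
  refine iSup_le fun χ => ?_
  have h1 : (jointGen (fun p => (φOps ρ p).restrict (hm p)) χ).map (weightSpace ρ 1 ω).subtype ≤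
      jointGen (φOps ρ) χ :=
    (Submodule.inf_iInf_maxGenEigenspace_of_forall_mapsTo (f := φOps ρ) (μ := χ) _ hm).ge.trans
      inf_le_right
  by_cases hb : jointGen (φOps ρ) χ = ⊥
  · exact h1.trans (hb.trans_le bot_le)
  · obtain ⟨Ψ, rfl⟩ := hO.exists_lWeight ht hb
    exact le_iSup_of_le Ψ (h1.trans (lWeightSpace_eq Ψ).ge)

lemma coeffAtZero_toNat {f : RatFunc ℂ} {n : ℤ} (hn : 0 ≤ n) :
    coeffAtZero f (n.toNat : ℤ) = coeffAtZero f n := by rw [toNat_of_nonneg hn]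

lemma jointGen_tensorFam_le (Ψ1 : LWeight T μ1) (Ψ2 : LWeight T μ2) :
    jointGen (tensorFam (φOps ρ1) (φOps ρ2)) (Sum.elim Ψ1.coeffs Ψ2.coeffs) ≤
      jointGen (convOp ρ1 ρ2) (Ψ1.mul Ψ2).coeffs := by
  refine le_iInf fun p => ?_
  let a : FreeAlgebra ℂ ((T.I0 × ℕ) ⊕ (T.I0 × ℕ)) := ∑ n ∈ Finset.Icc (0 : ℤ) p.2,
    FreeAlgebra.ι ℂ (.inl (p.1, (p.2 - n).toNat)) * FreeAlgebra.ι ℂ (.inr (p.1, n.toNat))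
  have h1 : FreeAlgebra.lift ℂ (tensorFam (φOps ρ1) (φOps ρ2)) a = convOp ρ1 ρ2 p := by
    rw [convOp, convElt, map_sum, map_sum]
    refine sum_congr rfl fun n hn => ?_
    rw [mem_Icc] at hn
    rw [map_mul, lift_ι_apply, lift_ι_apply]
    refine ext' fun v w => ?_
    change ρ1 (Alg.φ 1 p.1 ((p.2 - n).toNat : ℤ)) v ⊗ₜ[ℂ] ρ2 (Alg.φ 1 p.1 (n.toNat : ℤ)) w = _
    rw [toNat_of_nonneg hn.1, toNat_of_nonneg (by omega)]
    rfl
  have h2 : FreeAlgebra.lift ℂ (Sum.elim Ψ1.coeffs Ψ2.coeffs) a = (Ψ1.mul Ψ2).coeffs p := by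
    refine Eq.trans ?_ (coeffAtZero_mul (fun _ => coeffAtZero_of_neg (Ψ1.2 p.1).1)
      (fun _ => coeffAtZero_of_neg (Ψ2.2 p.1).1) p.2).symm
    rw [map_sum]
    refine sum_congr rfl fun n hn => ?_
    rw [mem_Icc] at hn
    rw [map_mul, lift_ι_apply, lift_ι_apply, ← coeffAtZero_toNat hn.1,
      ← coeffAtZero_toNat (n := p.2 - n) (by omega)]
    rfl
  have h3 := jointGen_le_lift (commute_tensorFam (commute_φOps (ρ := ρ1)) (commute_φOps (ρ := ρ2)))
    (Sum.elim Ψ1.coeffs Ψ2.coeffs) a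
  rwa [h1, h2] at h3

variable (ρ1 ρ2) in
/-- The tensor product of two `ℓ`-weight spaces. -/
def tensorLWeight (p : LWeight T μ1 × LWeight T μ2) : Submodule ℂ V12 :=
  map₂ (TensorProduct.mk ℂ V1 V2) (lWeightSpace ρ1 p.1) (lWeightSpace ρ2 p.2)

lemma tensorLWeight_le (p : LWeight T μ1 × LWeight T μ2) : tensorLWeight ρ1 ρ2 p ≤
    jointGen (tensorFam (φOps ρ1) (φOps ρ2)) (Sum.elim p.1.coeffs p.2.coeffs) := by
  rw [tensorLWeight, lWeightSpace_eq, lWeightSpace_eq]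
  exact map2_le_jointGen_tensorFam

lemma iSupIndep_tensorLWeight : iSupIndep (tensorLWeight ρ1 ρ2) := by
  have hinj : Function.Injective fun p : LWeight T μ1 × LWeight T μ2 =>
      (Sum.elim p.1.coeffs p.2.coeffs : (T.I0 × ℕ) ⊕ (T.I0 × ℕ) → ℂ) := fun p q h =>
    Prod.ext (LWeight.coeffs_injective (funext fun i => congrFun h (.inl i)))
      (LWeight.coeffs_injective (funext fun i => congrFun h (.inr i)))
  exact ((iSupIndep_jointGen (commute_tensorFam commute_φOps commute_φOps)).comp hinj).mono
    tensorLWeight_le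

lemma iSup_tensorLWeight (hO1 : InO ρ1) (hO2 : InO ρ2)
    (ht : Generic t) : ⨆ p, tensorLWeight ρ1 ρ2 p = ⊤ := by
  rw [eq_top_iff, ← map₂_mk_top_top_eq_top, ← hO1.iSup_lWeightSpace ht,
    ← hO2.iSup_lWeightSpace ht, map₂_iSup_left]
  refine iSup_le fun Ψ1 => ?_
  rw [map₂_iSup_right]
  exact iSup_le fun Ψ2 => le_iSup (tensorLWeight ρ1 ρ2) (Ψ1, Ψ2)

lemma jointGen_convOp_eq_iSup (hO1 : InO ρ1) (hO2 : InO ρ2)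
    (ht : Generic t) (Ψ : LWeight T (μ1 + μ2)) :
    jointGen (convOp ρ1 ρ2) Ψ.coeffs = ⨆ p : Factorization Ψ, tensorLWeight ρ1 ρ2 p.1 := by
  have hP (p : LWeight T μ1 × LWeight T μ2) :
      (p.1.mul p.2).coeffs = Ψ.coeffs ↔ p.1.mul p.2 = Ψ := LWeight.coeffs_injective.eq_iff
  have hle (p : LWeight T μ1 × LWeight T μ2) : tensorLWeight ρ1 ρ2 p ≤
      jointGen (convOp ρ1 ρ2) (p.1.mul p.2).coeffs :=
    (tensorLWeight_le p).trans (jointGen_tensorFam_le p.1 p.2)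
  have hcomm := commute_convOp (ρ1 := ρ1) (ρ2 := ρ2)
  have htop := iSup_tensorLWeight hO1 hO2 ht
  have h := jointGen_eq_iSup (A := tensorLWeight ρ1 ρ2) (c := fun p => (p.1.mul p.2).coeffs)
    (P := fun p => p.1.mul p.2 = Ψ) hcomm hle htop hP
  exact h

/-- The weight of an `ℓ`-weight. -/
def LWeight.weight (Ψ : LWeight T μ) : Weight T := fun i =>
  mk0 (coeffAtZero (Ψ.1 i) 0) (coeffAtZero_zero_ne_zero (Ψ.2 i).1 (Ψ.2 i).2.1)

lemma convolvable_and_qChar_fusion (hΔ : IsDeformedCoproduct Δ)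
    (h1 : IsHighestWeight ρ1 v1 ω1) (h2 : IsHighestWeight ρ2 v2 ω2)
    (ht : Generic t) : Convolvable (qChar ρ1) (qChar ρ2) ∧ qChar (fusionRep ρΔ v12) =
        convolve (qChar ρ1) (qChar ρ2) := by
  have hfin (Ψ : LWeight T (μ1 + μ2)) : FiniteDimensional ℂ (jointGen (convOp ρ1 ρ2) Ψ.coeffs) := by
    have := finite_tensorWeight h1 h2 ht Ψ.weight
    exact finiteDimensional_of_le (jointGen_convOp_le h1 h2 ht Ψ.weight fun _ => rfl)
  have key (Ψ : LWeight T (μ1 + μ2)) : {p : Factorization Ψ |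
      qChar ρ1 p.1.1 * qChar ρ2 p.1.2 ≠ 0}.Finite ∧
      (finrank ℂ (jointGen (convOp ρ1 ρ2) Ψ.coeffs) : ℤ) =
        ∑ᶠ p : Factorization Ψ, qChar ρ1 p.1.1 * qChar ρ2 p.1.2 :=
    finite_and_finsum_eq_of_iSupIndep (iSupIndep_tensorLWeight.comp Subtype.val_injective)
      (jointGen_convOp_eq_iSup h1.inO h2.inO ht Ψ) (hfin Ψ) fun p =>
      (Nat.cast_mul _ _).symm.trans (congrArg Nat.cast (finrank_map2_mk _ _).symm)
  refine ⟨fun Ψ => (key Ψ).1, funext fun Ψ => ?_⟩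
  rw [convolve, ← (key Ψ).2, qChar, lWeightSpace_eq,
    finrank_jointGen_fusion hΔ h1 h2 ht Ψ.weight fun _ => rfl]

end Character

end TwistedFusion

end

theorem theorem5p8 (T : TwistedType) (t : ℂˣ) (ht : ∀ n : ℕ, 0 < n → (t ^ 2) ^ n ≠ 1)
    (μ₁ μ₂ : T.Coweight)
    {V₁ : Type*} [AddCommGroup V₁] [Module ℂ V₁] {V₂ : Type*} [AddCommGroup V₂] [Module ℂ V₂]
    (ρ₁ : Alg T t μ₁ →ₐ[ℂ] Module.End ℂ V₁) (ρ₂ : Alg T t μ₂ →ₐ[ℂ] Module.End ℂ V₂)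
    (hO₁ : InO ρ₁) (hO₂ : InO ρ₂)
    (Ψ₁ : LWeight T μ₁) (Ψ₂ : LWeight T μ₂) (v₁ : V₁) (v₂ : V₂)
    (hv₁ : IsHighest ρ₁ Ψ₁ v₁) (hv₂ : IsHighest ρ₂ Ψ₂ v₂) :
    (∃! Δ : Alg T t (μ₁ + μ₂) →ₐ[ℂ] LaurentTensor T t μ₁ μ₂, IsDeformedCoproduct Δ) ∧
    ∀ Δ : Alg T t (μ₁ + μ₂) →ₐ[ℂ] LaurentTensor T t μ₁ μ₂, IsDeformedCoproduct Δ →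
      IsAForm (deformedAct Δ ρ₁ ρ₂) (lattice (deformedAct Δ ρ₁ ρ₂) (v₁ ⊗ₜ[ℂ] v₂)) ∧
      InO (fusionRep (deformedAct Δ ρ₁ ρ₂) (v₁ ⊗ₜ[ℂ] v₂)) ∧
      IsHighest (fusionRep (deformedAct Δ ρ₁ ρ₂) (v₁ ⊗ₜ[ℂ] v₂)) (Ψ₁.mul Ψ₂)
        (fusionVec (deformedAct Δ ρ₁ ρ₂) (v₁ ⊗ₜ[ℂ] v₂)) ∧
      (∀ Ψ : LWeight T μ₁, Module.Finite ℂ (lWeightSpace ρ₁ Ψ)) ∧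
      (∀ Ψ : LWeight T μ₂, Module.Finite ℂ (lWeightSpace ρ₂ Ψ)) ∧
      (∀ Ψ : LWeight T (μ₁ + μ₂), Module.Finite ℂ
        (lWeightSpace (fusionRep (deformedAct Δ ρ₁ ρ₂) (v₁ ⊗ₜ[ℂ] v₂)) Ψ)) ∧
      Convolvable (qChar ρ₁) (qChar ρ₂) ∧
      qChar (fusionRep (deformedAct Δ ρ₁ ρ₂) (v₁ ⊗ₜ[ℂ] v₂)) = convolve (qChar ρ₁) (qChar ρ₂) := by
  refine ⟨existsUnique_isDeformedCoproduct ht, fun Δ hΔ => ?_⟩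
  obtain ⟨ω₁, h₁⟩ := hv₁.exists_isHighestWeight hO₁
  obtain ⟨ω₂, h₂⟩ := hv₂.exists_isHighestWeight hO₂
  have hO := (isHighestWeight_fusion hΔ h₁ h₂ ht).inO
  exact ⟨isAForm_lattice hΔ h₁ h₂ ht, hO, isHighest_fusion hΔ ht hO₁ hO₂ hv₁ hv₂,
    hO₁.finite_lWeightSpace, hO₂.finite_lWeightSpace, hO.finite_lWeightSpace,
    convolvable_and_qChar_fusion hΔ h₁ h₂ ht⟩
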